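/- **Setting.** Let $C$ be a smooth (Hausdorff, $\sigma$-compact, finite-dimensional) manifold, $p\colon E\to C$ a smooth real vector bundle of finite rank $r$, $M$ the total space of $E$, with $C\subset M$ embedded as the zero section, and $I(C)\subset C^\infty(M)$ the ideal of functions vanishing on $C$. (A neighbourhood of a submanifold is identified in this way with its normal bundle.) Let $\mathcal T^1(M)$ be the $C^\infty(M)$-module of bivector fields on $M$ and $\mathcal T^1(M,C)=\varprojlim_N\mathcal T^1(M)/I(C)^N\mathcal T^1(M)$ the space of bivector fields on the formal neighbourhood of $C$. A $\pi\in\mathcal T^1(M,C)$ is *Poisson* if $[\pi,\pi]=0$, i.e. the bracket $\{f,g\}=\langle\pi,df\otimes dg\rangle$ satisfies the Jacobi identity modulo all powers of $I(C)$. Let $A=\bigoplus_j A^j$, $A^j=\Gamma(C,\wedge^jE)$. A *$P_\infty$-structure* on $A$ is a sequence of $\mathbb R$-multilinear maps $\lambda_n\colon A^{n}\to A$ of degree $2-n$, $n\ge 0$, such that (i) $\lambda_n(\dots,a_i,a_{i+1},\dots)=-(-1)^{|a_i||a_{i+1}|}\lambda_n(\dots,a_{i+1},a_i,\dots)$; (ii)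 $a\mapsto\lambda_n(a_1,\dots,a_{n-1},a)$ is a graded derivation of degree $2-n+\sum_{i<n}|a_i|$; (iii) for all $n\ge0$ the map $a_1\otimes\cdots\otimes a_n\mapsto\sum_{q=0}^n\frac{(-1)^{q(n-q)}}{q!(n-q)!}\lambda_{n-q+1}(\lambda_q(a_1,\dots,a_q),a_{q+1},\dots,a_n)$ vanishes on the image of the graded alternation map. Let $\hat{\mathcal T}^1(A)$ be the degree-one part of the completed Lie algebra of multiderivations of $A$: sequences $(\varphi_n)_{n\ge0}$ of maps $\varphi_n\colon A^n\to A$ of degree $2-n$ with (i) and (ii). A product $a\,\phi_1\cdots\phi_n$ ($a\in A$, $\phi_i$ homogeneous graded derivations of $A$) in the graded symmetric algebra $S_A(\mathrm{Der}(A)[-1])$ is viewed as the multiderivation $a\cdot(-1)^{\sum_i(i-1)|\phi_i|}\,\mu\circ\sum_{s\in S_n}\mathrm{sign}(s)\,s\cdot(\phi_1\otimes\cdots\otimes\phi_n)$ (Koszul signs; $\mu$ is the product), i.e. through $n!$ times the Hochschild–Kostant–Rosenberg map. **Fourier transform.** There is a unique additive bijection $\Phi\colon\mathcal T^1(M,C)\to\hat{\mathcal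 T}^1(A)$ that is $C^\infty(C)$-linear, continuous (every component $\Phi(\pi)_n$ depends only on $\pi$ modulo some power of $I(C)$), and multiplicative on products of generators according to $u\mapsto\iota_u$ for $u\in\Gamma(C,E^*)$ (a function on $M$ linear along the fibres), $e\mapsto-e$ for $e\in\Gamma(C,E)$ (a vertical vector field, constant along the fibres), and $X\mapsto\delta$ for a vector field $X$ on $M$ linear along the fibres and the degree-zero derivation $\delta$ of $A$ dual to it ($X$ and $\delta$ agree on $C^\infty(C)$ and $\langle s,Xu\rangle=\delta\langle s,u\rangle-\langle\delta s,u\rangle$; e.g. $X=\nabla^*_\xi$, $\delta=\nabla_\xi$ for a connection $\nabla$ on $E$). That is, $\Phi(u_1\cdots u_k\,X\wedge X')=\iota_{u_1}\cdots\iota_{u_k}\,\delta\,\delta'$, $\Phi(u_1\cdots u_k\,e\wedge X)=-e\,\iota_{u_1}\cdots\iota_{u_k}\,\delta$, $\Phi(u_1\cdots u_k\,e\wedge e')=e\,e'\,\iota_{u_1}\cdots\iota_{u_k}$. **Statement.** Put $\kappa_n=(-1)^{(n-1)(n-2)/2}$. For every Poisson $\pi\in\mathcal T^1(M,C)$ the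 maps $\lambda_n=\kappa_n\,\Phi(\pi)_n$, $n\ge0$, form a $P_\infty$-structure on $A$. It is the unique $P_\infty$-structure on $A$ such that for all $v_i\in\Gamma(C,E)$ (vertical vector fields), $f,g\in C^\infty(C)$ and $u,w\in\Gamma(C,E^*)$ (fibrewise linear functions), $$\lambda_n(v_1,\dots,v_{n-2},f,g)=\kappa_n\,(L_{v_1}\cdots L_{v_{n-2}}\pi)(p^*f,p^*g)|_C,$$ $$\langle\lambda_n(v_1,\dots,v_{n-1},f),u\rangle=\kappa_n\,(L_{v_1}\cdots L_{v_{n-1}}\pi)(p^*f,u)|_C,$$ $$\langle\lambda_n(v_1,\dots,v_n),u\otimes w\rangle=\kappa_n\,(L_{v_1}\cdots L_{v_n}\pi)(u,w)|_C,$$ where $L_v$ is the Lie derivative, $\pi(h,k)=\langle\pi,dh\otimes dk\rangle$ and $\langle e e',u\otimes w\rangle=\langle e,u\rangle\langle e',w\rangle-\langle e',u\rangle\langle e,w\rangle$. Its components are the Taylor coefficients of $\pi$ in the transverse coordinates: if $e_1,\dots,e_r$ are sections of $E$ forming a frame near $x_0\in C$, $y^1,\dots,y^r$ are fibrewise linear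 functions that are the dual fibre coordinates near $x_0$, and $\partial_\mu=\partial/\partial y^\mu$, then at $x_0$ $$\lambda_n(e_{\mu_1},\dots,e_{\mu_{n-2}},f,g)=\kappa_n\,\partial_{\mu_1}\cdots\partial_{\mu_{n-2}}\{p^*f,p^*g\}|_{y=0},$$ $$\lambda_n(e_{\mu_1},\dots,e_{\mu_{n-1}},f)=\kappa_n\sum_\nu\partial_{\mu_1}\cdots\partial_{\mu_{n-1}}\{p^*f,y^\nu\}|_{y=0}\,e_\nu,$$ $$\lambda_n(e_{\mu_1},\dots,e_{\mu_n})=\tfrac12\kappa_n\sum_{\nu,\rho}\partial_{\mu_1}\cdots\partial_{\mu_n}\{y^\nu,y^\rho\}|_{y=0}\,e_\nu e_\rho.$$ -/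

import Mathlib

open scoped Manifold ContDiff Topology

noncomputable section

namespace RelPoisson

/-! ### Graded algebra: multiderivations and `P_∞`-structures -/

section Algebra

/-- The sign `(-1)^z`. -/
def sgn (z : ℤ) : ℝ := (-1) ^ z

/-- The Koszul sign of rearranging homogeneous `a_1 ⊗ ⋯ ⊗ a_n` (degrees `β`) into
`a_{τ 1} ⊗ ⋯ ⊗ a_{τ n}`. -/
def koszul {n : ℕ} (τ : Equiv.Perm (Fin n)) (β : Fin n → ℤ) : ℝ :=
  ∏ i, ∏ j, if i < j ∧ τ j < τ i then sgn (β (τ i) * β (τ j)) else 1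

/-- The signature of a permutation as a real number. -/
def permSign {n : ℕ} (τ : Equiv.Perm (Fin n)) : ℝ := ((Equiv.Perm.sign τ : ℤ) : ℝ)

variable {A : Type*} [Ring A] [Algebra ℝ A]

/-- `l` is a graded skew-symmetric `n`-multiderivation of degree `2 - n` of the algebra `A`
with homogeneous components `𝒜 j`. -/
structure IsMultiDer (𝒜 : ℤ → Submodule ℝ A) {n : ℕ}
    (l : MultilinearMap ℝ (fun _ : Fin n => A) A) : Prop where
  degree : ∀ (β : Fin n → ℤ) (a : Fin n → A), (∀ i, a i ∈ 𝒜 (β i)) →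
    l a ∈ 𝒜 (2 - n + ∑ i, β i)
  skew : ∀ (β : Fin n → ℤ) (a : Fin n → A), (∀ i, a i ∈ 𝒜 (β i)) →
    ∀ i j : Fin n, (j : ℕ) = i + 1 → l (a ∘ Equiv.swap i j) = -(sgn (β i * β j) • l a)
  leibniz : ∀ (β : Fin n → ℤ) (a : Fin n → A), (∀ i, a i ∈ 𝒜 (β i)) →
    ∀ i : Fin n, (i : ℕ) + 1 = n → ∀ (p : ℤ) (b c : A), b ∈ 𝒜 p →
      l (Function.update a i (b * c)) = l (Function.update a i b) * c
        + sgn ((2 - n + ∑ j ∈ Finset.univ.erase i, β j) * p) • (b * l (Function.update a i c))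

/-- The expression `∑_q (-1)^{q(n-q)} / (q!(n-q)!) λ_{n-q+1}(λ_q(a_1,…,a_q), a_{q+1},…,a_n)`. -/
def jacobiSum (l : ∀ n, MultilinearMap ℝ (fun _ : Fin n => A) A) {n : ℕ} (a : Fin n → A) : A :=
  ∑ q : Fin (n + 1), ((-1 : ℝ) ^ ((q : ℕ) * (n - q)) / ((q : ℕ).factorial * (n - q).factorial)) •
    l (n - q + 1) (Fin.cons
      (l q fun i : Fin q => a ⟨i, by omega⟩)
      fun j : Fin (n - q) => a ⟨q + j, by omega⟩)

/-- A (not necessarily flat) `P_∞`-structure on the graded commutative algebra `A = ⨁_j 𝒜 j`: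
graded skew-symmetric multiderivations `λ_n` of degree `2 - n` (`n = 0, 1, 2, …`) such that for
all `n` the Jacobi expression `jacobiSum` vanishes on the image of the graded alternation map. -/
structure IsPInfty (𝒜 : ℤ → Submodule ℝ A)
    (l : ∀ n, MultilinearMap ℝ (fun _ : Fin n => A) A) : Prop where
  multiDer : ∀ n, IsMultiDer 𝒜 (l n)
  jacobi : ∀ (n : ℕ) (β : Fin n → ℤ) (a : Fin n → A), (∀ i, a i ∈ 𝒜 (β i)) →
    ∑ τ : Equiv.Perm (Fin n), (permSign τ * koszul τ β) • jacobiSum l (a ∘ τ) = 0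

/-- The value on homogeneous `b_1, …, b_n` (degrees `β`) of `n!` times the
Hochschild–Kostant–Rosenberg image of the product `φ_1 ⋯ φ_n` of homogeneous derivations of
degrees `d_1, …, d_n`, i.e. of
`(-1)^{∑ (α-1) d_α} ∑_s sign(s) s · μ ∘ (φ_1 ⊗ ⋯ ⊗ φ_n)` with all Koszul signs. -/
def hkr {n : ℕ} (d : Fin n → ℤ) (φ : Fin n → A → A) (β : Fin n → ℤ) (b : Fin n → A) : A :=
  sgn (∑ i : Fin n, (i : ℤ) * d i) • ∑ s : Equiv.Perm (Fin n),
    (permSign s * koszul s d * ∏ i, ∏ j, if i < j then sgn (d (s j) * β i) else 1) •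
      (List.ofFn fun i => φ (s i) (b i)).prod

/-- `l` is a derivation of degree zero. -/
structure IsDerZero (𝒜 : ℤ → Submodule ℝ A) (δ : A →ₗ[ℝ] A) : Prop where
  degree : ∀ j, ∀ a ∈ 𝒜 j, δ a ∈ 𝒜 j
  leibniz : ∀ a b, δ (a * b) = δ a * b + a * δ b

/-- The space `∏_n` of graded skew-symmetric `n`-multiderivations of degree `2 - n`: the part of
degree one of the completed Lie algebra of multiderivations of `A`. -/
def multiDer (𝒜 : ℤ → Submodule ℝ A) :
    Submodule ℝ (∀ n, MultilinearMap ℝ (fun _ : Fin n => A) A) where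
  carrier := {l | ∀ n, IsMultiDer 𝒜 (l n)}
  zero_mem' n := by
    refine ⟨fun _ _ _ => Submodule.zero_mem _, ?_, ?_⟩ <;> intros <;> simp
  add_mem' {l m} hl hm n := by
    refine ⟨fun β a h => Submodule.add_mem _ ((hl n).degree β a h) ((hm n).degree β a h), ?_, ?_⟩
    · intro β a h i j hij
      have h1 := (hl n).skew β a h i j hij
      have h2 := (hm n).skew β a h i j hij
      simp only [Pi.add_apply, add_apply, h1, h2, smul_add, neg_add]
    · intro β a h i hi p b c hb
      have h1 := (hl n).leibniz β a h i hi p b c hb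
      have h2 := (hm n).leibniz β a h i hi p b c hb
      simp only [Pi.add_apply, add_apply, h1, h2, smul_add, mul_add, add_mul]
      abel
  smul_mem' r l hl n := by
    refine ⟨fun β a h => Submodule.smul_mem _ r ((hl n).degree β a h), ?_, ?_⟩
    · intro β a h i j hij
      have h1 := (hl n).skew β a h i j hij
      simp only [Pi.smul_apply, smul_apply, h1, smul_neg]
      rw [smul_comm]
    · intro β a h i hi p b c hb
      have h1 := (hl n).leibniz β a h i hi p b c hb
      simp only [Pi.smul_apply, smul_apply, h1, smul_add, smul_mul_assoc,
        mul_smul_comm]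
      rw [smul_comm]

/-- The only nonzero component of `l` is the `N`-th, and it is the multiderivation
`c · φ_1 ⋯ φ_N` (an element of `S_A(Der(A)[-1])`, viewed as a multilinear map through `N!` times
the Hochschild–Kostant–Rosenberg map). -/
def IsProduct (𝒜 : ℤ → Submodule ℝ A) (l : ∀ n, MultilinearMap ℝ (fun _ : Fin n => A) A)
    {N : ℕ} (c : A) (d : Fin N → ℤ) (φ : Fin N → A → A) : Prop :=
  (∀ (β : Fin N → ℤ) (b : Fin N → A), (∀ i, b i ∈ 𝒜 (β i)) → l N b = c * hkr d φ β b) ∧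
    ∀ m, m ≠ N → l m = 0

end Algebra

/-! ### Bivector fields as biderivations of a commutative algebra -/

section Bivectors

variable (O : Type*) [CommRing O] [Algebra ℝ O]

/-- The `O`-module of skew-symmetric biderivations of a commutative algebra `O`; for
`O = C^∞(M)` these are the bivector fields `π` on `M`, `π f g = ⟨π, df ⊗ dg⟩`. -/
def biDer : Submodule O (O →ₗ[ℝ] O →ₗ[ℝ] O) where
  carrier := {β | (∀ f g, β f g = -β g f) ∧ ∀ f g h, β f (g * h) = β f g * h + g * β f h}
  zero_mem' := by simp
  add_mem' {β γ} hβ hγ := by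
    refine ⟨fun f g => ?_, fun f g h => ?_⟩
    · simp only [LinearMap.add_apply, hβ.1 f g, hγ.1 f g]; ring
    · simp only [LinearMap.add_apply, hβ.2 f g h, hγ.2 f g h]; ring
  smul_mem' r β hβ := by
    refine ⟨fun f g => ?_, fun f g h => ?_⟩
    · simp only [LinearMap.smul_apply, smul_eq_mul, hβ.1 f g]; ring
    · simp only [LinearMap.smul_apply, smul_eq_mul, hβ.2 f g h]; ring

instance : AddCommGroup (biDer O) := Module.addCommMonoidToAddCommGroup O

variable {O}

/-- The bivector field `X ∧ Y`, with `⟨X ∧ Y, df ⊗ dg⟩ = X f · Y g - Y f · X g`. -/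
def wedge (X Y : Derivation ℝ O O) : biDer O :=
  ⟨LinearMap.mk₂ ℝ (fun f g => X f * Y g - Y f * X g)
    (by intros; simp only [map_add]; ring)
    (by intros; simp only [Derivation.map_smul, smul_mul_assoc, smul_sub])
    (by intros; simp only [map_add]; ring)
    (by intros; simp only [Derivation.map_smul, mul_smul_comm, smul_sub]),
   by intro f g; simp only [LinearMap.mk₂_apply]; ring,
   by intro f g h; simp only [LinearMap.mk₂_apply, Derivation.leibniz, smul_eq_mul]; ring⟩

/-- `{f,{g,h}} + {g,{h,f}} + {h,{f,g}}`. -/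
def jacobiator (π : biDer O) (f g h : O) : O :=
  π.1 f (π.1 g h) + π.1 g (π.1 h f) + π.1 h (π.1 f g)

/-- The Lie derivative along `X` of a bilinear operation:
`(L_X β)(f, g) = X(β(f, g)) - β(X f, g) - β(f, X g)`. -/
def lieDer (X : Derivation ℝ O O) (β : O → O → O) : O → O → O :=
  fun f g => X (β f g) - β (X f) g - β f (X g)

end Bivectors

/-! ### Functions, sections and vertical vector fields of a vector bundle `E → C` -/

section Geometry

variable (V : Type*) [NormedAddCommGroup V] [NormedSpace ℝ V]
  (F : Type*) [NormedAddCommGroup F] [NormedSpace ℝ F]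
  {C : Type*} [TopologicalSpace C] [ChartedSpace V C]
  (E : C → Type*) [∀ x, AddCommGroup (E x)] [∀ x, Module ℝ (E x)]
  [∀ x, TopologicalSpace (E x)] [TopologicalSpace (Bundle.TotalSpace F E)]
  [FiberBundle F E] [VectorBundle ℝ F E]

variable (C) in
/-- `C^∞(C)`. -/
abbrev BaseFun := C^∞⟮𝓘(ℝ, V), C; 𝓘(ℝ, ℝ), ℝ⟯

/-- `C^∞(M)`, where `M` is the total space of `E`. -/
abbrev TotFun := C^∞⟮(𝓘(ℝ, V)).prod 𝓘(ℝ, F), Bundle.TotalSpace F E; 𝓘(ℝ, ℝ), ℝ⟯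

/-- `Γ(C, E)`. -/
abbrev Sec := ContMDiffSection 𝓘(ℝ, V) F ∞ E

/-- `Γ(C, E*)`: the smooth functions on `M` that are linear on the fibres. -/
def LinFun : Type _ :=
  {u : TotFun V F E // ∀ x, IsLinearMap ℝ fun e : E x => u ⟨x, e⟩}

variable {V F E}

/-- A section of `E*` at a point. -/
def LinFun.at (u : LinFun V F E) (x : C) : Module.Dual ℝ (E x) := IsLinearMap.mk' _ (u.2 x)

/-- The pullback `p^* f` of a function on `C` to `M`. -/
def pullback (f : BaseFun V C) : TotFun V F E :=
  ContMDiffMap.comp f ⟨Bundle.TotalSpace.proj, Bundle.contMDiff_proj E⟩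

/-- The restriction `h|_C` of a function on `M` to the zero section. -/
def restrict (h : TotFun V F E) : BaseFun V C :=
  ContMDiffMap.comp h ⟨Bundle.zeroSection F E, Bundle.contMDiff_zeroSection ℝ E⟩

/-- The pairing `⟨s, u⟩` of a section of `E*` and a section of `E`. -/
def pairing (u : LinFun V F E) (s : Sec V F E) : BaseFun V C :=
  ContMDiffMap.comp u.1 ⟨fun x => ⟨x, s x⟩, s.contMDiff⟩

section Vertical

lemma contMDiff_translate (s : Sec V F E) :
    ContMDiff (((𝓘(ℝ, V)).prod 𝓘(ℝ, F)).prod 𝓘(ℝ, ℝ)) ((𝓘(ℝ, V)).prod 𝓘(ℝ, F)) ∞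
      (fun q : Bundle.TotalSpace F E × ℝ =>
        (⟨q.1.1, q.1.2 + q.2 • s q.1.1⟩ : Bundle.TotalSpace F E)) := by
  intro q₀
  have hp : ContMDiff (((𝓘(ℝ, V)).prod 𝓘(ℝ, F)).prod 𝓘(ℝ, ℝ)) 𝓘(ℝ, V) ∞
      (fun q : Bundle.TotalSpace F E × ℝ => q.1.1) :=
    (Bundle.contMDiff_proj E).comp contMDiff_fst
  rw [Bundle.contMDiffAt_totalSpace]
  refine ⟨hp q₀, ?_⟩
  have h1 : ContMDiffAt (((𝓘(ℝ, V)).prod 𝓘(ℝ, F)).prod 𝓘(ℝ, ℝ)) 𝓘(ℝ, F) ∞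
      (fun q : Bundle.TotalSpace F E × ℝ => (trivializationAt F E q₀.1.1 q.1).2) q₀ :=
    ((Bundle.contMDiffAt_totalSpace (f := fun q : Bundle.TotalSpace F E × ℝ => q.1)).1
      contMDiffAt_fst).2
  have h2 : ContMDiffAt (((𝓘(ℝ, V)).prod 𝓘(ℝ, F)).prod 𝓘(ℝ, ℝ)) 𝓘(ℝ, F) ∞
      (fun q : Bundle.TotalSpace F E × ℝ =>
        (trivializationAt F E q₀.1.1 ⟨q.1.1, s q.1.1⟩).2) q₀ :=
    ContMDiffAt.comp (g := fun x : C => (trivializationAt F E q₀.1.1 ⟨x, s x⟩).2) q₀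
      ((Bundle.contMDiffAt_section q₀.1.1).1 (s.contMDiff q₀.1.1)) (hp q₀)
  have h3 : ContMDiffAt (((𝓘(ℝ, V)).prod 𝓘(ℝ, F)).prod 𝓘(ℝ, ℝ)) 𝓘(ℝ, ℝ) ∞
      (fun q : Bundle.TotalSpace F E × ℝ => q.2) q₀ := contMDiffAt_snd
  refine (h1.add (h3.smul h2)).congr_of_eventuallyEq ?_
  have hb : (trivializationAt F E q₀.1.1).baseSet ∈ 𝓝 q₀.1.1 :=
    (trivializationAt F E q₀.1.1).open_baseSet.mem_nhds (FiberBundle.mem_baseSet_trivializationAt' _)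
  filter_upwards [hp.continuous.continuousAt.preimage_mem_nhds hb] with q hq
  have hl := (trivializationAt F E q₀.1.1).linear ℝ hq
  change (trivializationAt F E q₀.1.1 ⟨q.1.1, q.1.2 + q.2 • s q.1.1⟩).2 = _
  rw [hl.map_add, hl.map_smul]
  rfl

lemma differentiable_fibre (h : TotFun V F E) (s : Sec V F E) (z : Bundle.TotalSpace F E) :
    DifferentiableAt ℝ (fun t : ℝ => h ⟨z.1, z.2 + t • s z.1⟩) 0 := by
  have h1 : ContMDiff 𝓘(ℝ, ℝ) (((𝓘(ℝ, V)).prod 𝓘(ℝ, F)).prod 𝓘(ℝ, ℝ)) ∞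
      (fun t : ℝ => ((z, t) : Bundle.TotalSpace F E × ℝ)) :=
    contMDiff_const.prodMk contMDiff_id
  have h2 := (h.contMDiff.comp ((contMDiff_translate s).comp h1)).contDiff
  exact (h2.differentiable (by simp)).differentiableAt

variable [IsManifold 𝓘(ℝ, V) ∞ C] [ContMDiffVectorBundle ∞ F E 𝓘(ℝ, V)]

lemma contMDiff_fibreDeriv (h : TotFun V F E) (s : Sec V F E) :
    ContMDiff ((𝓘(ℝ, V)).prod 𝓘(ℝ, F)) 𝓘(ℝ, ℝ) ∞
      (fun z : Bundle.TotalSpace F E => deriv (fun t : ℝ => h ⟨z.1, z.2 + t • s z.1⟩) 0) := by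
  intro z₀
  have : IsManifold ((𝓘(ℝ, V)).prod 𝓘(ℝ, F)) 1 (Bundle.TotalSpace F E) :=
    IsManifold.of_le (n := ∞) (by exact_mod_cast le_top)
  have h1 := (h.contMDiff.comp (contMDiff_translate s)) (z₀, (0 : ℝ))
  have h2 := ContMDiffAt.mfderiv (m := ∞)
    (fun (z : Bundle.TotalSpace F E) (t : ℝ) => h ⟨z.1, z.2 + t • s z.1⟩)
    (fun _ => (0 : ℝ)) h1 contMDiffAt_const (by simp)
  have h3 : ContMDiffAt ((𝓘(ℝ, V)).prod 𝓘(ℝ, F)) 𝓘(ℝ, ℝ →L[ℝ] ℝ) ∞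
      (fun z : Bundle.TotalSpace F E => fderiv ℝ (fun t : ℝ => h ⟨z.1, z.2 + t • s z.1⟩) 0) z₀ := by
    refine h2.congr_of_eventuallyEq (Filter.Eventually.of_forall fun z => ?_)
    have e := inTangentCoordinates_model_space (I := 𝓘(ℝ, ℝ)) (I' := 𝓘(ℝ, ℝ))
      (fun _ : Bundle.TotalSpace F E => (0 : ℝ))
      (fun z : Bundle.TotalSpace F E => h ⟨z.1, z.2 + (0 : ℝ) • s z.1⟩)
      (fun z => fderiv ℝ (fun t : ℝ => h ⟨z.1, z.2 + t • s z.1⟩) 0) z₀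
    simp only [mfderiv_eq_fderiv]
    exact (congrFun e z).symm
  have h4 := h3.clm_apply (contMDiffAt_const (c := (1 : ℝ)))
  exact h4.congr_of_eventuallyEq (Filter.Eventually.of_forall fun z => rfl)

/-- A section `s` of `E` as a vertical vector field on `M`, constant along the fibres:
`(s h)(x, e) = d/dt h(x, e + t s(x))` at `t = 0`. -/
def vertLift (s : Sec V F E) : Derivation ℝ (TotFun V F E) (TotFun V F E) :=
  Derivation.mk'
    { toFun := fun h => ⟨_, contMDiff_fibreDeriv h s⟩
      map_add' := fun h k => by
        ext z
        exact deriv_add (differentiable_fibre h s z) (differentiable_fibre k s z)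
      map_smul' := fun r h => by
        ext z
        exact deriv_const_smul r (differentiable_fibre h s z) }
    (fun h k => by
      ext z
      have := deriv_mul (differentiable_fibre h s z) (differentiable_fibre k s z)
      simp only [zero_smul, add_zero] at this
      refine this.trans ?_
      rw [add_comm, mul_comm (deriv (fun t : ℝ => h _) 0)]
      rfl)

/-- The iterated vertical derivative `v_1 ⋯ v_k h`. -/
def iterDer {k : ℕ} (v : Fin k → Sec V F E) (h : TotFun V F E) : TotFun V F E :=
  (List.ofFn v).foldr (fun s h => vertLift s h) h

/-- The iterated Lie derivative `L_{v_1} ⋯ L_{v_k} π` of a bivector field along vertical vector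
fields. -/
def iterLie {k : ℕ} (v : Fin k → Sec V F E) (π : biDer (TotFun V F E)) :
    TotFun V F E → TotFun V F E → TotFun V F E :=
  (List.ofFn v).foldr (fun s β => lieDer (vertLift s) β) (fun f g => π.1 f g)

end Vertical

section ExteriorSections

variable (V F E) in
/-- Functions and sections of `E`, as sections of the bundle of exterior algebras of `E`. -/
def extGenerators : Set (∀ x, ExteriorAlgebra ℝ (E x)) :=
  Set.range (fun (f : BaseFun V C) x => algebraMap ℝ (ExteriorAlgebra ℝ (E x)) (f x)) ∪
    Set.range (fun (s : Sec V F E) x => ExteriorAlgebra.ι ℝ (s x))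

variable (V F E) in
/-- The algebra `A = Γ(C, ⋀E)` of smooth sections of the bundle of exterior algebras: those
sections which near every point are finite sums of products of smooth functions and smooth
sections of `E`, i.e. which have smooth coefficients in local frames of `E`. -/
def extSections : Subalgebra ℝ (∀ x, ExteriorAlgebra ℝ (E x)) where
  carrier := {a | ∀ x₀, ∃ a' ∈ Algebra.adjoin ℝ (extGenerators V F E), ∀ᶠ x in 𝓝 x₀, a x = a' x}
  mul_mem' {a b} ha hb x₀ := by
    obtain ⟨a', ha', h1⟩ := ha x₀
    obtain ⟨η, hη, h2⟩ := hb x₀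
    refine ⟨a' * η, mul_mem ha' hη, ?_⟩
    filter_upwards [h1, h2] with x e1 e2
    simp [e1, e2]
  add_mem' {a b} ha hb x₀ := by
    obtain ⟨a', ha', h1⟩ := ha x₀
    obtain ⟨η, hη, h2⟩ := hb x₀
    refine ⟨a' + η, add_mem ha' hη, ?_⟩
    filter_upwards [h1, h2] with x e1 e2
    simp [e1, e2]
  algebraMap_mem' r x₀ := ⟨_, Subalgebra.algebraMap_mem _ r, Filter.Eventually.of_forall fun _ => rfl⟩

set_option linter.unusedSectionVars false in
lemma mem_extSections_of_adjoin {a' : ∀ x, ExteriorAlgebra ℝ (E x)}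
    (h : a' ∈ Algebra.adjoin ℝ (extGenerators V F E)) : a' ∈ extSections V F E :=
  fun _ => ⟨a', h, Filter.Eventually.of_forall fun _ => rfl⟩

variable (V F E) in
/-- The homogeneous component `A^j = Γ(C, ⋀^j E)`, which is zero for `j < 0`. -/
def extDeg (j : ℤ) : Submodule ℝ (extSections V F E) where
  carrier := {a | if 0 ≤ j then ∀ x, a.1 x ∈ ⋀[ℝ]^j.toNat (E x) else a = 0}
  zero_mem' := by
    split_ifs with h
    · intro x; exact Submodule.zero_mem _
    · rfl
  add_mem' {a b} ha hb := by
    split_ifs at * with h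
    · intro x; exact Submodule.add_mem _ (ha x) (hb x)
    · rw [Set.mem_ofPred_eq] at *; rw [ha, hb, add_zero]
  smul_mem' r a ha := by
    split_ifs at * with h
    · intro x; exact Submodule.smul_mem _ r (ha x)
    · rw [Set.mem_ofPred_eq] at *; rw [ha, smul_zero]

/-- `C^∞(C) = A^0 ⊆ A`. -/
def ofFun (f : BaseFun V C) : extSections V F E :=
  ⟨fun x => algebraMap ℝ (ExteriorAlgebra ℝ (E x)) (f x),
    mem_extSections_of_adjoin (Algebra.subset_adjoin (Or.inl ⟨f, rfl⟩))⟩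

/-- `Γ(C, E) = A^1 ⊆ A`. -/
def ofSec (s : Sec V F E) : extSections V F E :=
  ⟨fun x => ExteriorAlgebra.ι ℝ (s x),
    mem_extSections_of_adjoin (Algebra.subset_adjoin (Or.inr ⟨s, rfl⟩))⟩

set_option linter.unusedSectionVars false in
lemma contractLeft_mem_adjoin (u : LinFun V F E) {a' : ∀ x, ExteriorAlgebra ℝ (E x)}
    (h : a' ∈ Algebra.adjoin ℝ (extGenerators V F E)) :
    (fun x => CliffordAlgebra.contractLeft (u.at x) (a' x)) ∈
      Algebra.adjoin ℝ (extGenerators V F E) := by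
  let S : Set (∀ x, ExteriorAlgebra ℝ (E x)) :=
    {b | b ∈ Algebra.adjoin ℝ (extGenerators V F E) ∧
      (fun x => CliffordAlgebra.contractLeft (u.at x) (b x)) ∈
        Algebra.adjoin ℝ (extGenerators V F E)}
  have hgen : ∀ g ∈ extGenerators V F E, ∀ b ∈ S, g * b ∈ S := by
    rintro g hg b ⟨hb, hc⟩
    refine ⟨mul_mem (Algebra.subset_adjoin hg) hb, ?_⟩
    rcases hg with ⟨f, rfl⟩ | ⟨s, rfl⟩
    · have : (fun x => CliffordAlgebra.contractLeft (u.at x)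
          (((fun x => algebraMap ℝ (ExteriorAlgebra ℝ (E x)) (f x)) * b) x)) =
          (fun x => algebraMap ℝ (ExteriorAlgebra ℝ (E x)) (f x)) *
            fun x => CliffordAlgebra.contractLeft (u.at x) (b x) := by
        funext x
        exact CliffordAlgebra.contractLeft_algebraMap_mul _ _ _
      rw [this]
      exact mul_mem (Algebra.subset_adjoin (Or.inl ⟨f, rfl⟩)) hc
    · have : (fun x => CliffordAlgebra.contractLeft (u.at x)
          (((fun x => ExteriorAlgebra.ι ℝ (s x)) * b) x)) =
          (fun x => algebraMap ℝ (ExteriorAlgebra ℝ (E x)) (pairing u s x)) * b -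
          (fun x => ExteriorAlgebra.ι ℝ (s x)) *
            fun x => CliffordAlgebra.contractLeft (u.at x) (b x) := by
        funext x
        refine (CliffordAlgebra.contractLeft_ι_mul _ _ _).trans ?_
        rw [Algebra.smul_def]
        rfl
      rw [this]
      exact sub_mem (mul_mem (Algebra.subset_adjoin (Or.inl ⟨_, rfl⟩)) hb)
        (mul_mem (Algebra.subset_adjoin (Or.inr ⟨s, rfl⟩)) hc)
  have hone : (1 : ∀ x, ExteriorAlgebra ℝ (E x)) ∈ S := by
    refine ⟨one_mem _, ?_⟩
    have : (fun x => CliffordAlgebra.contractLeft (u.at x)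
        ((1 : ∀ x, ExteriorAlgebra ℝ (E x)) x)) = 0 := by
      funext x
      exact CliffordAlgebra.contractLeft_one (Q := (0 : QuadraticForm ℝ (E x))) (u.at x)
    rw [this]
    exact zero_mem _
  suffices a' ∈ S from this.2
  rw [← Subalgebra.mem_toSubmodule, Algebra.adjoin_eq_span] at h
  induction h using Submodule.span_induction with
  | mem b hb =>
    induction hb using Submonoid.closure_induction_left with
    | one => exact hone
    | mul_left g hg b _ ih => exact hgen g hg b ih
  | zero =>
    refine ⟨zero_mem _, ?_⟩
    have : (fun x => CliffordAlgebra.contractLeft (u.at x)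
        ((0 : ∀ x, ExteriorAlgebra ℝ (E x)) x)) = 0 := by
      funext x
      change CliffordAlgebra.contractLeft (u.at x) (0 : ExteriorAlgebra ℝ (E x)) = 0
      exact LinearMap.map_zero _
    rw [this]
    exact zero_mem _
  | add b c _ _ hb hc =>
    refine ⟨add_mem hb.1 hc.1, ?_⟩
    have : (fun x => CliffordAlgebra.contractLeft (u.at x) ((b + c) x)) =
        (fun x => CliffordAlgebra.contractLeft (u.at x) (b x)) +
          fun x => CliffordAlgebra.contractLeft (u.at x) (c x) := by
      funext x
      exact map_add _ _ _
    rw [this]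
    exact add_mem hb.2 hc.2
  | smul r b _ hb =>
    refine ⟨Subalgebra.smul_mem _ hb.1 r, ?_⟩
    have : (fun x => CliffordAlgebra.contractLeft (u.at x) ((r • b) x)) =
        r • fun x => CliffordAlgebra.contractLeft (u.at x) (b x) := by
      funext x
      exact (CliffordAlgebra.contractLeft (u.at x)).map_smul r (b x)
    rw [this]
    exact Subalgebra.smul_mem _ hb.2 r

/-- The inner multiplication `ι_u`, `u ∈ Γ(C, E*)`: the derivation of `A` of degree `-1` that
vanishes on functions and maps `s ∈ Γ(C, E)` to `⟨s, u⟩`. -/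
def contract (u : LinFun V F E) : extSections V F E →ₗ[ℝ] extSections V F E where
  toFun a := ⟨fun x => CliffordAlgebra.contractLeft (u.at x) (a.1 x), fun x₀ => by
    obtain ⟨a', ha', h⟩ := a.2 x₀
    exact ⟨_, contractLeft_mem_adjoin u ha', h.mono fun x e => by simp only [e]⟩⟩
  map_add' a b := by ext x; exact map_add _ _ _
  map_smul' r a := by
    ext x; exact (CliffordAlgebra.contractLeft (u.at x)).map_smul r (a.1 x)

end ExteriorSections

/-! ### Bivector fields on the formal neighbourhood and the Fourier transform -/

variable (V F E) in
/-- The vanishing ideal `I(C)` of the zero section `C ⊆ M`. -/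
def zeroIdeal : Ideal (TotFun V F E) where
  carrier := {h | ∀ x : C, h ⟨x, 0⟩ = 0}
  zero_mem' _ := rfl
  add_mem' {h k} hh hk x := by
    change h _ + k _ = 0
    rw [hh x, hk x, add_zero]
  smul_mem' r h hh x := by
    change r _ * h _ = 0
    rw [hh x, mul_zero]

variable (V F E) in
/-- Bivector fields on the formal neighbourhood of `C` in `M`:
`T¹(M, C) = lim T¹(M) / I(C)^n T¹(M)`, where `T¹(M)` is the `C^∞(M)`-module of bivector fields. -/
abbrev FormalBivector : Type _ := AdicCompletion (zeroIdeal V F E) (biDer (TotFun V F E))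

/-- The bivector field `π'` on `M` represents `π` modulo `I(C)^N T¹(M)`. -/
def Represents (N : ℕ) (π : FormalBivector V F E) (π' : biDer (TotFun V F E)) : Prop :=
  AdicCompletion.eval (zeroIdeal V F E) (biDer (TotFun V F E)) N π = Submodule.Quotient.mk π'

/-- `π` is a Poisson bivector field on the formal neighbourhood, `[π, π] = 0`: modulo all powers
of `I(C)` the bracket `{f, g} = ⟨π, df ⊗ dg⟩` obeys the Jacobi identity. (If `π` is known modulo
`I(C)^(N+1)`, then its Jacobiator is known modulo `I(C)^N`.) -/
def IsPoisson (π : FormalBivector V F E) : Prop :=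
  ∀ (N : ℕ) (π' : biDer (TotFun V F E)), Represents (N + 1) π π' →
    ∀ f g h, jacobiator π' f g h ∈ zeroIdeal V F E ^ N

variable (V F E) in
/-- `T̂¹(A)`: the part of degree one of the completed Lie algebra of multiderivations of
`A = Γ(C, ⋀E)`. -/
abbrev FormalMultiDer : Submodule ℝ
    (∀ n, MultilinearMap ℝ (fun _ : Fin n => extSections V F E) (extSections V F E)) :=
  multiDer (extDeg V F E)

/-- The derivation `δ` of `A` of degree zero and the vector field `X` on `M`, linear along the
fibres, are dual to each other: they agree on `C^∞(C)`, and
`⟨s, X u⟩ = δ⟨s, u⟩ - ⟨δ s, u⟩` for `s ∈ Γ(C, E)`, `u ∈ Γ(C, E*)`.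
For a connection `∇` on `E` and a vector field `ξ` on `C` such a pair is given by `∇_ξ` on
`A` and the dual `∇*_ξ` on functions on `M`. -/
structure IsDual (δ : extSections V F E →ₗ[ℝ] extSections V F E)
    (X : Derivation ℝ (TotFun V F E) (TotFun V F E)) : Prop where
  derivation : IsDerZero (extDeg V F E) δ
  base : ∀ f : BaseFun V C, ∃ g : BaseFun V C, δ (ofFun f) = ofFun g ∧ X (pullback f) = pullback g
  fibre : ∀ u : LinFun V F E, ∃ w : LinFun V F E, X u.1 = w.1 ∧ ∀ s : Sec V F E,
    ofFun (pairing w s) = δ (ofFun (pairing u s)) - contract u (δ (ofSec s))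

section Fourier

variable [IsManifold 𝓘(ℝ, V) ∞ C] [ContMDiffVectorBundle ∞ F E 𝓘(ℝ, V)]

/-- `Φ : T¹(M, C) → T̂¹(A)` is (the part of degree one of) the completed Fourier transform: the
continuous `C^∞(C)`-linear isomorphism induced by the isomorphism of graded commutative algebras
`S_B(Der(B)[-1]) → S_A(Der(A)[-1])` over `C^∞(C)` that maps fibrewise linear functions
`u ∈ Γ(C, E*)` to `ι_u`, vertical vector fields `e ∈ Γ(C, E)` to `-e ∈ A`, and fibrewise linear
vector fields (such as `∇*_ξ`) to the dual derivations of `A` (such as `∇_ξ`). -/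
structure IsFourier (Φ : FormalBivector V F E ≃+ FormalMultiDer V F E) : Prop where
  map_smul : ∀ (f : BaseFun V C) (π : FormalBivector V F E) (n : ℕ)
    (a : Fin n → extSections V F E),
    (Φ ((pullback f : TotFun V F E) • π)).1 n a = ofFun f * (Φ π).1 n a
  continuous : ∀ n, ∃ m, ∀ π : FormalBivector V F E,
    AdicCompletion.eval (zeroIdeal V F E) (biDer (TotFun V F E)) m π = 0 → (Φ π).1 n = 0
  linear_linear : ∀ (k : ℕ) (u : Fin k → LinFun V F E)
    (δ δ' : extSections V F E →ₗ[ℝ] extSections V F E)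
    (X X' : Derivation ℝ (TotFun V F E) (TotFun V F E)), IsDual δ X → IsDual δ' X' →
    IsProduct (extDeg V F E)
      (Φ (AdicCompletion.of _ _ ((∏ i, (u i).1) • wedge X X'))).1 1
      (Fin.append (fun _ : Fin k => (-1 : ℤ)) ![0, 0])
      (Fin.append (fun i a => contract (u i) a) ![fun a => δ a, fun a => δ' a])
  vertical_linear : ∀ (k : ℕ) (u : Fin k → LinFun V F E) (e : Sec V F E)
    (δ : extSections V F E →ₗ[ℝ] extSections V F E)
    (X : Derivation ℝ (TotFun V F E) (TotFun V F E)), IsDual δ X →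
    IsProduct (extDeg V F E)
      (Φ (AdicCompletion.of _ _ ((∏ i, (u i).1) • wedge (vertLift e) X))).1 (-ofSec e)
      (Fin.append (fun _ : Fin k => (-1 : ℤ)) ![0])
      (Fin.append (fun i a => contract (u i) a) ![fun a => δ a])
  vertical_vertical : ∀ (k : ℕ) (u : Fin k → LinFun V F E) (e e' : Sec V F E),
    IsProduct (extDeg V F E)
      (Φ (AdicCompletion.of _ _ ((∏ i, (u i).1) • wedge (vertLift e) (vertLift e')))).1
      (-ofSec e * -ofSec e')
      (fun _ : Fin k => (-1 : ℤ)) (fun i a => contract (u i) a)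

/-- The sign `(-1)^{(n-1)(n-2)/2}`. -/
def kappa (n : ℕ) : ℝ := sgn (((n : ℤ) - 1) * ((n : ℤ) - 2) / 2)

/-- The sequence of operations `λ_n = (-1)^{(n-1)(n-2)/2} φ_n` attached to an element `(φ_n)_n`
of `T̂¹(A)`. -/
def operations (φ : FormalMultiDer V F E) :
    ∀ n, MultilinearMap ℝ (fun _ : Fin n => extSections V F E) (extSections V F E) :=
  fun n => kappa n • φ.1 n

/-- The values of the operations `λ_n` on the generators `Γ(C, E)`, `C^∞(C)` of `A`, for a
bivector field `π` on the formal neighbourhood with bracket `{f, g} = ⟨π, df ⊗ dg⟩`: for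
`v_i ∈ Γ(C, E)` (vertical vector fields), `f, g ∈ C^∞(C)`, `u, w ∈ Γ(C, E*)` (linear functions),
up to the sign `kappa`,
`λ_n(v_1,…,v_{n-2},f,g) = (L_{v_1} ⋯ L_{v_{n-2}} π)(p^*f, p^*g)|_C`,
`⟨λ_n(v_1,…,v_{n-1},f),u⟩ = (L_{v_1} ⋯ L_{v_{n-1}} π)(p^*f, u)|_C`,
`⟨λ_n(v_1,…,v_n), u ⊗ w⟩ = (L_{v_1} ⋯ L_{v_n} π)(u, w)|_C`.
The right-hand sides involve at most `k` vertical derivatives of `π`, so that they can be computed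
from a representative modulo `I(C)^(k+1)`. -/
structure HasGeneratorValues (π : FormalBivector V F E)
    (l : ∀ n, MultilinearMap ℝ (fun _ : Fin n => extSections V F E) (extSections V F E)) :
    Prop where
  fun_fun : ∀ (k : ℕ) (v : Fin k → Sec V F E) (f g : BaseFun V C) (π' : biDer (TotFun V F E)),
    Represents (k + 1) π π' →
    l (k + 2) (Fin.append (fun i => ofSec (v i)) ![ofFun f, ofFun g]) =
      kappa (k + 2) • ofFun (restrict (iterLie v π' (pullback f) (pullback g)))
  fun_lin : ∀ (k : ℕ) (v : Fin k → Sec V F E) (f : BaseFun V C) (u : LinFun V F E)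
    (π' : biDer (TotFun V F E)), Represents (k + 1) π π' →
    contract u (l (k + 1) (Fin.append (fun i => ofSec (v i)) ![ofFun f])) =
      kappa (k + 1) • ofFun (restrict (iterLie v π' (pullback f) u.1))
  lin_lin : ∀ (k : ℕ) (v : Fin k → Sec V F E) (u w : LinFun V F E)
    (π' : biDer (TotFun V F E)), Represents (k + 1) π π' →
    contract w (contract u (l k fun i => ofSec (v i))) =
      kappa k • ofFun (restrict (iterLie v π' u.1 w.1))

/-- The components of the `λ_n` in local coordinates are the Taylor coefficients of `π` in the
transverse coordinates: for a local frame `e_1,…,e_r` of `E` near `x₀` with dual fibre coordinates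
`y^1,…,y^r`, and `∂_μ = ∂/∂y^μ` (the vertical vector field `e_μ`), up to the sign `kappa`,
`λ_n(e_{μ_1},…,e_{μ_{n-2}},f,g) = ∂_{μ_1} ⋯ ∂_{μ_{n-2}} {p^*f, p^*g}|_{y=0}`,
`λ_n(e_{μ_1},…,e_{μ_{n-1}},f) = ∑_ν ∂_{μ_1} ⋯ ∂_{μ_{n-1}} {p^*f, y^ν}|_{y=0} e_ν`,
`λ_n(e_{μ_1},…,e_{μ_n}) = 1/2 ∑_{ν,ρ} ∂_{μ_1} ⋯ ∂_{μ_n} {y^ν, y^ρ}|_{y=0} e_ν e_ρ`. -/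
structure HasTaylorComponents (π : FormalBivector V F E)
    (l : ∀ n, MultilinearMap ℝ (fun _ : Fin n => extSections V F E) (extSections V F E))
    (x₀ : C) (e : Fin (Module.finrank ℝ F) → Sec V F E)
    (y : Fin (Module.finrank ℝ F) → LinFun V F E) : Prop where
  fun_fun : ∀ (k : ℕ) (μ : Fin k → Fin (Module.finrank ℝ F)) (f g : BaseFun V C)
    (π' : biDer (TotFun V F E)), Represents (k + 1) π π' →
    (l (k + 2) (Fin.append (fun i => ofSec (e (μ i))) ![ofFun f, ofFun g])).1 x₀ =
      kappa (k + 2) • algebraMap ℝ _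
        (iterDer (fun i => e (μ i)) (π'.1 (pullback f) (pullback g)) ⟨x₀, 0⟩)
  fun_lin : ∀ (k : ℕ) (μ : Fin k → Fin (Module.finrank ℝ F)) (f : BaseFun V C)
    (π' : biDer (TotFun V F E)), Represents (k + 1) π π' →
    (l (k + 1) (Fin.append (fun i => ofSec (e (μ i))) ![ofFun f])).1 x₀ =
      kappa (k + 1) • ∑ ν, iterDer (fun i => e (μ i)) (π'.1 (pullback f) (y ν).1) ⟨x₀, 0⟩ •
        ExteriorAlgebra.ι ℝ (e ν x₀)
  lin_lin : ∀ (k : ℕ) (μ : Fin k → Fin (Module.finrank ℝ F))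
    (π' : biDer (TotFun V F E)), Represents (k + 1) π π' →
    (l k fun i => ofSec (e (μ i))).1 x₀ =
      kappa k • (1 / 2 : ℝ) • ∑ ν, ∑ ρ,
        iterDer (fun i => e (μ i)) (π'.1 (y ν).1 (y ρ).1) ⟨x₀, 0⟩ •
          (ExteriorAlgebra.ι ℝ (e ν x₀) * ExteriorAlgebra.ι ℝ (e ρ x₀))

end Fourier

end Geometry

end RelPoisson

end

noncomputable section

namespace RelPoisson

/-! ### Signs -/

section Signs

lemma sgn_add (a b : ℤ) : sgn (a + b) = sgn a * sgn b :=
  zpow_add₀ (by norm_num) a b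

@[simp] lemma sgn_zero : sgn 0 = 1 := rfl

@[simp] lemma sgn_one : sgn 1 = -1 := by simp [sgn]

lemma sgn_of_even {a : ℤ} (h : Even a) : sgn a = 1 := h.neg_one_zpow

lemma sgn_of_odd {a : ℤ} (h : Odd a) : sgn a = -1 := h.neg_one_zpow

lemma sgn_congr {a b : ℤ} (h : Even a ↔ Even b) : sgn a = sgn b := by
  by_cases ha : Even a
  · rw [sgn_of_even ha, sgn_of_even (h.1 ha)]
  · rw [sgn_of_odd (Int.not_even_iff_odd.1 ha), sgn_of_odd (Int.not_even_iff_odd.1 (h.not.1 ha))]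

@[simp] lemma sgn_mul_self (a : ℤ) : sgn a * sgn a = 1 := by
  rw [← sgn_add]; exact sgn_of_even ⟨a, rfl⟩

lemma sgn_ne_zero (a : ℤ) : sgn a ≠ 0 := zpow_ne_zero _ (by norm_num)

lemma neg_sgn (a : ℤ) : -sgn a = sgn (a + 1) := by simp [sgn_add]

@[simp] lemma sgn_neg (a : ℤ) : sgn (-a) = sgn a := sgn_congr (by simp)

lemma neg_smul_sgn {M : Type*} [AddCommGroup M] [Module ℝ M] (a : ℤ) (x : M) :
    -(sgn a • x) = sgn (a + 1) • x := by rw [← neg_sgn, neg_smul]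

lemma sgn_smul_smul {M : Type*} [AddCommGroup M] [Module ℝ M] (a b : ℤ) (x : M) :
    sgn a • sgn b • x = sgn (a + b) • x := by rw [smul_smul, sgn_add]

end Signs

lemma deg_cast {A : Type*} [AddCommGroup A] [Module ℝ A] {𝒜 : ℤ → Submodule ℝ A} {i k : ℤ} {a : A}
    (h : a ∈ 𝒜 i) (hik : i = k) : a ∈ 𝒜 k := hik ▸ h

/-! ### An algebraic model of a vector bundle with finite frames -/

/-- The algebraic data attached to a vector bundle: functions `B` on the base, functions `O` on the
total space, sections `A` of the exterior algebra, sections `S` and dual sections `L`, together with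
finite overcomplete frames `e`, `u` of the bundle and `x`, `dB`, `dO` of the tangent directions. -/
structure Model (B O A : Type*) [CommRing B] [Algebra ℝ B] [CommRing O] [Algebra ℝ O]
    [Ring A] [Algebra ℝ A] (𝒜 : ℤ → Submodule ℝ A) (S L κ η : Type*)
    [Fintype κ] [Fintype η] where
  /-- pullback of functions -/
  p : B →ₐ[ℝ] O
  /-- restriction to the zero section -/
  r : O →ₐ[ℝ] B
  /-- functions as elements of degree zero -/
  j : B →ₐ[ℝ] A
  /-- the component of degree zero -/
  ε : A →ₗ[ℝ] B
  /-- sections as elements of degree one -/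
  sec : S → A
  /-- inner multiplication -/
  con : L → A →ₗ[ℝ] A
  /-- dual sections as fibrewise linear functions -/
  lin : L → O
  /-- sections as vertical vector fields -/
  vert : S → Derivation ℝ O O
  /-- the pairing -/
  pair : L → S → B
  /-- frame of sections -/
  e : κ → S
  /-- frame of dual sections -/
  u : κ → L
  /-- functions on the base with spanning differentials -/
  x : η → B
  /-- vector fields on the base dual to the differentials of `x` -/
  dB : η → Derivation ℝ B B
  /-- horizontal lifts of `dB` -/
  dO : η → Derivation ℝ O O
  /-- bound for the degrees -/
  bd : ℕ
  r_p : ∀ f, r (p f) = f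
  j_comm : ∀ f a, j f * a = a * j f
  j_mem : ∀ f, j f ∈ 𝒜 0
  sec_mem : ∀ s, sec s ∈ 𝒜 1
  mul_mem : ∀ i k a b, a ∈ 𝒜 i → b ∈ 𝒜 k → a * b ∈ 𝒜 (i + k)
  neg_eq : ∀ i a, i < 0 → a ∈ 𝒜 i → a = 0
  bd_eq : ∀ i : ℤ, ∀ a, bd < i → a ∈ 𝒜 i → a = 0
  decomp : ∀ a, ∃ c : ℕ → A, (∀ i : ℕ, c i ∈ 𝒜 i) ∧ a = ∑ i ∈ Finset.range (bd + 1), c i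
  ε_j : ∀ f, ε (j f) = f
  ε_mul : ∀ f a, ε (j f * a) = f * ε a
  ε_pos : ∀ i a, 0 < i → a ∈ 𝒜 i → ε a = 0
  j_ε : ∀ a, a ∈ 𝒜 0 → j (ε a) = a
  sec_sec : ∀ s t, sec s * sec t = -(sec t * sec s)
  con_mem : ∀ w i a, a ∈ 𝒜 i → con w a ∈ 𝒜 (i - 1)
  con_j_mul : ∀ w f a, con w (j f * a) = j f * con w a
  con_sec_mul : ∀ w s a, con w (sec s * a) = j (pair w s) * a - sec s * con w a
  con_con : ∀ w w' a, con w (con w' a) = -con w' (con w a)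
  euler : ∀ (i : ℤ) a, a ∈ 𝒜 i → ∑ μ, sec (e μ) * con (u μ) a = (i : ℝ) • a
  con_eq : ∀ w a, con w a = ∑ μ, j (pair w (e μ)) * con (u μ) a
  sec_surj : ∀ a, a ∈ 𝒜 1 → ∃ s, sec s = a
  vert_p : ∀ s f, vert s (p f) = 0
  vert_lin : ∀ s w, vert s (lin w) = p (pair w s)
  r_lin : ∀ w, r (lin w) = 0
  vert_comm : ∀ s t h, vert s (vert t h) = vert t (vert s h)
  lin_eq : ∀ w, lin w = ∑ μ, p (pair w (e μ)) * lin (u μ)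
  lin_sum : ∀ f : κ → B, ∃ w, lin w = ∑ μ, p (f μ) * lin (u μ)
  vert_eq : ∀ s h, vert s h = ∑ μ, p (pair (u μ) s) * vert (e μ) h
  ker : ∀ h, r h = 0 → ∃ g : κ → O, h = ∑ μ, lin (u μ) * g μ
  dO_p : ∀ i f, dO i (p f) = p (dB i f)
  dO_lin : ∀ i w, dO i (lin w) = ∑ μ, p (dB i (pair w (e μ))) * lin (u μ)
  tightB : ∀ (D : Derivation ℝ B B) f, D f = ∑ i, dB i f * D (x i)
  tightO : ∀ (D : Derivation ℝ O O) h,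
    D h = ∑ i, D (p (x i)) * dO i h + ∑ μ, D (lin (u μ)) * vert (e μ) h

namespace Model

variable {B O A : Type*} [CommRing B] [Algebra ℝ B] [CommRing O] [Algebra ℝ O]
  [Ring A] [Algebra ℝ A] {𝒜 : ℤ → Submodule ℝ A} {S L κ η : Type*} [Fintype κ] [Fintype η]
  (M : Model B O A 𝒜 S L κ η)

/-! ### The exterior algebra -/

/-- The element of degree one given by a member of the frame. -/
abbrev E (μ : κ) : A := M.sec (M.e μ)

/-- Contraction with a member of the dual frame. -/
abbrev ι (μ : κ) : A →ₗ[ℝ] A := M.con (M.u μ)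

lemma eq_smul_euler {n : ℕ} {a : A} (h : a ∈ 𝒜 ((n + 1 : ℕ) : ℤ)) :
    a = ((n : ℝ) + 1)⁻¹ • ∑ μ, M.E μ * M.ι μ a := by
  rw [M.euler _ a h, smul_smul]
  push_cast
  rw [inv_mul_cancel₀ (by positivity), one_smul]

lemma ι_mem {n : ℕ} {a : A} (h : a ∈ 𝒜 ((n + 1 : ℕ) : ℤ)) (μ : κ) : M.ι μ a ∈ 𝒜 (n : ℤ) := by
  have := M.con_mem (M.u μ) _ a h
  exact deg_cast this (by push_cast; ring)

/-- Induction on the degree: everything is generated by functions and the frame. -/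
lemma hom_induction {Q : ℤ → A → Prop} (h0 : ∀ i, Q i 0)
    (hadd : ∀ i a b, a ∈ 𝒜 i → b ∈ 𝒜 i → Q i a → Q i b → Q i (a + b))
    (hsmul : ∀ i (c : ℝ) a, a ∈ 𝒜 i → Q i a → Q i (c • a))
    (hj : ∀ f, Q 0 (M.j f))
    (he : ∀ (n : ℕ) μ a, a ∈ 𝒜 (n : ℤ) → Q n a → Q ((n + 1 : ℕ) : ℤ) (M.E μ * a))
    (i : ℤ) (a : A) (ha : a ∈ 𝒜 i) : Q i a := by
  rcases lt_or_ge i 0 with hi | hi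
  · rw [M.neg_eq i a hi ha]; exact h0 i
  obtain ⟨n, rfl⟩ := Int.eq_ofNat_of_zero_le hi
  clear hi
  induction n generalizing a with
  | zero => have := hj (M.ε a); rwa [M.j_ε a ha] at this
  | succ n ih =>
    have hm : ∀ μ, M.E μ * M.ι μ a ∈ 𝒜 ((n + 1 : ℕ) : ℤ) := fun μ =>
      deg_cast (M.mul_mem 1 n _ _ (M.sec_mem _) (M.ι_mem ha μ)) (by push_cast; ring)
    have key : ∀ s : Finset κ, (∑ μ ∈ s, M.E μ * M.ι μ a) ∈ 𝒜 ((n + 1 : ℕ) : ℤ) ∧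
        Q ((n + 1 : ℕ) : ℤ) (∑ μ ∈ s, M.E μ * M.ι μ a) := by
      classical
      intro s
      induction s using Finset.induction_on with
      | empty => exact ⟨by simp, by simpa using h0 _⟩
      | insert μ s hμ ihs =>
        rw [Finset.sum_insert hμ]
        exact ⟨add_mem (hm μ) ihs.1, hadd _ _ _ (hm μ) ihs.1
          (he n μ _ (M.ι_mem ha μ) (ih _ (M.ι_mem ha μ))) ihs.2⟩
    rw [M.eq_smul_euler ha]
    exact hsmul _ _ _ (key Finset.univ).1 (key Finset.univ).2

lemma sec_comm (s : S) (i : ℤ) (a : A) (ha : a ∈ 𝒜 i) : M.sec s * a = sgn i • (a * M.sec s) := by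
  refine M.hom_induction (Q := fun i a => M.sec s * a = sgn i • (a * M.sec s))
    (by simp) ?_ ?_ ?_ ?_ i a ha
  · intro i a b _ _ h1 h2; rw [mul_add, add_mul, h1, h2, smul_add]
  · intro i c a _ h1; rw [mul_smul_comm, smul_mul_assoc, h1, smul_comm]
  · intro f; rw [← M.j_comm]; simp
  · intro n μ a _ h1
    rw [← mul_assoc, M.sec_sec, neg_mul, mul_assoc, h1, mul_smul_comm, neg_smul_sgn, mul_assoc]
    push_cast; rfl

lemma comm (M : Model B O A 𝒜 S L κ η) 
    (i k : ℤ) (a b : A) (ha : a ∈ 𝒜 i) (hb : b ∈ 𝒜 k) :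
    a * b = sgn (i * k) • (b * a) := by
  refine M.hom_induction (Q := fun i a => a * b = sgn (i * k) • (b * a))
    (by simp) ?_ ?_ ?_ ?_ i a ha
  · intro i a b _ _ h1 h2; rw [mul_add, add_mul, h1, h2, smul_add]
  · intro i c a _ h1; rw [mul_smul_comm, smul_mul_assoc, h1, smul_comm]
  · intro f; rw [← M.j_comm]; simp
  · intro n μ a _ h1
    rw [mul_assoc, h1, mul_smul_comm, ← mul_assoc, M.sec_comm _ k b hb, smul_mul_assoc,
      sgn_smul_smul, mul_assoc]
    congr 2; push_cast; ring

lemma con_j (w : L) (f : B) : M.con w (M.j f) = 0 :=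
  M.neg_eq (-1) _ (by norm_num) (by simpa using M.con_mem w 0 _ (M.j_mem f))

lemma con_mul (w : L) (i : ℤ) (b c : A) (hb : b ∈ 𝒜 i) :
    M.con w (b * c) = M.con w b * c + sgn i • (b * M.con w c) := by
  refine M.hom_induction (Q := fun i b => ∀ c, M.con w (b * c) =
    M.con w b * c + sgn i • (b * M.con w c)) (by simp) ?_ ?_ ?_ ?_ i b hb c
  · intro i a b _ _ h1 h2 c; simp only [add_mul, map_add, h1, h2, smul_add]; abel
  · intro i r a _ h1 c
    simp only [smul_mul_assoc, map_smul, h1, smul_add]; rw [smul_comm]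
  · intro f c; simp [M.con_j, M.con_j_mul]
  · intro n μ a _ h1 c
    rw [mul_assoc, M.con_sec_mul, M.con_sec_mul, h1]
    push_cast
    simp only [mul_add, sub_mul, mul_assoc, mul_smul_comm, sgn_add, sgn_one, mul_neg, mul_one,
      neg_smul]
    abel

lemma con_sec (w : L) (s : S) : M.con w (M.sec s) = M.j (M.pair w s) := by
  have := M.con_sec_mul w s 1
  have h1 : M.con w (1 : A) = 0 := by rw [← map_one M.j, M.con_j]
  simpa [h1] using this

lemma eq_zero_of_ι {n : ℕ} {a : A} (h : a ∈ 𝒜 ((n + 1 : ℕ) : ℤ)) (h0 : ∀ μ, M.ι μ a = 0) :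
    a = 0 := by
  rw [M.eq_smul_euler h]; simp [h0]

lemma j_injective : Function.Injective M.j := fun f g h => by rw [← M.ε_j f, h, M.ε_j]

lemma sec_eq (s : S) : M.sec s = ∑ μ, M.j (M.pair (M.u μ) s) * M.E μ := by
  have := M.euler 1 _ (M.sec_mem s)
  simp only [Int.cast_one, one_smul, M.con_sec] at this
  rw [← this]
  simp [M.j_comm]

/-- The extension to `A` of an operation on functions, in degree `n`. -/
def ext (D : B →ₗ[ℝ] B) : ℕ → A →ₗ[ℝ] A
  | 0 => M.j.toLinearMap ∘ₗ D ∘ₗ M.ε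
  | n + 1 => ((n : ℝ) + 1)⁻¹ • ∑ μ, (LinearMap.mulLeft ℝ (M.E μ)) ∘ₗ ext D n ∘ₗ M.ι μ

lemma ext_succ (D : B →ₗ[ℝ] B) (n : ℕ) (a : A) :
    M.ext D (n + 1) a = ((n : ℝ) + 1)⁻¹ • ∑ μ, M.E μ * M.ext D n (M.ι μ a) := by
  simp [ext]

lemma ext_mem (D : B →ₗ[ℝ] B) (n : ℕ) (a : A) : M.ext D n a ∈ 𝒜 (n : ℤ) := by
  induction n generalizing a with
  | zero => exact M.j_mem _
  | succ n ih =>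
    rw [ext_succ]
    refine Submodule.smul_mem _ _ (Submodule.sum_mem _ fun μ _ => ?_)
    exact deg_cast (M.mul_mem 1 n _ _ (M.sec_mem _) (ih _)) (by push_cast; ring)

lemma ext_ne (D : B →ₗ[ℝ] B) (n : ℕ) (i : ℤ) (hi : i ≠ n) (a : A) (ha : a ∈ 𝒜 i) :
    M.ext D n a = 0 := by
  induction n generalizing a i with
  | zero =>
    rcases lt_trichotomy i 0 with h | h | h
    · rw [M.neg_eq i a h ha, map_zero]
    · exact absurd h hi
    · simp [ext, M.ε_pos i a h ha]
  | succ n ih =>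
    rw [ext_succ]
    have : ∀ μ, M.ext D n (M.ι μ a) = 0 := fun μ =>
      ih (i - 1) (by push_cast at hi; intro h; apply hi; omega) _ (M.con_mem _ _ _ ha)
    simp [this]

lemma ext_id (n : ℕ) (a : A) (ha : a ∈ 𝒜 (n : ℤ)) : M.ext LinearMap.id n a = a := by
  induction n generalizing a with
  | zero => exact M.j_ε a ha
  | succ n ih =>
    rw [ext_succ]
    conv_rhs => rw [M.eq_smul_euler ha]
    congr 1
    exact Finset.sum_congr rfl fun μ _ => by rw [ih _ (M.ι_mem ha μ)]

/-- The extension to `A` of an operation on functions. -/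
def Ext (D : B →ₗ[ℝ] B) : A →ₗ[ℝ] A := ∑ n ∈ Finset.range (M.bd + 1), M.ext D n

lemma Ext_apply (D : B →ₗ[ℝ] B) (n : ℕ) (a : A) (ha : a ∈ 𝒜 (n : ℤ)) :
    M.Ext D a = M.ext D n a := by
  simp only [Ext, LinearMap.sum_apply]
  by_cases hn : n ∈ Finset.range (M.bd + 1)
  · rw [Finset.sum_eq_single_of_mem n hn]
    intro k _ hk
    exact M.ext_ne D k n (by exact_mod_cast hk.symm) a ha
  · have : a = 0 := M.bd_eq n a (by simp at hn; exact_mod_cast hn) ha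
    subst this; simp

lemma Ext_mem (D : B →ₗ[ℝ] B) (i : ℤ) (a : A) (ha : a ∈ 𝒜 i) : M.Ext D a ∈ 𝒜 i := by
  rcases lt_or_ge i 0 with hi | hi
  · rw [M.neg_eq i a hi ha, map_zero]; exact zero_mem _
  obtain ⟨n, rfl⟩ := Int.eq_ofNat_of_zero_le hi
  rw [M.Ext_apply D n a ha]; exact M.ext_mem D n a

lemma Ext_j (D : B →ₗ[ℝ] B) (f : B) : M.Ext D (M.j f) = M.j (D f) := by
  rw [M.Ext_apply D 0 _ (M.j_mem f)]; simp [ext, M.ε_j]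

lemma Ext_euler (D : B →ₗ[ℝ] B) (n : ℕ) (a : A) (ha : a ∈ 𝒜 ((n + 1 : ℕ) : ℤ)) :
    ∑ μ, M.E μ * M.Ext D (M.ι μ a) = ((n : ℝ) + 1) • M.Ext D a := by
  rw [M.Ext_apply D _ a ha, ext_succ, smul_smul, mul_inv_cancel₀ (by positivity), one_smul]
  exact Finset.sum_congr rfl fun μ _ => by rw [M.Ext_apply D n _ (M.ι_mem ha μ)]

lemma Ext_euler' (D : B →ₗ[ℝ] B) (n : ℕ) (a : A) (ha : a ∈ 𝒜 (n : ℤ)) :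
    ∑ μ, M.E μ * M.Ext D (M.ι μ a) = (n : ℝ) • M.Ext D a := by
  cases n with
  | zero =>
    have : ∀ μ, M.ι μ a = 0 := fun μ => by rw [← M.j_ε a ha, M.con_j]
    simp [this]
  | succ n => rw [M.Ext_euler D n a ha]; push_cast; rfl

/-- Multiplication of a homogeneous element by the sign of its degree. -/
def σ : A →ₗ[ℝ] A := ∑ n ∈ Finset.range (M.bd + 1), sgn n • M.ext LinearMap.id n

lemma σ_apply (i : ℤ) (a : A) (ha : a ∈ 𝒜 i) : M.σ a = sgn i • a := by
  rcases lt_or_ge i 0 with hi | hi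
  · rw [M.neg_eq i a hi ha]; simp
  obtain ⟨n, rfl⟩ := Int.eq_ofNat_of_zero_le hi
  simp only [σ, LinearMap.sum_apply, LinearMap.smul_apply]
  by_cases hn : n ∈ Finset.range (M.bd + 1)
  · rw [Finset.sum_eq_single_of_mem n hn, M.ext_id n a ha]
    intro k _ hk
    rw [M.ext_ne _ k n (by exact_mod_cast hk.symm) a ha, smul_zero]
  · have : a = 0 := M.bd_eq n a (by simp at hn; exact_mod_cast hn) ha
    subst this; simp

/-- Linear maps agreeing on homogeneous elements are equal. -/
lemma linear_ext (M : Model B O A 𝒜 S L κ η) 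
    {N : Type*} [AddCommGroup N] [Module ℝ N] {f g : A →ₗ[ℝ] N}
    (h : ∀ i : ℤ, ∀ a ∈ 𝒜 i, f a = g a) (a : A) : f a = g a := by
  obtain ⟨c, hc, rfl⟩ := M.decomp a
  rw [map_sum, map_sum]
  exact Finset.sum_congr rfl fun i _ => h i _ (hc i)

lemma σ_pow_apply (k : ℕ) (i : ℤ) (a : A) (ha : a ∈ 𝒜 i) : (M.σ ^ k) a = sgn (k * i) • a := by
  induction k with
  | zero => simp
  | succ n ih =>
    rw [pow_succ', Module.End.mul_apply, ih, map_smul, M.σ_apply i a ha, sgn_smul_smul]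
    congr 2; push_cast; ring

lemma Ext_mul (D : Derivation ℝ B B) (a b : A) :
    M.Ext D.toLinearMap (a * b) = M.Ext D.toLinearMap a * b + a * M.Ext D.toLinearMap b := by
  set T := M.Ext D.toLinearMap with hT
  have key : ∀ N n m : ℕ, n + m = N → ∀ a b, a ∈ 𝒜 (n : ℤ) → b ∈ 𝒜 (m : ℤ) →
      T (a * b) = T a * b + a * T b := by
    intro N
    induction N with
    | zero =>
      intro n m hnm a b ha hb
      obtain ⟨rfl, rfl⟩ : n = 0 ∧ m = 0 := by omega
      rw [← M.j_ε a ha, ← M.j_ε b hb, ← map_mul, hT, M.Ext_j, M.Ext_j, M.Ext_j]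
      simp only [Derivation.coeFn_coe, Derivation.leibniz, smul_eq_mul, map_add, map_mul]
      rw [add_comm, M.j_comm (M.ε b)]
    | succ N ih =>
      intro n m hnm a b ha hb
      have hab : a * b ∈ 𝒜 ((N + 1 : ℕ) : ℤ) :=
        deg_cast (M.mul_mem _ _ _ _ ha hb) (by rw [← hnm]; push_cast; ring)
      have h1 : ((N : ℝ) + 1) • T (a * b) = ((N : ℝ) + 1) • (T a * b + a * T b) := by
        rw [← M.Ext_euler D.toLinearMap N _ hab]
        have hterm : ∀ μ, M.E μ * T (M.ι μ (a * b)) =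
            (M.E μ * T (M.ι μ a)) * b + (M.E μ * M.ι μ a) * T b +
              (T a * (M.E μ * M.ι μ b) + a * (M.E μ * T (M.ι μ b))) := by
          intro μ
          have h1 : T (M.ι μ a * b) = T (M.ι μ a) * b + M.ι μ a * T b := by
            cases n with
            | zero =>
              have : M.ι μ a = 0 := by rw [← M.j_ε a ha, M.con_j]
              simp [this]
            | succ n => exact ih n m (by omega) _ _ (M.ι_mem ha μ) hb
          have h2 : T (a * M.ι μ b) = T a * M.ι μ b + a * T (M.ι μ b) := by
            cases m with
            | zero =>
              have : M.ι μ b = 0 := by rw [← M.j_ε b hb, M.con_j]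
              simp [this]
            | succ m => exact ih n m (by omega) _ _ ha (M.ι_mem hb μ)
          have hTa : T a ∈ 𝒜 (n : ℤ) := M.Ext_mem _ _ _ ha
          rw [M.con_mul _ n _ _ ha, map_add, map_smul, h1, h2]
          have c1 : a * M.E μ = sgn n • (M.E μ * a) := by
            rw [M.sec_comm _ n a ha, smul_smul, sgn_mul_self, one_smul]
          have c2 : T a * M.E μ = sgn n • (M.E μ * T a) := by
            rw [M.sec_comm _ n _ hTa, smul_smul, sgn_mul_self, one_smul]
          rw [← mul_assoc (T a), c2, ← mul_assoc a, c1]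
          simp only [mul_add, mul_smul_comm, smul_add, mul_assoc, smul_mul_assoc]
        rw [Finset.sum_congr rfl fun μ _ => hterm μ]
        simp only [Finset.sum_add_distrib, ← Finset.sum_mul, ← Finset.mul_sum]
        rw [M.Ext_euler' _ n a ha, M.Ext_euler' _ m b hb, M.euler n a ha, M.euler m b hb]
        have : ((N : ℝ) + 1) = (n : ℝ) + m := by exact_mod_cast hnm.symm
        rw [this]
        simp only [smul_mul_assoc, mul_smul_comm, Int.cast_natCast, add_smul, smul_add]
        abel
      exact smul_right_injective A (by positivity : ((N : ℝ) + 1) ≠ 0) h1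
  obtain ⟨c, hc, rfl⟩ := M.decomp a
  obtain ⟨d, hd, rfl⟩ := M.decomp b
  simp only [Finset.sum_mul, Finset.mul_sum, map_sum, ← Finset.sum_add_distrib]
  exact Finset.sum_congr rfl fun i _ => Finset.sum_congr rfl fun k _ =>
    key _ _ _ rfl _ _ (hc _) (hd _)

/-- The derivation of degree zero of `A` which extends the vector field `dB i`. -/
def δ (i : η) : A →ₗ[ℝ] A := M.Ext (M.dB i).toLinearMap

lemma δ_mem (i : η) (k : ℤ) (a : A) (ha : a ∈ 𝒜 k) : M.δ i a ∈ 𝒜 k := M.Ext_mem _ _ _ ha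

lemma δ_j (i : η) (f : B) : M.δ i (M.j f) = M.j (M.dB i f) := M.Ext_j _ f

lemma δ_mul (i : η) (a b : A) : M.δ i (a * b) = M.δ i a * b + a * M.δ i b := M.Ext_mul _ a b

lemma δ_sec (i : η) (s : S) : M.δ i (M.sec s) = ∑ μ, M.E μ * M.j (M.dB i (M.pair (M.u μ) s)) := by
  have := M.Ext_euler (M.dB i).toLinearMap 0 (M.sec s) (by simpa using M.sec_mem s)
  simp only [M.con_sec, M.Ext_j, CharP.cast_eq_zero, zero_add, one_smul] at this
  exact this.symm

lemma con_δ (w : L) (i : η) (k : ℤ) (a : A) (ha : a ∈ 𝒜 k) : M.con w (M.δ i a) =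
    M.δ i (M.con w a) - ∑ μ, M.j (M.dB i (M.pair w (M.e μ))) * M.ι μ a := by
  rcases lt_or_ge k 0 with hk | hk
  · rw [M.neg_eq k a hk ha]; simp
  obtain ⟨n, rfl⟩ := Int.eq_ofNat_of_zero_le hk
  clear hk
  induction n generalizing a w with
  | zero =>
    rw [← M.j_ε a ha, M.δ_j]
    simp [M.con_j]
  | succ n ih =>
    apply smul_right_injective A (by positivity : ((n : ℝ) + 1) ≠ 0)
    change ((n : ℝ) + 1) • M.con w (M.δ i a) = ((n : ℝ) + 1) • _
    have h0 := M.Ext_euler (M.dB i).toLinearMap n a ha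
    rw [← map_smul]
    change M.con w (((n : ℝ) + 1) • M.Ext _ a) = _
    rw [← h0, map_sum]
    change ∑ μ, M.con w (M.E μ * M.δ i (M.ι μ a)) = _
    have hw := M.con_mem w _ a ha
    have e1 := M.Ext_euler' (M.dB i).toLinearMap n (M.con w a) (deg_cast hw (by push_cast; ring))
    have e2 : ∀ ν, ∑ μ, M.E μ * M.ι μ (M.ι ν a) = (n : ℝ) • M.ι ν a := fun ν => by
      simpa using M.euler n _ (M.ι_mem ha ν)
    have hterm : ∀ μ, M.con w (M.E μ * M.δ i (M.ι μ a)) =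
        (M.δ i (M.j (M.pair w (M.e μ)) * M.ι μ a) - M.j (M.dB i (M.pair w (M.e μ))) * M.ι μ a)
        + (M.E μ * M.δ i (M.ι μ (M.con w a))
          - ∑ ν, M.j (M.dB i (M.pair w (M.e ν))) * (M.E μ * M.ι μ (M.ι ν a))) := by
      intro μ
      rw [M.con_sec_mul, ih w _ (M.ι_mem ha μ), M.δ_mul, M.δ_j, M.con_con w]
      have : ∀ ν, M.ι ν (M.ι μ a) = -M.ι μ (M.ι ν a) := fun ν => M.con_con _ _ _
      simp only [this, mul_sub, map_neg, mul_neg, Finset.sum_neg_distrib, Finset.mul_sum]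
      have : ∀ ν, M.E μ * (M.j (M.dB i (M.pair w (M.e ν))) * M.ι μ (M.ι ν a)) =
        M.j (M.dB i (M.pair w (M.e ν))) * (M.E μ * M.ι μ (M.ι ν a)) := fun ν => by
        rw [← mul_assoc, ← M.j_comm, mul_assoc]
      simp only [this]
      abel
    rw [Finset.sum_congr rfl fun μ _ => hterm μ]
    simp only [Finset.sum_add_distrib, Finset.sum_sub_distrib, ← map_sum, ← M.con_eq]
    rw [show (∑ μ, M.E μ * M.δ i (M.ι μ (M.con w a))) = (n : ℝ) • M.δ i (M.con w a) from e1,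
      Finset.sum_comm]
    simp only [← Finset.mul_sum, e2, mul_smul_comm, ← Finset.smul_sum]
    change _ = ((n : ℝ) + 1) • (M.δ i _ - _)
    simp only [smul_sub, add_smul, one_smul]
    abel

end Model

/-! ### Multivector fields as functions of lists -/

section Lists

variable {O : Type*} [CommRing O] [Algebra ℝ O]

/-- Insertion of `z` as the first argument. -/
def ins (z : O) : (List O → O) →ₗ[ℝ] (List O → O) where
  toFun Q l := Q (z :: l)
  map_add' _ _ := rfl
  map_smul' _ _ := rfl

lemma ins_apply (z : O) (Q : List O → O) (l : List O) : ins z Q l = Q (z :: l) := rfl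

lemma ins_smul (z h : O) (Q : List O → O) : ins z (h • Q) = h • ins z Q := rfl

/-- The values of the Lie derivative. -/
def lieAux (D : Derivation ℝ O O) : List O → (List O → O) → O
  | [], Q => D (Q [])
  | z :: l, Q => lieAux D l (ins z Q) - Q (D z :: l)

/-- The Lie derivative along `D`. -/
def lie (D : Derivation ℝ O O) : (List O → O) →ₗ[ℝ] (List O → O) where
  toFun Q l := lieAux D l Q
  map_add' Q R := by
    funext l
    induction l generalizing Q R with
    | nil => simp [lieAux]
    | cons z l ih => simp only [lieAux, map_add, Pi.add_apply] at ih ⊢; rw [ih]; ring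
  map_smul' c Q := by
    funext l
    induction l generalizing Q with
    | nil => simp [lieAux]
    | cons z l ih =>
      simp only [lieAux, map_smul, Pi.smul_apply, RingHom.id_apply] at ih ⊢; rw [ih, smul_sub]

lemma lie_nil (D : Derivation ℝ O O) (Q : List O → O) : lie D Q [] = D (Q []) := rfl

lemma lie_cons (D : Derivation ℝ O O) (Q : List O → O) (z : O) (l : List O) :
    lie D Q (z :: l) = lie D (ins z Q) l - Q (D z :: l) := rfl

lemma ins_lie (D : Derivation ℝ O O) (Q : List O → O) (z : O) :
    ins z (lie D Q) = lie D (ins z Q) - ins (D z) Q := rfl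

lemma lie_mul (D : Derivation ℝ O O) (h : O) (Q : List O → O) :
    lie D (h • Q) = D h • Q + h • lie D Q := by
  funext l
  induction l generalizing Q with
  | nil => simp [lie_nil]; ring
  | cons z l ih =>
    simp only [lie_cons, ins_smul, ih, Pi.add_apply, Pi.smul_apply, smul_eq_mul, ins_apply]; ring

lemma lie_comm {D D' : Derivation ℝ O O} (h : ∀ z, D (D' z) = D' (D z)) (Q : List O → O) :
    lie D (lie D' Q) = lie D' (lie D Q) := by
  funext l
  induction l generalizing Q with
  | nil => simp [lie_nil, h]
  | cons z l ih =>
    have h1 := congrFun (map_sub (lie D) (lie D' (ins z Q)) (ins (D' z) Q)) l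
    have h2 := congrFun (map_sub (lie D') (lie D (ins z Q)) (ins (D z) Q)) l
    simp only [Pi.sub_apply] at h1 h2
    rw [lie_cons D, ins_lie, h1, lie_cons D' (lie D Q), ins_lie, h2, lie_cons, lie_cons, ih, h]
    ring

/-- The values of the exterior product with a vector field. -/
def wdAux (D : Derivation ℝ O O) : List O → (List O → O) → O
  | [], _ => 0
  | z :: l, Q => D z * Q l - wdAux D l (ins z Q)

/-- The exterior product with the vector field `D` from the left. -/
def wd (D : Derivation ℝ O O) : (List O → O) →ₗ[ℝ] (List O → O) where
  toFun Q l := wdAux D l Q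
  map_add' Q R := by
    funext l
    induction l generalizing Q R with
    | nil => simp [wdAux]
    | cons z l ih => simp only [wdAux, map_add, Pi.add_apply] at ih ⊢; rw [ih]; ring
  map_smul' c Q := by
    funext l
    induction l generalizing Q with
    | nil => simp [wdAux]
    | cons z l ih =>
      simp only [wdAux, map_smul, Pi.smul_apply, RingHom.id_apply] at ih ⊢
      rw [ih, smul_sub, mul_smul_comm]

lemma wd_nil (D : Derivation ℝ O O) (Q : List O → O) : wd D Q [] = 0 := rfl

lemma wd_cons (D : Derivation ℝ O O) (Q : List O → O) (z : O) (l : List O) :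
    wd D Q (z :: l) = D z * Q l - wd D (ins z Q) l := rfl

lemma ins_wd (D : Derivation ℝ O O) (Q : List O → O) (z : O) :
    ins z (wd D Q) = D z • Q - wd D (ins z Q) := rfl

lemma wd_mul (D : Derivation ℝ O O) (h : O) (Q : List O → O) : wd D (h • Q) = h • wd D Q := by
  funext l
  induction l generalizing Q with
  | nil => simp [wd_nil]
  | cons z l ih => simp only [wd_cons, ins_smul, ih, Pi.smul_apply, smul_eq_mul]; ring

lemma wd_smul_left (D : Derivation ℝ O O) (h : O) (Q : List O → O) :
    wd (h • D) Q = h • wd D Q := by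
  funext l
  induction l generalizing Q with
  | nil => simp [wd_nil]
  | cons z l ih =>
    simp only [wd_cons, ih, Pi.smul_apply, smul_eq_mul, Derivation.smul_apply]; ring

lemma wd_add_left (D D' : Derivation ℝ O O) (Q : List O → O) :
    wd (D + D') Q = wd D Q + wd D' Q := by
  funext l
  induction l generalizing Q with
  | nil => simp [wd_nil]
  | cons z l ih => simp only [wd_cons, ih, Pi.add_apply, Derivation.add_apply]; ring

lemma wd_zero_left (Q : List O → O) : wd (0 : Derivation ℝ O O) Q = 0 := by
  have := wd_smul_left (0 : Derivation ℝ O O) 0 Q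
  simpa using this

lemma wd_neg_left (D : Derivation ℝ O O) (Q : List O → O) : wd (-D) Q = -wd D Q := by
  have := wd_smul_left D (-1) Q
  simpa using this

lemma wd_sum_left {ι' : Type*} (s : Finset ι') (D : ι' → Derivation ℝ O O) (Q : List O → O) :
    wd (∑ i ∈ s, D i) Q = ∑ i ∈ s, wd (D i) Q := by
  classical
  induction s using Finset.induction_on with
  | empty => simp [wd_zero_left]
  | insert i s hi ih => rw [Finset.sum_insert hi, Finset.sum_insert hi, wd_add_left, ih]

lemma wd_anti (D D' : Derivation ℝ O O) (Q : List O → O) : wd D (wd D' Q) = -wd D' (wd D Q) := by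
  funext l
  induction l generalizing Q with
  | nil => simp [wd_nil]
  | cons z l ih =>
    have h1 := congrFun (map_sub (wd D) (D' z • Q) (wd D' (ins z Q))) l
    have h2 := congrFun (map_sub (wd D') (D z • Q) (wd D (ins z Q))) l
    simp only [Pi.sub_apply, wd_mul, Pi.smul_apply, smul_eq_mul] at h1 h2
    simp only [Pi.neg_apply] at ih ⊢
    rw [wd_cons, wd_cons, ins_wd, ins_wd, h1, h2, ih]
    ring

lemma lie_wd (D D' : Derivation ℝ O O) (Q : List O → O) :
    lie D (wd D' Q) = wd ⁅D, D'⁆ Q + wd D' (lie D Q) := by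
  funext l
  induction l generalizing Q with
  | nil => simp [wd_nil, lie_nil]
  | cons z l ih =>
    have h1 := congrFun (map_sub (lie D) (D' z • Q) (wd D' (ins z Q))) l
    have h2 := congrFun (map_sub (wd D') (lie D (ins z Q)) (ins (D z) Q)) l
    simp only [Pi.sub_apply, lie_mul, Pi.smul_apply, smul_eq_mul, Pi.add_apply] at h1 h2 ih ⊢
    rw [lie_cons, ins_wd, h1, ih, wd_cons, wd_cons, wd_cons, ins_lie, h2, Derivation.commutator_apply]
    ring

/-- `Q` is an alternating derivation in each of its `k` arguments. -/
def IsMV : ℕ → (List O → O) → Prop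
  | 0, Q => ∀ z, ins z Q = 0
  | k + 1, Q => (∀ z, IsMV k (ins z Q)) ∧ (∀ z w, ins (z + w) Q = ins z Q + ins w Q) ∧
      (∀ (c : ℝ) z, ins (c • z) Q = c • ins z Q) ∧
      (∀ z w, ins (z * w) Q = z • ins w Q + w • ins z Q) ∧
      ∀ z w, ins z (ins w Q) = -ins w (ins z Q)

lemma IsMV.ins {k : ℕ} {Q : List O → O} (h : IsMV (k + 1) Q) (z : O) : IsMV k (ins z Q) := h.1 z

lemma IsMV.anti {k : ℕ} {Q : List O → O} (h : IsMV (k + 1) Q) (z w : O) :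
    RelPoisson.ins z (RelPoisson.ins w Q) = -RelPoisson.ins w (RelPoisson.ins z Q) := h.2.2.2.2 z w

lemma IsMV.mul {k : ℕ} {Q : List O → O} (h : IsMV (k + 1) Q) (z w : O) :
    RelPoisson.ins (z * w) Q = z • RelPoisson.ins w Q + w • RelPoisson.ins z Q := h.2.2.2.1 z w

lemma IsMV.sum {k : ℕ} {Q : List O → O} (h : IsMV (k + 1) Q) {ι' : Type*} (s : Finset ι')
    (z : ι' → O) : RelPoisson.ins (∑ i ∈ s, z i) Q = ∑ i ∈ s, RelPoisson.ins (z i) Q := by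
  classical
  induction s using Finset.induction_on with
  | empty => simpa using h.2.2.1 0 0
  | insert i s hi ih => rw [Finset.sum_insert hi, Finset.sum_insert hi, h.2.1, ih]

lemma isMV_zero (k : ℕ) : IsMV k (0 : List O → O) := by
  induction k with
  | zero => exact fun z => map_zero _
  | succ k ih => exact ⟨fun z => by rw [map_zero]; exact ih, by simp, by simp, by simp, by simp⟩

lemma IsMV.add {k : ℕ} {Q R : List O → O} (h : IsMV k Q) (h' : IsMV k R) : IsMV k (Q + R) := by
  induction k generalizing Q R with
  | zero => intro z; rw [map_add, h z, h' z, add_zero]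
  | succ k ih =>
    refine ⟨fun z => ih (h.1 z) (h'.1 z), fun z w => ?_, fun c z => ?_, fun z w => ?_, fun z w => ?_⟩
    · simp only [map_add, h.2.1, h'.2.1]; abel
    · simp only [map_add, h.2.2.1, h'.2.2.1, smul_add]
    · simp only [map_add, h.2.2.2.1, h'.2.2.2.1, smul_add]; abel
    · simp only [map_add]; rw [h.anti z w, h'.anti z w]; abel

lemma IsMV.smul {k : ℕ} {Q : List O → O} (h : IsMV k Q) (f : O) : IsMV k (f • Q) := by
  induction k generalizing Q with
  | zero => intro z; rw [ins_smul, h z, smul_zero]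
  | succ k ih =>
    refine ⟨fun z => ih (h.1 z), fun z w => ?_, fun c z => ?_, fun z w => ?_, fun z w => ?_⟩
    · simp only [ins_smul, h.2.1, smul_add]
    · simp only [ins_smul, h.2.2.1]; rw [smul_comm]
    · simp only [ins_smul, h.2.2.2.1, smul_add]; rw [smul_comm f z, smul_comm f w]
    · simp only [ins_smul]; rw [h.anti z w, smul_neg]

lemma IsMV.neg {k : ℕ} {Q : List O → O} (h : IsMV k Q) : IsMV k (-Q) := by
  simpa using h.smul (-1)

lemma IsMV.sub {k : ℕ} {Q R : List O → O} (h : IsMV k Q) (h' : IsMV k R) : IsMV k (Q - R) := by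
  rw [sub_eq_add_neg]; exact h.add h'.neg

lemma IsMV.real_smul {k : ℕ} {Q : List O → O} (h : IsMV k Q) (c : ℝ) : IsMV k (c • Q) := by
  have : c • Q = (algebraMap ℝ O c) • Q := by funext l; simp [Algebra.smul_def]
  rw [this]; exact h.smul _

lemma isMV_sum {k : ℕ} {ι' : Type*} (s : Finset ι') (Q : ι' → List O → O)
    (h : ∀ i ∈ s, IsMV k (Q i)) : IsMV k (∑ i ∈ s, Q i) := by
  classical
  induction s using Finset.induction_on with
  | empty => exact isMV_zero k
  | insert i s hi ih =>
    rw [Finset.sum_insert hi]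
    exact (h i (by simp)).add (ih fun i hi => h i (by simp [hi]))

lemma IsMV.lie {k : ℕ} {Q : List O → O} (h : IsMV k Q) (D : Derivation ℝ O O) :
    IsMV k (lie D Q) := by
  induction k generalizing Q with
  | zero => intro z; rw [ins_lie, h z, h (D z)]; simp
  | succ k ih =>
    refine ⟨fun z => (ih (h.1 z)).sub (h.1 _), fun z w => ?_, fun c z => ?_, fun z w => ?_,
      fun z w => ?_⟩
    · simp only [ins_lie, h.2.1, map_add]; abel
    · simp only [ins_lie, h.2.2.1, map_smul, Derivation.map_smul, smul_sub]
    · simp only [ins_lie, h.2.2.2.1, map_add, lie_mul, Derivation.leibniz, smul_eq_mul, h.2.1,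
        smul_sub]
      abel
    · simp only [ins_lie, map_sub]
      rw [h.anti z w, h.anti (D z) w, h.anti z (D w), map_neg]
      abel

lemma IsMV.wd {k : ℕ} {Q : List O → O} (h : IsMV k Q) (D : Derivation ℝ O O) :
    IsMV (k + 1) (wd D Q) := by
  induction k generalizing Q with
  | zero =>
    have e : ∀ z, RelPoisson.ins z (RelPoisson.wd D Q) = D z • Q := fun z => by
      rw [ins_wd, h z, map_zero, sub_zero]
    refine ⟨fun z w => ?_, fun z w => ?_, fun c z => ?_, fun z w => ?_, fun z w => ?_⟩
    · rw [e, ins_smul, h w, smul_zero]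
    · simp only [e, map_add, add_smul]
    · simp only [e, Derivation.map_smul, smul_assoc]
    · simp only [e, Derivation.leibniz, smul_eq_mul, add_smul, mul_smul]
    · simp only [e, ins_smul, h z, h w, smul_zero, neg_zero]
  | succ k ih =>
    refine ⟨fun z => (h.smul _).sub (ih (h.1 z)), fun z w => ?_, fun c z => ?_, fun z w => ?_,
      fun z w => ?_⟩
    · simp only [ins_wd, h.2.1, map_add, add_smul]; abel
    · simp only [ins_wd, h.2.2.1, map_smul, Derivation.map_smul, smul_sub, smul_assoc]
    · simp only [ins_wd, h.2.2.2.1, map_add, wd_mul, Derivation.leibniz, smul_eq_mul, smul_sub,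
        add_smul, mul_smul]
      abel
    · simp only [ins_wd, map_sub, ins_smul]
      rw [h.anti z w, map_neg]
      abel

/-- A function as a multivector field of degree zero. -/
def X0 (h : O) : List O → O
  | [] => h
  | _ => 0

/-- A derivation as a multivector field of degree one. -/
def X1 (D : Derivation ℝ O O) : List O → O
  | [z] => D z
  | _ => 0

/-- A bivector field as a multivector field of degree two. -/
def X2 (β : biDer O) : List O → O
  | [z, w] => β.1 z w
  | _ => 0

lemma isMV_X0 (h : O) : IsMV 0 (X0 h) := fun _ => rfl

lemma ins_X1 (D : Derivation ℝ O O) (z : O) : ins z (X1 D) = X0 (D z) := by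
  funext l; rcases l with _ | ⟨w, l⟩ <;> rfl

lemma X0_add (h k : O) : X0 (h + k) = X0 h + X0 k := by
  funext l; rcases l with _ | ⟨w, l⟩ <;> simp [X0]

lemma X0_smul (c h : O) : X0 (c * h) = c • X0 h := by
  funext l; rcases l with _ | ⟨w, l⟩ <;> simp [X0]

/-- The derivation `π(z, ·)`. -/
def biLeft (β : biDer O) (z : O) : Derivation ℝ O O :=
  Derivation.mk' (β.1 z) fun g h => by rw [β.2.2]; simp only [smul_eq_mul]; ring

@[simp] lemma biLeft_apply (β : biDer O) (z w : O) : biLeft β z w = β.1 z w := rfl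

lemma biDer_skew (β : biDer O) (z w : O) : β.1 z w = -β.1 w z := β.2.1 z w

lemma ins_X2 (β : biDer O) (z : O) : ins z (X2 β) = X1 (biLeft β z) := by
  funext l
  rcases l with _ | ⟨w, _ | ⟨y, l⟩⟩ <;> rfl

lemma isMV_X1 (D : Derivation ℝ O O) : IsMV 1 (X1 D) := by
  refine ⟨fun z => ?_, fun z w => ?_, fun c z => ?_, fun z w => ?_, fun z w => ?_⟩
  · rw [ins_X1]; exact isMV_X0 _
  · simp only [ins_X1, map_add, X0_add]
  · simp only [ins_X1, Derivation.map_smul]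
    rw [Algebra.smul_def, X0_smul]; funext l; simp [Algebra.smul_def]
  · simp only [ins_X1, Derivation.leibniz, smul_eq_mul, X0_add, X0_smul]
  · simp only [ins_X1, isMV_X0 _ _, neg_zero]

lemma isMV_X2 (β : biDer O) : IsMV 2 (X2 β) := by
  have key : ∀ (D D' : Derivation ℝ O O) (c : O), X1 (D + c • D') = X1 D + c • X1 D' := by
    intro D D' c
    funext l
    rcases l with _ | ⟨w, _ | ⟨y, l⟩⟩ <;> simp [X1]
  refine ⟨fun z => ?_, fun z w => ?_, fun c z => ?_, fun z w => ?_, fun z w => ?_⟩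
  · rw [ins_X2]; exact isMV_X1 _
  · funext l
    rcases l with _ | ⟨y, _ | ⟨y', l⟩⟩ <;> simp [ins_apply, X2]
  · funext l
    rcases l with _ | ⟨y, _ | ⟨y', l⟩⟩ <;> simp [ins_apply, X2]
  · funext l
    rcases l with _ | ⟨y, _ | ⟨y', l⟩⟩ <;> simp only [ins_apply, X2, Pi.add_apply, Pi.smul_apply,
      smul_eq_mul, mul_zero, add_zero]
    rw [biDer_skew, β.2.2, biDer_skew β y z, biDer_skew β y w]; ring
  · funext l
    rcases l with _ | ⟨y', l⟩
    · simpa [ins_apply, X2] using biDer_skew β w z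
    · simp [ins_apply, X2]

/-- The case distinction whether a natural number is positive. -/
def prev {N : Type*} [Zero N] : ℕ → (ℕ → N) → N
  | 0, _ => 0
  | k + 1, G => G k

@[simp] lemma prev_zero {N : Type*} [Zero N] (G : ℕ → N) : prev 0 G = 0 := rfl

@[simp] lemma prev_succ {N : Type*} [Zero N] (k : ℕ) (G : ℕ → N) : prev (k + 1) G = G k := rfl

end Lists

/-- A homogeneous element together with its degree. -/
@[ext] structure Hom {A : Type*} [AddCommGroup A] [Module ℝ A] (𝒜 : ℤ → Submodule ℝ A) where
  /-- the degree -/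
  deg : ℤ
  /-- the element -/
  val : A
  mem : val ∈ 𝒜 deg

/-- The sum of the degrees, each lowered by one. -/
def bsum {A : Type*} [AddCommGroup A] [Module ℝ A] {𝒜 : ℤ → Submodule ℝ A} :
    List (Hom 𝒜) → ℤ
  | [] => 0
  | a :: t => (a.deg - 1) + bsum t

namespace Model

variable {B O A : Type*} [CommRing B] [Algebra ℝ B] [CommRing O] [Algebra ℝ O]
  [Ring A] [Algebra ℝ A] {𝒜 : ℤ → Submodule ℝ A} {S L κ η : Type*} [Fintype κ] [Fintype η]
  (M : Model B O A 𝒜 S L κ η)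

/-- Insertion of a frame element of the linear functions. -/
abbrev Iu (μ : κ) : (List O → O) →ₗ[ℝ] (List O → O) := ins (M.lin (M.u μ))

/-- Insertion of one of the functions `x`. -/
abbrev Ix (i : η) : (List O → O) →ₗ[ℝ] (List O → O) := ins (M.p (M.x i))

/-- Lie derivative along a frame element. -/
abbrev Le (μ : κ) : (List O → O) →ₗ[ℝ] (List O → O) := lie (M.vert (M.e μ))

/-- The restriction to the zero section of the vertical part of a multivector field. -/
def P : ℕ → (List O → O) →ₗ[ℝ] A
  | 0 => M.j.toLinearMap ∘ₗ M.r.toLinearMap ∘ₗ LinearMap.proj []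
  | k + 1 => ((k : ℝ) + 1)⁻¹ • ∑ μ, LinearMap.mulLeft ℝ (M.E μ) ∘ₗ P k ∘ₗ M.Iu μ

lemma P_zero (Q : List O → O) : M.P 0 Q = M.j (M.r (Q [])) := rfl

lemma P_succ (k : ℕ) (Q : List O → O) :
    M.P (k + 1) Q = ((k : ℝ) + 1)⁻¹ • ∑ μ, M.E μ * M.P k (M.Iu μ Q) := by
  simp [P]

lemma P_succ' (k : ℕ) (Q : List O → O) :
    ∑ μ, M.E μ * M.P k (M.Iu μ Q) = ((k : ℝ) + 1) • M.P (k + 1) Q := by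
  rw [P_succ, smul_smul, mul_inv_cancel₀ (by positivity), one_smul]

lemma P_mem (k : ℕ) (Q : List O → O) : M.P k Q ∈ 𝒜 (k : ℤ) := by
  induction k generalizing Q with
  | zero => exact M.j_mem _
  | succ k ih =>
    rw [P_succ]
    refine Submodule.smul_mem _ _ (Submodule.sum_mem _ fun μ _ => ?_)
    exact deg_cast (M.mul_mem 1 k _ _ (M.sec_mem _) (ih _)) (by push_cast; ring)

lemma j_left_comm (f : B) (a b : A) : a * (M.j f * b) = M.j f * (a * b) := by
  rw [← mul_assoc, ← M.j_comm, mul_assoc]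

lemma P_mul (k : ℕ) (h : O) (Q : List O → O) : M.P k (h • Q) = M.j (M.r h) * M.P k Q := by
  induction k generalizing Q with
  | zero => simp [P_zero]
  | succ k ih =>
    rw [P_succ, P_succ, mul_smul_comm, Finset.mul_sum]
    congr 1
    exact Finset.sum_congr rfl fun μ _ => by rw [ins_smul, ih, M.j_left_comm]

lemma P_ins_p (k : ℕ) (Q : List O → O) (hQ : IsMV (k + 1) Q) (f : B) :
    M.P k (ins (M.p f) Q) = ∑ i, M.j (M.dB i f) * M.P k (M.Ix i Q) := by
  induction k generalizing Q with
  | zero =>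
    let D : Derivation ℝ B B := Derivation.mk'
      { toFun := fun f => M.r (Q [M.p f])
        map_add' := fun f g => by
          have := congrFun (hQ.2.1 (M.p f) (M.p g)) []
          simp only [ins_apply, Pi.add_apply] at this
          rw [map_add, this, map_add]
        map_smul' := fun c f => by
          have := congrFun (hQ.2.2.1 c (M.p f)) []
          simp only [ins_apply, Pi.smul_apply] at this
          rw [map_smul, this, map_smul]; rfl }
      (fun f g => by
        have := congrFun (hQ.mul (M.p f) (M.p g)) []
        simp only [ins_apply, Pi.smul_apply, Pi.add_apply] at this
        change M.r (Q [M.p (f * g)]) = f • M.r (Q [M.p g]) + g • M.r (Q [M.p f])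
        rw [map_mul, this]
        simp [M.r_p])
    have := congrArg M.j (M.tightB D f)
    rw [map_sum] at this
    simp only [map_mul] at this
    exact this
  | succ k ih =>
    rw [P_succ]
    have h1 : ∀ μ, M.E μ * M.P k (M.Iu μ (ins (M.p f) Q)) =
        ∑ i, M.j (M.dB i f) * (M.E μ * M.P k (M.Iu μ (M.Ix i Q))) := by
      intro μ
      rw [hQ.anti, map_neg, ih _ (hQ.ins _), mul_neg, Finset.mul_sum, ← Finset.sum_neg_distrib]
      refine Finset.sum_congr rfl fun i _ => ?_
      rw [hQ.anti (M.lin (M.u μ)), map_neg, M.j_left_comm, mul_neg, mul_neg]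
    rw [Finset.sum_congr rfl fun μ _ => h1 μ, Finset.sum_comm, Finset.smul_sum]
    refine Finset.sum_congr rfl fun i _ => ?_
    rw [P_succ, mul_smul_comm, Finset.mul_sum]

lemma P_ins_lin (k : ℕ) (Q : List O → O) (hQ : IsMV (k + 1) Q) (w : L) :
    ∑ μ, M.j (M.pair w (M.e μ)) * M.P k (M.Iu μ Q) = M.P k (ins (M.lin w) Q) := by
  conv_rhs => rw [M.lin_eq w, hQ.sum, map_sum]
  refine Finset.sum_congr rfl fun μ _ => ?_
  rw [hQ.mul, map_add, P_mul, P_mul, M.r_lin, M.r_p]; simp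

lemma con_P (k : ℕ) (Q : List O → O) (hQ : IsMV k Q) (w : L) :
    M.con w (M.P k Q) = prev k fun k' => M.P k' (ins (M.lin w) Q) := by
  induction k generalizing Q with
  | zero => rw [P_zero, M.con_j, prev_zero]
  | succ k ih =>
    rw [P_succ, map_smul, map_sum, prev_succ]
    simp only [M.con_sec_mul, Finset.sum_sub_distrib]
    rw [M.P_ins_lin k Q hQ w]
    have h2 : ∑ μ, M.E μ * M.con w (M.P k (M.Iu μ Q)) =
        -((k : ℝ) • M.P k (ins (M.lin w) Q)) := by
      cases k with
      | zero => simp [P_zero, M.con_j]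
      | succ k =>
        have : ∀ μ, M.E μ * M.con w (M.P (k + 1) (M.Iu μ Q)) =
            -(M.E μ * M.P k (M.Iu μ (ins (M.lin w) Q))) := fun μ => by
          rw [ih _ (hQ.ins _), prev_succ, hQ.anti, map_neg, mul_neg]
        simp only [this, Finset.sum_neg_distrib, M.P_succ']
        push_cast; rfl
    rw [h2, sub_neg_eq_add]
    have : M.P k (ins (M.lin w) Q) + (k : ℝ) • M.P k (ins (M.lin w) Q) =
        ((k : ℝ) + 1) • M.P k (ins (M.lin w) Q) := by rw [add_smul, one_smul, add_comm]
    rw [this, smul_smul, inv_mul_cancel₀ (by positivity), one_smul]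

lemma eq_of_con {n : ℕ} {a b : A} (ha : a ∈ 𝒜 ((n + 1 : ℕ) : ℤ)) (hb : b ∈ 𝒜 ((n + 1 : ℕ) : ℤ))
    (h : ∀ w, M.con w a = M.con w b) : a = b := by
  rw [← sub_eq_zero]
  exact M.eq_zero_of_ι (sub_mem ha hb) fun μ => by rw [map_sub, h, sub_self]

lemma con_δ_sec (w : L) (i : η) (v : S) : M.con w (M.δ i (M.sec v)) =
    M.j (M.dB i (M.pair w v)) -
      ∑ μ, M.j (M.pair (M.u μ) v) * M.j (M.dB i (M.pair w (M.e μ))) := by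
  rw [M.con_δ w i 1 _ (M.sec_mem v), M.con_sec, M.δ_j]
  congr 1
  exact Finset.sum_congr rfl fun μ _ => by rw [M.con_sec, M.j_comm]

lemma P_lie (k : ℕ) (Q : List O → O) (hQ : IsMV k Q) (v : S) :
    M.P k (lie (M.vert v) Q) = ∑ μ, M.j (M.pair (M.u μ) v) * M.P k (M.Le μ Q)
      - prev k fun k' => ∑ i, M.δ i (M.sec v) * M.P k' (M.Ix i Q) := by
  induction k generalizing Q with
  | zero =>
    simp only [P_zero, lie_nil, prev_zero, sub_zero]
    rw [M.vert_eq, map_sum, map_sum]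
    simp [M.r_p]
  | succ k ih =>
    apply M.eq_of_con (M.P_mem _ _)
    · refine sub_mem (Submodule.sum_mem _ fun μ _ => ?_) (Submodule.sum_mem _ fun i _ => ?_)
      · exact deg_cast (M.mul_mem 0 _ _ _ (M.j_mem _) (M.P_mem _ _)) (by ring)
      · exact deg_cast (M.mul_mem 1 _ _ _ (M.δ_mem _ _ _ (M.sec_mem _)) (M.P_mem _ _))
          (by push_cast; ring)
    intro w
    have hins : ∀ s : S, M.P k (ins (M.lin w) (lie (M.vert s) Q)) =
        M.P k (lie (M.vert s) (ins (M.lin w) Q)) -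
          ∑ i, M.j (M.dB i (M.pair w s)) * M.P k (M.Ix i Q) := by
      intro s
      rw [ins_lie, map_sub, M.vert_lin, M.P_ins_p k Q hQ]
    rw [M.con_P _ _ (hQ.lie _), prev_succ, hins, ih _ (hQ.ins _), map_sub, map_sum, prev_succ,
      map_sum]
    simp only [M.con_j_mul, M.con_P _ _ (hQ.lie _), prev_succ, hins]
    have hδ : ∀ i, M.con w (M.δ i (M.sec v) * M.P k (M.Ix i Q)) =
        (M.j (M.dB i (M.pair w v)) * M.P k (M.Ix i Q) -
          ∑ μ, M.j (M.pair (M.u μ) v) * (M.j (M.dB i (M.pair w (M.e μ))) * M.P k (M.Ix i Q)))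
          + prev k fun k' => M.δ i (M.sec v) * M.P k' (M.Ix i (ins (M.lin w) Q)) := by
      intro i
      rw [M.con_mul w 1 _ _ (M.δ_mem i _ _ (M.sec_mem v)), M.con_δ_sec, sub_mul, Finset.sum_mul]
      simp only [mul_assoc]
      congr 1
      rw [M.con_P _ _ (hQ.ins _)]
      cases k with
      | zero => simp
      | succ k => simp only [prev_succ]; rw [hQ.anti, map_neg]; simp
    simp only [hδ, mul_sub, Finset.sum_sub_distrib, Finset.sum_add_distrib, Finset.mul_sum]
    have hp : ∑ i, (prev k fun k' => M.δ i (M.sec v) * M.P k' (M.Ix i (ins (M.lin w) Q))) =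
        prev k fun k' => ∑ i, M.δ i (M.sec v) * M.P k' (M.Ix i (ins (M.lin w) Q)) := by
      cases k <;> simp
    rw [hp, Finset.sum_comm (f := fun i μ => M.j (M.pair (M.u μ) v) *
      (M.j (M.dB i (M.pair w (M.e μ))) * M.P k (M.Ix i Q)))]
    abel

lemma P_wd_vert (k : ℕ) (Q : List O → O) (hQ : IsMV k Q) (v : S) :
    M.P (k + 1) (wd (M.vert v) Q) = M.sec v * M.P k Q := by
  induction k generalizing Q with
  | zero =>
    rw [P_succ, M.sec_eq v]
    simp only [P_zero, ins_apply, wd_cons, wd_nil, M.vert_lin, sub_zero, map_mul, M.r_p,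
      CharP.cast_eq_zero, zero_add, inv_one, one_smul, Finset.sum_mul]
    exact Finset.sum_congr rfl fun μ _ => by rw [M.j_left_comm, mul_assoc]
  | succ k ih =>
    apply M.eq_of_con (M.P_mem _ _)
      (deg_cast (M.mul_mem 1 _ _ _ (M.sec_mem _) (M.P_mem _ _)) (by push_cast; ring))
    intro w
    rw [M.con_P _ _ (hQ.wd _), prev_succ, ins_wd, map_sub, ih _ (hQ.ins _), M.con_sec_mul,
      M.con_P _ _ hQ, prev_succ, P_mul, M.vert_lin, M.r_p]

/-! ### The Fourier transform of a multivector field in the symmetric normalization -/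

/-- The symmetric multiderivation attached to a `k`-vector field. -/
def om : List (Hom 𝒜) → ℕ → (List O → O) →ₗ[ℝ] A
  | [], k => M.P k
  | a :: t, k => sgn (k * (a.deg + 1)) •
        ∑ μ, LinearMap.mulLeft ℝ (M.ι μ a.val) ∘ₗ om t k ∘ₗ M.Le μ
      + prev k fun k' => sgn ((k + 1) * a.deg + k) •
        ∑ i, LinearMap.mulLeft ℝ (M.δ i a.val) ∘ₗ om t k' ∘ₗ M.Ix i

lemma om_nil (k : ℕ) (Q : List O → O) : M.om [] k Q = M.P k Q := rfl

lemma om_cons (a : Hom 𝒜) (t : List (Hom 𝒜)) (k : ℕ) (Q : List O → O) : M.om (a :: t) k Q =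
    sgn (k * (a.deg + 1)) • ∑ μ, M.ι μ a.val * M.om t k (M.Le μ Q)
      + prev k fun k' => sgn ((k + 1) * a.deg + k) •
        ∑ i, M.δ i a.val * M.om t k' (M.Ix i Q) := by
  cases k <;> simp [om]

lemma om_mem (t : List (Hom 𝒜)) (k : ℕ) (Q : List O → O) : M.om t k Q ∈ 𝒜 (k + bsum t) := by
  induction t generalizing k Q with
  | nil => exact deg_cast (M.P_mem k Q) (by simp [bsum])
  | cons a t ih =>
    rw [om_cons]
    refine add_mem (Submodule.smul_mem _ _ (Submodule.sum_mem _ fun μ _ => ?_)) ?_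
    · exact deg_cast (M.mul_mem _ _ _ _ (M.con_mem _ _ _ a.mem) (ih _ _)) (by simp [bsum]; ring)
    · cases k with
      | zero => exact zero_mem _
      | succ k =>
        refine Submodule.smul_mem _ _ (Submodule.sum_mem _ fun i _ => ?_)
        exact deg_cast (M.mul_mem _ _ _ _ (M.δ_mem _ _ _ a.mem) (ih _ _))
          (by simp [bsum]; ring)

/-- A function as a homogeneous element. -/
def hj (f : B) : Hom 𝒜 := ⟨0, M.j f, M.j_mem f⟩

/-- A section as a homogeneous element. -/
def hs (s : S) : Hom 𝒜 := ⟨1, M.sec s, M.sec_mem s⟩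

end Model

/-! ### Symmetric multiderivations -/

section SMD

variable {A : Type*} [Ring A] [Algebra ℝ A]

/-- Symmetric multiderivations of degree `d` with respect to the degrees lowered by one. -/
structure SMD (𝒜 : ℤ → Submodule ℝ A) (d : ℤ) (ψ : List (Hom 𝒜) → A) : Prop where
  mem : ∀ l, ψ l ∈ 𝒜 (d + 1 + bsum l)
  swap : ∀ l a b t, ψ (l ++ a :: b :: t) = sgn ((a.deg - 1) * (b.deg - 1)) • ψ (l ++ b :: a :: t)
  add : ∀ i a b (ha : a ∈ 𝒜 i) (hb : b ∈ 𝒜 i) (h : a + b ∈ 𝒜 i) t,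
    ψ (⟨i, a + b, h⟩ :: t) = ψ (⟨i, a, ha⟩ :: t) + ψ (⟨i, b, hb⟩ :: t)
  smul : ∀ i (c : ℝ) a (ha : a ∈ 𝒜 i) (h : c • a ∈ 𝒜 i) t,
    ψ (⟨i, c • a, h⟩ :: t) = c • ψ (⟨i, a, ha⟩ :: t)
  mul : ∀ (b c : Hom 𝒜) (h : b.val * c.val ∈ 𝒜 (b.deg + c.deg)) t,
    ψ (⟨_, _, h⟩ :: t) = sgn (d * b.deg) • (b.val * ψ (c :: t)) +
      sgn (d * c.deg + b.deg * c.deg) • (c.val * ψ (b :: t))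

end SMD

namespace Model

variable {B O A : Type*} [CommRing B] [Algebra ℝ B] [CommRing O] [Algebra ℝ O]
  [Ring A] [Algebra ℝ A] {𝒜 : ℤ → Submodule ℝ A} {S L κ η : Type*} [Fintype κ] [Fintype η]
  (M : Model B O A 𝒜 S L κ η)

lemma left_distrib_A (_ : Model B O A 𝒜 S L κ η) (x y z : A) : x * (y + z) = x * y + x * z :=
  mul_add x y z

lemma comm_left (M : Model B O A 𝒜 S L κ η) (i k : ℤ) (a b y : A) (ha : a ∈ 𝒜 i) (hb : b ∈ 𝒜 k) :
    a * (b * y) = sgn (i * k) • (b * (a * y)) := by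
  rw [← mul_assoc, M.comm i k a b ha hb, smul_mul_assoc, mul_assoc]

lemma lie_vert_comm (s t : S) (Q : List O → O) :
    lie (M.vert s) (lie (M.vert t) Q) = lie (M.vert t) (lie (M.vert s) Q) :=
  lie_comm (M.vert_comm s t) Q

lemma ins_zero {k : ℕ} {Q : List O → O} (hQ : IsMV k Q) : ins 0 Q = 0 := by
  cases k with
  | zero => exact hQ 0
  | succ k => simpa using hQ.2.2.1 0 0

lemma lie_ins_p {k : ℕ} {Q : List O → O} (hQ : IsMV k Q) (s : S) (f : B) :
    lie (M.vert s) (ins (M.p f) Q) = ins (M.p f) (lie (M.vert s) Q) := by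
  rw [ins_lie, M.vert_p, ins_zero hQ, sub_zero]

lemma om_ins_p (t : List (Hom 𝒜)) (k : ℕ) (Q : List O → O) (hQ : IsMV (k + 1) Q) (f : B) :
    M.om t k (ins (M.p f) Q) = ∑ i, M.j (M.dB i f) * M.om t k (M.Ix i Q) := by
  induction t generalizing k Q with
  | nil => exact M.P_ins_p k Q hQ f
  | cons a t ih =>
    have h1 : ∀ μ, M.ι μ a.val * M.om t k (M.Le μ (ins (M.p f) Q)) =
        ∑ i, M.j (M.dB i f) * (M.ι μ a.val * M.om t k (M.Le μ (M.Ix i Q))) := fun μ => by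
      rw [M.lie_ins_p hQ, ih k _ (hQ.lie _), Finset.mul_sum]
      exact Finset.sum_congr rfl fun i _ => by rw [M.j_left_comm, M.lie_ins_p hQ]
    simp only [om_cons, h1]
    rw [Finset.sum_comm]
    cases k with
    | zero => simp [Finset.mul_sum, Finset.smul_sum]
    | succ k =>
      have h2 : ∀ l, M.δ l a.val * M.om t k (M.Ix l (ins (M.p f) Q)) =
          ∑ i, M.j (M.dB i f) * (M.δ l a.val * M.om t k (M.Ix l (M.Ix i Q))) := fun l => by
        rw [hQ.anti, map_neg, ih k _ (hQ.ins _), mul_neg, Finset.mul_sum, ← Finset.sum_neg_distrib]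
        refine Finset.sum_congr rfl fun i _ => ?_
        rw [M.j_left_comm, hQ.anti (M.p (M.x l)), map_neg, mul_neg, mul_neg]
      simp only [prev_succ, h2]
      rw [Finset.sum_comm (f := fun l i => M.j (M.dB i f) * (M.δ l a.val * _))]
      simp only [M.left_distrib_A, Finset.sum_add_distrib, Finset.smul_sum, mul_smul_comm,
        Finset.mul_sum]

lemma om_hj (f : B) (t : List (Hom 𝒜)) (k : ℕ) (Q : List O → O) (hQ : IsMV k Q) :
    M.om (M.hj f :: t) k Q = sgn k • prev k fun k' => M.om t k' (ins (M.p f) Q) := by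
  rw [om_cons]
  cases k with
  | zero => simp [hj, M.con_j]
  | succ k => simp only [prev_succ]; rw [M.om_ins_p t k Q hQ]; simp [hj, M.con_j, M.δ_j]

lemma om_lie (t : List (Hom 𝒜)) (k : ℕ) (Q : List O → O) (hQ : IsMV k Q) (v : S) :
    M.om t k (lie (M.vert v) Q) = ∑ μ, M.j (M.pair (M.u μ) v) * M.om t k (M.Le μ Q)
      - prev k fun k' => ∑ i, M.δ i (M.sec v) * M.om t k' (M.Ix i Q) := by
  induction t generalizing k Q with
  | nil => exact M.P_lie k Q hQ v
  | cons a t ih =>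
    have h1 : ∀ μ, M.ι μ a.val * M.om t k (M.Le μ (lie (M.vert v) Q)) =
        ∑ ν, M.j (M.pair (M.u ν) v) * (M.ι μ a.val * M.om t k (M.Le μ (M.Le ν Q))) -
        sgn (a.deg - 1) • prev k fun k' => ∑ i, M.δ i (M.sec v) *
          (M.ι μ a.val * M.om t k' (M.Le μ (M.Ix i Q))) := fun μ => by
      rw [M.lie_vert_comm, ih k _ (hQ.lie _), mul_sub, Finset.mul_sum]
      congr 1
      · exact Finset.sum_congr rfl fun i _ => by rw [M.j_left_comm, M.lie_vert_comm]
      · cases k with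
        | zero => simp
        | succ k =>
          simp only [prev_succ, Finset.mul_sum, Finset.smul_sum]
          refine Finset.sum_congr rfl fun i _ => ?_
          rw [M.comm_left (a.deg - 1) 1 _ _ _ (M.con_mem _ _ _ a.mem)
            (M.δ_mem _ _ _ (M.sec_mem v)), mul_one, ← M.lie_ins_p hQ]
    simp only [om_cons, h1, Finset.sum_sub_distrib]
    rw [Finset.sum_comm]
    rcases k with _ | k
    · simp [Finset.mul_sum, Finset.smul_sum]
    simp only [prev_succ, ← Finset.mul_sum, M.left_distrib_A, Finset.sum_add_distrib, smul_sub,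
      mul_smul_comm, ← Finset.smul_sum]
    have h2 : ∀ i, M.δ i a.val * M.om t k (M.Ix i (lie (M.vert v) Q)) =
        ∑ ν, M.j (M.pair (M.u ν) v) * (M.δ i a.val * M.om t k (M.Ix i (M.Le ν Q))) +
        sgn a.deg • prev k fun k' => ∑ l, M.δ l (M.sec v) *
          (M.δ i a.val * M.om t k' (M.Ix i (M.Ix l Q))) := fun i => by
      rw [← M.lie_ins_p hQ, ih k _ (hQ.ins _), mul_sub, Finset.mul_sum, sub_eq_add_neg]
      congr 1
      · exact Finset.sum_congr rfl fun i _ => by rw [M.j_left_comm, M.lie_ins_p hQ]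
      · cases k with
        | zero => simp
        | succ k =>
          simp only [prev_succ, Finset.mul_sum, Finset.smul_sum, ← Finset.sum_neg_distrib]
          refine Finset.sum_congr rfl fun l _ => ?_
          rw [M.comm_left a.deg 1 _ _ _ (M.δ_mem _ _ _ a.mem)
            (M.δ_mem _ _ _ (M.sec_mem v)), mul_one, hQ.anti]
          simp
    simp only [h2, Finset.sum_add_distrib, smul_add]
    rw [Finset.sum_comm (f := fun i ν => M.j (M.pair (M.u ν) v) * (M.δ i a.val * _))]
    simp only [← Finset.mul_sum]
    simp only [← Finset.smul_sum, sgn_smul_smul]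
    rw [Finset.sum_comm (f := fun μ i => M.δ i (M.sec v) * (M.ι μ a.val * _))]
    simp only [← Finset.mul_sum]
    have e1 : sgn (((k + 1 : ℕ) : ℤ) * (a.deg + 1) + (a.deg - 1)) = sgn (k * (a.deg + 1)) :=
      sgn_congr (by push_cast; simp only [parity_simps]; grind)
    rw [e1]
    rcases k with _ | k
    · simp [Finset.mul_sum]; abel
    have e2 : sgn (((((k + 1 + 1 : ℕ) : ℤ) + 1) * a.deg + ((k + 1 + 1 : ℕ) : ℤ)) + a.deg) =
        -sgn ((((k + 1 : ℕ) : ℤ) + 1) * a.deg + ((k + 1 : ℕ) : ℤ)) := by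
      rw [neg_sgn]
      exact sgn_congr (by push_cast; simp only [parity_simps]; grind)
    simp only [prev_succ, mul_smul_comm, ← Finset.smul_sum]
    rw [e2, Finset.sum_comm (f := fun i l => M.δ l (M.sec v) * (M.δ i a.val * _))]
    simp only [← Finset.mul_sum, neg_smul]
    abel

lemma om_hs (v : S) (t : List (Hom 𝒜)) (k : ℕ) (Q : List O → O) (hQ : IsMV k Q) :
    M.om (M.hs v :: t) k Q = M.om t k (lie (M.vert v) Q) := by
  rw [om_cons, M.om_lie t k Q hQ]
  have e1 : sgn ((k : ℤ) * (1 + 1)) = 1 := sgn_of_even (by simp)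
  have e2 : sgn (((k : ℤ) + 1) * 1 + k) = -1 := by
    rw [show ((k : ℤ) + 1) * 1 + k = k + k + 1 by ring, sgn_add, sgn_of_even ⟨_, rfl⟩]; simp
  simp only [hs, e1, e2, M.con_sec, one_smul]
  cases k <;> simp [sub_eq_add_neg]

lemma om_mul (b c : Hom 𝒜) (h : b.val * c.val ∈ 𝒜 (b.deg + c.deg)) (t : List (Hom 𝒜)) (k : ℕ)
    (Q : List O → O) : M.om (⟨_, _, h⟩ :: t) k Q =
      sgn ((k - 1) * b.deg) • (b.val * M.om (c :: t) k Q) +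
      sgn ((k - 1) * c.deg + b.deg * c.deg) • (c.val * M.om (b :: t) k Q) := by
  simp only [om_cons]
  have h1 : ∀ μ y, M.ι μ (b.val * c.val) * y = sgn ((b.deg - 1) * c.deg) • (c.val * (M.ι μ b.val * y))
      + sgn b.deg • (b.val * (M.ι μ c.val * y)) := fun μ y => by
    rw [M.con_mul _ _ _ _ b.mem, add_mul, smul_mul_assoc, mul_assoc, mul_assoc,
      M.comm_left _ _ _ _ _ (M.con_mem _ _ _ b.mem) c.mem]
  have h2 : ∀ i y, M.δ i (b.val * c.val) * y = sgn (b.deg * c.deg) • (c.val * (M.δ i b.val * y))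
      + b.val * (M.δ i c.val * y) := fun i y => by
    rw [M.δ_mul, add_mul, mul_assoc, mul_assoc,
      M.comm_left _ _ _ _ _ (M.δ_mem _ _ _ b.mem) c.mem]
  simp only [h1, h2, Finset.sum_add_distrib, ← Finset.smul_sum, ← Finset.mul_sum, smul_add,
    M.left_distrib_A, sgn_smul_smul, mul_smul_comm]
  have e1 : sgn ((k : ℤ) * (b.deg + c.deg + 1) + (b.deg - 1) * c.deg) =
      sgn ((k - 1) * c.deg + b.deg * c.deg + k * (b.deg + 1)) :=
    sgn_congr (by simp only [parity_simps]; grind)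
  have e2 : sgn ((k : ℤ) * (b.deg + c.deg + 1) + b.deg) =
      sgn ((k - 1) * b.deg + k * (c.deg + 1)) :=
    sgn_congr (by simp only [parity_simps]; grind)
  rw [e1, e2]
  rcases k with _ | k
  · simp; abel
  have e3 : sgn ((((k + 1 : ℕ) : ℤ) + 1) * (b.deg + c.deg) + ((k + 1 : ℕ) : ℤ) + b.deg * c.deg) =
      sgn ((((k + 1 : ℕ) : ℤ) - 1) * c.deg + b.deg * c.deg +
        ((((k + 1 : ℕ) : ℤ) + 1) * b.deg + ((k + 1 : ℕ) : ℤ))) :=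
    sgn_congr (by push_cast; simp only [parity_simps]; grind)
  have e4 : sgn ((((k + 1 : ℕ) : ℤ) + 1) * (b.deg + c.deg) + ((k + 1 : ℕ) : ℤ)) =
      sgn ((((k + 1 : ℕ) : ℤ) - 1) * b.deg +
        ((((k + 1 : ℕ) : ℤ) + 1) * c.deg + ((k + 1 : ℕ) : ℤ))) :=
    sgn_congr (by push_cast; simp only [parity_simps]; grind)
  simp only [prev_succ, mul_smul_comm, sgn_smul_smul, e3, e4]
  abel

lemma om_swap_head (a b : Hom 𝒜) (t : List (Hom 𝒜)) (k : ℕ) (Q : List O → O) (hQ : IsMV k Q) :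
    M.om (a :: b :: t) k Q = sgn ((a.deg - 1) * (b.deg - 1)) • M.om (b :: a :: t) k Q := by
  have t1 : ∀ (k : ℕ) (Q : List O → O), ∑ μ, ∑ ν, M.ι μ a.val * (M.ι ν b.val *
      M.om t k (M.Le ν (M.Le μ Q))) = sgn ((a.deg - 1) * (b.deg - 1)) •
      ∑ μ, ∑ ν, M.ι μ b.val * (M.ι ν a.val * M.om t k (M.Le ν (M.Le μ Q))) := fun k Q => by
    rw [Finset.sum_comm, Finset.smul_sum]
    simp only [Finset.smul_sum]
    refine Finset.sum_congr rfl fun μ _ => Finset.sum_congr rfl fun ν _ => ?_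
    rw [M.lie_vert_comm, M.comm_left _ _ _ _ _ (M.con_mem _ _ _ a.mem) (M.con_mem _ _ _ b.mem)]
  have t2 : ∀ (a b : Hom 𝒜) (k : ℕ) (Q : List O → O), IsMV (k + 1) Q →
      ∑ μ, ∑ i, M.ι μ a.val * (M.δ i b.val * M.om t k (M.Ix i (M.Le μ Q))) =
      sgn ((a.deg - 1) * b.deg) •
        ∑ i, ∑ μ, M.δ i b.val * (M.ι μ a.val * M.om t k (M.Le μ (M.Ix i Q))) := fun a b k Q hQ => by
    rw [Finset.sum_comm, Finset.smul_sum]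
    simp only [Finset.smul_sum]
    refine Finset.sum_congr rfl fun μ _ => Finset.sum_congr rfl fun ν _ => ?_
    rw [M.lie_ins_p hQ, M.comm_left _ _ _ _ _ (M.con_mem _ _ _ a.mem) (M.δ_mem _ _ _ b.mem)]
  have t3 : ∀ (k : ℕ) (Q : List O → O), IsMV (k + 2) Q → ∑ i, ∑ l, M.δ i a.val * (M.δ l b.val *
      M.om t k (M.Ix l (M.Ix i Q))) = sgn (a.deg * b.deg + 1) •
      ∑ i, ∑ l, M.δ i b.val * (M.δ l a.val * M.om t k (M.Ix l (M.Ix i Q))) := fun k Q hQ => by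
    rw [Finset.sum_comm, Finset.smul_sum]
    simp only [Finset.smul_sum]
    refine Finset.sum_congr rfl fun μ _ => Finset.sum_congr rfl fun ν _ => ?_
    rw [hQ.anti, map_neg, M.comm_left _ _ _ _ _ (M.δ_mem _ _ _ a.mem) (M.δ_mem _ _ _ b.mem),
      mul_neg, mul_neg, smul_neg, neg_smul_sgn]
  have e1 : sgn ((k : ℤ) * (a.deg + 1) + (k * (b.deg + 1) + (a.deg - 1) * (b.deg - 1))) =
      sgn ((a.deg - 1) * (b.deg - 1) + (k * (b.deg + 1) + k * (a.deg + 1))) :=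
    sgn_congr (by simp only [parity_simps]; grind)
  rcases k with _ | k
  · simp only [om_cons, prev_zero, add_zero, mul_smul_comm, Finset.mul_sum, ← Finset.smul_sum]
    rw [t1]
    simp only [sgn_smul_smul]
    rw [e1]
  have t1' := t1 (k + 1) Q
  have t2' := t2 a b k Q hQ
  have t2'' := t2 b a k Q hQ
  have f1 : sgn ((((k + 1 : ℕ) : ℤ)) * (a.deg + 1) +
      (((((k + 1 : ℕ) : ℤ) + 1) * b.deg + ((k + 1 : ℕ) : ℤ)) + (a.deg - 1) * b.deg)) =
      sgn ((a.deg - 1) * (b.deg - 1) + ((((((k + 1 : ℕ) : ℤ) + 1) * b.deg + ((k + 1 : ℕ) : ℤ))) +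
        k * (a.deg + 1))) := sgn_congr (by push_cast; simp only [parity_simps]; grind)
  have f2 : sgn (((((k + 1 : ℕ) : ℤ) + 1) * a.deg + ((k + 1 : ℕ) : ℤ)) + k * (b.deg + 1)) =
      sgn ((a.deg - 1) * (b.deg - 1) + ((((k + 1 : ℕ) : ℤ)) * (b.deg + 1) +
      (((((k + 1 : ℕ) : ℤ) + 1) * a.deg + ((k + 1 : ℕ) : ℤ)) + (b.deg - 1) * a.deg))) :=
    sgn_congr (by push_cast; simp only [parity_simps]; grind)
  rcases k with _ | k
  · simp only [om_cons, prev_zero, mul_smul_comm, Finset.mul_sum, ← Finset.smul_sum,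
      prev_succ, M.left_distrib_A, Finset.sum_add_distrib, smul_add]
    rw [t1', t2', t2'']
    simp only [sgn_smul_smul]
    simp only [mul_zero, Finset.sum_const_zero, smul_zero, add_zero]
    rw [e1, f1, f2]
    abel
  have f3 : sgn (((((k + 1 + 1 : ℕ) : ℤ) + 1) * a.deg + ((k + 1 + 1 : ℕ) : ℤ)) +
      (((((k + 1 : ℕ) : ℤ) + 1) * b.deg + ((k + 1 : ℕ) : ℤ)) + (a.deg * b.deg + 1))) =
      sgn ((a.deg - 1) * (b.deg - 1) + (((((k + 1 + 1 : ℕ) : ℤ) + 1) * b.deg +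
      ((k + 1 + 1 : ℕ) : ℤ)) + ((((k + 1 : ℕ) : ℤ) + 1) * a.deg + ((k + 1 : ℕ) : ℤ)))) :=
    sgn_congr (by push_cast; simp only [parity_simps]; grind)
  simp only [om_cons, mul_smul_comm, Finset.mul_sum, ← Finset.smul_sum,
      prev_succ, M.left_distrib_A, Finset.sum_add_distrib, smul_add]
  rw [t1', t2', t2'', t3 k Q hQ]
  simp only [sgn_smul_smul]
  rw [e1, f1, f2, f3]
  abel

lemma om_smd (k : ℕ) (Q : List O → O) (hQ : IsMV k Q) : SMD 𝒜 (k - 1) fun l => M.om l k Q where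
  mem l := deg_cast (M.om_mem l k Q) (by ring)
  swap l a b t := by
    induction l generalizing k Q with
    | nil => exact M.om_swap_head a b t k Q hQ
    | cons c l ih =>
      simp only [List.cons_append, om_cons]
      rcases k with _ | k
      · simp only [ih 0 _ (hQ.lie _), mul_smul_comm, ← Finset.smul_sum, prev_zero, add_zero]
        rw [smul_comm]
      · simp only [ih (k + 1) _ (hQ.lie _), ih k _ (hQ.ins _), mul_smul_comm, ← Finset.smul_sum,
          prev_succ, smul_add]
        rw [smul_comm, smul_comm (sgn ((((k + 1 : ℕ) : ℤ) + 1) * _ + _))]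
  add i a b ha hb h t := by
    simp only [om_cons, map_add, add_mul, Finset.sum_add_distrib, smul_add]
    cases k <;> simp only [prev_zero, prev_succ] <;> abel
  smul i c a ha h t := by
    simp only [om_cons, map_smul, smul_mul_assoc, ← Finset.smul_sum, smul_add]
    rw [smul_comm]
    cases k
    · simp
    · simp only [prev_succ]; rw [smul_comm (sgn ((((_ + 1 : ℕ) : ℤ) + 1) * _ + _))]
  mul b c h t := M.om_mul b c h t k Q

end Model

section SMD

variable {A : Type*} [Ring A] [Algebra ℝ A] {𝒜 : ℤ → Submodule ℝ A}

lemma SMD.swap_head {d : ℤ} {ψ : List (Hom 𝒜) → A} (h : SMD 𝒜 d ψ) (a b : Hom 𝒜)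
    (t : List (Hom 𝒜)) :
    ψ (a :: b :: t) = sgn ((a.deg - 1) * (b.deg - 1)) • ψ (b :: a :: t) := h.swap [] a b t

lemma SMD.ins {d : ℤ} {ψ : List (Hom 𝒜) → A} (h : SMD 𝒜 d ψ) (a : Hom 𝒜) :
    SMD 𝒜 (d + (a.deg - 1)) fun t => ψ (a :: t) where
  mem l := deg_cast (h.mem (a :: l)) (by simp [bsum]; ring)
  swap l b c t := h.swap (a :: l) b c t
  add i b c hb hc hbc t := by
    rw [h.swap_head a, h.swap_head a, h.swap_head a, h.add i b c hb hc, smul_add]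
  smul i r b hb hrb t := by
    rw [h.swap_head a, h.swap_head a, h.smul i r b hb, smul_comm]
  mul b c hbc t := by
    rw [h.swap_head a, h.swap_head a, h.swap_head a, h.mul b c hbc, smul_add]
    simp only [mul_smul_comm, sgn_smul_smul]
    congr 2
    · exact sgn_congr (by simp only [parity_simps]; grind)
    · exact sgn_congr (by simp only [parity_simps]; grind)

lemma SMD.sub {d : ℤ} {ψ ψ' : List (Hom 𝒜) → A} (h : SMD 𝒜 d ψ) (h' : SMD 𝒜 d ψ') :
    SMD 𝒜 d fun l => ψ l - ψ' l where
  mem l := sub_mem (h.mem l) (h'.mem l)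
  swap l a b t := by rw [h.swap, h'.swap, smul_sub]
  add i a b ha hb hab t := by rw [h.add i a b ha hb, h'.add i a b ha hb]; abel
  smul i c a ha hca t := by rw [h.smul i c a ha, h'.smul i c a ha, smul_sub]
  mul b c hbc t := by
    rw [h.mul, h'.mul]; simp only [mul_sub, smul_sub]; abel

/-- The restriction to lists of length `n`. -/
def lenR (n : ℕ) (ψ : List (Hom 𝒜) → A) (l : List (Hom 𝒜)) : A := if l.length = n then ψ l else 0

lemma lenR_of {n : ℕ} (ψ : List (Hom 𝒜) → A) {l : List (Hom 𝒜)} (h : l.length = n) :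
    lenR n ψ l = ψ l := if_pos h

lemma SMD.lenR {d : ℤ} {ψ : List (Hom 𝒜) → A} (h : SMD 𝒜 d ψ) (n : ℕ) :
    SMD 𝒜 d (lenR n ψ) where
  mem l := by unfold RelPoisson.lenR; split_ifs; exacts [h.mem l, zero_mem _]
  swap l a b t := by
    simp only [RelPoisson.lenR, List.length_append, List.length_cons]
    split_ifs
    exacts [h.swap l a b t, by simp]
  add i a b ha hb hab t := by
    simp only [RelPoisson.lenR, List.length_cons]
    split_ifs
    exacts [h.add i a b ha hb hab t, by simp]
  smul i c a ha hca t := by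
    simp only [RelPoisson.lenR, List.length_cons]
    split_ifs
    exacts [h.smul i c a ha hca t, by simp]
  mul b c hbc t := by
    simp only [RelPoisson.lenR, List.length_cons]
    split_ifs
    exacts [h.mul b c hbc t, by simp]

lemma bsum_append (l t : List (Hom 𝒜)) : bsum (l ++ t) = bsum l + bsum t := by
  induction l with
  | nil => simp [bsum]
  | cons a l ih => simp only [List.cons_append, bsum, ih]; ring

lemma move_of_swap {ψ : List (Hom 𝒜) → A} (h : ∀ l a b t, ψ (l ++ a :: b :: t) =
    sgn ((a.deg - 1) * (b.deg - 1)) • ψ (l ++ b :: a :: t)) (g : List (Hom 𝒜)) (a : Hom 𝒜)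
    (s : List (Hom 𝒜)) :
    ψ (g ++ a :: s) = sgn ((a.deg - 1) * bsum g) • ψ (a :: (g ++ s)) := by
  induction g generalizing ψ with
  | nil => simp [bsum]
  | cons x g ih =>
    have h1 := ih (ψ := fun l => ψ (x :: l)) fun l => h (x :: l)
    have h2 := h [] x a (g ++ s)
    simp only [List.cons_append, List.nil_append] at h1 h2 ⊢
    rw [h1, h2, sgn_smul_smul]
    congr 2
    simp only [bsum]; ring

lemma SMD.move {d : ℤ} {ψ : List (Hom 𝒜) → A} (h : SMD 𝒜 d ψ) (g : List (Hom 𝒜)) (a : Hom 𝒜)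
    (s : List (Hom 𝒜)) :
    ψ (g ++ a :: s) = sgn ((a.deg - 1) * bsum g) • ψ (a :: (g ++ s)) := move_of_swap h.swap g a s

lemma SMD.eq_zero_of_perm {d : ℤ} {ψ : List (Hom 𝒜) → A} (h : SMD 𝒜 d ψ) {l l' : List (Hom 𝒜)}
    (hl : l.Perm l') (h0 : ψ l = 0) : ψ l' = 0 := by
  induction hl generalizing d ψ with
  | nil => exact h0
  | cons x _ ih => exact ih (h.ins x) h0
  | swap x y l => rw [h.swap_head, h0, smul_zero]
  | trans _ _ ih1 ih2 => exact ih2 h (ih1 h h0)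

/-- The sign relating graded symmetric and graded skew-symmetric operations. -/
def dsgn : List (Hom 𝒜) → ℝ
  | [] => 1
  | a :: t => sgn (t.length * (a.deg - 1)) * dsgn t

lemma dsgn_mul_self (l : List (Hom 𝒜)) : dsgn l * dsgn l = 1 := by
  induction l with
  | nil => simp [dsgn]
  | cons a t ih =>
    simp only [dsgn]
    rw [mul_mul_mul_comm, sgn_mul_self, ih, one_mul]

lemma dsgn_swap (l : List (Hom 𝒜)) (a b : Hom 𝒜) (t : List (Hom 𝒜)) :
    dsgn (l ++ a :: b :: t) = sgn (a.deg + b.deg) * dsgn (l ++ b :: a :: t) := by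
  induction l with
  | nil =>
    simp only [List.nil_append, dsgn, List.length_cons]
    rw [← mul_assoc, ← mul_assoc, ← mul_assoc, ← sgn_add, ← sgn_add, ← sgn_add]
    congr 1
    exact sgn_congr (by push_cast; simp only [parity_simps]; grind)
  | cons x l ih =>
    simp only [List.cons_append, dsgn, ih, List.length_append, List.length_cons]; ring

lemma dsgn_concat (t : List (Hom 𝒜)) (a b : Hom 𝒜) : dsgn (t ++ [a]) = dsgn (t ++ [b]) := by
  induction t with
  | nil => simp [dsgn]
  | cons x t ih => simp [dsgn, ih]

lemma exists_ofFn_swap {X : Type*} {n : ℕ} (h : Fin n → X) (i k : Fin n) (hik : (k : ℕ) = i + 1) :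
    ∃ l t : List X, l.length = (i : ℕ) ∧ List.ofFn h = l ++ h i :: h k :: t ∧
      List.ofFn (h ∘ Equiv.swap i k) = l ++ h k :: h i :: t := by
  induction n with
  | zero => exact i.elim0
  | succ n ih =>
    obtain ⟨k, rfl⟩ : ∃ k', k = Fin.succ k' :=
      Fin.exists_succ_eq_of_ne_zero (by intro h0; simp [h0] at hik) |>.imp fun _ h => h.symm
    induction i using Fin.cases with
    | zero =>
      cases n with
      | zero => exact k.elim0
      | succ n =>
        obtain rfl : k = 0 := by ext; simpa using hik
        refine ⟨[], List.ofFn fun i : Fin n => h i.succ.succ, rfl, ?_, ?_⟩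
        · rw [List.ofFn_succ, List.ofFn_succ]; rfl
        · rw [List.ofFn_succ, List.ofFn_succ]
          simp only [Function.comp_apply, Equiv.swap_apply_left, Equiv.swap_apply_right,
            List.nil_append]
          congr 3
    | succ i =>
      obtain ⟨l, t, h1, h2, h3⟩ := ih (fun m => h m.succ) i k (by simpa using hik)
      refine ⟨h 0 :: l, t, by simp [h1], ?_, ?_⟩
      · rw [List.ofFn_succ, h2]; rfl
      · rw [List.ofFn_succ, List.cons_append, ← h3]
        congr 1
        · congr 1
          funext m
          simp only [Function.comp_apply]
          rw [(Fin.succ_injective n).swap_apply]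

lemma bsum_ofFn {n : ℕ} (h : Fin n → Hom 𝒜) : bsum (List.ofFn h) = ∑ i, (h i).deg - n := by
  induction n with
  | zero => simp [bsum]
  | succ n ih =>
    rw [List.ofFn_succ, bsum, ih, Fin.sum_univ_succ]; push_cast; ring

/-- The skew-symmetric operation `φ` corresponds to the symmetric operation `ψ`. -/
def Corr {n : ℕ} (φ : MultilinearMap ℝ (fun _ : Fin n => A) A) (ψ : List (Hom 𝒜) → A) : Prop :=
  ∀ h : Fin n → Hom 𝒜, φ (fun i => (h i).val) = dsgn (List.ofFn h) • ψ (List.ofFn h)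

/-- The symmetric operation of a sequence of skew-symmetric operations. -/
def symm (φ : ∀ n, MultilinearMap ℝ (fun _ : Fin n => A) A) (l : List (Hom 𝒜)) : A :=
  dsgn l • φ l.length fun i => (l.get i).val

lemma symm_ofFn (φ : ∀ n, MultilinearMap ℝ (fun _ : Fin n => A) A) {n : ℕ} (h : Fin n → Hom 𝒜) :
    symm φ (List.ofFn h) = dsgn (List.ofFn h) • φ n fun i => (h i).val := by
  have : ∀ (l : List (Hom 𝒜)) (e : l.length = n),
      symm φ l = dsgn l • φ n fun i => (l.get (i.cast e.symm)).val := by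
    rintro l rfl; rfl
  rw [this _ (List.length_ofFn)]
  simp

lemma corr_symm (φ : ∀ n, MultilinearMap ℝ (fun _ : Fin n => A) A) (n : ℕ) :
    Corr (𝒜 := 𝒜) (φ n) (symm φ) := fun h => by
  rw [symm_ofFn, smul_smul, dsgn_mul_self, one_smul]

lemma exists_ofFn_concat {X : Type*} {n : ℕ} (h : Fin n → X) (i : Fin n) (hi : (i : ℕ) + 1 = n) :
    ∃ t : List X, t.length + 1 = n ∧ ∀ x, List.ofFn (Function.update h i x) = t ++ [x] := by
  obtain _ | m := n
  · exact i.elim0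
  obtain rfl : i = Fin.last m := by ext; simpa using hi
  refine ⟨List.ofFn fun i => h i.castSucc, by simp, fun x => ?_⟩
  rw [List.ofFn_succ', List.concat_eq_append]
  simp [Fin.castSucc_ne_last]

lemma ofFn_cons {X : Type*} {n : ℕ} (x : X) (g : Fin n → X) :
    List.ofFn (Fin.cons x g : Fin (n + 1) → X) = x :: List.ofFn g := by
  rw [List.ofFn_succ]; simp

lemma ofFn_snoc {X : Type*} {n : ℕ} (x : X) (g : Fin n → X) :
    List.ofFn (Fin.snoc g x : Fin (n + 1) → X) = List.ofFn g ++ [x] := by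
  rw [List.ofFn_succ', List.concat_eq_append]; simp

lemma val_cons {n : ℕ} (x : Hom 𝒜) (g : Fin n → Hom 𝒜) :
    (fun i => ((Fin.cons x g : Fin (n + 1) → Hom 𝒜) i).val) =
      (Fin.cons x.val fun i => (g i).val : Fin (n + 1) → A) := by
  funext i
  induction i using Fin.cases <;> simp

lemma symm_swap (φ : ∀ n, MultilinearMap ℝ (fun _ : Fin n => A) A) (h : ∀ n, IsMultiDer 𝒜 (φ n))
    (l : List (Hom 𝒜)) (a b : Hom 𝒜) (t : List (Hom 𝒜)) : symm φ (l ++ a :: b :: t) =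
      sgn ((a.deg - 1) * (b.deg - 1)) • symm φ (l ++ b :: a :: t) := by
  obtain ⟨n, f, hf⟩ : ∃ n, ∃ f : Fin n → Hom 𝒜, List.ofFn f = l ++ a :: b :: t :=
    ⟨_, _, List.ofFn_get _⟩
  have hn : n = l.length + (t.length + 1 + 1) := by
    have := congrArg List.length hf
    simpa using this
  obtain ⟨l', t', h1, h2, h3⟩ := exists_ofFn_swap f ⟨l.length, by omega⟩
    ⟨l.length + 1, by omega⟩ rfl
  rw [hf] at h2
  obtain ⟨rfl, h4⟩ := List.append_inj h2 h1.symm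
  simp only [List.cons.injEq] at h4
  obtain ⟨ha, hb, rfl⟩ := h4
  rw [← ha, ← hb] at h3
  have h5 := (h n).skew (fun i => (f i).deg) (fun i => (f i).val) (fun i => (f i).mem)
    ⟨l.length, by omega⟩ ⟨l.length + 1, by omega⟩ rfl
  have h6 := symm_ofFn φ f
  have h7 := symm_ofFn φ (f ∘ Equiv.swap ⟨l.length, by omega⟩ ⟨l.length + 1, by omega⟩)
  rw [hf] at h6
  rw [h3] at h7
  rw [h6, h7]
  change _ = sgn _ • dsgn _ • φ n ((fun i => (f i).val) ∘ _)
  rw [h5, ← ha, ← hb, dsgn_swap, smul_neg, smul_neg, smul_smul, smul_smul, ← neg_smul]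
  congr 1
  have : sgn (a.deg + b.deg) = -(sgn ((a.deg - 1) * (b.deg - 1)) * sgn (a.deg * b.deg)) := by
    rw [← sgn_add, neg_sgn]
    exact sgn_congr (by simp only [parity_simps]; grind)
  rw [this]; ring

lemma symm_last (φ : ∀ n, MultilinearMap ℝ (fun _ : Fin n => A) A) (h : ∀ n, IsMultiDer 𝒜 (φ n))
    (t : List (Hom 𝒜)) (b c : Hom 𝒜) (hbc : b.val * c.val ∈ 𝒜 (b.deg + c.deg)) :
    symm φ (t ++ [⟨_, _, hbc⟩]) = symm φ (t ++ [b]) * c.val +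
      sgn ((1 + bsum t) * b.deg) • (b.val * symm φ (t ++ [c])) := by
  obtain ⟨n, f, rfl⟩ : ∃ n, ∃ f : Fin n → Hom 𝒜, List.ofFn f = t := ⟨_, _, List.ofFn_get t⟩
  have key : ∀ x : Hom 𝒜, symm φ (List.ofFn f ++ [x]) = dsgn (List.ofFn f ++ [b]) •
      φ (n + 1) (Function.update (fun i => ((Fin.snoc f b : Fin (n + 1) → Hom 𝒜) i).val)
        (Fin.last n) x.val) := fun x => by
    rw [← ofFn_snoc, symm_ofFn, ofFn_snoc, dsgn_concat _ x b]
    congr 2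
    funext i
    induction i using Fin.lastCases <;> simp [Fin.castSucc_ne_last]
  rw [key, key, key]
  simp only
  rw [(h (n + 1)).leibniz (fun i => ((Fin.snoc f b : Fin (n + 1) → Hom 𝒜) i).deg) _
    (fun i => ((Fin.snoc f b : Fin (n + 1) → Hom 𝒜) i).mem) (Fin.last n) (by simp) b.deg _ _ b.mem,
    smul_add, smul_mul_assoc, mul_smul_comm, smul_comm]
  congr 4
  have h1 := Finset.add_sum_erase Finset.univ
    (fun i => ((Fin.snoc f b : Fin (n + 1) → Hom 𝒜) i).deg) (Finset.mem_univ (Fin.last n))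
  rw [Fin.sum_univ_castSucc, Fin.snoc_last, add_comm] at h1
  have h2 := add_right_cancel h1
  rw [h2, bsum_ofFn]
  simp only [Fin.snoc_castSucc]
  push_cast; ring

lemma symm_add (φ : ∀ n, MultilinearMap ℝ (fun _ : Fin n => A) A) (i : ℤ) (a b : A)
    (ha : a ∈ 𝒜 i) (hb : b ∈ 𝒜 i) (h : a + b ∈ 𝒜 i) (t : List (Hom 𝒜)) :
    symm φ (⟨i, a + b, h⟩ :: t) = symm φ (⟨i, a, ha⟩ :: t) + symm φ (⟨i, b, hb⟩ :: t) := by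
  obtain ⟨n, f, rfl⟩ : ∃ n, ∃ f : Fin n → Hom 𝒜, List.ofFn f = t := ⟨_, _, List.ofFn_get t⟩
  simp only [← ofFn_cons, symm_ofFn, val_cons, MultilinearMap.cons_add, smul_add]
  simp only [ofFn_cons, dsgn]

lemma symm_smul (φ : ∀ n, MultilinearMap ℝ (fun _ : Fin n => A) A) (i : ℤ) (c : ℝ) (a : A)
    (ha : a ∈ 𝒜 i) (h : c • a ∈ 𝒜 i) (t : List (Hom 𝒜)) :
    symm φ (⟨i, c • a, h⟩ :: t) = c • symm φ (⟨i, a, ha⟩ :: t) := by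
  obtain ⟨n, f, rfl⟩ : ∃ n, ∃ f : Fin n → Hom 𝒜, List.ofFn f = t := ⟨_, _, List.ofFn_get t⟩
  simp only [← ofFn_cons, symm_ofFn, val_cons, MultilinearMap.cons_smul]
  simp only [ofFn_cons, dsgn]
  rw [smul_comm]

end SMD

namespace Model

variable {B O A : Type*} [CommRing B] [Algebra ℝ B] [CommRing O] [Algebra ℝ O]
  [Ring A] [Algebra ℝ A] {𝒜 : ℤ → Submodule ℝ A} {S L κ η : Type*} [Fintype κ] [Fintype η]
  (M : Model B O A 𝒜 S L κ η)

lemma smd_head_zero {d : ℤ} {ψ : List (Hom 𝒜) → A} (h : SMD 𝒜 d ψ) (t : List (Hom 𝒜))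
    (hf : ∀ f, ψ (M.hj f :: t) = 0) (hv : ∀ v, ψ (M.hs v :: t) = 0) (a : Hom 𝒜) :
    ψ (a :: t) = 0 := by
  obtain ⟨i, a, ha⟩ := a
  refine M.hom_induction (Q := fun i a => ∀ ha : a ∈ 𝒜 i, ψ (⟨i, a, ha⟩ :: t) = 0)
    ?_ ?_ ?_ ?_ ?_ i a ha ha
  · intro i ha
    have := h.smul i 0 0 ha (by simp) t
    simpa using this
  · intro i a b ha hb h1 h2 hab
    rw [h.add i a b ha hb, h1, h2, add_zero]
  · intro i c a ha h1 hca
    rw [h.smul i c a ha, h1, smul_zero]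
  · exact fun f _ => hf f
  · intro n μ a ha h1 hea
    have e : ((n + 1 : ℕ) : ℤ) = (M.hs (M.e μ)).deg + (n : ℤ) := by simp [hs]; ring
    have h2 := h.mul (M.hs (M.e μ)) ⟨n, a, ha⟩ (deg_cast hea e) t
    rw [hv, h1, mul_zero, mul_zero, smul_zero, smul_zero, add_zero] at h2
    convert h2 using 3
    ext
    · exact e
    · rfl

/-- The lists of functions and sections. -/
def gens : List (S ⊕ B) → List (Hom 𝒜) := List.map (Sum.elim M.hs M.hj)

lemma smd_eq_zero_of_gens {d : ℤ} {ψ : List (Hom 𝒜) → A} (h : SMD 𝒜 d ψ)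
    (h0 : ∀ g, ψ (M.gens g) = 0) (l : List (Hom 𝒜)) : ψ l = 0 := by
  suffices ∀ (l : List (Hom 𝒜)) (g : List (S ⊕ B)), ψ (M.gens g ++ l) = 0 from this l []
  intro l
  induction l with
  | nil => intro g; rw [List.append_nil, h0]
  | cons a l ih =>
    intro g
    rw [h.move, M.smd_head_zero h _ (fun f => ?_) (fun v => ?_), smul_zero]
    · exact ih (Sum.inr f :: g)
    · exact ih (Sum.inl v :: g)

lemma smd_eq_of_gens {d : ℤ} {ψ ψ' : List (Hom 𝒜) → A} (h : SMD 𝒜 d ψ) (h' : SMD 𝒜 d ψ')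
    (h0 : ∀ g, ψ (M.gens g) = ψ' (M.gens g)) (l : List (Hom 𝒜)) : ψ l = ψ' l :=
  sub_eq_zero.1 (M.smd_eq_zero_of_gens (h.sub h') (fun g => sub_eq_zero.2 (h0 g)) l)

lemma smd_eq_zero (M : Model B O A 𝒜 S L κ η) {d : ℤ} {ψ : List (Hom 𝒜) → A} (h : SMD 𝒜 d ψ)
    (h0 : ∀ (v : List S) (f : List B), ψ (v.map M.hs ++ f.map M.hj) = 0) (l : List (Hom 𝒜)) :
    ψ l = 0 := by
  refine M.smd_eq_zero_of_gens h (fun g => ?_) l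
  have : ∃ (v : List S) (f : List B), (v.map M.hs ++ f.map M.hj).Perm (M.gens g) := by
    induction g with
    | nil => exact ⟨[], [], List.Perm.refl _⟩
    | cons x g ih =>
      obtain ⟨v, f, hp⟩ := ih
      rcases x with s | k
      · exact ⟨s :: v, f, hp.cons _⟩
      · exact ⟨v, k :: f, List.perm_middle.trans (hp.cons _)⟩
  obtain ⟨v, f, hp⟩ := this
  exact h.eq_zero_of_perm hp (h0 v f)

lemma bsum_sorted (v : List S) (f : List B) :
    bsum (v.map M.hs ++ f.map M.hj) = -(f.length : ℤ) := by
  rw [bsum_append]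
  have h1 : bsum (v.map M.hs) = 0 := by
    induction v with
    | nil => rfl
    | cons a v ih => simpa [bsum, hs] using ih
  have h2 : bsum (f.map M.hj) = -(f.length : ℤ) := by
    induction f with
    | nil => rfl
    | cons a v ih => simp only [List.map_cons, bsum, ih, List.length_cons]; simp [hj]
  rw [h1, h2, zero_add]

lemma smd_eq_zero_of_neg (M : Model B O A 𝒜 S L κ η)
    {d : ℤ} (hd : d + 1 < 0) {ψ : List (Hom 𝒜) → A} (h : SMD 𝒜 d ψ)
    (l : List (Hom 𝒜)) : ψ l = 0 := by
  refine M.smd_eq_zero h (fun v f => M.neg_eq _ _ ?_ (h.mem _)) l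
  rw [M.bsum_sorted]; omega

lemma smd_last (M : Model B O A 𝒜 S L κ η) {ψ : List (Hom 𝒜) → A} {d : ℤ} (h : SMD 𝒜 d ψ) (t : List (Hom 𝒜)) (b c : Hom 𝒜)
    (hbc : b.val * c.val ∈ 𝒜 (b.deg + c.deg)) :
    ψ (t ++ [⟨_, _, hbc⟩]) = ψ (t ++ [b]) * c.val +
      sgn ((d + bsum t) * b.deg) • (b.val * ψ (t ++ [c])) := by
  rw [h.move, h.move, h.move, h.mul, List.append_nil, smul_mul_assoc,
    M.comm _ _ _ _ (h.mem (b :: t)) c.mem]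
  simp only [smul_add, sgn_smul_smul, mul_smul_comm]
  rw [add_comm]
  congr 2
  · exact sgn_congr (by simp only [bsum]; simp only [parity_simps]; grind)
  · exact sgn_congr (by simp only [parity_simps]; grind)

lemma isMultiDer_of_corr (M : Model B O A 𝒜 S L κ η) {n : ℕ}
    {φ : MultilinearMap ℝ (fun _ : Fin n => A) A} {ψ : List (Hom 𝒜) → A} (h : SMD 𝒜 1 ψ)
    (hc : Corr φ ψ) : IsMultiDer 𝒜 φ where
  degree β a ha := by
    have := hc fun i => ⟨β i, a i, ha i⟩
    simp only at this
    rw [this]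
    refine Submodule.smul_mem _ _ (deg_cast (h.mem _) ?_)
    rw [bsum_ofFn]; ring
  skew β a ha i k hik := by
    obtain ⟨f, hf⟩ : ∃ f : Fin n → Hom 𝒜, ∀ i, f i = ⟨β i, a i, ha i⟩ := ⟨_, fun _ => rfl⟩
    have h1 := hc f
    have h2 := hc (f ∘ Equiv.swap i k)
    obtain ⟨l, t, -, e1, e2⟩ := exists_ofFn_swap f i k hik
    rw [e1, dsgn_swap, h.swap] at h1
    rw [e2] at h2
    simp only [Function.comp_apply, hf] at h1 h2
    change φ (fun x => a (Equiv.swap i k x)) = -(sgn (β i * β k) • φ fun x => a x)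
    rw [h1, h2, smul_smul, smul_smul, ← neg_smul]
    congr 1
    have : sgn (β i * β k) * sgn (β i + β k) * sgn ((β i - 1) * (β k - 1)) = -1 := by
      rw [← sgn_add, ← sgn_add, ← sgn_one]
      exact sgn_congr (by simp only [parity_simps]; grind)
    linear_combination dsgn (l ++ ⟨β k, a k, ha k⟩ :: ⟨β i, a i, ha i⟩ :: t) * this
  leibniz β a ha i hi p b c hb := by
    refine M.linear_ext (f := φ.toLinearMap a i ∘ₗ LinearMap.mulLeft ℝ b)
      (g := LinearMap.mulLeft ℝ (φ (Function.update a i b)) +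
        sgn ((2 - n + ∑ j ∈ Finset.univ.erase i, β j) * p) •
          (LinearMap.mulLeft ℝ b ∘ₗ φ.toLinearMap a i)) (fun q c hc' => ?_) c
    simp only [LinearMap.comp_apply, LinearMap.mulLeft_apply, MultilinearMap.toLinearMap_apply,
      LinearMap.add_apply, LinearMap.smul_apply]
    obtain ⟨f, hf⟩ : ∃ f : Fin n → Hom 𝒜, ∀ i, f i = ⟨β i, a i, ha i⟩ := ⟨_, fun _ => rfl⟩
    obtain ⟨t, ht, e⟩ := exists_ofFn_concat f i hi
    have hu : ∀ x : Hom 𝒜, φ (Function.update a i x.val) = dsgn (t ++ [x]) • ψ (t ++ [x]) := by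
      intro x
      rw [← e x, ← hc]
      congr 1
      funext k
      by_cases hk : k = i
      · subst hk; simp
      · simp [hk, hf]
    have hs : bsum t = ∑ j ∈ Finset.univ.erase i, β j - n + 1 := by
      have h1 := bsum_ofFn f
      have h4 := e (f i)
      rw [Function.update_eq_self] at h4
      rw [h4, bsum_append] at h1
      simp only [bsum, hf] at h1
      rw [← Finset.add_sum_erase _ _ (Finset.mem_univ i)] at h1
      linarith
    have hbc := M.mul_mem _ _ _ _ hb hc'
    have h3 := hu ⟨_, _, hbc⟩
    simp only at h3
    rw [h3, M.smd_last h t ⟨p, b, hb⟩ ⟨q, c, hc'⟩ hbc, hu ⟨p, b, hb⟩, hu ⟨q, c, hc'⟩,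
      dsgn_concat t ⟨q, c, hc'⟩ ⟨p, b, hb⟩, dsgn_concat t ⟨p + q, b * c, hbc⟩ ⟨p, b, hb⟩, smul_add]
    congr 1
    · rw [smul_mul_assoc]
    · rw [mul_smul_comm, smul_comm, hs]
      congr 3; ring

lemma symm_smd (M : Model B O A 𝒜 S L κ η) (φ : ∀ n, MultilinearMap ℝ (fun _ : Fin n => A) A)
    (h : ∀ n, IsMultiDer 𝒜 (φ n)) : SMD 𝒜 1 (symm φ) := by
  have hm : ∀ l, symm φ l ∈ 𝒜 (1 + 1 + bsum l) := fun l => by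
    rw [← List.ofFn_get l, symm_ofFn]
    refine Submodule.smul_mem _ _ (deg_cast ((h _).degree (fun i => (l.get i).deg) _
      fun i => (l.get i).mem) ?_)
    rw [bsum_ofFn]; ring
  refine ⟨hm, symm_swap φ h, symm_add φ, symm_smul φ, fun b c hbc t => ?_⟩
  have mv := fun x => move_of_swap (symm_swap φ h) t x []
  have mv' : ∀ x : Hom 𝒜, symm φ (x :: t) = sgn ((x.deg - 1) * bsum t) • symm φ (t ++ [x]) := by
    intro x
    rw [mv, sgn_smul_smul, List.append_nil, sgn_of_even ⟨_, rfl⟩, one_smul]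
  rw [mv' ⟨_, _, hbc⟩, symm_last φ h t b c hbc, mv, mv, List.append_nil, smul_mul_assoc,
    M.comm _ _ _ _ (hm (b :: t)) c.mem]
  simp only [smul_add, sgn_smul_smul, mul_smul_comm]
  rw [add_comm]
  congr 2
  · exact sgn_congr (by simp only [parity_simps]; grind)
  · exact sgn_congr (by simp only [bsum]; simp only [parity_simps]; grind)

lemma multi_ext (M : Model B O A 𝒜 S L κ η) {n : ℕ} {φ φ' : MultilinearMap ℝ (fun _ : Fin n => A) A}
    (h : ∀ f : Fin n → Hom 𝒜, φ (fun i => (f i).val) = φ' fun i => (f i).val) : φ = φ' := by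
  ext a
  choose c hc ha using M.decomp
  have e : a = fun i => ∑ k ∈ Finset.range (M.bd + 1), c (a i) k := funext fun i => ha (a i)
  rw [e, MultilinearMap.map_sum_finset, MultilinearMap.map_sum_finset]
  exact Finset.sum_congr rfl fun r _ => h fun i => ⟨_, _, hc (a i) (r i)⟩

lemma eq_of_corr (M : Model B O A 𝒜 S L κ η) {n : ℕ}
    {φ φ' : MultilinearMap ℝ (fun _ : Fin n => A) A} {ψ ψ' : List (Hom 𝒜) → A} (h : Corr φ ψ)
    (h' : Corr φ' ψ') (e : ∀ l : List (Hom 𝒜), l.length = n → ψ l = ψ' l) : φ = φ' :=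
  M.multi_ext fun f => by rw [h, h', e _ (List.length_ofFn)]

/-- Multiplication of the values of a multilinear map. -/
def mulMulti {n : ℕ} (G : MultilinearMap ℝ (fun _ : Fin n => A) A) :
    A →ₗ[ℝ] MultilinearMap ℝ (fun _ : Fin n => A) A where
  toFun x := (LinearMap.mulLeft ℝ x).compMultilinearMap G
  map_add' x y := by ext; simp [add_mul]
  map_smul' r x := by ext; simp

/-- The Fourier transform of a `k`-vector field, in `n` arguments. -/
def F : ∀ (n k : ℕ), (List O → O) → MultilinearMap ℝ (fun _ : Fin n => A) A
  | 0, k, Q => MultilinearMap.constOfIsEmpty ℝ _ (M.P k Q)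
  | n + 1, k, Q => (sgn (n + k) • (∑ μ, mulMulti (F n k (M.Le μ Q)) ∘ₗ M.ι μ ∘ₗ (M.σ ^ (n + k)))
      + prev k fun k' => sgn (n + k) • ∑ i, mulMulti (F n k' (M.Ix i Q)) ∘ₗ M.δ i ∘ₗ
          (M.σ ^ (n + k + 1))).uncurryLeft

lemma F_corr (n k : ℕ) (Q : List O → O) : Corr (M.F n k Q) fun l => M.om l k Q := by
  induction n generalizing k Q with
  | zero => intro h; simp [F, dsgn, om_nil]
  | succ n ih =>
    intro h
    rw [List.ofFn_succ]
    simp only [F, LinearMap.uncurryLeft_apply, om_cons, dsgn, List.length_ofFn, smul_add]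
    have ih' := fun k Q => ih k Q fun i => h i.succ
    have e2 : ∀ (x : A) (k : ℕ) (Q : List O → O),
        mulMulti (M.F n k Q) x (Fin.tail fun i => (h i).val) =
        dsgn (List.ofFn fun i => h i.succ) • (x * M.om (List.ofFn fun i => h i.succ) k Q) :=
      fun x k Q => by
        simp only [mulMulti, LinearMap.coe_mk, AddHom.coe_mk,
          LinearMap.compMultilinearMap_apply, LinearMap.mulLeft_apply]
        rw [← mul_smul_comm, ← ih']; rfl
    rw [LinearMap.add_apply, add_apply]
    congr 1
    · simp only [LinearMap.smul_apply, LinearMap.sum_apply, LinearMap.comp_apply,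
        M.σ_pow_apply _ _ _ (h 0).mem, smul_apply, map_smul, sum_apply, e2, ← Finset.smul_sum,
        smul_smul]
      congr 1
      rw [← sgn_add, mul_right_comm, ← sgn_add, mul_comm, mul_comm _ (dsgn _)]
      congr 1
      exact sgn_congr (by push_cast; simp only [parity_simps]; grind)
    · cases k with
      | zero => simp
      | succ k =>
        simp only [prev_succ, LinearMap.smul_apply, LinearMap.sum_apply, LinearMap.comp_apply,
          M.σ_pow_apply _ _ _ (h 0).mem, smul_apply, map_smul, sum_apply, e2, ← Finset.smul_sum, smul_smul]
        congr 1
        rw [← sgn_add, mul_right_comm, ← sgn_add, mul_comm, mul_comm _ (dsgn _)]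
        congr 1
        exact sgn_congr (by push_cast; simp only [parity_simps]; grind)

lemma F_isMultiDer (n : ℕ) (Q : List O → O) (hQ : IsMV 2 Q) : IsMultiDer 𝒜 (M.F n 2 Q) :=
  M.isMultiDer_of_corr (by simpa using M.om_smd 2 Q hQ) (M.F_corr n 2 Q)

end Model

namespace Model

variable {B O A : Type*} [CommRing B] [Algebra ℝ B] [CommRing O] [Algebra ℝ O]
  [Ring A] [Algebra ℝ A] {𝒜 : ℤ → Submodule ℝ A} {S L κ η : Type*} [Fintype κ] [Fintype η]
  (M : Model B O A 𝒜 S L κ η)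

/-! ### Expansion of multiderivations in the frames -/

lemma tightA (m : ℤ) (D : B →ₗ[ℝ] A) (hm : ∀ f, D f ∈ 𝒜 m)
    (hD : ∀ f g, D (f * g) = M.j f * D g + M.j g * D f) (f : B) :
    D f = ∑ i, M.j (M.dB i f) * D (M.x i) := by
  rcases lt_or_ge m 0 with hi | hi
  · have : ∀ f, D f = 0 := fun f => M.neg_eq m _ hi (hm f)
    simp [this]
  obtain ⟨n, rfl⟩ := Int.eq_ofNat_of_zero_le hi
  clear hi
  induction n generalizing D with
  | zero =>
    let D' : Derivation ℝ B B := Derivation.mk' (M.ε ∘ₗ D) fun f g => by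
      simp only [LinearMap.comp_apply, hD, map_add, M.ε_mul, smul_eq_mul]
    have h1 := congrArg M.j (M.tightB D' f)
    have h2 : ∀ f, M.j (D' f) = D f := fun f => M.j_ε _ (hm f)
    simpa only [map_sum, map_mul, h2] using h1
  | succ n ih =>
    apply M.eq_of_con (hm f)
    · exact Submodule.sum_mem _ fun i _ =>
        deg_cast (M.mul_mem 0 _ _ _ (M.j_mem _) (hm _)) (by ring)
    intro w
    have h1 : ∀ f, (M.con w ∘ₗ D) f ∈ 𝒜 (n : ℤ) := fun f =>
      deg_cast (M.con_mem w _ _ (hm f)) (by push_cast; ring)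
    have := ih (M.con w ∘ₗ D)
      (fun f g => by simp only [LinearMap.comp_apply, hD, map_add, M.con_j_mul]) h1
    simpa only [map_sum, M.con_j_mul, LinearMap.comp_apply] using this

lemma smd_hj {d : ℤ} {ψ : List (Hom 𝒜) → A} (h : SMD 𝒜 d ψ) (f : B) (t : List (Hom 𝒜)) :
    ψ (M.hj f :: t) = ∑ i, M.j (M.dB i f) * ψ (M.hj (M.x i) :: t) := by
  have e0 : ∀ f (a : A) (ha : a ∈ 𝒜 0), a = M.j f → ψ (⟨0, a, ha⟩ :: t) = ψ (M.hj f :: t) := by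
    rintro f a ha rfl; rfl
  refine M.tightA (d + 1 + (-1 + bsum t))
    { toFun := fun f => ψ (M.hj f :: t)
      map_add' := fun f g => by
        exact (e0 _ _ _ (map_add _ _ _).symm).symm.trans
          (h.add 0 _ _ (M.j_mem f) (M.j_mem g) (add_mem (M.j_mem f) (M.j_mem g)) t)
      map_smul' := fun c f => by
        exact (e0 _ _ _ (map_smul _ _ _).symm).symm.trans
          (h.smul 0 c _ (M.j_mem f) (Submodule.smul_mem _ _ (M.j_mem f)) t) }
    (fun f => deg_cast (h.mem _) (by simp [bsum, hj])) (fun f g => ?_) f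
  change ψ (M.hj (f * g) :: t) = M.j f * ψ (M.hj g :: t) + M.j g * ψ (M.hj f :: t)
  have h1 := h.mul (M.hj f) (M.hj g) (M.mul_mem _ _ _ _ (M.j_mem f) (M.j_mem g)) t
  simp only [hj, mul_zero, add_zero, sgn_zero, one_smul] at h1
  rw [← e0 _ _ (add_zero (0 : ℤ) ▸ M.mul_mem _ _ _ _ (M.j_mem f) (M.j_mem g)) (map_mul _ _ _).symm]
  exact h1

lemma smd_sum {d : ℤ} {ψ : List (Hom 𝒜) → A} (h : SMD 𝒜 d ψ) {ξ : Type*} (s : Finset ξ)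
    (i : ℤ) (a : ξ → A) (ha : ∀ x, a x ∈ 𝒜 i) (t : List (Hom 𝒜)) (y : A) (hy : y ∈ 𝒜 i)
    (e : y = ∑ x ∈ s, a x) : ψ (⟨i, y, hy⟩ :: t) = ∑ x ∈ s, ψ (⟨i, a x, ha x⟩ :: t) := by
  classical
  induction s using Finset.induction_on generalizing y with
  | empty =>
    obtain rfl : y = (0 : ℝ) • 0 := by simpa using e
    rw [h.smul i 0 0 (zero_mem _)]; simp
  | insert x s hx ih =>
    have h1 := Submodule.sum_mem (𝒜 i) (fun x (_ : x ∈ s) => ha x)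
    obtain rfl : y = a x + ∑ x ∈ s, a x := by rw [e, Finset.sum_insert hx]
    rw [Finset.sum_insert hx, ← ih _ h1 rfl, ← h.add]

lemma smd_hs {d : ℤ} {ψ : List (Hom 𝒜) → A} (h : SMD 𝒜 d ψ) (v : S) (t : List (Hom 𝒜)) :
    ψ (M.hs v :: t) = ∑ μ, M.j (M.pair (M.u μ) v) * ψ (M.hs (M.e μ) :: t) +
      sgn d • ∑ i, M.δ i (M.sec v) * ψ (M.hj (M.x i) :: t) := by
  have hm : ∀ μ, M.j (M.pair (M.u μ) v) * M.E μ ∈ 𝒜 1 := fun μ =>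
    deg_cast (M.mul_mem 0 1 _ _ (M.j_mem _) (M.sec_mem _)) (by ring)
  have h1 : ψ (M.hs v :: t) = ∑ μ, ψ (⟨1, _, hm μ⟩ :: t) :=
    smd_sum h Finset.univ 1 _ hm t _ (M.sec_mem v) (M.sec_eq v)
  have h3 : ∀ μ, ψ (⟨1, _, hm μ⟩ :: t) = M.j (M.pair (M.u μ) v) * ψ (M.hs (M.e μ) :: t) +
      sgn d • (M.E μ * ψ (M.hj (M.pair (M.u μ) v) :: t)) := fun μ => by
    have := h.mul (M.hj (M.pair (M.u μ) v)) (M.hs (M.e μ))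
      (M.mul_mem _ _ _ _ (M.j_mem _) (M.sec_mem _)) t
    simp only [hj, hs, mul_zero, add_zero, mul_one, sgn_zero, one_smul] at this
    simp only [hj, hs]
    rw [← this]
    congr 2
  rw [h1, Finset.sum_congr rfl fun μ _ => h3 μ, Finset.sum_add_distrib, ← Finset.smul_sum]
  congr 2
  have h4 : ∀ μ, M.E μ * ψ (M.hj (M.pair (M.u μ) v) :: t) = ∑ i,
      M.E μ * M.j (M.dB i (M.pair (M.u μ) v)) * ψ (M.hj (M.x i) :: t) := fun μ => by
    rw [M.smd_hj h, Finset.mul_sum]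
    exact Finset.sum_congr rfl fun i _ => by rw [mul_assoc]
  rw [Finset.sum_congr rfl fun μ _ => h4 μ, Finset.sum_comm]
  exact Finset.sum_congr rfl fun i _ => by rw [M.δ_sec, Finset.sum_mul]

/-! ### Multivector fields with given Fourier transform -/

/-- A function as a multivector field of degree zero. -/
def X0lin : O →ₗ[ℝ] (List O → O) where
  toFun := X0
  map_add' := X0_add
  map_smul' c h := by rw [Algebra.smul_def, X0_smul]; funext l; simp [Algebra.smul_def]

/-- The vertical multivector field, constant along the fibres, attached to an element of `A`. -/
def V : ℕ → A →ₗ[ℝ] (List O → O)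
  | 0 => X0lin ∘ₗ M.p.toLinearMap ∘ₗ M.ε
  | k + 1 => ((k : ℝ) + 1)⁻¹ • ∑ μ, wd (M.vert (M.e μ)) ∘ₗ V k ∘ₗ M.ι μ

lemma V_zero (a : A) : M.V 0 a = X0 (M.p (M.ε a)) := rfl

lemma V_succ (k : ℕ) (a : A) :
    M.V (k + 1) a = ((k : ℝ) + 1)⁻¹ • ∑ μ, wd (M.vert (M.e μ)) (M.V k (M.ι μ a)) := by
  simp [V]

lemma V_isMV (k : ℕ) (a : A) : IsMV k (M.V k a) := by
  induction k generalizing a with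
  | zero => exact isMV_X0 _
  | succ k ih =>
    rw [V_succ]
    exact (isMV_sum _ _ fun μ _ => (ih _).wd _).real_smul _

lemma V_j_mul (k : ℕ) (f : B) (a : A) : M.V k (M.j f * a) = M.p f • M.V k a := by
  induction k generalizing a with
  | zero => rw [V_zero, V_zero, M.ε_mul, map_mul, X0_smul]
  | succ k ih =>
    simp only [V_succ, M.con_j_mul, ih, wd_mul, ← Finset.smul_sum]
    rw [smul_comm]

lemma der_sum_apply {ξ : Type*} (s : Finset ξ) (D : ξ → Derivation ℝ O O) (h : O) :
    (∑ x ∈ s, D x) h = ∑ x ∈ s, D x h := by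
  classical
  induction s using Finset.induction_on with
  | empty => simp
  | insert x s hx ih => rw [Finset.sum_insert hx, Finset.sum_insert hx, Derivation.add_apply, ih]

lemma wd_vert (s : S) (Q : List O → O) :
    wd (M.vert s) Q = ∑ μ, M.p (M.pair (M.u μ) s) • wd (M.vert (M.e μ)) Q := by
  have : M.vert s = ∑ μ, M.p (M.pair (M.u μ) s) • M.vert (M.e μ) := by
    ext h
    rw [M.vert_eq, der_sum_apply]; rfl
  rw [this, wd_sum_left]
  exact Finset.sum_congr rfl fun μ _ => wd_smul_left _ _ _

lemma V_sec_mul (k : ℕ) (s : S) (a : A) (ha : a ∈ 𝒜 (k : ℤ)) :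
    M.V (k + 1) (M.sec s * a) = wd (M.vert s) (M.V k a) := by
  induction k generalizing a with
  | zero =>
    have : ∀ μ, M.ι μ a = 0 := fun μ => by rw [← M.j_ε a ha, M.con_j]
    simp only [V_succ, M.con_sec_mul, this, mul_zero, sub_zero, M.V_j_mul, wd_mul]
    rw [M.wd_vert s]; simp
  | succ k ih =>
    have h1 : ∀ μ, wd (M.vert (M.e μ)) (M.V (k + 1) (M.ι μ (M.sec s * a))) =
        M.p (M.pair (M.u μ) s) • wd (M.vert (M.e μ)) (M.V (k + 1) a) +
          wd (M.vert s) (wd (M.vert (M.e μ)) (M.V k (M.ι μ a))) := fun μ => by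
      rw [M.con_sec_mul, map_sub, map_sub, ih _ (M.ι_mem ha μ), M.V_j_mul, wd_mul,
        wd_anti (M.vert (M.e μ)), sub_neg_eq_add]
    rw [V_succ, Finset.sum_congr rfl fun μ _ => h1 μ, Finset.sum_add_distrib, ← M.wd_vert,
      ← map_sum]
    have h2 : ∑ μ, wd (M.vert (M.e μ)) (M.V k (M.ι μ a)) = ((k : ℝ) + 1) • M.V (k + 1) a := by
      rw [V_succ, smul_smul, mul_inv_cancel₀ (by positivity), one_smul]
    rw [h2, map_smul, ← one_smul ℝ (wd (M.vert s) (M.V (k + 1) a)), smul_smul, ← add_smul, smul_smul]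
    have : ((((k + 1 : ℕ) : ℝ) + 1)⁻¹ * (1 + ((k : ℝ) + 1) * 1)) = 1 := by
      push_cast; field_simp; ring
    rw [this]

lemma ins_p_V (k : ℕ) (f : B) (a : A) : ins (M.p f) (M.V k a) = 0 := by
  induction k generalizing a with
  | zero => exact isMV_X0 _ _
  | succ k ih =>
    rw [V_succ, map_smul, map_sum]
    simp [ins_wd, M.vert_p, ih]

lemma lie_V (k : ℕ) (v : S) (a : A) : lie (M.vert v) (M.V k a) = 0 := by
  induction k generalizing a with
  | zero =>
    funext l
    rcases l with _ | ⟨z, l⟩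
    · simp [lie_nil, V_zero, X0, M.vert_p]
    · have h := isMV_X0 (M.p (M.ε a))
      have h1 : ins z (M.V 0 a) = 0 := h z
      have h2 : ins (M.vert v z) (M.V 0 a) = 0 := h _
      have h3 := congrFun h2 l
      rw [ins_apply] at h3
      rw [lie_cons, h1, h3]; simp
  | succ k ih =>
    rw [V_succ, map_smul, map_sum]
    have : ∀ μ, ⁅M.vert v, M.vert (M.e μ)⁆ = 0 := fun μ => by
      ext h; rw [Derivation.commutator_apply, M.vert_comm, sub_self]; rfl
    simp [lie_wd, this, wd_zero_left, ih]

lemma P_V (k : ℕ) (a : A) (ha : a ∈ 𝒜 (k : ℤ)) : M.P k (M.V k a) = a := by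
  induction k generalizing a with
  | zero => rw [P_zero, V_zero]; simp only [X0, M.r_p, M.j_ε a ha]
  | succ k ih =>
    rw [V_succ, map_smul, map_sum]
    conv_rhs => rw [M.eq_smul_euler ha]
    congr 1
    exact Finset.sum_congr rfl fun μ _ => by
      rw [M.P_wd_vert _ _ (M.V_isMV _ _), ih _ (M.ι_mem ha μ)]

/-- Insertion of a first argument. -/
def insA (a : Hom 𝒜) : (List (Hom 𝒜) → A) →ₗ[ℝ] (List (Hom 𝒜) → A) where
  toFun ψ t := ψ (a :: t)
  map_add' _ _ := rfl
  map_smul' _ _ := rfl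

lemma insA_apply (a : Hom 𝒜) (ψ : List (Hom 𝒜) → A) (t : List (Hom 𝒜)) :
    insA a ψ t = ψ (a :: t) := rfl

/-- Multiplication by a function. -/
def mulO (h : O) : (List O → O) →ₗ[ℝ] (List O → O) where
  toFun R := h • R
  map_add' _ _ := smul_add _ _ _
  map_smul' _ _ := smul_comm _ _ _

/-- A `k`-vector field, homogeneous of degree `n` along the fibres, whose Fourier transform is a
given multiderivation. -/
def R : ℕ → ℕ → (List (Hom 𝒜) → A) →ₗ[ℝ] (List O → O)
  | 0, k => M.V k ∘ₗ LinearMap.proj []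
  | n + 1, k => ((n : ℝ) + 1)⁻¹ • ((∑ μ, mulO (M.lin (M.u μ)) ∘ₗ
      R n k ∘ₗ insA (M.hs (M.e μ))) + sgn k • prev k fun k' =>
        ∑ i, wd (M.dO i) ∘ₗ R n k' ∘ₗ insA (M.hj (M.x i)))

lemma R_zero (k : ℕ) (ψ : List (Hom 𝒜) → A) : M.R 0 k ψ = M.V k (ψ []) := rfl

lemma R_succ (n k : ℕ) (ψ : List (Hom 𝒜) → A) : M.R (n + 1) k ψ = ((n : ℝ) + 1)⁻¹ •
    ((∑ μ, M.lin (M.u μ) • M.R n k (insA (M.hs (M.e μ)) ψ)) + sgn k • prev k fun k' =>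
        ∑ i, wd (M.dO i) (M.R n k' (insA (M.hj (M.x i)) ψ))) := by
  cases k <;> simp [R, mulO]

lemma R_isMV (n k : ℕ) (ψ : List (Hom 𝒜) → A) : IsMV k (M.R n k ψ) := by
  induction n generalizing k ψ with
  | zero => exact M.V_isMV _ _
  | succ n ih =>
    rw [R_succ]
    refine ((isMV_sum _ _ fun μ _ => (ih _ _).smul _).add (IsMV.real_smul ?_ _)).real_smul _
    cases k with
    | zero => exact isMV_zero _
    | succ k => exact isMV_sum _ _ fun i _ => (ih _ _).wd _

lemma R_j_mul (n k : ℕ) (f : B) (ψ : List (Hom 𝒜) → A) :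
    M.R n k (fun t => M.j f * ψ t) = M.p f • M.R n k ψ := by
  induction n generalizing k ψ with
  | zero => exact M.V_j_mul _ _ _
  | succ n ih =>
    have h1 : ∀ k a, M.R n k (insA a fun t => M.j f * ψ t) = M.p f • M.R n k (insA a ψ) :=
      fun k a => ih k _
    have h2 : ∀ μ, M.lin (M.u μ) • M.p f • M.R n k (insA (M.hs (M.e μ)) ψ) =
        M.p f • M.lin (M.u μ) • M.R n k (insA (M.hs (M.e μ)) ψ) := fun μ => smul_comm _ _ _
    simp only [R_succ, h1, wd_mul, h2]
    rw [smul_comm (M.p f)]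
    congr 1
    rw [smul_add, Finset.smul_sum]
    congr 1
    rw [smul_comm (M.p f)]
    congr 1
    cases k <;> simp [Finset.smul_sum]

lemma smd_hs_ins {d : ℤ} {ψ : List (Hom 𝒜) → A} (h : SMD 𝒜 d ψ) (v : S) :
    SMD 𝒜 d (insA (M.hs v) ψ) := by
  have h1 : SMD 𝒜 (d + ((M.hs v).deg - 1)) (insA (M.hs v) ψ) := h.ins _
  have e : d + ((M.hs v).deg - 1) = d := by simp [hs]
  rwa [e] at h1

lemma smd_hj_ins {d : ℤ} {ψ : List (Hom 𝒜) → A} (h : SMD 𝒜 d ψ) (f : B) :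
    SMD 𝒜 (d - 1) (insA (M.hj f) ψ) := by
  have h1 : SMD 𝒜 (d + ((M.hj f).deg - 1)) (insA (M.hj f) ψ) := h.ins _
  have e : d + ((M.hj f).deg - 1) = d - 1 := by simp [hj]; ring
  rwa [e] at h1

lemma smd_hj_zero {ψ : List (Hom 𝒜) → A} (h : SMD 𝒜 (-1) ψ) (f : B) :
    insA (M.hj f) ψ = 0 :=
  funext fun l => M.smd_eq_zero_of_neg (by norm_num) (M.smd_hj_ins h f) l

lemma R_sec_mul (n k : ℕ) (s : S) (ψ : List (Hom 𝒜) → A) (h : SMD 𝒜 (k - 1) ψ) :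
    M.R n (k + 1) (fun t => M.sec s * ψ t) = wd (M.vert s) (M.R n k ψ) := by
  induction n generalizing k ψ with
  | zero => exact M.V_sec_mul _ _ _ (deg_cast (h.mem []) (by simp [bsum]))
  | succ n ih =>
    have h1 : ∀ v, M.R n (k + 1) (insA (M.hs v) fun t => M.sec s * ψ t) =
        wd (M.vert s) (M.R n k (insA (M.hs v) ψ)) := fun v => ih k _ (M.smd_hs_ins h v)
    have h2 : ∀ i, wd (M.dO i) (M.R n k (insA (M.hj (M.x i)) fun t => M.sec s * ψ t)) =
        -wd (M.vert s) (prev k fun k' => wd (M.dO i) (M.R n k' (insA (M.hj (M.x i)) ψ))) := by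
      intro i
      cases k with
      | zero =>
        have : insA (M.hj (M.x i)) (fun t => M.sec s * ψ t) = 0 := by
          funext t
          have := congrFun (M.smd_hj_zero (by simpa using h) (M.x i)) t
          rw [insA_apply] at this ⊢
          rw [this]; simp
        simp [this]
      | succ k =>
        rw [prev_succ, ← wd_anti, ← ih k _ (by simpa using M.smd_hj_ins h (M.x i))]
        rfl
    simp only [R_succ, h1, prev_succ, h2, map_smul, map_add, map_sum, wd_mul,
      Finset.sum_neg_distrib, smul_neg, neg_smul_sgn]
    congr 3
    · exact sgn_congr (by push_cast; simp only [parity_simps]; grind)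
    · cases k <;> simp

lemma vert_bracket (v s : S) (i : η) (h : M.sec s = M.δ i (M.sec v)) :
    ⁅M.vert v, M.dO i⁆ = -M.vert s := by
  have hp : ∀ f, ⁅M.vert v, M.dO i⁆ (M.p f) = 0 := fun f => by
    rw [Derivation.commutator_apply, M.dO_p, M.vert_p, M.vert_p]; simp
  have hl : ∀ w, ⁅M.vert v, M.dO i⁆ (M.lin w) = -M.p (M.pair w s) := fun w => by
    rw [Derivation.commutator_apply, M.vert_lin, M.dO_lin, M.dO_p, map_sum]
    have h1 : M.pair w s = M.dB i (M.pair w v) -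
        ∑ μ, M.pair (M.u μ) v * M.dB i (M.pair w (M.e μ)) := by
      apply M.j_injective
      rw [← M.con_sec, h, M.con_δ_sec]
      simp
    rw [h1]
    simp only [Derivation.leibniz, M.vert_p, M.vert_lin, smul_eq_mul, mul_zero, add_zero, map_sub,
      map_sum, map_mul]
    rw [neg_sub]
    congr 1
    exact Finset.sum_congr rfl fun μ _ => mul_comm _ _
  ext h
  rw [M.tightO, M.tightO (-M.vert s)]
  simp [hp, hl, M.vert_p, M.vert_lin]

lemma R_hs (n k : ℕ) (v : S) (ψ : List (Hom 𝒜) → A) (h : SMD 𝒜 (k - 1) ψ) :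
    (∑ μ, M.p (M.pair (M.u μ) v) • M.R n k (insA (M.hs (M.e μ)) ψ)) + sgn k • prev k (fun k' =>
      ∑ i, wd ⁅M.vert v, M.dO i⁆ (M.R n k' (insA (M.hj (M.x i)) ψ))) =
    M.R n k (insA (M.hs v) ψ) := by
  choose s hs using fun i => M.sec_surj _ (M.δ_mem i 1 _ (M.sec_mem v))
  have h1 : insA (M.hs v) ψ = (∑ μ, fun t => M.j (M.pair (M.u μ) v) * insA (M.hs (M.e μ)) ψ t) +
      sgn (k - 1) • ∑ i, fun t => M.sec (s i) * insA (M.hj (M.x i)) ψ t := by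
    funext t
    rw [insA_apply, M.smd_hs h v t]
    simp [Finset.sum_apply, insA_apply, hs]
  rw [h1, map_add, map_sum, map_smul, map_sum]
  simp only [M.R_j_mul]
  congr 1
  cases k with
  | zero =>
    have : ∀ i, (fun t => M.sec (s i) * insA (M.hj (M.x i)) ψ t) = 0 := fun i => by
      rw [M.smd_hj_zero (by simpa using h)]; funext t; simp
    simp [this]
  | succ k =>
    have h2 : ∀ i, M.R n (k + 1) (fun t => M.sec (s i) * insA (M.hj (M.x i)) ψ t) =
        wd (M.vert (s i)) (M.R n k (insA (M.hj (M.x i)) ψ)) := fun i =>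
      M.R_sec_mul n k _ _ (by simpa using M.smd_hj_ins h (M.x i))
    simp only [h2, prev_succ, fun i => M.vert_bracket v (s i) i (hs i), wd_neg_left,
      Finset.sum_neg_distrib, smul_neg, neg_smul_sgn]
    congr 1
    exact sgn_congr (by push_cast; simp only [parity_simps])

lemma insA_comm {d : ℤ} {ψ : List (Hom 𝒜) → A} (h : SMD 𝒜 d ψ) (a b : Hom 𝒜) :
    insA a (insA b ψ) = sgn ((a.deg - 1) * (b.deg - 1)) • insA b (insA a ψ) := by
  funext t
  have := h.swap_head b a t
  rw [mul_comm] at this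
  exact this

lemma lie_R (n k : ℕ) (v : S) (ψ : List (Hom 𝒜) → A) (h : SMD 𝒜 (k - 1) ψ) :
    lie (M.vert v) (M.R (n + 1) k ψ) = M.R n k (insA (M.hs v) ψ) := by
  have key : ∀ (n k : ℕ) (ψ : List (Hom 𝒜) → A) (c : List O → O), SMD 𝒜 (k - 1) ψ →
      ((∑ μ, M.lin (M.u μ) • lie (M.vert v) (M.R n k (insA (M.hs (M.e μ)) ψ))) +
        sgn k • prev k fun k' => ∑ i, wd (M.dO i)
          (lie (M.vert v) (M.R n k' (insA (M.hj (M.x i)) ψ)))) =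
        (n : ℝ) • M.R n k (insA (M.hs v) ψ) →
      lie (M.vert v) (M.R (n + 1) k ψ) = M.R n k (insA (M.hs v) ψ) := by
    intro n k ψ _ h hc
    have h1 : lie (M.vert v) (M.R (n + 1) k ψ) = ((n : ℝ) + 1)⁻¹ •
        (M.R n k (insA (M.hs v) ψ) + (n : ℝ) • M.R n k (insA (M.hs v) ψ)) := by
      conv_rhs => rw [← hc, ← M.R_hs n k v ψ h]
      rw [R_succ, map_smul, map_add, map_sum, map_smul]
      congr 1
      simp only [lie_mul, M.vert_lin, Finset.sum_add_distrib]
      have h2 : lie (M.vert v) (prev k fun k' =>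
          ∑ i, wd (M.dO i) (M.R n k' (insA (M.hj (M.x i)) ψ))) =
          (prev k fun k' => ∑ i, wd ⁅M.vert v, M.dO i⁆ (M.R n k' (insA (M.hj (M.x i)) ψ))) +
          (prev k fun k' => ∑ i, wd (M.dO i)
            (lie (M.vert v) (M.R n k' (insA (M.hj (M.x i)) ψ)))) := by
        cases k <;> simp [lie_wd, Finset.sum_add_distrib]
      rw [h2, smul_add]
      abel
    rw [h1]
    have : M.R n k (insA (M.hs v) ψ) + (n : ℝ) • M.R n k (insA (M.hs v) ψ) =
        ((n : ℝ) + 1) • M.R n k (insA (M.hs v) ψ) := by rw [add_smul, one_smul, add_comm]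
    rw [this, smul_smul, inv_mul_cancel₀ (by positivity), one_smul]
  induction n generalizing k ψ with
  | zero =>
    refine key 0 k ψ 0 h ?_
    simp only [R_zero, M.lie_V]
    cases k <;> simp
  | succ n ih =>
    refine key (n + 1) k ψ 0 h ?_
    conv_rhs => rw [R_succ, smul_smul]
    have : (((n + 1 : ℕ) : ℝ) * ((n : ℝ) + 1)⁻¹) = 1 := by
      push_cast; exact mul_inv_cancel₀ (by positivity)
    rw [this, one_smul]
    congr 1
    · refine Finset.sum_congr rfl fun μ _ => ?_
      rw [ih k _ (M.smd_hs_ins h _), insA_comm h]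
      simp [hs]
    · cases k with
      | zero => simp
      | succ k =>
        simp only [prev_succ]
        congr 1
        refine Finset.sum_congr rfl fun i _ => ?_
        rw [ih k _ (by simpa using M.smd_hj_ins h _), insA_comm h]
        simp [hs]

lemma ins_p_R (n k : ℕ) (f : B) (ψ : List (Hom 𝒜) → A) (h : SMD 𝒜 k ψ) :
    ins (M.p f) (M.R (n + 1) (k + 1) ψ) = sgn (k + 1) • M.R n k (insA (M.hj f) ψ) := by
  have key : ∀ (n k : ℕ) (ψ : List (Hom 𝒜) → A), SMD 𝒜 k ψ →
      (∑ μ, M.lin (M.u μ) • ins (M.p f) (M.R n (k + 1) (insA (M.hs (M.e μ)) ψ))) -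
        sgn (k + 1) • (∑ i, wd (M.dO i) (ins (M.p f) (M.R n k (insA (M.hj (M.x i)) ψ)))) =
        (n : ℝ) • sgn (k + 1) • M.R n k (insA (M.hj f) ψ) →
      ins (M.p f) (M.R (n + 1) (k + 1) ψ) = sgn (k + 1) • M.R n k (insA (M.hj f) ψ) := by
    intro n k ψ h hc
    have h0 : M.R n k (insA (M.hj f) ψ) =
        ∑ i, M.p (M.dB i f) • M.R n k (insA (M.hj (M.x i)) ψ) := by
      simp only [← M.R_j_mul, ← map_sum]
      congr 1
      funext t
      rw [Finset.sum_apply]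
      exact M.smd_hj h f t
    have h1 : ins (M.p f) (M.R (n + 1) (k + 1) ψ) = ((n : ℝ) + 1)⁻¹ •
        (sgn (k + 1) • M.R n k (insA (M.hj f) ψ) +
          (n : ℝ) • sgn (k + 1) • M.R n k (insA (M.hj f) ψ)) := by
      rw [← hc, h0, R_succ, map_smul, map_add, map_sum, map_smul, prev_succ, map_sum]
      congr 1
      simp only [ins_wd, M.dO_p, Finset.sum_sub_distrib, smul_sub, ins_smul]
      push_cast
      abel
    rw [h1]
    have : ∀ Q : List O → O, Q + (n : ℝ) • Q = ((n : ℝ) + 1) • Q := fun Q => by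
      rw [add_smul, one_smul, add_comm]
    rw [this, smul_smul, inv_mul_cancel₀ (by positivity), one_smul]
  induction n generalizing k ψ with
  | zero =>
    refine key 0 k ψ h ?_
    simp [R_zero, M.ins_p_V]
  | succ n ih =>
    refine key (n + 1) k ψ h ?_
    conv_rhs => rw [R_succ, smul_comm, smul_smul (((n + 1 : ℕ) : ℝ))]
    have : (((n + 1 : ℕ) : ℝ) * ((n : ℝ) + 1)⁻¹) = 1 := by
      push_cast; exact mul_inv_cancel₀ (by positivity)
    rw [this, one_smul, smul_add, sub_eq_add_neg]
    congr 1
    · rw [Finset.smul_sum]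
      refine Finset.sum_congr rfl fun μ _ => ?_
      rw [ih k _ (M.smd_hs_ins h _), insA_comm h, smul_comm]
      simp [hs, hj]
    · cases k with
      | zero => simp [(M.R_isMV (n + 1) 0 _) _]
      | succ k =>
        simp only [prev_succ]
        rw [← smul_neg, ← Finset.sum_neg_distrib]
        congr 1
        rw [Finset.smul_sum]
        refine Finset.sum_congr rfl fun i _ => ?_
        rw [ih k _ (by simpa using M.smd_hj_ins h _), insA_comm h, map_smul, map_smul,
          map_smul]
        simp only [hj]
        rw [show sgn ((0 - 1) * (0 - 1)) = -1 by norm_num [sgn]]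
        rw [neg_smul, one_smul, smul_neg, neg_neg]
        push_cast; rfl

lemma P_wd_zero (D : Derivation ℝ O O) (hD : ∀ μ, M.r (D (M.lin (M.u μ))) = 0) (k : ℕ)
    (Q : List O → O) : M.P (k + 1) (wd D Q) = 0 := by
  induction k generalizing Q with
  | zero => simp [P_succ, P_zero, ins_apply, wd_cons, wd_nil, hD]
  | succ k ih =>
    rw [P_succ]
    have : ∀ μ, M.P (k + 1) (M.Iu μ (wd D Q)) = 0 := fun μ => by
      rw [ins_wd, map_sub, M.P_mul, hD, ih]; simp
    simp [this]

lemma P_R (n k : ℕ) (ψ : List (Hom 𝒜) → A) : M.P k (M.R (n + 1) k ψ) = 0 := by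
  have h1 : ∀ i μ, M.r (M.dO i (M.lin (M.u μ))) = 0 := fun i μ => by
    rw [M.dO_lin]; simp [M.r_lin]
  rw [R_succ, map_smul, map_add, map_sum, map_smul]
  simp only [M.P_mul, M.r_lin, map_zero, zero_mul, Finset.sum_const_zero, zero_add]
  cases k with
  | zero => simp
  | succ k => simp [M.P_wd_zero _ (h1 _)]

lemma om_R (n k : ℕ) (ψ : List (Hom 𝒜) → A) (h : SMD 𝒜 (k - 1) ψ) (l : List (Hom 𝒜)) :
    M.om l k (M.R n k ψ) = lenR n ψ l := by
  refine M.smd_eq_of_gens (M.om_smd k _ (M.R_isMV n k ψ)) (h.lenR n) (fun g => ?_) l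
  clear l
  induction g generalizing n k ψ with
  | nil =>
    cases n with
    | zero => exact M.P_V k _ (deg_cast (h.mem []) (by simp [bsum]))
    | succ n => exact M.P_R n k ψ
  | cons x g ih =>
    have hl : ∀ (a : Hom 𝒜) n, lenR (n + 1) ψ (a :: M.gens g) = lenR n (insA a ψ) (M.gens g) :=
      fun a n => by simp [lenR, insA_apply]
    have hl0 : ∀ (a : Hom 𝒜), lenR 0 ψ (a :: M.gens g) = 0 := fun a => by simp [lenR]
    rcases x with v | f
    · change M.om (M.hs v :: M.gens g) k _ = lenR n ψ (M.hs v :: M.gens g)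
      rw [M.om_hs _ _ _ _ (M.R_isMV n k ψ)]
      cases n with
      | zero => rw [R_zero, M.lie_V, map_zero, hl0]
      | succ n => rw [M.lie_R n k v ψ h, ih n k _ (M.smd_hs_ins h v), hl]
    · change M.om (M.hj f :: M.gens g) k _ = lenR n ψ (M.hj f :: M.gens g)
      rw [M.om_hj _ _ _ _ (M.R_isMV n k ψ)]
      cases n with
      | zero =>
        rw [R_zero, hl0]
        cases k <;> simp [M.ins_p_V]
      | succ n =>
        rw [hl]
        cases k with
        | zero => rw [M.smd_hj_zero (by simpa using h)]; simp [lenR]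
        | succ k =>
          rw [prev_succ, M.ins_p_R n k f ψ (by simpa using h), map_smul, ih n k _
            (by simpa using M.smd_hj_ins h f), sgn_smul_smul]
          rw [sgn_of_even ⟨(k : ℤ) + 1, by push_cast; ring⟩, one_smul]

end Model

/-! ### The filtration by powers of the vanishing ideal -/

section Filtration

variable {O : Type*} [CommRing O] [Algebra ℝ O]

variable (O) in
/-- The module of `k`-vector fields. -/
def mvSub (k : ℕ) : Submodule O (List O → O) where
  carrier := {Q | IsMV k Q}
  zero_mem' := isMV_zero k
  add_mem' h h' := h.add h'
  smul_mem' c _ h := h.smul c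

/-- Multivector fields with coefficients in a power of an ideal. -/
def fil (I : Ideal O) (N k : ℕ) : Submodule O (List O → O) := I ^ N • mvSub O k

lemma fil_mono {I : Ideal O} {N N' k : ℕ} (h : N ≤ N') : fil I N' k ≤ fil I N k :=
  Submodule.smul_mono_left (Ideal.pow_le_pow_right h)

lemma fil_induction {I : Ideal O} {N k : ℕ} {p : (List O → O) → Prop} {Q : List O → O}
    (hQ : Q ∈ fil I N k) (h1 : ∀ h ∈ I ^ N, ∀ R, IsMV k R → p (h • R))
    (h2 : ∀ R R', p R → p R' → p (R + R')) : p Q :=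
  Submodule.smul_induction_on hQ h1 h2

lemma fil_ins {I : Ideal O} {N k : ℕ} {Q : List O → O} (hQ : Q ∈ fil I N (k + 1)) (z : O) :
    ins z Q ∈ fil I N k := by
  refine fil_induction (p := fun Q => ins z Q ∈ fil I N k) hQ (fun h hh R hR => ?_)
    fun R R' h1 h2 => ?_
  · rw [ins_smul]; exact Submodule.smul_mem_smul hh (hR.ins z)
  · rw [map_add]; exact add_mem h1 h2

lemma der_pow_mem (I : Ideal O) (D : Derivation ℝ O O) (N : ℕ) {h : O} (hh : h ∈ I ^ (N + 1)) :
    D h ∈ I ^ N := by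
  induction N generalizing h with
  | zero => simp
  | succ N ih =>
    rw [pow_succ] at hh
    refine Submodule.mul_induction_on hh (fun a ha b hb => ?_) fun a b ha hb => ?_
    · rw [Derivation.leibniz]
      refine add_mem (Ideal.mul_mem_right _ _ ha) ?_
      rw [smul_eq_mul, pow_succ']
      exact Ideal.mul_mem_mul hb (ih ha)
    · rw [map_add]; exact add_mem ha hb

lemma fil_lie {I : Ideal O} {N k : ℕ} {Q : List O → O} (hQ : Q ∈ fil I (N + 1) k)
    (D : Derivation ℝ O O) : lie D Q ∈ fil I N k := by
  refine fil_induction (p := fun Q => lie D Q ∈ fil I N k) hQ (fun h hh R hR => ?_)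
    fun R R' h1 h2 => ?_
  · rw [lie_mul]
    exact add_mem (Submodule.smul_mem_smul (der_pow_mem I D N hh) hR)
      (Submodule.smul_mem_smul (Ideal.pow_le_pow_right (Nat.le_succ N) hh) (hR.lie D))
  · rw [map_add]; exact add_mem h1 h2

lemma X2_add (β γ : biDer O) : X2 (β + γ) = X2 β + X2 γ := by
  funext l
  rcases l with _ | ⟨w, _ | ⟨y, _ | ⟨z, l⟩⟩⟩ <;> simp [X2]

lemma X2_smul (h : O) (β : biDer O) : X2 (h • β) = h • X2 β := by
  funext l
  rcases l with _ | ⟨w, _ | ⟨y, _ | ⟨z, l⟩⟩⟩ <;> simp [X2]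

variable (O) in
/-- Bivector fields as functions of lists. -/
def X2lin : biDer O →ₗ[O] (List O → O) where
  toFun := X2
  map_add' := X2_add
  map_smul' := X2_smul

lemma IsMV.two_skew {Q : List O → O} (h : IsMV 2 Q) (a b : O) : Q [a, b] = -Q [b, a] :=
  congrFun (h.anti b a) []

/-- A bivector field given as a function of lists. -/
def toBi (Q : List O → O) (h : IsMV 2 Q) : biDer O :=
  ⟨LinearMap.mk₂ ℝ (fun z w => Q [z, w])
    (fun z z' w => congrFun (h.2.1 z z') [w])
    (fun c z w => congrFun (h.2.2.1 c z) [w])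
    (fun z w w' => congrFun ((h.ins z).2.1 w w') [])
    (fun c z w => congrFun ((h.ins z).2.2.1 c w) []),
   fun z w => h.two_skew z w,
   fun z w w' => by
    have := congrFun ((h.ins z).mul w w') []
    change Q [z, w * w'] = Q [z, w] * w' + w * Q [z, w']
    refine this.trans ?_
    simp only [Pi.add_apply, Pi.smul_apply, smul_eq_mul, ins_apply]; ring⟩

end Filtration

namespace Model

variable {B O A : Type*} [CommRing B] [Algebra ℝ B] [CommRing O] [Algebra ℝ O]
  [Ring A] [Algebra ℝ A] {𝒜 : ℤ → Submodule ℝ A} {S L κ η : Type*} [Fintype κ] [Fintype η]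
  (M : Model B O A 𝒜 S L κ η)

lemma P_fil {I : Ideal O} (hI : ∀ h, h ∈ I ↔ M.r h = 0) {N k : ℕ} {Q : List O → O}
    (hQ : Q ∈ fil I (N + 1) k) : M.P k Q = 0 := by
  refine fil_induction (p := fun Q => M.P k Q = 0) hQ (fun h hh R hR => ?_) fun R R' h1 h2 => ?_
  · rw [M.P_mul, (hI h).1 (Ideal.pow_le_self (Nat.succ_ne_zero N) hh)]; simp
  · rw [map_add, h1, h2, add_zero]

lemma om_fil {I : Ideal O} (hI : ∀ h, h ∈ I ↔ M.r h = 0) {N k : ℕ} {Q : List O → O}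
    (hQ : Q ∈ fil I N k) (l : List (Hom 𝒜)) (hl : l.length < N) : M.om l k Q = 0 := by
  induction l generalizing N k Q with
  | nil =>
    obtain ⟨N, rfl⟩ : ∃ n, N = n + 1 := ⟨N - 1, by simp at hl; omega⟩
    exact M.P_fil hI hQ
  | cons a t ih =>
    obtain ⟨N, rfl⟩ : ∃ n, N = n + 1 := ⟨N - 1, by simp at hl; omega⟩
    have hl' : t.length < N := by simpa using hl
    rw [om_cons]
    have h1 : ∀ μ, M.om t k (M.Le μ Q) = 0 := fun μ => ih (fil_lie hQ _) hl'
    cases k with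
    | zero => simp [h1]
    | succ k =>
      have h2 : ∀ i, M.om t k (M.Ix i Q) = 0 := fun i =>
        ih (fil_mono (Nat.le_succ N) (fil_ins hQ _)) hl'
      simp [h1, h2]

/-! ### Injectivity -/

lemma euler_fil {I : Ideal O} (hI : ∀ h, h ∈ I ↔ M.r h = 0) (N : ℕ) (h : O) (hh : h ∈ I ^ N) :
    (∑ μ, M.lin (M.u μ) * M.vert (M.e μ) h) - (N : ℝ) • h ∈ I ^ (N + 1) := by
  set T : O →ₗ[ℝ] O := ∑ μ, LinearMap.mulLeft ℝ (M.lin (M.u μ)) ∘ₗ (M.vert (M.e μ)).toLinearMap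
    with hT
  have hTa : ∀ h, T h = ∑ μ, M.lin (M.u μ) * M.vert (M.e μ) h := fun h => by
    simp [hT]
  have hTm : ∀ a b, T (a * b) = a * T b + T a * b := fun a b => by
    simp only [hTa, Derivation.leibniz, smul_eq_mul, mul_add, Finset.sum_add_distrib,
      Finset.mul_sum, Finset.sum_mul]
    congr 1 <;> exact Finset.sum_congr rfl fun μ _ => by ring
  rw [← hTa]
  have hl : ∀ w, T (M.lin w) = M.lin w := fun w => by
    rw [hTa]
    conv_rhs => rw [M.lin_eq w]
    exact Finset.sum_congr rfl fun μ _ => by rw [M.vert_lin, mul_comm]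
  have hTI : ∀ h, T h ∈ I := fun h => by
    rw [hTa]
    exact Submodule.sum_mem _ fun μ _ => Ideal.mul_mem_right _ _ ((hI _).2 (M.r_lin _))
  have h1 : ∀ h ∈ I, T h - h ∈ I ^ 2 := by
    intro h hh
    obtain ⟨g, rfl⟩ := M.ker h ((hI h).1 hh)
    rw [map_sum, ← Finset.sum_sub_distrib]
    refine Submodule.sum_mem _ fun μ _ => ?_
    rw [hTm, hl, add_sub_cancel_right, pow_two]
    exact Ideal.mul_mem_mul ((hI _).2 (M.r_lin _)) (hTI _)
  induction N generalizing h with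
  | zero => simpa using hTI h
  | succ N ih =>
    rw [pow_succ] at hh
    refine Submodule.mul_induction_on hh (fun a ha b hb => ?_) fun a b ha hb => ?_
    · have e : T (a * b) - ((N + 1 : ℕ) : ℝ) • (a * b) =
          a * (T b - b) + (T a - (N : ℝ) • a) * b := by
        rw [hTm]; push_cast; rw [add_smul, one_smul, sub_mul, mul_sub, smul_mul_assoc]; ring
      rw [e]
      refine add_mem ?_ ?_
      · rw [show N + 1 + 1 = N + 2 from rfl, pow_add]
        exact Ideal.mul_mem_mul ha (h1 b hb)
      · rw [pow_succ]
        exact Ideal.mul_mem_mul (ih a ha) hb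
    · rw [map_add, smul_add, add_sub_add_comm]; exact add_mem ha hb

lemma mem_pow_of_vert {I : Ideal O} (hI : ∀ h, h ∈ I ↔ M.r h = 0) (N : ℕ) (h : O)
    (h0 : M.r h = 0) (hv : ∀ μ, M.vert (M.e μ) h ∈ I ^ N) : h ∈ I ^ (N + 1) := by
  have h1 : ∑ μ, M.lin (M.u μ) * M.vert (M.e μ) h ∈ I ^ (N + 1) :=
    Submodule.sum_mem _ fun μ _ => by
      rw [pow_succ']; exact Ideal.mul_mem_mul ((hI _).2 (M.r_lin _)) (hv μ)
  have key : ∀ j, j ≤ N → h ∈ I ^ (j + 1) := by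
    intro j
    induction j with
    | zero => intro _; simpa using (hI h).2 h0
    | succ j ih =>
      intro hj
      have h2 := M.euler_fil hI (j + 1) h (ih (by omega))
      have h3 : ((j + 1 : ℕ) : ℝ) • h ∈ I ^ (j + 1 + 1) := by
        have := sub_mem (Ideal.pow_le_pow_right (by omega) h1) h2
        simpa using this
      have h4 : algebraMap ℝ O (((j + 1 : ℕ) : ℝ))⁻¹ * (((j + 1 : ℕ) : ℝ) • h) ∈ I ^ (j + 1 + 1) :=
        Ideal.mul_mem_left _ _ h3
      rw [← Algebra.smul_def, smul_smul, inv_mul_cancel₀ (by positivity), one_smul] at h4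
      exact h4
  exact key N le_rfl

/-- The frame of functions on the total space. -/
def fz : η ⊕ κ → O := Sum.elim (fun i => M.p (M.x i)) fun μ => M.lin (M.u μ)

/-- The frame of vector fields on the total space. -/
def fD : η ⊕ κ → Derivation ℝ O O := Sum.elim M.dO fun μ => M.vert (M.e μ)

lemma tight (D : Derivation ℝ O O) (h : O) : D h = ∑ ξ, D (M.fz ξ) * M.fD ξ h := by
  rw [Fintype.sum_sum_type]; exact M.tightO D h

lemma bi_expand (β : biDer O) :
    (2 : O) • β = ∑ ξ, ∑ ζ, β.1 (M.fz ξ) (M.fz ζ) • wedge (M.fD ξ) (M.fD ζ) := by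
  have h1 : ∀ f g, β.1 f g = ∑ ξ, ∑ ζ, β.1 (M.fz ξ) (M.fz ζ) * (M.fD ξ f * M.fD ζ g) := by
    intro f g
    have e1 : ∀ f, β.1 f g = ∑ ζ, β.1 f (M.fz ζ) * M.fD ζ g := fun f => M.tight (biLeft β f) g
    have e2 : ∀ g, β.1 f g = ∑ ξ, β.1 (M.fz ξ) g * M.fD ξ f := fun g => by
      have := M.tight (biLeft β g) f
      simp only [biLeft_apply] at this
      rw [biDer_skew, this, ← Finset.sum_neg_distrib]
      exact Finset.sum_congr rfl fun ξ _ => by rw [biDer_skew β (M.fz ξ) g]; ring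
    rw [e1, Finset.sum_comm]
    refine Finset.sum_congr rfl fun ζ _ => ?_
    rw [e2, Finset.sum_mul]
    exact Finset.sum_congr rfl fun ξ _ => by ring
  ext f g
  have e3 : ∀ (s : Finset (η ⊕ κ)) (G : η ⊕ κ → biDer O), (∑ ξ ∈ s, G ξ).1 f g =
      ∑ ξ ∈ s, (G ξ).1 f g := by
    intro s G
    rw [Submodule.coe_sum]; simp
  rw [e3]
  simp only [e3]
  change (2 : O) * β.1 f g = ∑ ξ, ∑ ζ, β.1 (M.fz ξ) (M.fz ζ) *
    (M.fD ξ f * M.fD ζ g - M.fD ζ f * M.fD ξ g)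
  simp only [mul_sub, Finset.sum_sub_distrib]
  rw [← h1]
  have h2 : ∑ ξ, ∑ ζ, β.1 (M.fz ξ) (M.fz ζ) * (M.fD ζ f * M.fD ξ g) = -β.1 f g := by
    rw [h1 f g, Finset.sum_comm]
    simp only [← Finset.sum_neg_distrib]
    exact Finset.sum_congr rfl fun ξ _ => Finset.sum_congr rfl fun ζ _ => by
      rw [biDer_skew β (M.fz ζ)]; ring
  rw [h2]; ring

lemma bi_mem_of (M : Model B O A 𝒜 S L κ η) {I : Ideal O} {N : ℕ} (β : biDer O)
    (h : ∀ ξ ζ, β.1 (M.fz ξ) (M.fz ζ) ∈ I ^ N) :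
    β ∈ (I ^ N • ⊤ : Submodule O (biDer O)) := by
  have h1 : (2 : O) • β ∈ (I ^ N • ⊤ : Submodule O (biDer O)) := by
    rw [M.bi_expand]
    exact Submodule.sum_mem _ fun ξ _ => Submodule.sum_mem _ fun ζ _ =>
      Submodule.smul_mem_smul (h ξ ζ) trivial
  have h2 := Submodule.smul_mem _ (algebraMap ℝ O (2⁻¹)) h1
  rw [smul_smul] at h2
  have : algebraMap ℝ O 2⁻¹ * 2 = 1 := by
    rw [← map_ofNat (algebraMap ℝ O) 2, ← map_mul]; norm_num
  rwa [this, one_smul] at h2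

lemma mem_fil_of_om {I : Ideal O} (hI : ∀ h, h ∈ I ↔ M.r h = 0) (N : ℕ) (Q : List O → O)
    (hQ : IsMV 2 Q) (h : ∀ l : List (Hom 𝒜), l.length < N + 2 → M.om l 2 Q = 0) :
    (∀ f g, Q [M.p f, M.p g] ∈ I ^ N) ∧ (∀ f w, Q [M.p f, M.lin w] ∈ I ^ N) ∧
      ∀ w w', Q [M.lin w, M.lin w'] ∈ I ^ N := by
  induction N generalizing Q with
  | zero => simp
  | succ N ih =>
    have hle : ∀ μ, (∀ f g, M.Le μ Q [M.p f, M.p g] ∈ I ^ N) ∧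
        (∀ f w, M.Le μ Q [M.p f, M.lin w] ∈ I ^ N) ∧
        ∀ w w', M.Le μ Q [M.lin w, M.lin w'] ∈ I ^ N := fun μ => by
      refine ih _ (hQ.lie _) fun l hl => ?_
      rw [← M.om_hs _ _ _ _ hQ]
      exact h _ (by simp; omega)
    have hv : ∀ (D : Derivation ℝ O O) z w,
        D (Q [z, w]) = lie D Q [z, w] + Q [D z, w] + Q [z, D w] := fun D z w => by
      rw [lie_cons, lie_cons, lie_nil]
      simp only [ins_apply]; ring
    have z1 : ∀ w, Q [0, w] = 0 := fun w => congrFun (ins_zero hQ) [w]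
    have z2 : ∀ w, Q [w, 0] = 0 := fun w => by rw [hQ.two_skew, z1, neg_zero]
    have r_zero : ∀ h, M.j (M.r h) = 0 → M.r h = 0 := fun h e => by
      rw [← M.ε_j (M.r h), e, map_zero]
    have hff : ∀ f g, Q [M.p f, M.p g] ∈ I ^ (N + 1) := fun f g => by
      refine M.mem_pow_of_vert hI N _ (r_zero _ ?_) fun μ => ?_
      · have := h [M.hj f, M.hj g] (by simp)
        rw [M.om_hj _ _ _ _ hQ, prev_succ, M.om_hj _ _ _ _ (hQ.ins _), prev_succ, om_nil,
          P_zero, sgn_smul_smul] at this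
        exact (smul_eq_zero.1 this).resolve_left (sgn_ne_zero _)
      · rw [hv, M.vert_p, M.vert_p, z1, z2, add_zero, add_zero]
        exact (hle μ).1 f g
    have hfl : ∀ f w, Q [M.p f, M.lin w] ∈ I ^ (N + 1) := fun f w => by
      refine M.mem_pow_of_vert hI N _ (r_zero _ ?_) fun μ => ?_
      · have := h [M.hj f] (by simp)
        rw [M.om_hj _ _ _ _ hQ, prev_succ, om_nil] at this
        have h1 := (smul_eq_zero.1 this).resolve_left (sgn_ne_zero _)
        have h2 := M.con_P 1 _ (hQ.ins (M.p f)) w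
        rw [h1, map_zero, prev_succ, P_zero] at h2
        exact h2.symm
      · rw [hv, M.vert_p, M.vert_lin, z1, add_zero]
        exact add_mem ((hle μ).2.1 f w) (Ideal.pow_le_pow_right (Nat.le_succ N) (hff _ _))
    refine ⟨hff, hfl, fun w w' => ?_⟩
    refine M.mem_pow_of_vert hI N _ (r_zero _ ?_) fun μ => ?_
    · have h1 := h [] (by simp)
      have h2 := M.con_P 2 _ hQ w
      rw [← om_nil, h1, map_zero, prev_succ] at h2
      have h3 := M.con_P 1 _ (hQ.ins (M.lin w)) w'
      rw [← h2, map_zero, prev_succ, P_zero] at h3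
      exact h3.symm
    · rw [hv, M.vert_lin, M.vert_lin, hQ.two_skew (M.lin w)]
      exact add_mem (add_mem ((hle μ).2.2 w w')
        (Ideal.pow_le_pow_right (Nat.le_succ N) (hfl _ _)))
        (neg_mem (Ideal.pow_le_pow_right (Nat.le_succ N) (hfl _ _)))

lemma bi_mem_of_om {I : Ideal O} (hI : ∀ h, h ∈ I ↔ M.r h = 0) (N : ℕ) (β : biDer O)
    (h : ∀ l : List (Hom 𝒜), l.length < N + 2 → M.om l 2 (X2 β) = 0) :
    β ∈ (I ^ N • ⊤ : Submodule O (biDer O)) := by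
  obtain ⟨h1, h2, h3⟩ := M.mem_fil_of_om hI N (X2 β) (isMV_X2 β) h
  refine M.bi_mem_of β fun ξ ζ => ?_
  rcases ξ with i | μ <;> rcases ζ with i' | μ'
  · exact h1 _ _
  · exact h2 _ _
  · rw [biDer_skew]; exact neg_mem (h2 _ _)
  · exact h3 _ _

lemma X2_mem_fil {I : Ideal O} {N : ℕ} {β : biDer O}
    (h : β ∈ (I ^ N • ⊤ : Submodule O (biDer O))) : X2 β ∈ fil I N 2 := by
  refine Submodule.smul_induction_on (p := fun β => X2 β ∈ fil I N 2) h (fun a ha γ _ => ?_)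
    fun γ γ' h1 h2 => ?_
  · rw [X2_smul]; exact Submodule.smul_mem_smul ha (isMV_X2 γ)
  · rw [X2_add]; exact add_mem h1 h2

end Model

section Completion

variable {O : Type*} [CommRing O] [Algebra ℝ O]

lemma lie_vanish (D : Derivation ℝ O O) {Q : List O → O} {l : List O}
    (h : ∀ l' : List O, l'.length = l.length → Q l' = 0) : lie D Q l = 0 := by
  induction l generalizing Q with
  | nil => rw [lie_nil, h [] rfl, map_zero]
  | cons z l ih =>
    rw [lie_cons, ih (Q := ins z Q) fun l' hl => h (z :: l') (by simp [hl]), h (D z :: l) rfl, sub_zero]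

lemma X2_toBi_apply (Q : List O → O) (h : IsMV 2 Q) (l : List O) (hl : l.length = 2) :
    X2 (toBi Q h) l = Q l := by
  obtain ⟨a, b, rfl⟩ := List.length_eq_two.1 hl
  rfl

/-- The bivector field `β` represents `π` modulo `I ^ N`. -/
def Rep (I : Ideal O) (N : ℕ) (π : AdicCompletion I (biDer O)) (β : biDer O) : Prop :=
  AdicCompletion.eval I (biDer O) N π = Submodule.Quotient.mk β

variable {I : Ideal O}

lemma exists_rep (N : ℕ) (π : AdicCompletion I (biDer O)) : ∃ β, Rep I N π β := by
  obtain ⟨β, h⟩ := Submodule.Quotient.mk_surjective _ (AdicCompletion.eval I (biDer O) N π)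
  exact ⟨β, h.symm⟩

lemma Rep.mono {N N' : ℕ} {π : AdicCompletion I (biDer O)} {β : biDer O} (h : Rep I N' π β)
    (hN : N ≤ N') : Rep I N π β := by
  unfold Rep at *
  have h1 := AdicCompletion.transitionMap_comp_eval_apply I (biDer O) hN π
  rw [← AdicCompletion.eval_apply, ← AdicCompletion.eval_apply, h] at h1
  exact h1.symm

lemma Rep.exists_add {N : ℕ} {π : AdicCompletion I (biDer O)} {β β' : biDer O} (h : Rep I N π β)
    (h' : Rep I N π β') : ∃ γ ∈ (I ^ N • ⊤ : Submodule O (biDer O)), β = γ + β' := by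
  have h1 : (Submodule.Quotient.mk β : biDer O ⧸ (I ^ N • ⊤ : Submodule O (biDer O))) =
    Submodule.Quotient.mk β' := h.symm.trans h'
  exact ⟨β - β', (Submodule.Quotient.eq _).1 h1, (sub_add_cancel β β').symm⟩

lemma Rep.add {N : ℕ} {π π' : AdicCompletion I (biDer O)} {β β' : biDer O} (h : Rep I N π β)
    (h' : Rep I N π' β') : Rep I N (π + π') (β + β') := by
  unfold Rep at *
  rw [map_add, h, h', Submodule.Quotient.mk_add]

lemma Rep.smul {N : ℕ} {π : AdicCompletion I (biDer O)} {β : biDer O} (h : Rep I N π β) (f : O) :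
    Rep I N (f • π) (f • β) := by
  unfold Rep at *
  rw [map_smul, h, Submodule.Quotient.mk_smul]

lemma rep_of (N : ℕ) (β : biDer O) : Rep I N (AdicCompletion.of I (biDer O) β) β := rfl

lemma eq_of_rep {π π' : AdicCompletion I (biDer O)}
    (h : ∀ N, ∃ β, Rep I N π β ∧ Rep I N π' β) : π = π' :=
  AdicCompletion.ext fun N => by
    obtain ⟨β, h1, h2⟩ := h N
    exact h1.trans h2.symm

lemma rep_zero_of_mem {N : ℕ} {π : AdicCompletion I (biDer O)} {β : biDer O} (h : Rep I N π β)
    (hβ : β ∈ (I ^ N • ⊤ : Submodule O (biDer O))) : Rep I N π 0 := by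
  unfold Rep at *
  rw [h, (Submodule.Quotient.mk_eq_zero _).2 hβ, Submodule.Quotient.mk_zero]

lemma rep_zero (N : ℕ) : Rep I N (0 : AdicCompletion I (biDer O)) 0 := by
  unfold Rep
  rw [map_zero, Submodule.Quotient.mk_zero]

/-- A series of bivector fields with terms of increasing order defines an element of the
completion. -/
lemma exists_series (T : ℕ → biDer O) (k : ℕ)
    (hT : ∀ n, T (n + k) ∈ (I ^ n • ⊤ : Submodule O (biDer O))) :
    ∃ π : AdicCompletion I (biDer O), ∀ N, Rep I N π (∑ n ∈ Finset.range (N + k), T n) := by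
  refine ⟨AdicCompletion.mk I (biDer O) (AdicCompletion.AdicCauchySequence.mk I (biDer O)
    (fun N => ∑ n ∈ Finset.range (N + k), T n) fun N => ?_), fun N => rfl⟩
  rw [SModEq.def, show N + 1 + k = (N + k) + 1 by ring, Finset.sum_range_succ,
    Submodule.Quotient.mk_add, (Submodule.Quotient.mk_eq_zero _).2 (hT N), add_zero]

end Completion

namespace Model

variable {B O A : Type*} [CommRing B] [Algebra ℝ B] [CommRing O] [Algebra ℝ O]
  [Ring A] [Algebra ℝ A] {𝒜 : ℤ → Submodule ℝ A} {S L κ η : Type*} [Fintype κ] [Fintype η]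
  (M : Model B O A 𝒜 S L κ η)

variable {I : Ideal O}

lemma P_vanish {k : ℕ} {Q : List O → O} (h : ∀ l : List O, l.length = k → Q l = 0) :
    M.P k Q = 0 := by
  induction k generalizing Q with
  | zero => rw [P_zero, h [] rfl, map_zero, map_zero]
  | succ k ih =>
    have h1 : ∀ μ, M.P k (M.Iu μ Q) = 0 := fun μ => ih fun l hl => h (_ :: l) (by simp [hl])
    simp [P_succ, h1]

lemma om_vanish (l : List (Hom 𝒜)) {k : ℕ} {Q : List O → O}
    (h : ∀ l : List O, l.length = k → Q l = 0) : M.om l k Q = 0 := by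
  induction l generalizing k Q with
  | nil => exact M.P_vanish h
  | cons a t ih =>
    have h1 : ∀ μ, M.om t k (M.Le μ Q) = 0 := fun μ => ih fun l hl =>
      lie_vanish _ fun l' hl' => h l' (hl'.trans hl)
    rw [om_cons]
    cases k with
    | zero => simp [h1]
    | succ k =>
      have h2 : ∀ i, M.om t k (M.Ix i Q) = 0 := fun i => ih fun l hl => h (_ :: l) (by simp [hl])
      simp [h1, h2]

lemma om_congr (l : List (Hom 𝒜)) {k : ℕ} {Q Q' : List O → O}
    (h : ∀ l : List O, l.length = k → Q l = Q' l) : M.om l k Q = M.om l k Q' := by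
  rw [← sub_eq_zero, ← map_sub]
  exact M.om_vanish l fun l' hl' => by simp [h l' hl']

lemma F_eq_iff (n k : ℕ) (Q Q' : List O → O) : M.F n k Q = M.F n k Q' ↔
    ∀ l : List (Hom 𝒜), l.length = n → M.om l k Q = M.om l k Q' := by
  refine ⟨fun h l hl => ?_, M.eq_of_corr (M.F_corr n k Q) (M.F_corr n k Q')⟩
  subst hl
  have h1 := M.F_corr l.length k Q l.get
  have h2 := M.F_corr l.length k Q' l.get
  rw [h, h2] at h1
  simp only [List.ofFn_get] at h1
  have h3 := congrArg (dsgn l • ·) h1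
  simpa only [smul_smul, dsgn_mul_self, one_smul] using h3.symm

lemma F_add (n k : ℕ) (Q Q' : List O → O) : M.F n k (Q + Q') = M.F n k Q + M.F n k Q' := by
  refine M.eq_of_corr (ψ' := fun l => M.om l k Q + M.om l k Q') (M.F_corr n k _) (fun h => ?_)
    fun l _ => map_add _ _ _
  rw [add_apply, M.F_corr, M.F_corr, smul_add]

lemma F_congr (hI : ∀ h, h ∈ I ↔ M.r h = 0) (n : ℕ) {N : ℕ} (hN : n < N) {π : AdicCompletion I (biDer O)} {β β' : biDer O}
    (h : Rep I N π β) (h' : Rep I N π β') : M.F n 2 (X2 β) = M.F n 2 (X2 β') := by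
  obtain ⟨γ, hγ, rfl⟩ := h.exists_add h'
  rw [F_eq_iff]
  intro l hl
  rw [X2_add, map_add, M.om_fil hI (X2_mem_fil hγ) l (by omega), zero_add]

/-- The components of the Fourier transform. -/
def phiFun (I : Ideal O) (π : AdicCompletion I (biDer O)) (n : ℕ) :
    MultilinearMap ℝ (fun _ : Fin n => A) A :=
  M.F n 2 (X2 (exists_rep (n + 1) π).choose)

lemma phiFun_eq (hI : ∀ h, h ∈ I ↔ M.r h = 0) (n : ℕ) {N : ℕ} (hN : n < N) {π : AdicCompletion I (biDer O)} {β : biDer O}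
    (h : Rep I N π β) : M.phiFun I π n = M.F n 2 (X2 β) :=
  M.F_congr hI n (Nat.lt_succ_self n) (exists_rep (n + 1) π).choose_spec (h.mono hN)

/-- The Fourier transform as an additive map. -/
def phiHom (hI : ∀ h, h ∈ I ↔ M.r h = 0) : AdicCompletion I (biDer O) →+ multiDer 𝒜 where
  toFun π := ⟨M.phiFun I π, fun n => M.F_isMultiDer n _ (isMV_X2 _)⟩
  map_zero' := by
    ext1
    funext n
    change M.phiFun I 0 n = 0
    rw [M.phiFun_eq hI n (Nat.lt_succ_self n) (rep_zero _)]
    have := M.F_add n 2 (X2 0) (X2 0)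
    rwa [← X2_add, add_zero, left_eq_add] at this
  map_add' π π' := by
    ext1
    funext n
    obtain ⟨β, hβ⟩ := exists_rep (n + 1) π
    obtain ⟨β', hβ'⟩ := exists_rep (n + 1) π'
    change M.phiFun I (π + π') n = M.phiFun I π n + M.phiFun I π' n
    rw [M.phiFun_eq hI n (Nat.lt_succ_self n) (hβ.add hβ'),
      M.phiFun_eq hI n (Nat.lt_succ_self n) hβ, M.phiFun_eq hI n (Nat.lt_succ_self n) hβ',
      X2_add, F_add]

lemma phiHom_apply (hI : ∀ h, h ∈ I ↔ M.r h = 0) (π : AdicCompletion I (biDer O)) (n : ℕ) {N : ℕ} (hN : n < N) {β : biDer O}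
    (h : Rep I N π β) : (M.phiHom hI π).1 n = M.F n 2 (X2 β) := M.phiFun_eq hI n hN h

lemma phiHom_injective (hI : ∀ h, h ∈ I ↔ M.r h = 0) : Function.Injective (M.phiHom hI) := by
  refine (injective_iff_map_eq_zero _).2 fun π hπ => ?_
  refine eq_of_rep fun N => ⟨0, ?_, rep_zero N⟩
  obtain ⟨β, hβ⟩ := exists_rep (N + 2) π
  refine rep_zero_of_mem (hβ.mono (by omega)) (M.bi_mem_of_om hI N β fun l hl => ?_)
  have h1 : M.F l.length 2 (X2 β) = M.F l.length 2 (X2 0) := by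
    rw [← M.phiHom_apply hI π _ hl hβ, hπ, ← map_zero (M.phiHom hI),
      M.phiHom_apply hI 0 _ hl (rep_zero _)]
  rw [(M.F_eq_iff _ _ _ _).1 h1 l rfl]
  have : X2 (0 : biDer O) = 0 := map_zero (X2lin O)
  rw [this, map_zero]

lemma phiHom_surjective (hI : ∀ h, h ∈ I ↔ M.r h = 0) : Function.Surjective (M.phiHom hI) := by
  intro φ
  have hs := M.symm_smd φ.1 φ.2
  have hs' : SMD 𝒜 ((2 : ℕ) - 1) (symm φ.1) := by simpa using hs
  set T : ℕ → biDer O := fun n => toBi (M.R n 2 (symm φ.1)) (M.R_isMV n 2 _) with hT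
  have hom : ∀ n l, M.om l 2 (X2 (T n)) = lenR n (symm φ.1) l := fun n l => by
    rw [← M.om_R _ _ _ hs']
    exact M.om_congr l (X2_toBi_apply _ _)
  obtain ⟨π, hπ⟩ := exists_series (I := I) T 2 fun n => M.bi_mem_of_om hI n _ fun l hl => by
    rw [hom, lenR, if_neg (by omega)]
  refine ⟨π, ?_⟩
  ext1
  funext n
  rw [M.phiHom_apply hI π n (Nat.lt_succ_self n) (hπ (n + 1))]
  refine M.eq_of_corr (M.F_corr n 2 _) (corr_symm φ.1 n) fun l hl => ?_
  have : X2 (∑ m ∈ Finset.range (n + 1 + 2), T m) = ∑ m ∈ Finset.range (n + 1 + 2), X2 (T m) :=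
    map_sum (X2lin O) _ _
  rw [this, map_sum]
  simp only [hom, lenR]
  rw [Finset.sum_ite_eq, if_pos (by simp; omega)]

/-- The Fourier transform. -/
def phi (hI : ∀ h, h ∈ I ↔ M.r h = 0) : AdicCompletion I (biDer O) ≃+ multiDer 𝒜 :=
  AddEquiv.ofBijective (M.phiHom hI) ⟨M.phiHom_injective hI, M.phiHom_surjective hI⟩

lemma phi_apply (hI : ∀ h, h ∈ I ↔ M.r h = 0) (π : AdicCompletion I (biDer O)) (n : ℕ) {N : ℕ} (hN : n < N) {β : biDer O}
    (h : Rep I N π β) : (M.phi hI π).1 n = M.F n 2 (X2 β) := M.phiHom_apply hI π n hN h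

/-! ### Values on generators -/

/-- Iterated Lie derivatives along vertical vector fields. -/
def lieL (v : List S) (Q : List O → O) : List O → O := v.foldr (fun s Q => lie (M.vert s) Q) Q

lemma lieL_lie (v : List S) (s : S) (Q : List O → O) :
    M.lieL v (lie (M.vert s) Q) = lie (M.vert s) (M.lieL v Q) := by
  induction v with
  | nil => rfl
  | cons t v ih =>
    change lie (M.vert t) (M.lieL v _) = lie (M.vert s) (lie (M.vert t) (M.lieL v Q))
    rw [ih, M.lie_vert_comm]

lemma lieL_isMV {k : ℕ} {Q : List O → O} (hQ : IsMV k Q) (v : List S) : IsMV k (M.lieL v Q) := by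
  induction v with
  | nil => exact hQ
  | cons t v ih => exact ih.lie _

lemma lieL_fil {N k : ℕ} (v : List S) {Q : List O → O} (hQ : Q ∈ fil I (N + v.length) k) :
    M.lieL v Q ∈ fil I N k := by
  induction v generalizing N with
  | nil => exact hQ
  | cons t v ih =>
    exact fil_lie (ih (by rwa [List.length_cons, ← add_assoc, add_right_comm] at hQ)) _

lemma om_lieL (v : List S) (t : List (Hom 𝒜)) {k : ℕ} {Q : List O → O} (hQ : IsMV k Q) :
    M.om (v.map M.hs ++ t) k Q = M.om t k (M.lieL v Q) := by
  induction v generalizing Q with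
  | nil => rfl
  | cons s v ih =>
    rw [List.map_cons, List.cons_append, M.om_hs _ _ _ _ hQ, ih (hQ.lie _), lieL_lie]
    rfl

lemma om_sec_fun_fun (v : List S) (f g : B) {Q : List O → O} (hQ : IsMV 2 Q) :
    M.om (v.map M.hs ++ [M.hj f, M.hj g]) 2 Q = -M.j (M.r (M.lieL v Q [M.p f, M.p g])) := by
  have h := M.lieL_isMV hQ v
  rw [M.om_lieL _ _ hQ, M.om_hj _ _ _ _ h, prev_succ, M.om_hj _ _ _ _ (h.ins _), prev_succ,
    om_nil, P_zero, sgn_smul_smul, sgn_of_odd ⟨1, by norm_num⟩, neg_smul, one_smul]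
  rfl

lemma om_sec_fun (v : List S) (f : B) (w : L) {Q : List O → O} (hQ : IsMV 2 Q) :
    M.con w (M.om (v.map M.hs ++ [M.hj f]) 2 Q) = M.j (M.r (M.lieL v Q [M.p f, M.lin w])) := by
  have h := M.lieL_isMV hQ v
  rw [M.om_lieL _ _ hQ, M.om_hj _ _ _ _ h, prev_succ, om_nil, map_smul,
    M.con_P _ _ (h.ins _), prev_succ, P_zero, sgn_of_even ⟨1, by norm_num⟩, one_smul]
  rfl

lemma om_sec (v : List S) (w w' : L) {Q : List O → O} (hQ : IsMV 2 Q) :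
    M.con w' (M.con w (M.om (v.map M.hs) 2 Q)) = M.j (M.r (M.lieL v Q [M.lin w, M.lin w'])) := by
  have h := M.lieL_isMV hQ v
  have := M.om_lieL v [] hQ
  rw [List.append_nil] at this
  rw [this, om_nil, M.con_P _ _ h, prev_succ, M.con_P _ _ (h.ins _), prev_succ, P_zero]
  rfl

lemma dsgn_hs (v : List S) (t : List (Hom 𝒜)) : dsgn (v.map M.hs ++ t) = dsgn t := by
  induction v with
  | nil => rfl
  | cons s v ih =>
    rw [List.map_cons, List.cons_append, dsgn, ih, sgn_of_even ⟨0, by simp [hs]⟩, one_mul]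

lemma r_lieL_congr (hI : ∀ h, h ∈ I ↔ M.r h = 0) (v : List S) {N : ℕ} (hN : v.length < N) {π : AdicCompletion I (biDer O)}
    {β β' : biDer O} (h : Rep I N π β) (h' : Rep I N π β') (a b : O) :
    M.r (M.lieL v (X2 β) [a, b]) = M.r (M.lieL v (X2 β') [a, b]) := by
  obtain ⟨γ, hγ, rfl⟩ := (h.mono (N := 1 + v.length) (by omega)).exists_add
    (h'.mono (N := 1 + v.length) (by omega))
  have h1 : ∀ Q Q' : List O → O, M.lieL v (Q + Q') = M.lieL v Q + M.lieL v Q' := fun Q Q' => by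
    clear hN hγ h
    induction v with
    | nil => rfl
    | cons s v ih =>
      change lie _ (M.lieL v _) = lie _ (M.lieL v _) + lie _ (M.lieL v _)
      rw [ih, map_add]
  have h2 := M.P_fil hI (fil_ins (fil_ins (M.lieL_fil v (X2_mem_fil hγ)) a) b)
  rw [P_zero] at h2
  have h3 : M.r (M.lieL v (X2 γ) [a, b]) = 0 := by
    rw [← M.ε_j (M.r _)]
    exact (congrArg M.ε h2).trans (map_zero _)
  rw [X2_add, h1, Pi.add_apply, map_add, h3, zero_add]

end Model

/-! ### The Hochschild–Kostant–Rosenberg map -/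

section HKR

lemma sgn_sum {ξ : Type*} (s : Finset ξ) (f : ξ → ℤ) : sgn (∑ i ∈ s, f i) = ∏ i ∈ s, sgn (f i) := by
  classical
  induction s using Finset.induction_on with
  | empty => simp
  | insert i s hi ih => rw [Finset.sum_insert hi, Finset.prod_insert hi, sgn_add, ih]

/-- The permutation that maps `0` to `α` and is given by `e` on the other elements. -/
def ps {n : ℕ} (α : Fin (n + 1)) (e : Equiv.Perm (Fin n)) : Equiv.Perm (Fin (n + 1)) :=
  α.cycleRange.symm * Equiv.Perm.decomposeFin.symm (0, e)

lemma ps_zero {n : ℕ} (α : Fin (n + 1)) (e : Equiv.Perm (Fin n)) : ps α e 0 = α := by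
  simp [ps, Equiv.Perm.mul_apply]

lemma ps_succ {n : ℕ} (α : Fin (n + 1)) (e : Equiv.Perm (Fin n)) (i : Fin n) :
    ps α e i.succ = α.succAbove (e i) := by
  simp [ps, Equiv.Perm.mul_apply]

lemma permSign_ps {n : ℕ} (α : Fin (n + 1)) (e : Equiv.Perm (Fin n)) :
    permSign (ps α e) = sgn α * permSign e := by
  simp [permSign, ps, Equiv.Perm.decomposeFin.symm_sign, sgn]

lemma ps_bijective (n : ℕ) :
    Function.Bijective fun q : Fin (n + 1) × Equiv.Perm (Fin n) => ps q.1 q.2 := by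
  refine (Fintype.bijective_iff_injective_and_card _).2 ⟨fun q q' h => ?_,
    Fintype.card_congr Equiv.Perm.decomposeFin.symm⟩
  have h : ps q.1 q.2 = ps q'.1 q'.2 := h
  have h1 : q.1 = q'.1 := by rw [← ps_zero q.1 q.2, h, ps_zero]
  refine Prod.ext h1 (Equiv.ext fun i => ?_)
  have h2 := ps_succ q.1 q.2 i
  rw [h, ps_succ, h1] at h2
  exact (Fin.succAbove_right_injective h2).symm

lemma sum_perm_succ {n : ℕ} {X : Type*} [AddCommMonoid X] (f : Equiv.Perm (Fin (n + 1)) → X) :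
    ∑ s, f s = ∑ α, ∑ e, f (ps α e) := by
  rw [← Fintype.sum_prod_type']
  exact ((ps_bijective n).sum_comp f).symm

/-- The sum of the values before `α`. -/
def before {n : ℕ} (d : Fin (n + 1) → ℤ) (α : Fin (n + 1)) : ℤ :=
  ∑ m, if α.succAbove m < α then d (α.succAbove m) else 0

lemma koszul_ps {n : ℕ} (α : Fin (n + 1)) (e : Equiv.Perm (Fin n)) (d : Fin (n + 1) → ℤ) :
    koszul (ps α e) d = sgn (d α * before d α) * koszul e (d ∘ α.succAbove) := by
  simp only [koszul, Fin.prod_univ_succ, ps_zero, ps_succ, false_and, if_false, one_mul,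
    Fin.succ_lt_succ_iff, Fin.not_lt_zero, Fin.succ_pos, true_and, Function.comp_apply,
    (Fin.strictMono_succAbove α).lt_iff_lt]
  congr 1
  rw [before, Finset.mul_sum, sgn_sum]
  refine (Equiv.prod_comp e fun m => if α.succAbove m < α then
    sgn (d α * d (α.succAbove m)) else 1).trans ?_
  exact Finset.prod_congr rfl fun m _ => by split_ifs <;> simp

lemma sum_mul_succAbove {n : ℕ} (α : Fin (n + 1)) (d : Fin (n + 1) → ℤ) :
    ∑ i : Fin (n + 1), (i : ℤ) * d i = α * d α + ∑ m : Fin n, (m : ℤ) * d (α.succAbove m) +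
      (∑ m, d (α.succAbove m) - before d α) := by
  rw [Fin.sum_univ_succAbove _ α, add_assoc, before, ← Finset.sum_sub_distrib,
    ← Finset.sum_add_distrib]
  congr 1
  refine Finset.sum_congr rfl fun m _ => ?_
  rcases lt_or_ge m.castSucc α with h | h
  · rw [Fin.succAbove_of_castSucc_lt _ _ h, if_pos h]; simp
  · rw [Fin.succAbove_of_le_castSucc _ _ h, if_neg (by
      rw [not_lt]; exact h.trans (Fin.castSucc_lt_succ).le)]
    push_cast [Fin.val_succ]; ring

variable {A : Type*} [Ring A] [Algebra ℝ A]

lemma hkr_zero (d : Fin 0 → ℤ) (φ : Fin 0 → A → A) (β : Fin 0 → ℤ) (b : Fin 0 → A) :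
    hkr d φ β b = 1 := by
  simp [hkr, permSign, koszul]

lemma hkr_succ {n : ℕ} (d : Fin (n + 1) → ℤ) (φ : Fin (n + 1) → A → A) (β : Fin (n + 1) → ℤ)
    (b : Fin (n + 1) → A) : hkr d φ β b = ∑ α : Fin (n + 1),
      sgn (α + d α * before d α + β 0 * ∑ m, d (α.succAbove m) +
        (α * d α + (∑ m, d (α.succAbove m) - before d α))) •
      (φ α (b 0) * hkr (d ∘ α.succAbove) (φ ∘ α.succAbove) (β ∘ Fin.succ) (b ∘ Fin.succ)) := by
  unfold hkr
  rw [sum_perm_succ, Finset.smul_sum]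
  refine Finset.sum_congr rfl fun α _ => ?_
  rw [mul_smul_comm, smul_smul, ← sgn_add, Finset.mul_sum _ _ (φ α (b 0)), Finset.smul_sum,
    Finset.smul_sum]
  refine Finset.sum_congr rfl fun e _ => ?_
  rw [List.ofFn_succ, List.prod_cons, mul_smul_comm, smul_smul, smul_smul, ps_zero]
  simp only [ps_succ]
  congr 1
  rw [permSign_ps, koszul_ps, Fin.prod_univ_succ, Fin.prod_univ_succ, if_neg (lt_irrefl _), one_mul]
  simp only [Fin.succ_pos, if_true, ps_succ]
  have h1 : ∏ x, sgn (d (α.succAbove (e x)) * β 0) = sgn (β 0 * ∑ m, d (α.succAbove m)) := by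
    rw [Finset.mul_sum, sgn_sum, ← Equiv.prod_comp e fun m => sgn (β 0 * d (α.succAbove m))]
    exact Finset.prod_congr rfl fun m _ => by rw [mul_comm]
  have h2 : ∀ i : Fin n, (∏ j, if i.succ < j then sgn (d (ps α e j) * β i.succ) else 1) =
      ∏ j, if i < j then sgn ((d ∘ α.succAbove) (e j) * (β ∘ Fin.succ) i) else 1 := fun i => by
    rw [Fin.prod_univ_succ, if_neg (by simp), one_mul]
    simp [ps_succ]
  rw [h1]
  simp only [h2]
  rw [sum_mul_succAbove α]
  simp only [sgn_add, Function.comp_apply]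
  ring

end HKR

namespace Model

variable {B O A : Type*} [CommRing B] [Algebra ℝ B] [CommRing O] [Algebra ℝ O]
  [Ring A] [Algebra ℝ A] {𝒜 : ℤ → Submodule ℝ A} {S L κ η : Type*} [Fintype κ] [Fintype η]
  (M : Model B O A 𝒜 S L κ η)

/-! ### Products of generators -/

/-- A derivation of degree zero of `A` and the dual fibrewise linear vector field. -/
structure Dual where
  /-- the derivation -/
  der : A →ₗ[ℝ] A
  /-- the vector field -/
  X : Derivation ℝ O O
  mem : ∀ i, ∀ a ∈ 𝒜 i, der a ∈ 𝒜 i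
  mul : ∀ a b, der (a * b) = der a * b + a * der b
  base : ∀ f, ∃ g, der (M.j f) = M.j g ∧ X (M.p f) = M.p g
  fibre : ∀ u, ∃ w, X (M.lin u) = M.lin w ∧
    ∀ s, M.j (M.pair w s) = der (M.j (M.pair u s)) - M.con u (der (M.sec s))

variable {M}

lemma Dual.der_j (q : M.Dual) (f : B) : q.der (M.j f) =
    ∑ i, M.j (M.dB i f) * q.der (M.j (M.x i)) := by
  have := M.tightA 0 (q.der ∘ₗ M.j.toLinearMap) (fun f => q.mem 0 _ (M.j_mem f)) (fun f g => by
    simp only [LinearMap.comp_apply, AlgHom.toLinearMap_apply, map_mul, q.mul]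
    rw [← M.j_comm g, add_comm]) f
  simpa using this

lemma Dual.expand (q : M.Dual) (i : ℤ) (a : A) (ha : a ∈ 𝒜 i) : q.der a =
    ∑ i, q.der (M.j (M.x i)) * M.δ i a + ∑ μ, q.der (M.E μ) * M.ι μ a := by
  have hc : ∀ i, M.j (M.ε (q.der (M.j (M.x i)))) = q.der (M.j (M.x i)) := fun i =>
    M.j_ε _ (q.mem 0 _ (M.j_mem _))
  have hE : ∀ ν, q.der (M.E ν) = ∑ i, q.der (M.j (M.x i)) * M.δ i (M.E ν) +
      ∑ μ, q.der (M.E μ) * M.j (M.pair (M.u μ) (M.e ν)) := fun ν => by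
    refine (congrArg q.der (M.sec_eq (M.e ν))).trans ?_
    simp only [map_sum, q.mul, Finset.sum_add_distrib, M.δ_sec, Finset.mul_sum, M.j_comm]
    rw [Finset.sum_comm, add_comm]
    congr 1
    refine Finset.sum_congr rfl fun μ _ => ?_
    rw [q.der_j, Finset.mul_sum]
    exact Finset.sum_congr rfl fun i _ => by
      rw [← hc i, ← mul_assoc (M.E μ), M.j_comm _ (M.E μ * _)]
  refine M.hom_induction (Q := fun _ a => q.der a =
    ∑ i, q.der (M.j (M.x i)) * M.δ i a + ∑ μ, q.der (M.E μ) * M.ι μ a)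
    (by simp) ?_ ?_ ?_ ?_ i a ha
  · intro i a b _ _ h1 h2
    rw [map_add, h1, h2]
    simp only [map_add, M.left_distrib_A, Finset.sum_add_distrib]; abel
  · intro i c a _ h1
    rw [map_smul, h1]
    simp only [map_smul, mul_smul_comm, ← Finset.smul_sum, smul_add]
  · intro f
    rw [q.der_j]
    simp only [M.δ_j, M.con_j, mul_zero, Finset.sum_const_zero, add_zero, M.j_comm]
  · intro n ν a _ h1
    rw [q.mul, h1, hE]
    have h2 : ∀ μ, q.der (M.E μ) * M.ι μ (M.E ν * a) =
        q.der (M.E μ) * M.j (M.pair (M.u μ) (M.e ν)) * a + M.E ν * (q.der (M.E μ) * M.ι μ a) :=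
      fun μ => by
        rw [M.con_sec_mul, mul_sub, ← mul_assoc, ← mul_assoc, M.comm 1 1 _ (M.E ν)
          (q.mem _ _ (M.sec_mem _)) (M.sec_mem _), mul_one (1 : ℤ), sgn_one, neg_smul, one_smul, neg_mul,
          sub_neg_eq_add, mul_assoc (M.E ν)]
    have h3 : ∀ i, q.der (M.j (M.x i)) * M.δ i (M.E ν * a) =
        q.der (M.j (M.x i)) * M.δ i (M.E ν) * a + M.E ν * (q.der (M.j (M.x i)) * M.δ i a) :=
      fun i => by
        rw [M.δ_mul, mul_add, ← mul_assoc, ← hc i, M.j_left_comm]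
    simp only [h2, h3, Finset.sum_add_distrib, add_mul, Finset.sum_mul, M.left_distrib_A, Finset.mul_sum]
    abel

lemma Dual.bracket (q : M.Dual) (v s : S) (h : M.sec s = q.der (M.sec v)) :
    ⁅M.vert v, q.X⁆ = -M.vert s := by
  have hp : ∀ f, ⁅M.vert v, q.X⁆ (M.p f) = 0 := fun f => by
    obtain ⟨g, -, hg⟩ := q.base f
    rw [Derivation.commutator_apply, hg, M.vert_p, M.vert_p]; simp
  have hl : ∀ w, ⁅M.vert v, q.X⁆ (M.lin w) = -M.p (M.pair w s) := fun w => by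
    obtain ⟨w', hw, hw'⟩ := q.fibre w
    obtain ⟨g, hg, hg'⟩ := q.base (M.pair w v)
    have h1 : M.pair w' v = g - M.pair w s := by
      apply M.j_injective
      rw [hw', map_sub, ← M.con_sec w s, h, hg]
    rw [Derivation.commutator_apply, hw, M.vert_lin, M.vert_lin, hg', h1, map_sub]
    abel
  ext h
  rw [M.tightO, M.tightO (-M.vert s)]
  simp [hp, hl, M.vert_p, M.vert_lin]

variable (M)

/-- A fibrewise linear function, or a fibrewise linear vector field with its dual. -/
abbrev Lt := L ⊕ M.Dual

variable {M}

/-- The exterior product of a multivector field with a generator. -/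
def act : M.Lt → (List O → O) →ₗ[ℝ] (List O → O)
  | .inl u => mulO (M.lin u)
  | .inr q => wd q.X

/-- The degree of the derivation of `A` dual to a generator. -/
def ldeg : M.Lt → ℤ
  | .inl _ => -1
  | .inr _ => 0

/-- The derivation of `A` dual to a generator. -/
def lop : M.Lt → A →ₗ[ℝ] A
  | .inl u => M.con u
  | .inr q => q.der

/-- The number of vector fields. -/
def nder : List M.Lt → ℕ
  | [] => 0
  | .inl _ :: l => nder l
  | .inr _ :: l => nder l + 1

/-- The exterior product of generators. -/
def Pi (l : List M.Lt) : List O → O := l.foldr (fun x Q => act x Q) (X0 1)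

lemma Pi_cons (x : M.Lt) (l : List M.Lt) : Pi (x :: l) = act x (Pi l) := rfl

lemma isMV_Pi (l : List M.Lt) : IsMV (nder l) (Pi l) := by
  induction l with
  | nil => exact isMV_X0 1
  | cons x l ih =>
    rcases x with u | q
    · exact ih.smul _
    · exact ih.wd _

variable (M) in
lemma om_wd_vert (t : List (Hom 𝒜)) (k : ℕ) (Q : List O → O) (hQ : IsMV k Q) (s : S) :
    M.om t (k + 1) (wd (M.vert s) Q) = M.sec s * M.om t k Q := by
  induction t generalizing k Q with
  | nil => exact M.P_wd_vert k Q hQ s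
  | cons a t ih =>
    have h0 : ∀ μ, ⁅M.vert (M.e μ), M.vert s⁆ = 0 := fun μ => by
      ext h
      rw [Derivation.commutator_apply, M.vert_comm, sub_self]; rfl
    have h1 : ∀ μ, M.ι μ a.val * M.om t (k + 1) (M.Le μ (wd (M.vert s) Q)) =
        sgn (a.deg - 1) • (M.sec s * (M.ι μ a.val * M.om t k (M.Le μ Q))) := fun μ => by
      rw [lie_wd, h0, wd_zero_left, zero_add, ih _ _ (hQ.lie _),
        M.comm_left _ 1 _ _ _ (M.con_mem _ _ _ a.mem) (M.sec_mem s), mul_one]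
    have h2 : ∀ i, M.δ i a.val * M.om t k (M.Ix i (wd (M.vert s) Q)) =
        -(sgn a.deg • (M.sec s * prev k fun k' => M.δ i a.val * M.om t k' (M.Ix i Q))) := fun i => by
      rw [ins_wd, M.vert_p, zero_smul, zero_sub]
      cases k with
      | zero => rw [hQ]; simp
      | succ k =>
        rw [map_neg, ih _ _ (hQ.ins _), mul_neg, M.comm_left _ 1 _ _ _ (M.δ_mem _ _ _ a.mem)
          (M.sec_mem s), mul_one, prev_succ]
    rw [om_cons, om_cons, prev_succ]
    simp only [h1, h2, neg_smul_sgn, ← Finset.smul_sum,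
      ← Finset.mul_sum, M.left_distrib_A, mul_smul_comm, sgn_smul_smul]
    congr 1
    · congr 1
      exact sgn_congr (by push_cast; simp only [parity_simps]; grind)
    · cases k with
      | zero => simp
      | succ k =>
        simp only [prev_succ, mul_smul_comm]
        congr 1
        exact sgn_congr (by push_cast; simp only [parity_simps]; grind)

lemma om_p_smul (t : List (Hom 𝒜)) (k : ℕ) (Q : List O → O) (f : B) :
    M.om t k (M.p f • Q) = M.j f * M.om t k Q := by
  induction t generalizing k Q with
  | nil => rw [om_nil, M.P_mul, M.r_p, om_nil]
  | cons a t ih =>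
    have h1 : ∀ μ, M.ι μ a.val * M.om t k (M.Le μ (M.p f • Q)) =
        M.j f * (M.ι μ a.val * M.om t k (M.Le μ Q)) := fun μ => by
      rw [lie_mul, M.vert_p, zero_smul, zero_add, ih, M.j_left_comm]
    rw [om_cons, om_cons, M.left_distrib_A]
    simp only [h1, mul_smul_comm, ← Finset.mul_sum]
    congr 1
    cases k with
    | zero => simp
    | succ k =>
      simp only [prev_succ, ins_smul, ih, M.j_left_comm, mul_smul_comm, ← Finset.mul_sum]

/-- A term of the expansion of the value of a product on its first argument. -/
def lterm (a : A) (c₁ c₂ : ℝ) (θ θ' : (List O → O) →ₗ[ℝ] A) (l : List M.Lt) (i : Fin l.length) : A :=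
  match l.get i with
  | .inl u => c₁ • (M.con u a * θ (Pi (l.eraseIdx i)))
  | .inr q => (c₂ * sgn (nder (l.take i))) • (q.der a * θ' (Pi (l.eraseIdx i)))

lemma expand (l : List M.Lt) (a : Hom 𝒜) (c₁ c₂ ε : ℝ) (hc : c₁ * ε * sgn a.deg = c₂)
    (θ θ' : (List O → O) →ₗ[ℝ] A)
    (hV : ∀ k Q s, k + 1 = nder l → IsMV k Q → θ (wd (M.vert s) Q) = ε • (M.sec s * θ' Q))
    (hC : ∀ f Q, θ (M.p f • Q) = M.j f * θ Q) (hC' : ∀ f Q, θ' (M.p f • Q) = M.j f * θ' Q) :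
    c₁ • ∑ μ, M.ι μ a.val * θ (M.Le μ (Pi l)) + c₂ • ∑ i, M.δ i a.val * θ' (M.Ix i (Pi l)) =
      ∑ i, lterm a.val c₁ c₂ θ θ' l i := by
  induction l generalizing θ θ' with
  | nil =>
    have h1 : ∀ μ, M.Le μ (X0 1) = 0 := fun μ => by
      funext l
      induction l with
      | nil => simp [lie_nil, X0]
      | cons z l ih =>
        rw [lie_cons]
        have h0 : ins z (X0 (1 : O)) = 0 := isMV_X0 1 z
        rw [h0, map_zero]; simp [X0]
    have h2 : ∀ z, ins z (X0 (1 : O)) = 0 := isMV_X0 1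
    simp [Pi, h1, h2]
  | cons x l ih =>
    have hs : ∑ i, lterm a.val c₁ c₂ θ θ' (x :: l) i =
        lterm a.val c₁ c₂ θ θ' (x :: l) (0 : Fin (l.length + 1)) +
          ∑ i : Fin l.length, lterm a.val c₁ c₂ θ θ' (x :: l) (Fin.succ i) := Fin.sum_univ_succ _
    rw [hs]
    rcases x with u | q
    · have := ih (θ ∘ₗ mulO (M.lin u)) (θ' ∘ₗ mulO (M.lin u)) (fun k Q s hk hQ => by
          have := hV k (M.lin u • Q) s hk (hQ.smul _)
          rwa [wd_mul] at this) (fun f Q => by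
          change θ (M.lin u • M.p f • Q) = M.j f * θ (M.lin u • Q)
          rw [smul_comm, hC]) fun f Q => by
          change θ' (M.lin u • M.p f • Q) = M.j f * θ' (M.lin u • Q)
          rw [smul_comm, hC']
      have e : ∑ i : Fin l.length, lterm a.val c₁ c₂ θ θ' (Sum.inl u :: l) i.succ =
          ∑ i, lterm a.val c₁ c₂ (θ ∘ₗ mulO (M.lin u)) (θ' ∘ₗ mulO (M.lin u)) l i := rfl
      rw [e, ← this, ← add_assoc]
      congr 1
      change _ = c₁ • (M.con u a.val * θ (Pi l)) + _
      rw [← smul_add, M.con_eq, Finset.sum_mul, ← Finset.sum_add_distrib]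
      congr 1
      refine Finset.sum_congr rfl fun μ _ => ?_
      change M.ι μ a.val * θ (M.Le μ (M.lin u • Pi l)) = _ * _ + _ * θ (M.lin u • M.Le μ (Pi l))
      rw [lie_mul, map_add, M.vert_lin, M.left_distrib_A, hC, M.j_left_comm, mul_assoc]
    · have := ih (θ ∘ₗ wd q.X) (-(θ' ∘ₗ wd q.X)) (fun k Q s hk hQ => by
          have := hV (k + 1) (wd q.X Q) s (by simp [nder, hk]) (hQ.wd _)
          rw [wd_anti, map_neg] at this
          change θ (wd q.X _) = ε • (_ * -θ' (wd q.X Q))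
          rw [mul_neg, smul_neg, ← this, neg_neg]) (fun f Q => by
          change θ (wd q.X (M.p f • Q)) = M.j f * θ (wd q.X Q)
          rw [wd_mul, hC]) fun f Q => by
          change -θ' (wd q.X (M.p f • Q)) = M.j f * -θ' (wd q.X Q)
          rw [wd_mul, hC', mul_neg]
      have e : ∑ i : Fin l.length, lterm a.val c₁ c₂ θ θ' (Sum.inr q :: l) i.succ =
          ∑ i, lterm a.val c₁ c₂ (θ ∘ₗ wd q.X) (-(θ' ∘ₗ wd q.X)) l i := by
        refine Finset.sum_congr rfl fun i _ => ?_
        unfold lterm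
        change (match l.get i with
          | .inl u => _
          | .inr q' => _) = _
        cases l.get i with
        | inl u => rfl
        | inr q' =>
          change (c₂ * sgn (nder (Sum.inr q :: l.take i))) • (q'.der a.val * θ' (wd q.X (Pi (l.eraseIdx i)))) =
            (c₂ * sgn (nder (l.take i))) • (q'.der a.val * -θ' (wd q.X (Pi (l.eraseIdx i))))
          rw [nder, Nat.cast_succ, sgn_add, sgn_one]
          simp
      rw [e, ← this]
      choose s hs using fun μ => M.sec_surj _ (q.mem 1 _ (M.sec_mem (M.e μ)))
      choose g hg hg' using fun i => q.base (M.x i)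
      have h1 : ∀ μ, M.ι μ a.val * θ (M.Le μ (wd q.X (Pi l))) =
          -(ε * sgn (a.deg - 1)) • (q.der (M.E μ) * M.ι μ a.val * θ' (Pi l)) +
            M.ι μ a.val * θ (wd q.X (M.Le μ (Pi l))) := fun μ => by
        rw [lie_wd, q.bracket _ _ (hs μ), wd_neg_left, map_add, map_neg,
          hV _ _ _ rfl (isMV_Pi l), hs, M.left_distrib_A, mul_neg, mul_smul_comm,
          M.comm_left _ 1 _ _ _ (M.con_mem _ _ _ a.mem) (q.mem _ _ (M.sec_mem _)), mul_one,
          smul_smul, neg_smul, mul_assoc]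
      have h2 : ∀ i, M.δ i a.val * θ' (M.Ix i (wd q.X (Pi l))) =
          q.der (M.j (M.x i)) * M.δ i a.val * θ' (Pi l) -
            M.δ i a.val * θ' (wd q.X (M.Ix i (Pi l))) := fun i => by
        rw [ins_wd, hg', map_sub, mul_sub, hC', hg, M.j_left_comm, mul_assoc]
      change c₁ • ∑ μ, M.ι μ a.val * θ (M.Le μ (wd q.X (Pi l))) +
        c₂ • ∑ i, M.δ i a.val * θ' (M.Ix i (wd q.X (Pi l))) =
        (c₂ * sgn (nder ([] : List M.Lt))) • (q.der a.val * θ' (Pi l)) +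
        (c₁ • ∑ μ, M.ι μ a.val * θ (wd q.X (M.Le μ (Pi l))) +
          c₂ • ∑ i, M.δ i a.val * -θ' (wd q.X (M.Ix i (Pi l))))
      simp only [h1, h2, Finset.sum_add_distrib, Finset.sum_sub_distrib, mul_neg,
        Finset.sum_neg_distrib, smul_add, smul_sub, smul_neg]
      rw [q.expand _ _ a.mem, add_mul, Finset.sum_mul, Finset.sum_mul, ← Finset.smul_sum, smul_smul,
        nder, Nat.cast_zero, sgn_zero, mul_one, smul_add]
      have : c₁ * -(ε * sgn (a.deg - 1)) = c₂ := by
        rw [← hc, sub_eq_add_neg, sgn_add, sgn_neg, sgn_one]; ring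
      rw [this]
      abel

end Model

lemma before_eq {n : ℕ} (d : Fin (n + 1) → ℤ) (α : Fin (n + 1)) :
    before d α = ((List.ofFn d).take α).sum := by
  rw [List.sum_take_ofFn, Finset.sum_filter, Fin.sum_univ_succAbove _ α, if_neg (lt_irrefl _),
    zero_add]
  rfl

lemma eraseIdx_ofFn {X : Type*} {n : ℕ} (f : Fin (n + 1) → X) (α : Fin (n + 1)) :
    (List.ofFn f).eraseIdx α = List.ofFn (f ∘ α.succAbove) := by
  induction n with
  | zero =>
    obtain rfl : α = 0 := Fin.ext (by omega)
    simp
  | succ n ih =>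
    rw [List.ofFn_succ]
    induction α using Fin.cases with
    | zero => simp
    | succ α =>
      rw [Fin.val_succ, List.eraseIdx_cons_succ, ih, List.ofFn_succ]
      simp [Function.comp_def]

namespace Model

variable {B O A : Type*} [CommRing B] [Algebra ℝ B] [CommRing O] [Algebra ℝ O]
  [Ring A] [Algebra ℝ A] {𝒜 : ℤ → Submodule ℝ A} {S L κ η : Type*} [Fintype κ] [Fintype η]
  {M : Model B O A 𝒜 S L κ η}

lemma nder_eq (l : List M.Lt) : (nder l : ℤ) = l.length + (l.map ldeg).sum := by
  induction l with
  | nil => rfl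
  | cons x l ih => rcases x with u | q <;> simp [nder, ldeg, ih]; ring

lemma nder_eraseIdx (l : List M.Lt) (i : Fin l.length) :
    (nder l : ℤ) = nder (l.eraseIdx i) + (ldeg (l.get i) + 1) := by
  induction l with
  | nil => exact i.elim0
  | cons x l ih =>
    induction i using Fin.cases with
    | zero => rcases x with u | q <;> simp [nder, ldeg]
    | succ i =>
      have := ih i
      rcases x with u | q
      · simpa [nder] using this
      · simp only [nder, Fin.val_succ, List.eraseIdx_cons_succ, Nat.cast_add, Nat.cast_one, this]
        simp only [List.get_eq_getElem, List.getElem_cons_succ, Fin.val_succ]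
        ring

lemma om_Pi_cons (l : List M.Lt) (a : Hom 𝒜) (t : List (Hom 𝒜)) :
    M.om (a :: t) (nder l) (Pi l) = ∑ i, lterm a.val (sgn (nder l * (a.deg + 1)))
      (sgn ((nder l + 1) * a.deg + nder l)) (M.om t (nder l)) (prev (nder l) (M.om t)) l i := by
  rw [← expand l a _ _ 1, om_cons]
  · congr 1
    cases nder l with
    | zero => simp
    | succ k => rfl
  · rw [mul_one, ← sgn_add]
    congr 1; ring
  · intro k Q s hk hQ
    rw [← hk, prev_succ, one_smul, M.om_wd_vert t k Q hQ]
  · exact fun f Q => om_p_smul t _ Q f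
  · intro f Q
    cases nder l with
    | zero => simp
    | succ k => exact om_p_smul t _ Q f

lemma om_Pi_of_length_ne (l : List M.Lt) (t : List (Hom 𝒜)) (h : t.length ≠ l.length) :
    M.om t (nder l) (Pi l) = 0 := by
  induction t generalizing l with
  | nil =>
    rcases l with _ | ⟨x, l⟩
    · exact absurd rfl h
    rcases x with u | q
    · change M.P (nder l) (M.lin u • Pi l) = 0
      rw [M.P_mul, M.r_lin, map_zero, zero_mul]
    · refine M.P_wd_zero q.X (fun μ => ?_) (nder l) (Pi l)
      obtain ⟨w, hw, -⟩ := q.fibre (M.u μ)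
      rw [hw, M.r_lin]
  | cons a t ih =>
    rw [om_Pi_cons]
    refine Finset.sum_eq_zero fun i _ => ?_
    have h1 := nder_eraseIdx l i
    have h2 : t.length ≠ (l.eraseIdx i).length := by
      rw [List.length_eraseIdx_of_lt i.2]
      have := i.2
      simp only [List.length_cons] at h
      omega
    have h3 := ih _ h2
    unfold lterm
    cases e : l.get i with
    | inl u =>
      have h0 : ldeg (l.get i) = -1 := by rw [e]; rfl
      have h4 : nder l = nder (l.eraseIdx i) := by omega
      simp only
      rw [h4, h3, mul_zero, smul_zero]
    | inr q =>
      have h0 : ldeg (l.get i) = 0 := by rw [e]; rfl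
      have h4 : nder l = nder (l.eraseIdx i) + 1 := by omega
      simp only
      rw [h4, prev_succ, h3, mul_zero, smul_zero]

lemma om_Pi_ofFn {N : ℕ} (c : Fin N → M.Lt) (h : Fin N → Hom 𝒜) :
    dsgn (List.ofFn h) • M.om (List.ofFn h) (nder (List.ofFn c)) (Pi (List.ofFn c)) =
      sgn (nder (List.ofFn c)) • hkr (fun i => ldeg (c i)) (fun i a => lop (c i) a)
        (fun i => (h i).deg) fun i => (h i).val := by
  induction N with
  | zero =>
    have : M.om [] 0 (X0 1) = 1 := by rw [om_nil, P_zero]; simp [X0]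
    simpa [hkr_zero, nder, Pi, dsgn] using this
  | succ N ih =>
    set l := List.ofFn c with hl
    have hlen : l.length = N + 1 := List.length_ofFn
    rw [List.ofFn_succ, om_Pi_cons, hkr_succ, Finset.smul_sum, Finset.smul_sum,
      ← Equiv.sum_comp (finCongr hlen)]
    refine Finset.sum_congr rfl fun i _ => ?_
    obtain ⟨α, rfl⟩ : ∃ α, i = finCongr hlen.symm α := ⟨finCongr hlen i, rfl⟩
    have hget : l.get (finCongr hlen.symm α) = c α := by
      rw [List.get_eq_getElem]; exact List.getElem_ofFn _
    have her : l.eraseIdx (finCongr hlen.symm α) = List.ofFn (c ∘ α.succAbove) :=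
      eraseIdx_ofFn c α
    have ht : (nder (l.take (finCongr hlen.symm α)) : ℤ) = α + before (fun i => ldeg (c i)) α := by
      rw [nder_eq, before_eq, List.map_take, List.map_ofFn]
      simp [hlen, Function.comp_def]
    have hn : (nder (List.ofFn (c ∘ α.succAbove)) : ℤ) = N + ∑ m, ldeg (c (α.succAbove m)) := by
      rw [nder_eq, List.map_ofFn, List.sum_ofFn]; simp
    have h1 := nder_eraseIdx l (finCongr hlen.symm α)
    rw [hget, her] at h1
    have ih' := ih (c ∘ α.succAbove) (h ∘ Fin.succ)
    change _ = sgn (nder l) • sgn (α + ldeg (c α) * before (fun i => ldeg (c i)) α + (h 0).deg *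
      ∑ m, ldeg (c (α.succAbove m)) + (α * ldeg (c α) + (∑ m, ldeg (c (α.succAbove m)) -
        before (fun i => ldeg (c i)) α))) • (lop (c α) (h 0).val * hkr
        (fun i => ldeg ((c ∘ α.succAbove) i)) (fun i a => lop ((c ∘ α.succAbove) i) a)
        (fun i => ((h ∘ Fin.succ) i).deg) fun i => ((h ∘ Fin.succ) i).val)
    have ih2 : hkr
        (fun i => ldeg ((c ∘ α.succAbove) i)) (fun i a => lop ((c ∘ α.succAbove) i) a)
        (fun i => ((h ∘ Fin.succ) i).deg) (fun i => ((h ∘ Fin.succ) i).val) =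
        sgn (nder (List.ofFn (c ∘ α.succAbove))) • dsgn (List.ofFn (h ∘ Fin.succ)) •
          M.om (List.ofFn (h ∘ Fin.succ)) (nder (List.ofFn (c ∘ α.succAbove)))
          (Pi (List.ofFn (c ∘ α.succAbove))) := by
      rw [ih', smul_smul, sgn_mul_self, one_smul]
    rw [ih2]
    generalize before (fun i => ldeg (c i)) α = bf at *
    generalize (∑ m, ldeg (c (α.succAbove m))) = T at *
    unfold lterm
    rw [hget, her, ht]
    simp only [dsgn, List.length_ofFn]
    have e0 : (List.ofFn fun i => h (Fin.succ i)) = List.ofFn (h ∘ Fin.succ) := rfl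
    rw [e0]
    generalize dsgn (List.ofFn (h ∘ Fin.succ)) = ds at *
    cases e : c α with
    | inl u =>
      rw [e] at h1
      have h4 : nder l = nder (List.ofFn (c ∘ α.succAbove)) := by simp only [ldeg] at h1; omega
      simp only [lop, ldeg]
      rw [h4, hn, mul_smul_comm, mul_smul_comm, smul_smul, smul_smul, smul_smul, smul_smul,
        mul_right_comm, ← sgn_add, ← sgn_add, ← sgn_add]
      congr 2
      exact sgn_congr (by simp only [parity_simps]; grind)
    | inr q =>
      rw [e] at h1
      have h4 : nder l = nder (List.ofFn (c ∘ α.succAbove)) + 1 := by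
        simp only [ldeg] at h1; omega
      simp only [lop, ldeg]
      rw [h4, prev_succ, Nat.cast_succ, hn, mul_smul_comm, mul_smul_comm, smul_smul, smul_smul,
        smul_smul, smul_smul, ← sgn_add,
        mul_right_comm, ← sgn_add, ← sgn_add, ← sgn_add]
      congr 2
      exact sgn_congr (by simp only [parity_simps]; grind)

lemma isProduct_of (Q : List O → O) {N : ℕ} (c : Fin N → M.Lt) (x y : A)
    (h : ∀ t, M.om t 2 Q = y * M.om t (nder (List.ofFn c)) (Pi (List.ofFn c)))
    (hx : x = sgn (nder (List.ofFn c)) • y) :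
    IsProduct 𝒜 (fun n => M.F n 2 Q) x (fun i => ldeg (c i)) (fun i a => lop (c i) a) := by
  refine ⟨fun β b hb => ?_, fun m hm => ?_⟩
  · have h1 := M.F_corr N 2 Q fun i => ⟨β i, b i, hb i⟩
    refine h1.trans ?_
    change dsgn _ • M.om _ 2 Q = _
    rw [h, ← mul_smul_comm, om_Pi_ofFn, hx, mul_smul_comm, smul_mul_assoc]
  · refine M.eq_of_corr (M.F_corr m 2 Q) (ψ' := 0) (fun h => by simp) fun l hl => ?_
    rw [h, om_Pi_of_length_ne _ _ (by rw [hl, List.length_ofFn]; exact hm), mul_zero]; rfl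

lemma Pi_append_lin {k : ℕ} (w : Fin k → L) (l : List M.Lt) :
    Pi ((List.ofFn fun i => (Sum.inl (w i) : M.Lt)) ++ l) = (∏ i, M.lin (w i)) • Pi l := by
  induction k with
  | zero => simp
  | succ k ih =>
    rw [List.ofFn_succ, List.cons_append, Pi_cons, ih, Fin.prod_univ_succ, ← smul_smul]; rfl

lemma nder_append_lin {k : ℕ} (w : Fin k → L) (l : List M.Lt) :
    nder ((List.ofFn fun i => (Sum.inl (w i) : M.Lt)) ++ l) = nder l := by
  induction k with
  | zero => simp
  | succ k ih => rw [List.ofFn_succ, List.cons_append, nder, ih]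

lemma X2_wedge (h : O) (D D' : Derivation ℝ O O) (l : List O) (hl : l.length = 2) :
    X2 (h • wedge D D') l = (h • wd D (wd D' (X0 1))) l := by
  obtain ⟨f, g, rfl⟩ := List.length_eq_two.1 hl
  rw [X2_smul]
  change h * (D f * D' g - D' f * D g) = h * _
  rw [wd_cons, ins_wd, map_sub, wd_mul, isMV_X0 1 f]
  simp [wd_cons, wd_nil, X0, isMV_X0 (1 : O) _]

lemma om_linear_linear {k : ℕ} (w : Fin k → L) (q q' : M.Dual) :
    IsProduct 𝒜 (fun n => M.F n 2 (X2 ((∏ i, M.lin (w i)) • wedge q.X q'.X))) 1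
      (Fin.append (fun _ : Fin k => (-1 : ℤ)) ![0, 0])
      (Fin.append (fun i a => M.con (w i) a) ![fun a => q.der a, fun a => q'.der a]) := by
  have e : List.ofFn (Fin.append (fun i => Sum.inl (w i)) ![Sum.inr q, Sum.inr q']) =
      (List.ofFn fun i => (Sum.inl (w i) : M.Lt)) ++ [Sum.inr q, Sum.inr q'] := by
    rw [List.ofFn_fin_append]; rfl
  have := isProduct_of (M := M) (X2 ((∏ i, M.lin (w i)) • wedge q.X q'.X))
    (Fin.append (fun i => Sum.inl (w i)) ![Sum.inr q, Sum.inr q']) 1 1 (fun t => by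
      rw [e, Pi_append_lin, nder_append_lin, one_mul]
      exact M.om_congr t (X2_wedge _ _ _)) (by
      rw [e, nder_append_lin]; simp [nder, sgn])
  convert this using 1
  · funext i
    refine Fin.addCases (fun i => ?_) (fun i => ?_) i
    · simp [ldeg]
    · fin_cases i <;> simp [ldeg]
  · funext i
    refine Fin.addCases (fun i => ?_) (fun i => ?_) i
    · simp [lop]
    · fin_cases i <;> simp [lop]

lemma om_vertical_linear {k : ℕ} (w : Fin k → L) (s : S) (q : M.Dual) :
    IsProduct 𝒜 (fun n => M.F n 2 (X2 ((∏ i, M.lin (w i)) • wedge (M.vert s) q.X))) (-M.sec s)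
      (Fin.append (fun _ : Fin k => (-1 : ℤ)) ![0])
      (Fin.append (fun i a => M.con (w i) a) ![fun a => q.der a]) := by
  have e : List.ofFn (Fin.append (fun i => Sum.inl (w i)) ![Sum.inr q]) =
      (List.ofFn fun i => (Sum.inl (w i) : M.Lt)) ++ [Sum.inr q] := by
    rw [List.ofFn_fin_append]; rfl
  have := isProduct_of (M := M) (X2 ((∏ i, M.lin (w i)) • wedge (M.vert s) q.X))
    (Fin.append (fun i => Sum.inl (w i)) ![Sum.inr q]) (-M.sec s) (M.sec s) (fun t => by
      rw [e, Pi_append_lin, nder_append_lin]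
      refine (M.om_congr t (X2_wedge _ _ _)).trans ?_
      rw [← wd_mul]
      exact M.om_wd_vert t 1 _ (((isMV_X0 1).wd _).smul _) s) (by
      rw [e, nder_append_lin]; simp [nder])
  convert this using 1
  · funext i
    refine Fin.addCases (fun i => ?_) (fun i => ?_) i
    · simp [ldeg]
    · fin_cases i; simp [ldeg]
  · funext i
    refine Fin.addCases (fun i => ?_) (fun i => ?_) i
    · simp [lop]
    · fin_cases i; simp [lop]

lemma om_vertical_vertical {k : ℕ} (w : Fin k → L) (s s' : S) :
    IsProduct 𝒜 (fun n => M.F n 2 (X2 ((∏ i, M.lin (w i)) • wedge (M.vert s) (M.vert s'))))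
      (-M.sec s * -M.sec s') (fun _ : Fin k => (-1 : ℤ)) (fun i a => M.con (w i) a) := by
  have e := Pi_append_lin (M := M) w []
  have e' := nder_append_lin (M := M) w []
  rw [List.append_nil] at e e'
  exact isProduct_of (M := M) (X2 ((∏ i, M.lin (w i)) • wedge (M.vert s) (M.vert s')))
    (fun i => Sum.inl (w i)) _ (M.sec s * M.sec s') (fun t => by
      rw [e, e']
      refine (M.om_congr t (X2_wedge _ _ _)).trans ?_
      rw [← wd_mul, ← wd_mul, M.om_wd_vert t 1 _ (((isMV_X0 1).smul _).wd _),
        M.om_wd_vert t 0 _ ((isMV_X0 1).smul _), mul_assoc]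
      rfl) (by
      rw [e']; simp [nder])

end Model

namespace Model

variable {B O A : Type*} [CommRing B] [Algebra ℝ B] [CommRing O] [Algebra ℝ O]
  [Ring A] [Algebra ℝ A] {𝒜 : ℤ → Submodule ℝ A} {S L κ η : Type*} [Fintype κ] [Fintype η]
  (M : Model B O A 𝒜 S L κ η)

/-! ### Characterization of the Fourier transform -/

/-- The Fourier transform in terms of a model. -/
structure IsFou (I : Ideal O) (Φ : AdicCompletion I (biDer O) ≃+ multiDer 𝒜) : Prop where
  map_smul : ∀ f π n a, (Φ (M.p f • π)).1 n a = M.j f * (Φ π).1 n a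
  continuous : ∀ n, ∃ m, ∀ π, AdicCompletion.eval I (biDer O) m π = 0 → (Φ π).1 n = 0
  linear_linear : ∀ (k : ℕ) (w : Fin k → L) (q q' : M.Dual), IsProduct 𝒜
    (Φ (AdicCompletion.of _ _ ((∏ i, M.lin (w i)) • wedge q.X q'.X))).1 1
    (Fin.append (fun _ : Fin k => (-1 : ℤ)) ![0, 0])
    (Fin.append (fun i a => M.con (w i) a) ![fun a => q.der a, fun a => q'.der a])
  vertical_linear : ∀ (k : ℕ) (w : Fin k → L) (s : S) (q : M.Dual), IsProduct 𝒜
    (Φ (AdicCompletion.of _ _ ((∏ i, M.lin (w i)) • wedge (M.vert s) q.X))).1 (-M.sec s)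
    (Fin.append (fun _ : Fin k => (-1 : ℤ)) ![0])
    (Fin.append (fun i a => M.con (w i) a) ![fun a => q.der a])
  vertical_vertical : ∀ (k : ℕ) (w : Fin k → L) (s s' : S), IsProduct 𝒜
    (Φ (AdicCompletion.of _ _ ((∏ i, M.lin (w i)) • wedge (M.vert s) (M.vert s')))).1
    (-M.sec s * -M.sec s') (fun _ : Fin k => (-1 : ℤ)) (fun i a => M.con (w i) a)

variable {I : Ideal O}

lemma isFou_phi (hI : ∀ h, h ∈ I ↔ M.r h = 0) : M.IsFou I (M.phi hI) where
  map_smul f π n a := by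
    obtain ⟨β, hβ⟩ := exists_rep (n + 1) π
    rw [M.phi_apply hI _ n (Nat.lt_succ_self n) (hβ.smul _),
      M.phi_apply hI _ n (Nat.lt_succ_self n) hβ, X2_smul]
    have : M.F n 2 (M.p f • X2 β) = mulMulti (M.F n 2 (X2 β)) (M.j f) := by
      refine M.eq_of_corr (M.F_corr n 2 _) (ψ' := fun l => M.j f * M.om l 2 (X2 β)) (fun h => ?_)
        fun l _ => M.om_p_smul l 2 _ f
      rw [← mul_smul_comm, ← M.F_corr n 2 (X2 β)]; rfl
    rw [this]; rfl
  continuous n := ⟨n + 1, fun π hπ => by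
    have h : Rep I (n + 1) π 0 := by
      rw [Rep, hπ, Submodule.Quotient.mk_zero]
    rw [M.phi_apply hI _ n (Nat.lt_succ_self n) h,
      ← M.phi_apply hI 0 n (Nat.lt_succ_self n) (rep_zero _), map_zero]
    rfl⟩
  linear_linear k w q q' := by
    rw [show (M.phi hI _).1 = _ from funext fun n =>
      M.phi_apply hI _ n (Nat.lt_succ_self n) (rep_of _ _)]
    exact om_linear_linear w q q'
  vertical_linear k w s q := by
    rw [show (M.phi hI _).1 = _ from funext fun n =>
      M.phi_apply hI _ n (Nat.lt_succ_self n) (rep_of _ _)]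
    exact om_vertical_linear w s q
  vertical_vertical k w s s' := by
    rw [show (M.phi hI _).1 = _ from funext fun n =>
      M.phi_apply hI _ n (Nat.lt_succ_self n) (rep_of _ _)]
    exact om_vertical_vertical w s s'

lemma isProduct_unique (M : Model B O A 𝒜 S L κ η)
    {l l' : ∀ n, MultilinearMap ℝ (fun _ : Fin n => A) A} {N : ℕ} {c : A} {d : Fin N → ℤ}
    {φ : Fin N → A → A} (h : IsProduct 𝒜 l c d φ) (h' : IsProduct 𝒜 l' c d φ) : l = l' := by
  funext n
  by_cases hn : n = N
  · subst hn
    exact M.multi_ext fun f => by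
      rw [h.1 _ _ fun i => (f i).mem, h'.1 _ _ fun i => (f i).mem]
  · rw [h.2 n hn, h'.2 n hn]

lemma exists_dual (i : η) : ∃ q : M.Dual, q.X = M.dO i := by
  refine ⟨⟨M.δ i, M.dO i, fun k a ha => M.δ_mem i k a ha, M.δ_mul i,
    fun f => ⟨M.dB i f, M.δ_j i f, M.dO_p i f⟩, fun w => ?_⟩, rfl⟩
  obtain ⟨w', hw'⟩ := M.lin_sum fun μ => M.dB i (M.pair w (M.e μ))
  refine ⟨w', (M.dO_lin i w).trans hw'.symm, fun s => ?_⟩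
  rw [M.con_δ_sec]
  have h1 := M.vert_lin s w'
  rw [hw'] at h1
  have h2 : M.pair w' s = ∑ μ, M.dB i (M.pair w (M.e μ)) * M.pair (M.u μ) s := by
    rw [← M.r_p (M.pair w' s), ← h1]
    simp [M.vert_lin, M.vert_p, M.r_p]
  rw [h2, M.δ_j]
  simp only [map_sum, map_mul]
  rw [eq_sub_iff_add_eq, add_sub_left_comm, sub_eq_zero.2, add_zero]
  exact Finset.sum_congr rfl fun μ _ => M.j_comm _ _

lemma wedge_neg (X Y : Derivation ℝ O O) : wedge X Y = -wedge Y X := by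
  refine eq_neg_of_add_eq_zero_left (Subtype.ext (LinearMap.ext fun f => LinearMap.ext fun g => ?_))
  change (X f * Y g - Y f * X g) + (Y f * X g - X f * Y g) = 0
  ring

lemma isFou_unique (hI : ∀ h, h ∈ I ↔ M.r h = 0)
    {Φ Ψ : AdicCompletion I (biDer O) ≃+ multiDer 𝒜} (hΦ : M.IsFou I Φ) (hΨ : M.IsFou I Ψ) :
    Ψ = Φ := by
  refine AddEquiv.ext fun π => Subtype.ext (funext fun n => ?_)
  obtain ⟨m₁, hm₁⟩ := hΦ.continuous n
  obtain ⟨m₂, hm₂⟩ := hΨ.continuous n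
  set m := max m₁ m₂
  set T : AdicCompletion I (biDer O) → MultilinearMap ℝ (fun _ : Fin n => A) A :=
    fun π => (Ψ π).1 n - (Φ π).1 n with hT
  have hadd : ∀ π π', T (π + π') = T π + T π' := fun π π' => by
    simp only [hT, map_add, Submodule.coe_add, Pi.add_apply]; abel
  have hsm : ∀ f π, T π = 0 → T (M.p f • π) = 0 := fun f π h => by
    ext a
    have h1 : (Ψ π).1 n a - (Φ π).1 n a = 0 := congrArg (fun G => G a) h
    change (Ψ (M.p f • π)).1 n a - (Φ (M.p f • π)).1 n a = 0
    rw [hΦ.map_smul, hΨ.map_smul, ← mul_sub, h1, mul_zero]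
  have hrep : ∀ π, Rep I m π 0 → T π = 0 := fun π h => by
    have e : ∀ k, k ≤ m → AdicCompletion.eval I (biDer O) k π = 0 := fun k hk => by
      rw [h.mono hk, Submodule.Quotient.mk_zero]
    simp only [hT]
    rw [hm₁ π (e _ (le_max_left _ _)), hm₂ π (e _ (le_max_right _ _)), sub_zero]
  set T' : biDer O →+ MultilinearMap ℝ (fun _ : Fin n => A) A :=
    { toFun := fun β => T (AdicCompletion.of I (biDer O) β)
      map_zero' := by rw [map_zero]; exact hrep 0 (rep_zero _)
      map_add' := fun β γ => by rw [map_add, hadd] } with hT'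
  have hmem : ∀ β ∈ (I ^ m • ⊤ : Submodule O (biDer O)), T' β = 0 := fun β hβ =>
    hrep _ (rep_zero_of_mem (rep_of m β) hβ)
  have key : ∀ W : biDer O, (∀ (k : ℕ) (w : Fin k → L), T' ((∏ i, M.lin (w i)) • W) = 0) →
      ∀ (j k : ℕ) (w : Fin k → L) (h : O), m ≤ k + j → T' (h • (∏ i, M.lin (w i)) • W) = 0 := by
    intro W hW j
    induction j with
    | zero =>
      intro k w h hk
      refine hmem _ (Submodule.smul_mem _ _ (Submodule.smul_mem_smul ?_ trivial))
      refine Ideal.pow_le_pow_right (by omega : m ≤ k) ?_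
      have := Ideal.prod_mem_prod (s := Finset.univ) (I := fun _ : Fin k => I)
        (x := fun i => M.lin (w i)) fun i _ => (hI _).2 (M.r_lin _)
      simpa using this
    | succ j ih =>
      intro k w h hk
      obtain ⟨g, hg⟩ := M.ker (h - M.p (M.r h)) (by rw [map_sub, M.r_p, sub_self])
      rw [sub_eq_iff_eq_add] at hg
      rw [hg, add_smul, map_add, Finset.sum_smul, map_sum]
      have h1 : T' (M.p (M.r h) • (∏ i, M.lin (w i)) • W) = 0 := by
        change T (AdicCompletion.of I (biDer O) (M.p (M.r h) • _)) = 0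
        rw [_root_.map_smul]
        exact hsm _ _ (hW k w)
      rw [h1, add_zero]
      refine Finset.sum_eq_zero fun μ _ => ?_
      have := ih (k + 1) (Fin.cons (M.u μ) w) (g μ) (by omega)
      rw [Fin.prod_univ_succ] at this
      simp only [Fin.cons_zero, Fin.cons_succ] at this
      rw [← this]
      congr 1
      simp only [smul_smul]
      congr 1
      ring
  choose q hq using M.exists_dual
  have hprod : ∀ (W : biDer O) (N : ℕ) (c : A) (d : Fin N → ℤ) (φ : Fin N → A → A),
      IsProduct 𝒜 (Φ (AdicCompletion.of I _ W)).1 c d φ →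
      IsProduct 𝒜 (Ψ (AdicCompletion.of I _ W)).1 c d φ → T' W = 0 := fun W N c d φ h1 h2 => by
    change (Ψ _).1 n - (Φ _).1 n = 0
    rw [M.isProduct_unique h1 h2, sub_self]
  have h0 : ∀ ξ ζ (h : O), T' (h • wedge (M.fD ξ) (M.fD ζ)) = 0 := by
    have e : ∀ W : biDer O, (∀ (k : ℕ) (w : Fin k → L), T' ((∏ i, M.lin (w i)) • W) = 0) →
        ∀ h, T' (h • W) = 0 := fun W hW h => by
      simpa using key W hW m 0 Fin.elim0 h (by omega)
    have hvl : ∀ μ i (h : O), T' (h • wedge (M.vert (M.e μ)) (M.dO i)) = 0 := fun μ i =>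
      e _ fun k w => hprod _ _ _ _ _ (hq i ▸ hΦ.vertical_linear k w _ (q i))
        (hq i ▸ hΨ.vertical_linear k w _ (q i))
    intro ξ ζ h
    rcases ξ with i | μ <;> rcases ζ with i' | μ'
    · change T' (h • wedge (M.dO i) (M.dO i')) = 0
      rw [← hq i, ← hq i']
      exact e _ (fun k w => hprod _ _ _ _ _ (hΦ.linear_linear k w (q i) (q i'))
        (hΨ.linear_linear k w (q i) (q i'))) h
    · change T' (h • wedge (M.dO i) (M.vert (M.e μ'))) = 0
      rw [wedge_neg, smul_neg, map_neg, hvl, neg_zero]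
    · exact hvl μ i' h
    · exact e _ (fun k w => hprod _ _ _ _ _ (hΦ.vertical_vertical k w _ _)
        (hΨ.vertical_vertical k w _ _)) h
  have hall : ∀ β, T' β = 0 := fun β => by
    have h2 : algebraMap ℝ O 2⁻¹ * 2 = 1 := by
      rw [← map_ofNat (algebraMap ℝ O) 2, ← map_mul]; norm_num
    rw [← one_smul O β, ← h2, ← smul_smul, M.bi_expand]
    simp only [Finset.smul_sum, smul_smul, map_sum, h0, Finset.sum_const_zero]
  obtain ⟨β, hβ⟩ := exists_rep m π
  have h1 : T π = T' β + T (π - AdicCompletion.of I (biDer O) β) := by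
    change _ = T (AdicCompletion.of I (biDer O) β) + _
    rw [← hadd, add_sub_cancel]
  rw [hall, zero_add] at h1
  have h2 : T (π - AdicCompletion.of I (biDer O) β) = 0 := hrep _ (by
    rw [Rep, map_sub, hβ, rep_of m β, sub_self, Submodule.Quotient.mk_zero])
  rw [h2] at h1
  exact sub_eq_zero.1 h1

/-! ### Values on generators -/

/-- The values of a sequence of operations on generators. -/
structure GenVals (I : Ideal O) (c : ℕ → ℝ) (π : AdicCompletion I (biDer O))
    (l : ∀ n, MultilinearMap ℝ (fun _ : Fin n => A) A) : Prop where
  fun_fun : ∀ (k : ℕ) (v : Fin k → S) (f g : B) (β : biDer O), Rep I (k + 1) π β →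
    l (k + 2) (Fin.append (fun i => M.sec (v i)) ![M.j f, M.j g]) =
      c (k + 2) • M.j (M.r (M.lieL (List.ofFn v) (X2 β) [M.p f, M.p g]))
  fun_lin : ∀ (k : ℕ) (v : Fin k → S) (f : B) (w : L) (β : biDer O), Rep I (k + 1) π β →
    M.con w (l (k + 1) (Fin.append (fun i => M.sec (v i)) ![M.j f])) =
      c (k + 1) • M.j (M.r (M.lieL (List.ofFn v) (X2 β) [M.p f, M.lin w]))
  lin_lin : ∀ (k : ℕ) (v : Fin k → S) (w w' : L) (β : biDer O), Rep I (k + 1) π β →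
    M.con w' (M.con w (l k fun i => M.sec (v i))) =
      c k • M.j (M.r (M.lieL (List.ofFn v) (X2 β) [M.lin w, M.lin w']))

lemma corr_append {n k : ℕ} {φ : MultilinearMap ℝ (fun _ : Fin (n + k) => A) A}
    {ψ : List (Hom 𝒜) → A} (h : Corr φ ψ) (v : Fin n → S) (x : Fin k → Hom 𝒜) :
    φ (Fin.append (fun i => M.sec (v i)) fun i => (x i).val) =
      dsgn (List.ofFn x) • ψ ((List.ofFn v).map M.hs ++ List.ofFn x) := by
  have h1 := h (Fin.append (fun i => M.hs (v i)) x)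
  have h2 : (fun i => (Fin.append (fun i => M.hs (v i)) x i).val) =
      Fin.append (fun i => M.sec (v i)) fun i => (x i).val := by
    funext i
    refine Fin.addCases (fun i => ?_) (fun i => ?_) i
    · simp [hs]
    · simp
  have h3 : List.ofFn (Fin.append (fun i => M.hs (v i)) x) =
      (List.ofFn v).map M.hs ++ List.ofFn x := by
    rw [List.ofFn_fin_append, List.map_ofFn]; rfl
  rw [h2, h3, M.dsgn_hs] at h1
  exact h1

lemma corr_sec_fun_fun {n : ℕ} {φ : MultilinearMap ℝ (fun _ : Fin (n + 2) => A) A}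
    {ψ : List (Hom 𝒜) → A} (h : Corr φ ψ) (v : Fin n → S) (f g : B) :
    φ (Fin.append (fun i => M.sec (v i)) ![M.j f, M.j g]) =
      -ψ ((List.ofFn v).map M.hs ++ [M.hj f, M.hj g]) := by
  have := M.corr_append h v ![M.hj f, M.hj g]
  have e : (fun i => (![M.hj f, M.hj g] i).val) = ![M.j f, M.j g] := by
    funext i; fin_cases i <;> rfl
  rw [e] at this
  rw [this]
  simp [dsgn, hj]

lemma corr_sec_fun {n : ℕ} {φ : MultilinearMap ℝ (fun _ : Fin (n + 1) => A) A}
    {ψ : List (Hom 𝒜) → A} (h : Corr φ ψ) (v : Fin n → S) (f : B) :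
    φ (Fin.append (fun i => M.sec (v i)) ![M.j f]) = ψ ((List.ofFn v).map M.hs ++ [M.hj f]) := by
  have := M.corr_append h v ![M.hj f]
  have e : (fun i => (![M.hj f] i).val) = ![M.j f] := by
    funext i; fin_cases i; rfl
  rw [e] at this
  rw [this]
  simp [dsgn]

lemma corr_sec {n : ℕ} {φ : MultilinearMap ℝ (fun _ : Fin n => A) A}
    {ψ : List (Hom 𝒜) → A} (h : Corr φ ψ) (v : Fin n → S) :
    φ (fun i => M.sec (v i)) = ψ ((List.ofFn v).map M.hs) := by
  have h1 := h fun i => M.hs (v i)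
  have h3 : List.ofFn (fun i => M.hs (v i)) = (List.ofFn v).map M.hs ++ [] := by
    rw [List.map_ofFn, List.append_nil]; rfl
  rw [h3, M.dsgn_hs, dsgn, one_smul, List.append_nil] at h1
  exact h1

lemma genVals_phi (hI : ∀ h, h ∈ I ↔ M.r h = 0) (c : ℕ → ℝ) (π : AdicCompletion I (biDer O)) :
    M.GenVals I c π fun n => c n • (M.phi hI π).1 n where
  fun_fun k v f g β hβ := by
    obtain ⟨β', hβ'⟩ := exists_rep (k + 3) π
    rw [smul_apply, M.phi_apply hI π (k + 2) (Nat.lt_succ_self _) hβ',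
      M.corr_sec_fun_fun (M.F_corr _ 2 _), M.om_sec_fun_fun _ _ _ (isMV_X2 _), neg_neg,
      M.r_lieL_congr hI (List.ofFn v) (N := k + 1) (by simp) hβ (hβ'.mono (by omega))]
  fun_lin k v f w β hβ := by
    obtain ⟨β', hβ'⟩ := exists_rep (k + 2) π
    rw [smul_apply, M.phi_apply hI π (k + 1) (Nat.lt_succ_self _) hβ', map_smul,
      M.corr_sec_fun (M.F_corr _ 2 _), M.om_sec_fun _ _ _ (isMV_X2 _),
      M.r_lieL_congr hI (List.ofFn v) (N := k + 1) (by simp) hβ (hβ'.mono (by omega))]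
  lin_lin k v w w' β hβ := by
    rw [smul_apply, M.phi_apply hI π k (Nat.lt_succ_self _) hβ, map_smul, map_smul,
      M.corr_sec (M.F_corr _ 2 _), M.om_sec _ _ _ (isMV_X2 _)]

lemma genVals_unique {c : ℕ → ℝ} {π : AdicCompletion I (biDer O)}
    {l l' : ∀ n, MultilinearMap ℝ (fun _ : Fin n => A) A} (hl : ∀ n, IsMultiDer 𝒜 (l n))
    (hl' : ∀ n, IsMultiDer 𝒜 (l' n)) (h : M.GenVals I c π l) (h' : M.GenVals I c π l') :
    l = l' := by
  have hs := (M.symm_smd l hl).sub (M.symm_smd l' hl')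
  have key : ∀ t : List (Hom 𝒜), symm l t - symm l' t = 0 := by
    refine M.smd_eq_zero hs fun v f => ?_
    have hm := fun l (hl : ∀ n, IsMultiDer 𝒜 (l n)) => (M.symm_smd l hl).mem
      (v.map M.hs ++ f.map M.hj)
    rw [M.bsum_sorted] at hm
    obtain ⟨β, hβ⟩ := exists_rep (v.length + 1) π
    have ev : List.ofFn v.get = v := List.ofFn_get v
    rcases f with _ | ⟨f, _ | ⟨g, _ | ⟨g', f'⟩⟩⟩
    · have h1 := fun w w' => (h.lin_lin _ v.get w w' β hβ).trans (h'.lin_lin _ v.get w w' β hβ).symm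
      rw [M.corr_sec (corr_symm l _), M.corr_sec (corr_symm l' _), ev] at h1
      simp only [List.map_nil, List.append_nil] at hm ⊢
      rw [sub_eq_zero]
      refine M.eq_of_con (n := 1) (deg_cast (hm l hl) (by simp)) (deg_cast (hm l' hl') (by simp))
        fun w => ?_
      exact M.eq_of_con (n := 0) (deg_cast (M.con_mem w _ _ (hm l hl)) (by simp))
        (deg_cast (M.con_mem w _ _ (hm l' hl')) (by simp)) fun w' => h1 w w'
    · have h1 := fun w => (h.fun_lin _ v.get f w β hβ).trans (h'.fun_lin _ v.get f w β hβ).symm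
      rw [M.corr_sec_fun (corr_symm l _), M.corr_sec_fun (corr_symm l' _), ev] at h1
      simp only [List.map_nil, List.map_cons] at hm ⊢
      rw [sub_eq_zero]
      exact M.eq_of_con (n := 0) (deg_cast (hm l hl) (by simp)) (deg_cast (hm l' hl') (by simp)) h1
    · have h1 := (h.fun_fun _ v.get f g β hβ).trans (h'.fun_fun _ v.get f g β hβ).symm
      rw [M.corr_sec_fun_fun (corr_symm l _), M.corr_sec_fun_fun (corr_symm l' _), ev] at h1
      exact sub_eq_zero.2 (neg_injective h1)
    · have h0 : ∀ l (hl : ∀ n, IsMultiDer 𝒜 (l n)), symm l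
          (v.map M.hs ++ (f :: g :: g' :: f').map M.hj) = 0 := fun l hl =>
        M.neg_eq _ _ (by simp only [List.length_cons]; push_cast; linarith) (hm l hl)
      rw [h0 l hl, h0 l' hl', sub_zero]
  funext n
  exact M.eq_of_corr (corr_symm l n) (corr_symm l' n) fun t _ => sub_eq_zero.1 (key t)

end Model

/-! ### Composition of symmetric multiderivations -/

section Composition

variable {A : Type*} [Ring A] [Algebra ℝ A] {𝒜 : ℤ → Submodule ℝ A}

variable (𝒜) in
/-- A symmetric multiderivation together with its degree. -/
@[ext] structure SM where
  /-- the degree -/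
  d : ℤ
  /-- the values -/
  fn : List (Hom 𝒜) → A
  smd : SMD 𝒜 d fn

/-- Insertion of a first argument. -/
def SM.ins (χ : SM 𝒜) (x : Hom 𝒜) : SM 𝒜 := ⟨χ.d + (x.deg - 1), fun t => χ.fn (x :: t), χ.smd.ins x⟩

/-- The value without arguments. -/
def SM.val (χ : SM 𝒜) : Hom 𝒜 := ⟨χ.d + 1, χ.fn [], deg_cast (χ.smd.mem []) (by simp [bsum])⟩

/-- The sum over all ways of distributing the arguments to `χ` and `ψ` of the values of `ψ` on the
values of `χ`. -/
def JJ : List (Hom 𝒜) → SM 𝒜 → SM 𝒜 → A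
  | [], χ, ψ => ψ.fn [χ.val]
  | x :: t, χ, ψ => JJ t (χ.ins x) ψ + sgn ((x.deg - 1) * χ.d) • JJ t χ (ψ.ins x)

/-- The sum over all ways of distributing the arguments of the products of the values. -/
def NN : List (Hom 𝒜) → SM 𝒜 → SM 𝒜 → A
  | [], χ, θ => θ.fn [] * χ.fn []
  | x :: t, χ, θ => NN t (χ.ins x) θ + sgn ((x.deg - 1) * (χ.d + 1)) • NN t χ (θ.ins x)

lemma JJ_lin_left (t : List (Hom 𝒜)) (χ χ₁ χ₂ ψ : SM 𝒜) (c c' : ℝ) (h1 : χ₁.d = χ.d)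
    (h2 : χ₂.d = χ.d) (h : ∀ l, χ.fn l = c • χ₁.fn l + c' • χ₂.fn l) :
    JJ t χ ψ = c • JJ t χ₁ ψ + c' • JJ t χ₂ ψ := by
  induction t generalizing χ χ₁ χ₂ ψ with
  | nil =>
    obtain ⟨d, f, hf⟩ := χ
    obtain ⟨d₁, f₁, hf₁⟩ := χ₁
    obtain ⟨d₂, f₂, hf₂⟩ := χ₂
    obtain rfl : d₁ = d := h1
    obtain rfl : d₂ = d₁ := h2
    have m1 : f₁ [] ∈ 𝒜 (d₂ + 1) := (SM.mk d₂ f₁ hf₁).val.mem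
    have m2 : f₂ [] ∈ 𝒜 (d₂ + 1) := (SM.mk d₂ f₂ hf₂).val.mem
    have e := ψ.smd.add (d₂ + 1) _ _ (Submodule.smul_mem _ c m1) (Submodule.smul_mem _ c' m2)
      (add_mem (Submodule.smul_mem _ c m1) (Submodule.smul_mem _ c' m2)) []
    rw [ψ.smd.smul (d₂ + 1) c _ m1, ψ.smd.smul (d₂ + 1) c' _ m2] at e
    refine Eq.trans ?_ e
    change ψ.fn [_] = ψ.fn [_]
    congr 2
    exact Hom.ext rfl (h [])
  | cons x t ih =>
    have h1' : (χ₁.ins x).d = (χ.ins x).d := by simp [SM.ins, h1]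
    have h2' : (χ₂.ins x).d = (χ.ins x).d := by simp [SM.ins, h2]
    simp only [JJ]
    rw [ih (χ.ins x) (χ₁.ins x) (χ₂.ins x) ψ h1' h2' fun l => h (x :: l),
      ih χ χ₁ χ₂ (ψ.ins x) h1 h2 h, h1, h2]
    simp only [smul_add, smul_comm c, smul_comm c']
    abel

lemma JJ_lin_right (t : List (Hom 𝒜)) (χ ψ ψ₁ ψ₂ : SM 𝒜) (c c' : ℝ)
    (h : ∀ l, ψ.fn l = c • ψ₁.fn l + c' • ψ₂.fn l) :
    JJ t χ ψ = c • JJ t χ ψ₁ + c' • JJ t χ ψ₂ := by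
  induction t generalizing χ ψ ψ₁ ψ₂ with
  | nil => exact h _
  | cons x t ih =>
    simp only [JJ]
    rw [ih (χ.ins x) ψ ψ₁ ψ₂ h,
      ih χ (ψ.ins x) (ψ₁.ins x) (ψ₂.ins x) fun l => h (x :: l)]
    simp only [smul_add, smul_comm c, smul_comm c']
    abel

lemma JJ_smul_left (t : List (Hom 𝒜)) (χ χ₁ ψ : SM 𝒜) (c : ℝ) (h1 : χ₁.d = χ.d)
    (h : ∀ l, χ.fn l = c • χ₁.fn l) : JJ t χ ψ = c • JJ t χ₁ ψ := by
  rw [JJ_lin_left t χ χ₁ χ₁ ψ c 0 h1 h1 (by simpa using h)]; simp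

lemma JJ_smul_right (t : List (Hom 𝒜)) (χ ψ ψ₁ : SM 𝒜) (c : ℝ)
    (h : ∀ l, ψ.fn l = c • ψ₁.fn l) : JJ t χ ψ = c • JJ t χ ψ₁ := by
  rw [JJ_lin_right t χ ψ ψ₁ ψ₁ c 0 (by simpa using h)]; simp

lemma NN_smul_right (t : List (Hom 𝒜)) (χ θ θ₁ : SM 𝒜) (c : ℝ)
    (h : ∀ l, θ.fn l = c • θ₁.fn l) : NN t χ θ = c • NN t χ θ₁ := by
  induction t generalizing χ θ θ₁ with
  | nil => simp [NN, h]
  | cons x t ih =>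
    simp only [NN]
    rw [ih (χ.ins x) θ θ₁ h, ih χ (θ.ins x) (θ₁.ins x) fun l => h (x :: l), smul_add, smul_comm c]

lemma JJ_swap (l : List (Hom 𝒜)) (a b : Hom 𝒜) (t : List (Hom 𝒜)) (χ ψ : SM 𝒜) :
    JJ (l ++ a :: b :: t) χ ψ =
      sgn ((a.deg - 1) * (b.deg - 1)) • JJ (l ++ b :: a :: t) χ ψ := by
  induction l generalizing χ ψ with
  | nil =>
    simp only [List.nil_append, JJ]
    rw [JJ_smul_left t ((χ.ins a).ins b) ((χ.ins b).ins a) ψ (sgn ((a.deg - 1) * (b.deg - 1)))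
      (by simp only [SM.ins]; ring) fun l => χ.smd.swap_head a b l,
      JJ_smul_right t χ ((ψ.ins a).ins b) ((ψ.ins b).ins a) (sgn ((a.deg - 1) * (b.deg - 1)))
      fun l => ψ.smd.swap_head a b l]
    simp only [SM.ins, smul_add, sgn_smul_smul]
    have e1 : sgn ((b.deg - 1) * (χ.d + (a.deg - 1))) =
        sgn ((a.deg - 1) * (b.deg - 1) + (b.deg - 1) * χ.d) := by congr 1; ring
    have e2 : sgn ((a.deg - 1) * χ.d) =
        sgn ((a.deg - 1) * (b.deg - 1) + (a.deg - 1) * (χ.d + (b.deg - 1))) :=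
      sgn_congr (by simp only [parity_simps]; grind)
    have e3 : sgn ((a.deg - 1) * χ.d + ((b.deg - 1) * χ.d + (a.deg - 1) * (b.deg - 1))) =
        sgn ((a.deg - 1) * (b.deg - 1) + ((b.deg - 1) * χ.d + (a.deg - 1) * χ.d)) := by
      congr 1; ring
    rw [e1, e3, ← e2]
    abel
  | cons x l ih =>
    simp only [List.cons_append, JJ]
    rw [ih, ih, smul_add, smul_comm (sgn ((x.deg - 1) * χ.d))]

lemma JJ_mem
    (t : List (Hom 𝒜)) (χ ψ : SM 𝒜) : JJ t χ ψ ∈ 𝒜 (χ.d + ψ.d + 1 + bsum t) := by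
  induction t generalizing χ ψ with
  | nil => exact deg_cast (ψ.smd.mem _) (by simp [bsum, SM.val]; ring)
  | cons x t ih =>
    exact add_mem (deg_cast (ih _ _) (by simp only [bsum, SM.ins]; ring))
      (Submodule.smul_mem _ _ (deg_cast (ih _ _) (by simp only [bsum, SM.ins]; ring)))

lemma JJ_mul_right (t : List (Hom 𝒜)) (χ ψ ψ' : SM 𝒜) (b : A) (h : ∀ l, ψ'.fn l = b * ψ.fn l) :
    JJ t χ ψ' = b * JJ t χ ψ := by
  induction t generalizing χ ψ ψ' with
  | nil => exact h _
  | cons x t ih =>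
    simp only [JJ]
    rw [ih (χ.ins x) ψ ψ' h, ih χ (ψ.ins x) (ψ'.ins x) fun l => h (x :: l),
      ← mul_smul_comm]
    exact (mul_add _ _ _).symm

/-- The graded commutator of two symmetric multiderivations. -/
def SS (χ ψ : SM 𝒜) (t : List (Hom 𝒜)) : A := JJ t χ ψ - sgn (χ.d * ψ.d) • JJ t ψ χ

end Composition

namespace Model

variable {B O A : Type*} [CommRing B] [Algebra ℝ B] [CommRing O] [Algebra ℝ O]
  [Ring A] [Algebra ℝ A] {𝒜 : ℤ → Submodule ℝ A} {S L κ η : Type*} [Fintype κ] [Fintype η]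
  (M : Model B O A 𝒜 S L κ η)

lemma JJ_mul_left (M : Model B O A 𝒜 S L κ η) (t : List (Hom 𝒜)) (χ χ' ψ : SM 𝒜) (b : Hom 𝒜)
    (hd : χ'.d = χ.d + b.deg) (h : ∀ l, χ'.fn l = b.val * χ.fn l) :
    JJ t χ' ψ = sgn (ψ.d * b.deg) • (b.val * JJ t χ ψ) + NN t χ (ψ.ins b) := by
  induction t generalizing χ χ' ψ with
  | nil =>
    have m : b.val * χ.val.val ∈ 𝒜 (b.deg + χ.val.deg) := M.mul_mem _ _ _ _ b.mem χ.val.mem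
    have e := ψ.smd.mul b χ.val m []
    have e1 : (⟨_, _, m⟩ : Hom 𝒜) = χ'.val :=
      Hom.ext (by simp only [SM.val, hd]; ring) (h []).symm
    rw [e1] at e
    simp only [JJ, NN]
    rw [e]
    congr 1
    change _ • (χ.fn [] * ψ.fn [b]) = ψ.fn [b] * χ.fn []
    have hc : χ.fn [] * ψ.fn [b] = sgn _ • (ψ.fn [b] * χ.fn []) :=
      M.comm _ _ _ _ χ.val.mem (ψ.smd.mem [b])
    rw [hc, sgn_smul_smul, sgn_of_even, one_smul]
    simp only [SM.val, bsum]; simp only [parity_simps]; grind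
  | cons x t ih =>
    have hx : ∀ l, (χ'.ins x).fn l = b.val * (χ.ins x).fn l := fun l => h (x :: l)
    simp only [JJ, NN]
    rw [ih (χ.ins x) (χ'.ins x) ψ (by simp only [SM.ins, hd]; ring) hx, ih χ χ' (ψ.ins x) hd h,
      NN_smul_right t χ ((ψ.ins x).ins b) ((ψ.ins b).ins x) _ fun l => ψ.smd.swap_head x b l, hd,
      M.left_distrib_A]
    simp only [smul_add, sgn_smul_smul, mul_smul_comm]
    have e1 : sgn ((x.deg - 1) * (χ.d + b.deg) + (ψ.ins x).d * b.deg) =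
        sgn (ψ.d * b.deg + (x.deg - 1) * χ.d) :=
      sgn_congr (by simp only [SM.ins]; simp only [parity_simps]; grind)
    have e2 : sgn ((x.deg - 1) * (χ.d + b.deg) + (x.deg - 1) * (b.deg - 1)) =
        sgn ((x.deg - 1) * (χ.d + 1)) := sgn_congr (by simp only [parity_simps]; grind)
    rw [e1, e2]
    abel

lemma NN_comm (M : Model B O A 𝒜 S L κ η) (t : List (Hom 𝒜)) (χ θ : SM 𝒜) :
    NN t χ θ = sgn ((χ.d + 1) * (θ.d + 1)) • NN t θ χ := by
  induction t generalizing χ θ with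
  | nil =>
    simp only [NN]
    have := M.comm _ _ _ _ θ.val.mem χ.val.mem
    rw [mul_comm θ.val.deg] at this
    exact this
  | cons x t ih =>
    simp only [NN]
    rw [ih (χ.ins x), ih χ (θ.ins x), smul_add, sgn_smul_smul, sgn_smul_smul, add_comm]
    congr 2
    · exact sgn_congr (by simp only [SM.ins]; simp only [parity_simps]; grind)
    · exact sgn_congr (by simp only [SM.ins]; simp only [parity_simps]; grind)

lemma JJ_head_mul (M : Model B O A 𝒜 S L κ η) (b c : Hom 𝒜)
    (hbc : b.val * c.val ∈ 𝒜 (b.deg + c.deg)) (t : List (Hom 𝒜)) (χ ψ : SM 𝒜) :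
    JJ (⟨_, _, hbc⟩ :: t) χ ψ = sgn ((χ.d + ψ.d) * b.deg) • (b.val * JJ (c :: t) χ ψ) +
      sgn ((χ.d + ψ.d) * c.deg + b.deg * c.deg) • (c.val * JJ (b :: t) χ ψ) +
      (sgn (χ.d * b.deg) • NN t (χ.ins c) (ψ.ins b) +
        sgn (χ.d * c.deg + b.deg * c.deg) • NN t (χ.ins b) (ψ.ins c)) := by
  have lm : ∀ (b : Hom 𝒜) (χ : SM 𝒜), SMD 𝒜 (χ.d + b.deg) fun l => b.val * χ.fn l := by
    intro b χ
    refine ⟨fun l => deg_cast (M.mul_mem _ _ _ _ b.mem (χ.smd.mem l)) (by ring), fun l x y t => ?_,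
      fun i x y hx hy hxy t => ?_, fun i r x hx hrx t => ?_, fun x y hxy t => ?_⟩
    · rw [χ.smd.swap, mul_smul_comm]
    · rw [χ.smd.add i x y hx hy, M.left_distrib_A]
    · rw [χ.smd.smul i r x hx, mul_smul_comm]
    · rw [χ.smd.mul, M.left_distrib_A, mul_smul_comm, mul_smul_comm,
        M.comm_left _ _ _ _ _ b.mem x.mem, M.comm_left _ _ _ _ _ b.mem y.mem, sgn_smul_smul,
        sgn_smul_smul]
      congr 2
      · exact sgn_congr (by simp only [parity_simps]; grind)
      · exact sgn_congr (by simp only [parity_simps]; grind)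
  set P : Hom 𝒜 → SM 𝒜 → SM 𝒜 := fun b χ => ⟨χ.d + b.deg, _, lm b χ⟩ with hP
  simp only [JJ]
  rw [JJ_lin_left t (χ.ins ⟨_, _, hbc⟩) (P b (χ.ins c)) (P c (χ.ins b)) ψ _ _
      (by simp only [hP, SM.ins]; ring) (by simp only [hP, SM.ins]; ring)
      fun l => χ.smd.mul b c hbc l,
    JJ_lin_right t χ (ψ.ins ⟨_, _, hbc⟩) (P b (ψ.ins c)) (P c (ψ.ins b)) _ _
      fun l => ψ.smd.mul b c hbc l,
    M.JJ_mul_left t (χ.ins c) (P b (χ.ins c)) ψ b rfl fun l => rfl,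
    M.JJ_mul_left t (χ.ins b) (P c (χ.ins b)) ψ c rfl fun l => rfl,
    JJ_mul_right t χ (ψ.ins c) (P b (ψ.ins c)) b.val fun l => rfl,
    JJ_mul_right t χ (ψ.ins b) (P c (ψ.ins b)) c.val fun l => rfl,
    M.left_distrib_A, M.left_distrib_A]
  simp only [smul_add, sgn_smul_smul, mul_smul_comm]
  have e1 : sgn ((b.deg + c.deg - 1) * χ.d + ψ.d * b.deg) =
    sgn ((χ.d + ψ.d) * b.deg + (c.deg - 1) * χ.d) := sgn_congr (by simp only [parity_simps]; grind)
  have e2 : sgn ((b.deg + c.deg - 1) * χ.d + (ψ.d * c.deg + b.deg * c.deg)) =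
    sgn ((χ.d + ψ.d) * c.deg + b.deg * c.deg + (b.deg - 1) * χ.d) :=
    sgn_congr (by simp only [parity_simps]; grind)
  have e3 : sgn (χ.d * b.deg + ψ.d * b.deg) = sgn ((χ.d + ψ.d) * b.deg) := by congr 1; ring
  have e4 : sgn (χ.d * c.deg + b.deg * c.deg + ψ.d * c.deg) =
    sgn ((χ.d + ψ.d) * c.deg + b.deg * c.deg) := by congr 1; ring
  rw [e1, e2, e3, e4]
  abel

lemma SS_smd (M : Model B O A 𝒜 S L κ η) (χ ψ : SM 𝒜) : SMD 𝒜 (χ.d + ψ.d) (SS χ ψ) where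
  mem l := sub_mem (JJ_mem l χ ψ)
    (Submodule.smul_mem _ _ (deg_cast (JJ_mem l ψ χ) (by ring)))
  swap l a b t := by
    simp only [SS]
    rw [JJ_swap l a b t χ ψ, JJ_swap l a b t ψ χ, smul_sub, smul_comm (sgn (χ.d * ψ.d))]
  add i a b ha hb hab t := by
    have h1 : ∀ χ ψ : SM 𝒜, JJ (⟨i, a + b, hab⟩ :: t) χ ψ =
        JJ (⟨i, a, ha⟩ :: t) χ ψ + JJ (⟨i, b, hb⟩ :: t) χ ψ := fun χ ψ => by
      simp only [JJ]
      rw [JJ_lin_left t (χ.ins ⟨i, a + b, hab⟩) (χ.ins ⟨i, a, ha⟩) (χ.ins ⟨i, b, hb⟩) ψ 1 1 rfl rfl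
          (fun l => by rw [one_smul, one_smul]; exact χ.smd.add i a b ha hb hab l),
        JJ_lin_right t χ (ψ.ins ⟨i, a + b, hab⟩) (ψ.ins ⟨i, a, ha⟩) (ψ.ins ⟨i, b, hb⟩) 1 1
          (fun l => by rw [one_smul, one_smul]; exact ψ.smd.add i a b ha hb hab l)]
      simp only [one_smul, smul_add]; abel
    simp only [SS]
    rw [h1, h1, smul_add]; abel
  smul i c a ha hca t := by
    have h1 : ∀ χ ψ : SM 𝒜, JJ (⟨i, c • a, hca⟩ :: t) χ ψ = c • JJ (⟨i, a, ha⟩ :: t) χ ψ :=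
      fun χ ψ => by
        simp only [JJ]
        rw [JJ_smul_left t (χ.ins ⟨i, c • a, hca⟩) (χ.ins ⟨i, a, ha⟩) ψ c rfl
            (fun l => χ.smd.smul i c a ha hca l),
          JJ_smul_right t χ (ψ.ins ⟨i, c • a, hca⟩) (ψ.ins ⟨i, a, ha⟩) c
            (fun l => ψ.smd.smul i c a ha hca l), smul_add, smul_comm c]
    simp only [SS]
    rw [h1, h1, smul_sub, smul_comm c]
  mul b c hbc t := by
    simp only [SS]
    rw [M.JJ_head_mul b c hbc t χ ψ, M.JJ_head_mul b c hbc t ψ χ,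
      M.NN_comm t (ψ.ins c) (χ.ins b), M.NN_comm t (ψ.ins b) (χ.ins c)]
    simp only [smul_add, sgn_smul_smul, mul_sub, smul_sub, mul_smul_comm, SM.ins]
    have e1 : sgn (χ.d * ψ.d + (ψ.d + χ.d) * b.deg) = sgn ((χ.d + ψ.d) * b.deg + χ.d * ψ.d) := by
      congr 1; ring
    have e2 : sgn (χ.d * ψ.d + ((ψ.d + χ.d) * c.deg + b.deg * c.deg)) =
      sgn ((χ.d + ψ.d) * c.deg + b.deg * c.deg + χ.d * ψ.d) := by congr 1; ring
    have e3 : sgn (χ.d * ψ.d + (ψ.d * b.deg + (ψ.d + (c.deg - 1) + 1) * (χ.d + (b.deg - 1) + 1))) =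
      sgn (χ.d * c.deg + b.deg * c.deg) := sgn_congr (by simp only [parity_simps]; grind)
    have e4 : sgn (χ.d * ψ.d + (ψ.d * c.deg + b.deg * c.deg +
      (ψ.d + (b.deg - 1) + 1) * (χ.d + (c.deg - 1) + 1))) = sgn (χ.d * b.deg) :=
      sgn_congr (by simp only [parity_simps]; grind)
    rw [e1, e2, e3, e4]
    abel

end Model

section Bracket

variable {O : Type*} [CommRing O] [Algebra ℝ O]

/-- The Schouten bracket of a `k`-vector field and an `l`-vector field, up to a sign. -/
def Br : List O → ℕ → ℕ → (List O → O) → (List O → O) → O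
  | [], k, l, Q, R => if k = 1 ∧ l = 0 then Q [R []] else if k = 0 ∧ l = 1 then -R [Q []] else 0
  | z :: t, k, l, Q, R => (prev l fun l' => Br t k l' Q (ins z R)) -
      sgn l • prev k fun k' => Br t k' l (ins z Q) R

lemma Br_add_left (t : List O) (k l : ℕ) (Q Q' R : List O → O) (hR : IsMV l R) :
    Br t k l (Q + Q') R = Br t k l Q R + Br t k l Q' R := by
  induction t generalizing k l Q Q' R with
  | nil =>
    simp only [Br]
    split_ifs with h1 h2
    · rfl
    · obtain ⟨rfl, rfl⟩ := h2
      have := congrFun (hR.2.1 (Q []) (Q' [])) []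
      change -R [Q [] + Q' []] = _
      rw [show R [Q [] + Q' []] = R [Q []] + R [Q' []] from this]; ring
    · simp
  | cons z t ih =>
    simp only [Br]
    have h1 : ∀ k', Br t k' l (ins z (Q + Q')) R = Br t k' l (ins z Q) R + Br t k' l (ins z Q') R :=
      fun k' => by rw [map_add, ih _ _ _ _ _ hR]
    rcases l with _ | l
    · cases k <;> simp only [prev_zero, prev_succ, h1, smul_add, smul_zero] <;> ring
    · cases k <;> simp only [prev_zero, prev_succ, h1, smul_add, smul_zero,
        ih _ _ _ _ _ (hR.ins z)] <;> abel

lemma Br_add_right (t : List O) (k l : ℕ) (Q R R' : List O → O) (hQ : IsMV k Q) :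
    Br t k l Q (R + R') = Br t k l Q R + Br t k l Q R' := by
  induction t generalizing k l Q R R' with
  | nil =>
    simp only [Br]
    split_ifs with h1 h2
    · obtain ⟨rfl, rfl⟩ := h1
      exact congrFun (hQ.2.1 (R []) (R' [])) []
    · simp; ring
    · simp
  | cons z t ih =>
    simp only [Br]
    have h1 : ∀ l', Br t k l' Q (ins z (R + R')) = Br t k l' Q (ins z R) + Br t k l' Q (ins z R') :=
      fun k' => by rw [map_add, ih _ _ _ _ _ hQ]
    rcases k with _ | k
    · cases l <;> simp only [prev_zero, prev_succ, h1, smul_zero] <;> ring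
    · cases l <;> simp only [prev_zero, prev_succ, h1, smul_add, ih _ _ _ _ _ (hQ.ins z)] <;> abel

lemma lie_Br (D : Derivation ℝ O O) (t : List O) (k l : ℕ) (Q R : List O → O) (hQ : IsMV k Q)
    (hR : IsMV l R) : lie D (fun t => Br t k l Q R) t =
      Br t k l (lie D Q) R + Br t k l Q (lie D R) := by
  induction t generalizing k l Q R with
  | nil =>
    rw [lie_nil]
    simp only [Br]
    split_ifs with h1 h2
    · simp only [lie_cons, lie_nil, ins_apply]; ring
    · simp only [lie_cons, lie_nil, ins_apply, map_neg]; ring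
    · simp
  | cons z t ih =>
    have e : ins z (fun t => Br t k l Q R) = (prev l fun l' => fun t => Br t k l' Q (ins z R)) -
        sgn l • prev k fun k' => fun t => Br t k' l (ins z Q) R := by
      funext t
      rw [ins_apply]
      cases k <;> cases l <;> rfl
    rw [lie_cons, e, map_sub, map_smul]
    have s1 : ∀ k', IsMV (k' + 1) Q → Br t k' l (ins z (lie D Q)) R =
        Br t k' l (lie D (ins z Q)) R - Br t k' l (ins (D z) Q) R := fun k' h => by
      rw [eq_sub_iff_add_eq, ← Br_add_left _ _ _ _ _ _ hR, ins_lie, sub_add_cancel]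
    have s2 : ∀ l', IsMV (l' + 1) R → Br t k l' Q (ins z (lie D R)) =
        Br t k l' Q (lie D (ins z R)) - Br t k l' Q (ins (D z) R) := fun k' h => by
      rw [eq_sub_iff_add_eq, ← Br_add_right _ _ _ _ _ _ hQ, ins_lie, sub_add_cancel]
    simp only [Br, Pi.sub_apply, Pi.smul_apply]
    rcases k with _ | k <;> rcases l with _ | l
    · simp
    · simp only [prev_zero, prev_succ, s2 l hR, ih 0 l Q _ hQ (hR.ins z), map_zero, Pi.zero_apply,
        smul_zero]
      abel
    · simp only [prev_zero, prev_succ, s1 k hQ, ih k 0 _ R (hQ.ins z) hR, map_zero, Pi.zero_apply,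
        smul_add, smul_sub]
      abel
    · simp only [prev_succ, s1 k hQ, s2 l hR, ih k (l + 1) _ R (hQ.ins z) hR,
        ih (k + 1) l Q _ hQ (hR.ins z), smul_add, smul_sub]
      abel

end Bracket

namespace Model

variable {B O A : Type*} [CommRing B] [Algebra ℝ B] [CommRing O] [Algebra ℝ O]
  [Ring A] [Algebra ℝ A] {𝒜 : ℤ → Submodule ℝ A} {S L κ η : Type*} [Fintype κ] [Fintype η]
  (M : Model B O A 𝒜 S L κ η)

lemma SS_cons (x : Hom 𝒜) (t : List (Hom 𝒜)) (χ ψ : SM 𝒜) : SS χ ψ (x :: t) =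
    SS (χ.ins x) ψ t + sgn ((x.deg - 1) * χ.d) • SS χ (ψ.ins x) t := by
  simp only [SS, JJ, smul_add, smul_sub, sgn_smul_smul, SM.ins]
  have e1 : (χ.d + (x.deg - 1)) * ψ.d = χ.d * ψ.d + (x.deg - 1) * ψ.d := by ring
  have e2 : sgn ((x.deg - 1) * χ.d + χ.d * (ψ.d + (x.deg - 1))) = sgn (χ.d * ψ.d) :=
    sgn_congr (by simp only [parity_simps]; grind)
  rw [e1, e2]
  abel

lemma SS_smul_left (t : List (Hom 𝒜)) (χ χ₁ ψ : SM 𝒜) (c : ℝ) (h1 : χ₁.d = χ.d)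
    (h : ∀ l, χ.fn l = c • χ₁.fn l) : SS χ ψ t = c • SS χ₁ ψ t := by
  rw [SS, JJ_smul_left t χ χ₁ ψ c h1 h, JJ_smul_right t ψ χ χ₁ c h, smul_comm, ← smul_sub, SS, h1]

lemma SS_smul_right (t : List (Hom 𝒜)) (χ ψ ψ₁ : SM 𝒜) (c : ℝ) (h1 : ψ₁.d = ψ.d)
    (h : ∀ l, ψ.fn l = c • ψ₁.fn l) : SS χ ψ t = c • SS χ ψ₁ t := by
  rw [SS, JJ_smul_left t ψ ψ₁ χ c h1 h, JJ_smul_right t χ ψ ψ₁ c h, smul_comm, ← smul_sub, SS, h1]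

lemma SS_antisymm (t : List (Hom 𝒜)) (χ ψ : SM 𝒜) :
    SS χ ψ t = -(sgn (χ.d * ψ.d) • SS ψ χ t) := by
  simp only [SS, smul_sub, sgn_smul_smul]
  rw [mul_comm ψ.d, sgn_of_even (a := χ.d * ψ.d + χ.d * ψ.d) ⟨_, rfl⟩]
  simp

/-- The symmetric multiderivation of a multivector field. -/
def sm (k : ℕ) (Q : List O → O) (hQ : IsMV k Q) : SM 𝒜 := ⟨k - 1, fun l => M.om l k Q, M.om_smd k Q hQ⟩

lemma sm_ins_hs (k : ℕ) (Q : List O → O) (hQ : IsMV k Q) (v : S) :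
    (M.sm k Q hQ).ins (M.hs v) = M.sm k (lie (M.vert v) Q) (hQ.lie _) :=
  SM.ext (by simp [sm, SM.ins, hs]) (funext fun l => M.om_hs v l k Q hQ)

open Classical in
/-- The graded commutator of the symmetric multiderivations of two multivector fields. -/
def ssv (t : List (Hom 𝒜)) (k l : ℕ) (Q R : List O → O) : A :=
  if h : IsMV k Q ∧ IsMV l R then SS (M.sm k Q h.1) (M.sm l R h.2) t else 0

lemma ssv_eq (t : List (Hom 𝒜)) {k l : ℕ} {Q R : List O → O} (hQ : IsMV k Q) (hR : IsMV l R) :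
    M.ssv t k l Q R = SS (M.sm k Q hQ) (M.sm l R hR) t := dif_pos ⟨hQ, hR⟩

lemma ssv_hs (v : S) (t : List (Hom 𝒜)) {k l : ℕ} {Q R : List O → O} (hQ : IsMV k Q)
    (hR : IsMV l R) : M.ssv (M.hs v :: t) k l Q R =
      M.ssv t k l (lie (M.vert v) Q) R + M.ssv t k l Q (lie (M.vert v) R) := by
  rw [M.ssv_eq _ hQ hR, M.ssv_eq _ (hQ.lie _) hR, M.ssv_eq _ hQ (hR.lie _), SS_cons, sm_ins_hs,
    sm_ins_hs]
  simp [hs]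

lemma ssv_hj (f : B) (t : List (Hom 𝒜)) {k l : ℕ} {Q R : List O → O} (hQ : IsMV k Q)
    (hR : IsMV l R) : M.ssv (M.hj f :: t) k l Q R = sgn (k + l + 1) •
      ((prev l fun l' => M.ssv t k l' Q (ins (M.p f) R)) -
        sgn l • prev k fun k' => M.ssv t k' l (ins (M.p f) Q) R) := by
  have h1 : SS ((M.sm k Q hQ).ins (M.hj f)) (M.sm l R hR) t =
      sgn k • prev k fun k' => M.ssv t k' l (ins (M.p f) Q) R := by
    rcases k with _ | k
    · rw [SS_smul_left t _ ((M.sm 0 Q hQ).ins (M.hj f)) _ 0 rfl fun l => ?_]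
      · simp
      · rw [zero_smul]; exact (M.om_hj f l 0 Q hQ).trans (by simp)
    · rw [prev_succ, M.ssv_eq _ (hQ.ins _) hR]
      exact SS_smul_left t _ _ _ _ (by simp [sm, SM.ins, hj, sub_eq_add_neg]) fun l => M.om_hj f l (k + 1) Q hQ
  have h2 : SS (M.sm k Q hQ) ((M.sm l R hR).ins (M.hj f)) t =
      sgn l • prev l fun l' => M.ssv t k l' Q (ins (M.p f) R) := by
    rcases l with _ | l
    · rw [SS_smul_right t _ ((M.sm 0 R hR).ins (M.hj f)) ((M.sm 0 R hR).ins (M.hj f)) 0 rfl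
        fun l => ?_]
      · simp
      · rw [zero_smul]; exact (M.om_hj f l 0 R hR).trans (by simp)
    · rw [prev_succ, M.ssv_eq _ hQ (hR.ins _)]
      exact SS_smul_right t _ _ _ _ (by simp [sm, SM.ins, hj, sub_eq_add_neg]) fun t => M.om_hj f t (l + 1) R hR
  rw [M.ssv_eq _ hQ hR, SS_cons, h1, h2]
  simp only [sm, hj, sgn_smul_smul, sub_eq_add_neg, neg_smul_sgn]
  have e1 : sgn ((0 + -1) * ((k : ℤ) + -1) + l) = sgn (k + l + 1) :=
    sgn_congr (by simp only [parity_simps]; grind)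
  have e2 : sgn ((k : ℤ) + l + 1 + (l + 1)) = sgn k := sgn_congr (by simp only [parity_simps]; grind)
  rw [smul_add, sgn_smul_smul, e1, e2, add_comm]

lemma con_om_single (w : L) (a : Hom 𝒜) (k : ℕ) (Q : List O → O) (hQ : IsMV k Q) :
    M.con w (M.om [a] k Q) = (prev k fun k' => M.om [a] k' (ins (M.lin w) Q)) +
      sgn (k + 1) • M.om [⟨_, _, M.con_mem w _ _ a.mem⟩] k Q := by
  rcases k with _ | k
  · simp only [om_cons, prev_zero, om_nil, P_zero, map_smul, map_sum, add_zero, zero_add]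
    simp only [M.con_mul w _ _ _ (M.con_mem _ _ _ a.mem), M.con_j, M.con_con w]
    simp
  have h1 : ∀ μ, M.con w (M.ι μ a.val * M.P (k + 1) (M.Le μ Q)) =
      -(M.ι μ (M.con w a.val) * M.P (k + 1) (M.Le μ Q)) +
      sgn (a.deg - 1) • (M.ι μ a.val * M.P k (M.Le μ (ins (M.lin w) Q)) -
        ∑ i, M.j (M.dB i (M.pair w (M.e μ))) * (M.ι μ a.val * M.P k (M.Ix i Q))) := fun μ => by
    rw [M.con_mul w _ _ _ (M.con_mem _ _ _ a.mem), M.con_con w, neg_mul,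
      M.con_P _ _ (hQ.lie _), prev_succ, ins_lie, map_sub, M.vert_lin, M.P_ins_p k Q hQ, mul_sub,
      Finset.mul_sum]
    simp only [M.j_left_comm]
  have h2 : ∀ i, M.con w (M.δ i a.val * M.P k (M.Ix i Q)) =
      M.δ i (M.con w a.val) * M.P k (M.Ix i Q) -
      (∑ μ, M.j (M.dB i (M.pair w (M.e μ))) * (M.ι μ a.val * M.P k (M.Ix i Q))) +
      sgn (a.deg + 1) • (M.δ i a.val * prev k fun k' => M.P k' (M.Ix i (ins (M.lin w) Q))) :=
    fun i => by
    rw [M.con_mul w _ _ _ (M.δ_mem _ _ _ a.mem), M.con_δ w i _ _ a.mem, sub_mul, Finset.sum_mul,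
      M.con_P _ _ (hQ.ins _), ← neg_sgn, neg_smul, ← smul_neg, ← mul_neg]
    simp only [mul_assoc]
    congr 3
    cases k with
    | zero => simp
    | succ k => simp only [prev_succ]; rw [hQ.anti, map_neg]
  simp only [om_cons, prev_succ, om_nil, map_add, map_smul, map_sum, h1, h2]
  simp only [Finset.sum_add_distrib, Finset.sum_sub_distrib, ← Finset.smul_sum, smul_add, smul_sub,
    Finset.sum_neg_distrib, smul_neg, sgn_smul_smul]
  rw [Finset.sum_comm (f := fun i μ => M.j (M.dB i (M.pair w (M.e μ))) *
      (M.ι μ a.val * M.P k (M.Ix i Q)))]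
  have e1 : sgn (((k + 1 : ℕ) : ℤ) + 1 + ((k + 1 : ℕ) : ℤ) * (a.deg - 1 + 1)) =
    -sgn (((k + 1 : ℕ) : ℤ) * (a.deg + 1)) := by
    rw [neg_sgn]; exact sgn_congr (by push_cast; simp only [parity_simps]; grind)
  have e2 : sgn (((k + 1 : ℕ) : ℤ) + 1 + ((((k + 1 : ℕ) : ℤ) + 1) * (a.deg - 1) + ((k + 1 : ℕ) : ℤ))) =
    sgn ((((k + 1 : ℕ) : ℤ) + 1) * a.deg + ((k + 1 : ℕ) : ℤ)) :=
    sgn_congr (by push_cast; simp only [parity_simps]; grind)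
  have e3 : sgn (((k + 1 : ℕ) : ℤ) * (a.deg + 1) + (a.deg - 1)) = sgn (k * (a.deg + 1)) :=
    sgn_congr (by push_cast; simp only [parity_simps]; grind)
  have e4 : sgn ((((k + 1 : ℕ) : ℤ) + 1) * a.deg + ((k + 1 : ℕ) : ℤ)) = -sgn (k * (a.deg + 1)) := by
    rw [neg_sgn]; exact sgn_congr (by push_cast; simp only [parity_simps]; grind)
  have e5 : sgn ((((k + 1 : ℕ) : ℤ) + 1) * a.deg + ((k + 1 : ℕ) : ℤ) + (a.deg + 1)) =
    sgn ((k + 1) * a.deg + k) := sgn_congr (by push_cast; simp only [parity_simps]; grind)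
  have e6 : (prev k fun k' => sgn ((k + 1) * a.deg + k) •
      ∑ i, M.δ i a.val * M.P k' (M.Ix i (ins (M.lin w) Q))) =
      sgn ((k + 1) * a.deg + k) •
      ∑ i, M.δ i a.val * prev k fun k' => M.P k' (M.Ix i (ins (M.lin w) Q)) := by
    cases k <;> simp
  rw [e1, e2, e3, e5, e6, e4]
  simp only [neg_smul]
  abel

lemma con_ssv (w : L) {k l : ℕ} {Q R : List O → O} (hQ : IsMV k Q) (hR : IsMV l R) :
    M.con w (M.ssv [] k l Q R) = (prev l fun l' => M.ssv [] k l' Q (ins (M.lin w) R)) -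
        sgn l • prev k fun k' => M.ssv [] k' l (ins (M.lin w) Q) R := by
  have z : ∀ (i : ℤ) (h : (0 : A) ∈ 𝒜 i) (k : ℕ) (Q : List O → O), M.om [⟨i, 0, h⟩] k Q = 0 :=
    fun i h k Q => by simp only [om_cons]; cases k <;> simp
  have c : ∀ {k l : ℕ} {Q R : List O → O} (hQ : IsMV k Q) (hR : IsMV l R),
      M.con w (M.om [(M.sm k Q hQ).val] l R) =
      (prev l fun l' => M.om [(M.sm k Q hQ).val] l' (ins (M.lin w) R)) + sgn (l + 1) •
        M.om [⟨_, _, M.con_mem w _ _ (M.sm k Q hQ).val.mem⟩] l R :=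
    fun hQ hR => M.con_om_single w _ _ _ hR
  have d : ∀ {k l : ℕ} {Q R : List O → O} (hQ : IsMV (k + 1) Q) (hR : IsMV l R),
      M.om [⟨_, _, M.con_mem w _ _ (M.sm (k + 1) Q hQ).val.mem⟩] l R =
      M.om [(M.sm k (ins (M.lin w) Q) (hQ.ins _)).val] l R := fun {k l Q R} hQ hR => by
    refine congrArg (fun x => M.om [x] l R) (Hom.ext ?_ ?_)
    · simp [SM.val, sm]
    · exact M.con_P _ _ hQ w
  have d0 : ∀ {l : ℕ} {Q R : List O → O} (hQ : IsMV 0 Q) (hR : IsMV l R),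
      M.om [⟨_, _, M.con_mem w _ _ (M.sm 0 Q hQ).val.mem⟩] l R = 0 := fun {l Q R} hQ hR => by
    have e : M.con w (M.sm 0 Q hQ).val.val = 0 := M.con_j _ _
    rw [← z _ (zero_mem _) l R]
    exact congrArg (fun x => M.om [x] l R) (Hom.ext rfl e)
  have s : ∀ {k l : ℕ} {Q R : List O → O} (hQ : IsMV k Q) (hR : IsMV l R),
      M.ssv [] k l Q R = M.om [(M.sm k Q hQ).val] l R -
        sgn ((k - 1) * (l - 1)) • M.om [(M.sm l R hR).val] k Q := fun hQ hR => M.ssv_eq _ hQ hR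
  rw [s hQ hR, map_sub, map_smul, c hQ hR, c hR hQ]
  rcases k with _ | k <;> rcases l with _ | l
  · simp only [prev_zero, d0 hQ hR, d0 hR hQ]; simp
  · simp only [prev_zero, prev_succ, d0 hQ hR, d hR hQ, s hQ (hR.ins _)]
    simp only [smul_zero, add_zero, sub_zero, zero_add, sgn_smul_smul]
    refine congrArg₂ _ rfl (congrArg₂ _ (sgn_congr ?_) rfl)
    push_cast; simp only [parity_simps]; grind
  · simp only [prev_zero, prev_succ, d0 hR hQ, d hQ hR, s (hQ.ins _) hR]
    simp only [smul_zero, add_zero, zero_add, zero_sub, sgn_smul_smul, smul_sub]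
    have e1 : sgn (((0 : ℕ) : ℤ) + 1) = -sgn ((0 : ℕ) : ℤ) := by rw [neg_sgn]
    have e2 : sgn ((((k + 1 : ℕ) : ℤ) - 1) * (((0 : ℕ) : ℤ) - 1)) =
      -sgn (((0 : ℕ) : ℤ) + ((k : ℤ) - 1) * (((0 : ℕ) : ℤ) - 1)) := by
      rw [neg_sgn]; exact sgn_congr (by push_cast; simp only [parity_simps]; grind)
    rw [e1, e2]
    simp only [neg_smul]
    abel
  · simp only [prev_succ, d hR hQ, d hQ hR, s (hQ.ins _) hR, s hQ (hR.ins _)]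
    simp only [sgn_smul_smul, smul_sub, smul_add]
    have e1 : sgn (((l + 1 : ℕ) : ℤ) + 1) = -sgn ((l + 1 : ℕ) : ℤ) := by rw [neg_sgn]
    have e2 : sgn ((((k + 1 : ℕ) : ℤ) - 1) * (((l + 1 : ℕ) : ℤ) - 1)) =
      -sgn (((l + 1 : ℕ) : ℤ) + ((k : ℤ) - 1) * (((l + 1 : ℕ) : ℤ) - 1)) := by
      rw [neg_sgn]; exact sgn_congr (by push_cast; simp only [parity_simps]; grind)
    have e3 : sgn ((((k + 1 : ℕ) : ℤ) - 1) * (((l + 1 : ℕ) : ℤ) - 1) + (((k + 1 : ℕ) : ℤ) + 1)) =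
      sgn ((((k + 1 : ℕ) : ℤ) - 1) * ((l : ℤ) - 1)) :=
      sgn_congr (by push_cast; simp only [parity_simps]; grind)
    rw [e1, e2, e3]
    simp only [neg_smul]
    abel

lemma r_base (D : Derivation ℝ O O) (h : O) :
    M.r (D h) = M.r (D (M.p (M.r h))) + ∑ μ, M.r (D (M.lin (M.u μ))) * M.r (M.vert (M.e μ) h) := by
  have h0 : ∀ i, M.r (M.dO i h) = M.r (M.dO i (M.p (M.r h))) := fun i => by
    obtain ⟨g, hg⟩ := M.ker (h - M.p (M.r h)) (by rw [map_sub, M.r_p, sub_self])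
    rw [← sub_eq_zero, ← map_sub, ← map_sub, hg]
    simp only [map_sum, Derivation.leibniz, M.dO_lin, smul_eq_mul, map_add, map_mul, M.r_lin]
    simp
  rw [M.tightO D h, M.tightO D (M.p (M.r h))]
  simp only [map_add, map_sum, map_mul, h0, M.vert_p]
  simp

lemma ssv_one_zero {Q R : List O → O} (hQ : IsMV 1 Q) (hR : IsMV 0 R) :
    M.ssv [] 1 0 Q R = M.j (M.r (Q [R []])) := by
  have e : M.ssv [] 1 0 Q R = M.om [(M.sm 1 Q hQ).val] 0 R - M.om [M.hj (M.r (R []))] 1 Q := by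
    rw [M.ssv_eq _ hQ hR]
    simp only [SS, sm, Nat.cast_one, sub_self, zero_mul, sgn_zero, one_smul]
    rfl
  let D : Derivation ℝ O O := Derivation.mk'
    { toFun := fun h => Q [h]
      map_add' := fun a b => congrFun (hQ.2.1 a b) []
      map_smul' := fun c a => congrFun (hQ.2.2.1 c a) [] }
    fun a b => congrFun (hQ.mul a b) []
  have h1 : M.om [(M.sm 1 Q hQ).val] 0 R =
      ∑ μ, M.j (M.r (Q [M.lin (M.u μ)]) * M.r (M.vert (M.e μ) (R []))) := by
    simp only [om_cons, prev_zero, add_zero, om_nil, P_zero, lie_nil]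
    rw [Nat.cast_zero, zero_mul, sgn_zero, one_smul]
    refine Finset.sum_congr rfl fun μ _ => ?_
    rw [map_mul]
    congr 1
    exact M.con_P _ _ hQ _
  rw [e, h1, M.om_hj _ _ _ _ hQ, prev_succ, om_nil, P_zero]
  have := congrArg M.j (M.r_base D (R []))
  rw [map_add, map_sum] at this
  refine Eq.trans ?_ this.symm
  simp only [Nat.cast_one, sgn_one, neg_smul, one_smul, sub_neg_eq_add]
  rw [add_comm]
  rfl

end Model

namespace Model

variable {B O A : Type*} [CommRing B] [Algebra ℝ B] [CommRing O] [Algebra ℝ O]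
  [Ring A] [Algebra ℝ A] {𝒜 : ℤ → Submodule ℝ A} {S L κ η : Type*} [Fintype κ] [Fintype η]
  (M : Model B O A 𝒜 S L κ η)

/-- Iterated contraction. -/
def conL : List L → A →ₗ[ℝ] A
  | [] => LinearMap.id
  | w :: ws => conL ws ∘ₗ M.con w

lemma eq_zero_of_conL {n : ℕ} {a : A} (ha : a ∈ 𝒜 (n : ℤ))
    (h : ∀ ws : List L, ws.length = n → M.conL ws a = 0) : a = 0 := by
  induction n generalizing a with
  | zero => exact h [] rfl
  | succ n ih =>
    exact M.eq_zero_of_ι ha fun μ => ih (M.ι_mem ha μ) fun ws hws => h (_ :: ws) (by simp [hws])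

lemma conL_ssv_nil (ws : List L) {k l : ℕ} {Q R : List O → O} (hQ : IsMV k Q) (hR : IsMV l R)
    (hl : k + l = ws.length + 1) : M.conL ws (M.ssv [] k l Q R) =
      M.j (M.r (Br (ws.map M.lin) k l Q R)) := by
  induction ws generalizing k l Q R with
  | nil =>
    simp only [List.length_nil, zero_add] at hl
    obtain ⟨rfl, rfl⟩ | ⟨rfl, rfl⟩ : (k = 1 ∧ l = 0) ∨ (k = 0 ∧ l = 1) := by omega
    · exact M.ssv_one_zero hQ hR
    · have h1 := M.ssv_one_zero hR hQ
      rw [M.ssv_eq _ hR hQ] at h1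
      change M.ssv [] 0 1 Q R = _
      rw [M.ssv_eq _ hQ hR, SS_antisymm, h1]
      simp [sm, Br]
  | cons w ws ih =>
    change M.conL ws (M.con w _) = _
    rw [M.con_ssv w hQ hR, map_sub, map_smul]
    simp only [List.map_cons, Br, List.length_cons] at hl ⊢
    rcases k with _ | k <;> rcases l with _ | l
    · simp
    · simp [ih hQ (hR.ins _) (by omega)]
    · simp [ih (hQ.ins _) hR (by omega)]
    · simp only [prev_succ]
      rw [ih hQ (hR.ins _) (by omega), ih (hQ.ins _) hR (by omega)]
      simp

/-- The sign arising from the insertion of functions. -/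
def fsgn : ℕ → ℕ → ℝ
  | 0, _ => 1
  | m + 1, n => sgn (n + 1) * fsgn m (n - 1)

lemma conL_ssv_fun (fs : List B) (ws : List L) {k l : ℕ} {Q R : List O → O} (hQ : IsMV k Q)
    (hR : IsMV l R) (hl : k + l = fs.length + ws.length + 1) :
    M.conL ws (M.ssv (fs.map M.hj) k l Q R) =
      fsgn fs.length (k + l) • M.j (M.r (Br (fs.map M.p ++ ws.map M.lin) k l Q R)) := by
  induction fs generalizing k l Q R with
  | nil => simpa [fsgn] using M.conL_ssv_nil ws hQ hR (by simpa using hl)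
  | cons f fs ih =>
    rw [List.map_cons, M.ssv_hj f _ hQ hR, map_smul, map_sub, map_smul]
    simp only [List.map_cons, List.cons_append, Br, List.length_cons, fsgn, mul_smul] at hl ⊢
    push_cast
    congr 1
    rcases k with _ | k <;> rcases l with _ | l
    · simp
    · simp only [prev_succ, prev_zero, map_zero, smul_zero, sub_zero]
      rw [ih hQ (hR.ins _) (by omega)]
      rfl
    · simp only [prev_succ, prev_zero, map_zero, zero_sub]
      rw [ih (hQ.ins _) hR (by omega)]
      simp
    · simp only [prev_succ]
      rw [ih hQ (hR.ins _) (by omega), ih (hQ.ins _) hR (by omega)]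
      have e : k + 1 + (l + 1) - 1 = k + 1 + l := by omega
      have e' : k + (l + 1) = k + 1 + l := by omega
      rw [e, e', map_sub, map_sub, map_smul, map_smul, smul_sub, smul_comm]

lemma lieL_add (vs : List S) (Q Q' : List O → O) :
    M.lieL vs (Q + Q') = M.lieL vs Q + M.lieL vs Q' := by
  induction vs with
  | nil => rfl
  | cons s v ih =>
    change lie _ (M.lieL v _) = lie _ (M.lieL v _) + lie _ (M.lieL v _)
    rw [ih, map_add]

lemma conL_ssv (vs : List S) (fs : List B) (ws : List L) {k l : ℕ} {Q R : List O → O}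
    (hQ : IsMV k Q) (hR : IsMV l R) (hl : k + l = fs.length + ws.length + 1) :
    M.conL ws (M.ssv (vs.map M.hs ++ fs.map M.hj) k l Q R) =
      fsgn fs.length (k + l) •
        M.j (M.r (M.lieL vs (fun t => Br t k l Q R) (fs.map M.p ++ ws.map M.lin))) := by
  induction vs generalizing Q R with
  | nil => exact M.conL_ssv_fun fs ws hQ hR hl
  | cons v vs ih =>
    rw [List.map_cons, List.cons_append, M.ssv_hs v _ hQ hR, map_add, ih (hQ.lie _) hR,
      ih hQ (hR.lie _), ← smul_add, ← map_add, ← map_add]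
    congr 3
    change _ = lie (M.vert v) (M.lieL vs _) _
    rw [← lieL_lie]
    rw [← Pi.add_apply, ← lieL_add]
    congr 2
    funext t
    exact (lie_Br _ t k l Q R hQ hR).symm

lemma lieL_mem_pow {I : Ideal O} (vs : List S) (Q : List O → O) (n N : ℕ)
    (hQ : ∀ t : List O, t.length = n → Q t ∈ I ^ (N + vs.length)) (t : List O)
    (ht : t.length = n) : M.lieL vs Q t ∈ I ^ N := by
  have key : ∀ (D : Derivation ℝ O O) (N : ℕ) (t : List O) (Q : List O → O),
      (∀ t' : List O, t'.length = t.length → Q t' ∈ I ^ (N + 1)) → lie D Q t ∈ I ^ N := by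
    intro D N t
    induction t with
    | nil => exact fun Q h => der_pow_mem I D N (h [] rfl)
    | cons z t ih =>
      intro Q h
      rw [lie_cons]
      exact sub_mem (ih _ fun t' ht' => h (z :: t') (by simp [ht']))
        (Ideal.pow_le_pow_right (Nat.le_succ N) (h _ rfl))
  induction vs generalizing N t with
  | nil => exact hQ t ht
  | cons v vs ih =>
    refine key _ _ _ _ fun t' ht' => ih (N + 1) (fun t ht => ?_) t' (ht'.trans ht)
    have := hQ t ht
    rwa [List.length_cons, ← add_assoc, add_right_comm] at this

lemma Br_two_two (β : biDer O) (x y z : O) :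
    Br [x, y, z] 2 2 (X2 β) (X2 β) = -2 * jacobiator β x y z := by
  have h1 : β.1 y (β.1 z x) = - β.1 y (β.1 x z) := by rw [biDer_skew β z x, map_neg]
  simp [Br, X2, ins_apply, jacobiator, sgn_of_even (a := 2) ⟨1, by norm_num⟩, h1]
  ring

lemma JJ_eq_zero {I : Ideal O} (hI : ∀ h, h ∈ I ↔ M.r h = 0) (n : ℕ) (β : biDer O)
    (hβ : ∀ f g h, jacobiator β f g h ∈ I ^ (n + 1)) (t : List (Hom 𝒜)) (ht : t.length = n) :
    JJ t (M.sm 2 (X2 β) (isMV_X2 β)) (M.sm 2 (X2 β) (isMV_X2 β)) = 0 := by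
  set χ : SM 𝒜 := M.sm 2 (X2 β) (isMV_X2 β) with hχ
  have h1 : lenR n (SS χ χ) t = 0 := by
    refine M.smd_eq_zero ((M.SS_smd χ χ).lenR n) (fun vs fs => ?_) t
    by_cases hn : (vs.map M.hs ++ fs.map M.hj).length = n
    swap
    · exact if_neg hn
    rw [lenR_of _ hn]
    have hm := (M.SS_smd χ χ).mem (vs.map M.hs ++ fs.map M.hj)
    have hd : χ.d = 1 := by simp [hχ, sm]
    rw [M.bsum_sorted, hd] at hm
    rcases Nat.lt_or_ge 3 fs.length with h3 | h3
    · exact M.neg_eq _ _ (by omega) hm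
    refine M.eq_zero_of_conL (n := 3 - fs.length) (deg_cast hm (by push_cast [h3]; ring))
      fun ws hws => ?_
    have := M.conL_ssv vs fs ws (isMV_X2 β) (isMV_X2 β) (by omega)
    rw [M.ssv_eq _ (isMV_X2 β) (isMV_X2 β)] at this
    rw [hχ, this, (hI _).1, map_zero, smul_zero]
    have := M.lieL_mem_pow (I := I) vs (fun t => Br t 2 2 (X2 β) (X2 β)) 3 1 (fun t ht => ?_)
      (fs.map M.p ++ ws.map M.lin) (by simp; omega)
    · simpa using this
    · obtain ⟨x, y, z, rfl⟩ := List.length_eq_three.1 ht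
      rw [Br_two_two]
      refine Ideal.mul_mem_left _ _ (Ideal.pow_le_pow_right ?_ (hβ x y z))
      simp at hn; omega
  rw [lenR_of _ ht, SS, sgn_of_odd (a := χ.d * χ.d) (by simp [hχ, sm])] at h1
  have h2 : (2 : ℝ) • JJ t χ χ = 0 := by
    rw [two_smul]; simpa [sub_eq_add_neg] using h1
  exact (smul_eq_zero.1 h2).resolve_left (by norm_num)

end Model

/-! ### Sums over permutations -/

section Permutations

/-- The permutation that maps `i` to `0` and is given by `e` on the other elements. -/
def pz {n : ℕ} (i : Fin (n + 1)) (e : Equiv.Perm (Fin n)) : Equiv.Perm (Fin (n + 1)) :=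
  Equiv.Perm.decomposeFin.symm (0, e) * i.cycleRange

lemma pz_self {n : ℕ} (i : Fin (n + 1)) (e : Equiv.Perm (Fin n)) : pz i e i = 0 := by
  simp [pz, Equiv.Perm.mul_apply]

lemma pz_succAbove {n : ℕ} (i : Fin (n + 1)) (e : Equiv.Perm (Fin n)) (m : Fin n) :
    pz i e (i.succAbove m) = (e m).succ := by
  simp [pz, Equiv.Perm.mul_apply]

lemma permSign_pz {n : ℕ} (i : Fin (n + 1)) (e : Equiv.Perm (Fin n)) :
    permSign (pz i e) = sgn i * permSign e := by
  simp [permSign, pz, Equiv.Perm.decomposeFin.symm_sign, sgn, mul_comm]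

lemma pz_bijective (n : ℕ) :
    Function.Bijective fun q : Fin (n + 1) × Equiv.Perm (Fin n) => pz q.1 q.2 := by
  refine (Fintype.bijective_iff_injective_and_card _).2 ⟨fun q q' h => ?_,
    Fintype.card_congr Equiv.Perm.decomposeFin.symm⟩
  have h : pz q.1 q.2 = pz q'.1 q'.2 := h
  have h1 : q.1 = q'.1 := (pz q.1 q.2).injective (by rw [pz_self, h, pz_self])
  refine Prod.ext h1 (Equiv.ext fun i => ?_)
  have h2 := pz_succAbove q.1 q.2 i
  rw [h, h1, pz_succAbove] at h2
  exact (Fin.succ_injective _ h2).symm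

lemma koszul_pz {n : ℕ} (i : Fin (n + 1)) (e : Equiv.Perm (Fin n)) (d : Fin (n + 1) → ℤ) :
    koszul (pz i e) d = sgn (d 0 * ∑ m : Fin n, if (m : ℕ) < i then d (e m).succ else 0) *
      koszul e (d ∘ Fin.succ) := by
  simp only [koszul]
  rw [Fin.prod_univ_succAbove _ i]
  simp only [Fin.prod_univ_succAbove _ i, pz_self, pz_succAbove, Fin.not_lt_zero, and_false,
    if_false, Finset.prod_const_one, one_mul, Fin.succ_pos, and_true, Function.comp_apply,
    (Fin.strictMono_succAbove i).lt_iff_lt, Fin.succ_lt_succ_iff]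
  rw [Finset.prod_mul_distrib, Finset.mul_sum, sgn_sum]
  congr 1
  refine Finset.prod_congr rfl fun m _ => ?_
  have : i.succAbove m < i ↔ (m : ℕ) < i := by
    rw [Fin.succAbove_lt_iff_castSucc_lt]; rfl
  simp only [this]
  split_ifs <;> simp [mul_comm]

lemma ofFn_eq_insert {X : Type*} {n : ℕ} (f : Fin (n + 1) → X) (i : Fin (n + 1)) :
    List.ofFn f = (List.ofFn (f ∘ i.succAbove)).take i ++
      f i :: (List.ofFn (f ∘ i.succAbove)).drop i := by
  induction n with
  | zero =>
    obtain rfl : i = 0 := Fin.ext (by omega)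
    simp
  | succ n ih =>
    induction i using Fin.cases with
    | zero => rw [List.ofFn_succ]; simp [Function.comp_def]
    | succ i =>
      rw [List.ofFn_succ, List.ofFn_succ (f := f ∘ i.succ.succAbove), ih (fun k => f k.succ) i]
      simp [Function.comp_def]

variable {A : Type*} [Ring A] [Algebra ℝ A] {𝒜 : ℤ → Submodule ℝ A}

lemma bsum_take_ofFn {n : ℕ} (h : Fin n → Hom 𝒜) (i : ℕ) :
    bsum ((List.ofFn h).take i) = ∑ m : Fin n, if (m : ℕ) < i then (h m).deg - 1 else 0 := by
  induction n generalizing i with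
  | zero => simp [bsum]
  | succ n ih =>
    rw [List.ofFn_succ, Fin.sum_univ_succ]
    cases i with
    | zero => simp [bsum]
    | succ i => simp [bsum, ih]

lemma dsgn_insert (l : List (Hom 𝒜)) (x : Hom 𝒜) (t : List (Hom 𝒜)) :
    dsgn (l ++ x :: t) = sgn (l.length * x.deg + (bsum l + l.length)) * dsgn (x :: (l ++ t)) := by
  induction l with
  | nil => simp [bsum]
  | cons y l ih =>
    have h := dsgn_swap [] x y (l ++ t)
    simp only [List.nil_append] at h
    rw [List.cons_append, List.cons_append, h, dsgn, ih]
    have h2 : dsgn (y :: x :: (l ++ t)) =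
      sgn ((x :: (l ++ t)).length * (y.deg - 1)) * dsgn (x :: (l ++ t)) := rfl
    rw [h2]
    simp only [bsum, List.length_cons, List.length_append]
    simp only [← mul_assoc, ← sgn_add]
    congr 1
    exact sgn_congr (by push_cast; simp only [parity_simps]; grind)

lemma permSign_mul_koszul_mul_dsgn {n : ℕ} (h : Fin n → Hom 𝒜) (τ : Equiv.Perm (Fin n)) :
    permSign τ * koszul τ (fun i => (h i).deg) * dsgn (List.ofFn (h ∘ τ)) =
      dsgn (List.ofFn h) * koszul τ fun i => (h i).deg - 1 := by
  induction n with
  | zero =>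
    obtain rfl : τ = 1 := Subsingleton.elim _ _
    simp [permSign, koszul]
  | succ n ih =>
    obtain ⟨⟨i, e⟩, rfl⟩ := (pz_bijective n).2 τ
    have hi := ih (fun k => h k.succ) e
    have e1 : (h ∘ pz i e) ∘ i.succAbove = (fun k => h k.succ) ∘ e := by
      funext m; simp [pz_succAbove]
    have hlen : ((List.ofFn ((fun k => h k.succ) ∘ e)).take i).length = (i : ℕ) := by
      simp; omega
    simp only
    rw [permSign_pz, koszul_pz, koszul_pz, ofFn_eq_insert _ i, e1, dsgn_insert, hlen,
      List.take_append_drop, bsum_take_ofFn, Function.comp_apply, pz_self, List.ofFn_succ, dsgn,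
      dsgn, List.length_ofFn, List.length_ofFn]
    simp only [Function.comp_def] at hi ⊢
    have e2 : ∑ m : Fin n, (if (m : ℕ) < i then (h (e m).succ).deg - 1 else 0) =
      (∑ m : Fin n, if (m : ℕ) < i then (h (e m).succ).deg else 0) - i := by
      have : (i : ℤ) = ∑ m : Fin n, if (m : ℕ) < i then (1 : ℤ) else 0 := by
        rw [Finset.sum_boole]
        rw [Fin.card_filter_val_lt, Nat.min_eq_right (by omega)]
      conv_rhs => rw [this]
      rw [← Finset.sum_sub_distrib]
      exact Finset.sum_congr rfl fun m _ => by split_ifs <;> simp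
    rw [e2]
    set D := ∑ m : Fin n, if (m : ℕ) < i then (h (e m).succ).deg else 0
    have e3 : sgn i * (sgn ((h 0).deg * D) * sgn (i * (h 0).deg + (D - i + i))) =
        sgn (((h 0).deg - 1) * (D - i)) := by
      rw [← sgn_add, ← sgn_add]
      exact sgn_congr (by simp only [parity_simps]; grind)
    rw [← e3]
    linear_combination (sgn i * (sgn ((h 0).deg * D) * sgn (i * (h 0).deg + (D - i + i)))) *
      sgn (n * ((h 0).deg - 1)) * hi

/-- The value of `ψ` on the value of `χ` and further arguments. -/
def nest (χ ψ : SM 𝒜) (l t : List (Hom 𝒜)) : A := ψ.fn (⟨_, χ.fn l, χ.smd.mem l⟩ :: t)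

lemma nest_insert_left (χ ψ : SM 𝒜) (l l' t : List (Hom 𝒜)) (x : Hom 𝒜) :
    nest χ ψ (l ++ x :: l') t = sgn ((x.deg - 1) * bsum l) • nest (χ.ins x) ψ (l ++ l') t := by
  have h := χ.smd.move l x l'
  have hm : χ.fn (x :: (l ++ l')) ∈ 𝒜 ((χ.ins x).d + 1 + bsum (l ++ l')) := (χ.ins x).smd.mem (l ++ l')
  have := ψ.smd.smul _ (sgn ((x.deg - 1) * bsum l)) _ hm (Submodule.smul_mem _ _ hm) t
  refine Eq.trans ?_ this
  refine congrArg (fun y => ψ.fn (y :: t)) (Hom.ext ?_ h)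
  simp only [bsum_append, bsum, SM.ins]; ring

lemma nest_insert_right (χ ψ : SM 𝒜) (l t t' : List (Hom 𝒜)) (x : Hom 𝒜) :
    nest χ ψ l (t ++ x :: t') =
      sgn ((x.deg - 1) * (χ.d + bsum l + bsum t)) • nest χ (ψ.ins x) l (t ++ t') := by
  have := ψ.smd.move (⟨_, χ.fn l, χ.smd.mem l⟩ :: t) x t'
  refine this.trans ?_
  simp only [bsum]
  refine congrArg₂ _ (sgn_congr ?_) rfl
  simp only [parity_simps]; grind

/-- The weighted sum of the values of `ψ` on the value of `χ` on an initial segment. -/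
def wsum (χ ψ : SM 𝒜) (l : List (Hom 𝒜)) : A :=
  ∑ q ∈ Finset.range (l.length + 1),
    (1 / ((q.factorial : ℝ) * (l.length - q).factorial)) • nest χ ψ (l.take q) (l.drop q)

lemma sum_wsum_insert (χ ψ : SM 𝒜) (x : Hom 𝒜) (l : List (Hom 𝒜)) :
    ∑ i ∈ Finset.range (l.length + 1), sgn ((x.deg - 1) * bsum (l.take i)) •
      wsum χ ψ (l.take i ++ x :: l.drop i) =
    wsum (χ.ins x) ψ l + sgn ((x.deg - 1) * χ.d) • wsum χ (ψ.ins x) l := by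
  set n := l.length with hn
  have h1 : ∀ i ∈ Finset.range (n + 1), sgn ((x.deg - 1) * bsum (l.take i)) •
      wsum χ ψ (l.take i ++ x :: l.drop i) = ∑ q ∈ Finset.range (n + 2),
      (1 / ((q.factorial : ℝ) * (n + 1 - q).factorial)) • (if q ≤ i then
        sgn ((x.deg - 1) * χ.d) • nest χ (ψ.ins x) (l.take q) (l.drop q) else
        nest (χ.ins x) ψ (l.take (q - 1)) (l.drop (q - 1))) := by
    intro i hi
    rw [Finset.mem_range] at hi
    have hl : (l.take i ++ x :: l.drop i).length = n + 1 := by simp; omega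
    rw [wsum, hl, Finset.smul_sum]
    refine Finset.sum_congr rfl fun q _ => ?_
    rw [smul_comm]
    congr 1
    have hti : (l.take i).length = i := by simp; omega
    split_ifs with hq
    · have e1 : (l.take i ++ x :: l.drop i).take q = l.take q := by
        rw [List.take_append_of_le_length (by omega), List.take_take, min_eq_left hq]
      have e2 : (l.take i ++ x :: l.drop i).drop q = (l.take i).drop q ++ x :: l.drop i := by
        rw [List.drop_append_of_le_length (by omega)]
      have e3 : (l.take i).drop q ++ l.drop i = l.drop q := by
        rw [← List.drop_append_of_le_length (by omega), List.take_append_drop]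
      have e4 : bsum (l.take q) + bsum ((l.take i).drop q) = bsum (l.take i) := by
        rw [← bsum_append]
        congr 1
        conv_rhs => rw [← List.take_append_drop q (l.take i), List.take_take, min_eq_left hq]
      rw [e1, e2, nest_insert_right, e3, add_assoc, e4, sgn_smul_smul]
      refine congrArg₂ _ (sgn_congr ?_) rfl
      simp only [parity_simps]; grind
    · obtain ⟨m, rfl⟩ : ∃ m, q = i + 1 + m := ⟨q - (i + 1), by omega⟩
      have e1 : (l.take i ++ x :: l.drop i).take (i + 1 + m) = l.take i ++ x :: (l.drop i).take m := by
        rw [List.take_append, hti, List.take_of_length_le (by omega)]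
        congr 1
        rw [show i + 1 + m - i = m + 1 by omega, List.take_succ_cons]
      have e2 : (l.take i ++ x :: l.drop i).drop (i + 1 + m) = l.drop (i + 1 + m - 1) := by
        rw [List.drop_append, hti, List.drop_of_length_le (by omega), List.nil_append,
          show i + 1 + m - i = m + 1 by omega, List.drop_succ_cons, List.drop_drop]
        congr 1; omega
      have e3 : l.take i ++ (l.drop i).take m = l.take (i + 1 + m - 1) := by
        rw [show i + 1 + m - 1 = i + m by omega, List.take_add]
      rw [e1, e2, nest_insert_left, e3, sgn_smul_smul, sgn_of_even ⟨_, rfl⟩, one_smul]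
  rw [Finset.sum_congr rfl h1, Finset.sum_comm]
  have h2 : ∀ q ∈ Finset.range (n + 2), (∑ i ∈ Finset.range (n + 1),
      (1 / ((q.factorial : ℝ) * (n + 1 - q).factorial)) • (if q ≤ i then
        sgn ((x.deg - 1) * χ.d) • nest χ (ψ.ins x) (l.take q) (l.drop q) else
        nest (χ.ins x) ψ (l.take (q - 1)) (l.drop (q - 1)))) =
      (((n + 1 - q : ℕ) : ℝ) * (1 / ((q.factorial : ℝ) * (n + 1 - q).factorial))) •
        (sgn ((x.deg - 1) * χ.d) • nest χ (ψ.ins x) (l.take q) (l.drop q)) +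
      ((q : ℝ) * (1 / ((q.factorial : ℝ) * (n + 1 - q).factorial))) •
        nest (χ.ins x) ψ (l.take (q - 1)) (l.drop (q - 1)) := by
    intro q hq
    rw [Finset.mem_range] at hq
    rw [← Finset.smul_sum, ← Finset.sum_range_add_sum_Ico _ (show q ≤ n + 1 by omega),
      Finset.sum_congr rfl fun i hi => if_neg (by rw [Finset.mem_range] at hi; omega),
      Finset.sum_congr (s₁ := Finset.Ico _ _) rfl fun i hi => if_pos (Finset.mem_Ico.1 hi).1,
      Finset.sum_const, Finset.sum_const, Finset.card_range, Nat.card_Ico, smul_add, add_comm,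
      ← Nat.cast_smul_eq_nsmul ℝ, ← Nat.cast_smul_eq_nsmul ℝ]
    simp only [smul_smul]
    congr 2 <;> ring
  rw [Finset.sum_congr rfl h2, Finset.sum_add_distrib, Finset.sum_range_succ,
    Finset.sum_range_succ' (n := n + 1), add_comm (Finset.sum _ _ + _)]
  simp only [wsum, ← hn, Finset.smul_sum]
  rw [Nat.sub_self, Nat.cast_zero, zero_mul, zero_smul, add_zero, zero_mul, zero_smul, add_zero]
  congr 1
  · refine Finset.sum_congr rfl fun q hq => ?_
    rw [Nat.factorial_succ, Nat.add_sub_add_right, Nat.add_sub_cancel]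
    congr 1
    push_cast
    have := Nat.factorial_ne_zero q
    have := Nat.factorial_ne_zero (n - q)
    field_simp
  · refine Finset.sum_congr rfl fun q hq => ?_
    rw [Finset.mem_range] at hq
    rw [show n + 1 - q = n - q + 1 by omega, Nat.factorial_succ, smul_comm]
    congr 2
    push_cast
    have := Nat.factorial_ne_zero q
    have := Nat.factorial_ne_zero (n - q)
    field_simp

lemma sum_koszul_wsum {n : ℕ} (h : Fin n → Hom 𝒜) (χ ψ : SM 𝒜) :
    ∑ τ : Equiv.Perm (Fin n), koszul τ (fun i => (h i).deg - 1) • wsum χ ψ (List.ofFn (h ∘ τ)) =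
      JJ (List.ofFn h) χ ψ := by
  induction n generalizing χ ψ with
  | zero =>
    rw [Fintype.sum_eq_single 1 fun τ hτ => absurd (Subsingleton.elim _ _) hτ]
    simp only [koszul, Finset.univ_eq_empty, Finset.prod_empty, one_smul, List.ofFn_zero, wsum, JJ]
    simp only [List.length_nil, zero_add, Finset.sum_range_one, Nat.factorial_zero, Nat.cast_one,
      mul_one, div_one, one_smul, List.take_nil, List.drop_nil, nest, Nat.sub_self]
    exact congrArg (fun y => ψ.fn [y]) (Hom.ext (by simp [SM.val, bsum]) rfl)
  | succ n ih =>
    rw [← (pz_bijective n).sum_comp, Fintype.sum_prod_type_right, List.ofFn_succ]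
    simp only [JJ]
    rw [← ih (fun k => h k.succ), ← ih (fun k => h k.succ), Finset.smul_sum,
      ← Finset.sum_add_distrib]
    refine Finset.sum_congr rfl fun e _ => ?_
    rw [smul_comm, ← smul_add, ← sum_wsum_insert, List.length_ofFn, Finset.smul_sum, Finset.sum_range]
    refine Finset.sum_congr rfl fun i _ => ?_
    have e1 : (h ∘ pz i e) ∘ i.succAbove = (fun k => h k.succ) ∘ e := by
      funext m; simp [pz_succAbove]
    rw [koszul_pz, ofFn_eq_insert _ i, e1, bsum_take_ofFn, mul_comm, mul_smul, Function.comp_apply,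
      pz_self]
    rfl

end Permutations

/-! ### The Jacobi identities -/

section Jacobi

lemma kappa_succ (n : ℕ) : kappa (n + 1) = sgn (n - 1) * kappa n := by
  have h : ((n + 1 : ℕ) - 1 : ℤ) * ((n + 1 : ℕ) - 2) / 2 = (n - 1) + (n - 1) * (n - 2) / 2 := by
    have : ((n + 1 : ℕ) - 1 : ℤ) * ((n + 1 : ℕ) - 2) = (n - 1) * (n - 2) + (n - 1) * 2 := by
      push_cast; ring
    rw [this, Int.add_mul_ediv_right _ _ (by norm_num)]; ring
  rw [kappa, h, sgn_add, kappa]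

lemma kappa_mul (q m : ℕ) :
    (-1 : ℝ) ^ (q * m) * (kappa (m + 1) * kappa q) * sgn m = kappa (q + m) := by
  induction m with
  | zero => simp [kappa]
  | succ m ih =>
    have e : (-1 : ℝ) ^ q = sgn q := by simp [sgn]
    rw [← add_assoc, kappa_succ (m + 1), kappa_succ (q + m), ← ih, mul_add, pow_add, mul_one, e]
    have : sgn q * sgn ((m + 1 : ℕ) - 1 : ℤ) * sgn (m + 1 : ℕ) = sgn ((q + m : ℕ) - 1 : ℤ) * sgn m := by
      simp only [← sgn_add]
      exact sgn_congr (by push_cast; simp only [parity_simps]; grind)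
    linear_combination (-1 : ℝ) ^ (q * m) * kappa (m + 1) * kappa q * this

lemma ofFn_take {X : Type*} {n : ℕ} (h : Fin n → X) (q : ℕ) (hq : q ≤ n) :
    List.ofFn (fun i : Fin q => h ⟨i, by omega⟩) = (List.ofFn h).take q :=
  List.ext_getElem (by simp [hq]) fun i _ _ => by simp

lemma ofFn_drop {X : Type*} {n : ℕ} (h : Fin n → X) (q : ℕ) (hq : q ≤ n) :
    List.ofFn (fun i : Fin (n - q) => h ⟨q + i, by omega⟩) = (List.ofFn h).drop q :=
  List.ext_getElem (by simp) fun i _ _ => by simp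

variable {A : Type*} [Ring A] [Algebra ℝ A] {𝒜 : ℤ → Submodule ℝ A}

lemma dsgn_append (l t : List (Hom 𝒜)) :
    dsgn (l ++ t) = dsgn l * sgn (t.length * bsum l) * dsgn t := by
  induction l with
  | nil => simp [dsgn, bsum]
  | cons a l ih =>
    simp only [List.cons_append, dsgn, ih, bsum, List.length_append]
    push_cast
    rw [add_mul, mul_add, sgn_add, sgn_add]
    ring

lemma jacobiSum_eq (φ : ∀ n, MultilinearMap ℝ (fun _ : Fin n => A) A) (χ : SM 𝒜) (hd : χ.d = 1)
    (n : ℕ) (hc : ∀ m ≤ n + 1, Corr (φ m) χ.fn) (h : Fin n → Hom 𝒜) :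
    jacobiSum (fun m => kappa m • φ m) (fun i => (h i).val) =
      kappa n • dsgn (List.ofFn h) • wsum χ χ (List.ofFn h) := by
  simp only [jacobiSum, wsum, List.length_ofFn]
  rw [Finset.sum_range, Finset.smul_sum, Finset.smul_sum]
  refine Finset.sum_congr rfl fun q _ => ?_
  have hq : (q : ℕ) ≤ n := by omega
  obtain ⟨q, hq'⟩ := q
  simp only at hq ⊢
  set h1 : Fin q → Hom 𝒜 := fun i => h ⟨i, by omega⟩ with hh1
  set h2 : Fin (n - q) → Hom 𝒜 := fun i => h ⟨q + i, by omega⟩ with hh2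
  have e1 : List.ofFn h1 = (List.ofFn h).take q := ofFn_take h q hq
  have e2 : List.ofFn h2 = (List.ofFn h).drop q := ofFn_drop h q hq
  have e3 : φ q (fun i : Fin q => (h1 i).val) = dsgn (List.ofFn h1) • χ.fn (List.ofFn h1) :=
    hc q (by omega) h1
  set x : Hom 𝒜 := ⟨_, χ.fn (List.ofFn h1), χ.smd.mem (List.ofFn h1)⟩ with hx
  have e4 : φ (n - q + 1) (Fin.cons x.val fun i => (h2 i).val) =
      dsgn (x :: List.ofFn h2) • χ.fn (x :: List.ofFn h2) := by
    rw [← val_cons, hc _ (by omega) (Fin.cons x h2), ofFn_cons]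
  have e5 : dsgn (List.ofFn h) = dsgn (List.ofFn h1) * sgn ((n - q : ℕ) * bsum (List.ofFn h1)) *
      dsgn (List.ofFn h2) := by
    rw [← List.take_append_drop q (List.ofFn h), ← e1, ← e2, dsgn_append, List.length_ofFn]
  have e6 : nest χ χ ((List.ofFn h).take q) ((List.ofFn h).drop q) = χ.fn (x :: List.ofFn h2) := by
    rw [← e1, ← e2]; rfl
  rw [e6, e5]
  have e7 : (kappa (n - q + 1) • φ (n - q + 1)) (Fin.cons ((kappa q • φ q) fun i => (h1 i).val)
      fun j => (h2 j).val) = (kappa (n - q + 1) * (kappa q * dsgn (List.ofFn h1))) •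
      dsgn (x :: List.ofFn h2) • χ.fn (x :: List.ofFn h2) := by
    rw [smul_apply, smul_apply, e3, smul_smul, MultilinearMap.cons_smul, ← e4, smul_smul]
  refine (congrArg _ e7).trans ?_
  simp only [smul_smul]
  congr 1
  have e8 := kappa_mul q (n - q)
  rw [Nat.add_sub_cancel' hq] at e8
  rw [← e8]
  simp only [dsgn, List.length_ofFn, hx, hd]
  have e9 : sgn ((n - q : ℕ) * (1 + 1 + bsum (List.ofFn h1) - 1)) =
      sgn (n - q : ℕ) * sgn ((n - q : ℕ) * bsum (List.ofFn h1)) := by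
    rw [← sgn_add]; congr 1; ring
  rw [e9]
  ring

end Jacobi

namespace Model

variable {B O A : Type*} [CommRing B] [Algebra ℝ B] [CommRing O] [Algebra ℝ O]
  [Ring A] [Algebra ℝ A] {𝒜 : ℤ → Submodule ℝ A} {S L κ η : Type*} [Fintype κ] [Fintype η]
  (M : Model B O A 𝒜 S L κ η)

theorem isPInfty_phi {I : Ideal O} (hI : ∀ h, h ∈ I ↔ M.r h = 0) (π : AdicCompletion I (biDer O))
    (hπ : ∀ (N : ℕ) (β : biDer O), Rep I (N + 1) π β → ∀ f g h, jacobiator β f g h ∈ I ^ N) :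
    IsPInfty 𝒜 fun n => kappa n • (M.phi hI π).1 n where
  multiDer n := ((multiDer 𝒜).smul_mem (kappa n) (M.phi hI π).2) n
  jacobi n β a ha := by
    obtain ⟨b, hb⟩ := exists_rep (n + 2) π
    set χ : SM 𝒜 := M.sm 2 (X2 b) (isMV_X2 b) with hχ
    set h : Fin n → Hom 𝒜 := fun i => ⟨β i, a i, ha i⟩ with hh
    have h1 : ∀ τ : Equiv.Perm (Fin n), (permSign τ * koszul τ β) •
        jacobiSum (fun n => kappa n • (M.phi hI π).1 n) (a ∘ τ) =
        (kappa n * dsgn (List.ofFn h)) • koszul τ (fun i => (h i).deg - 1) •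
          wsum χ χ (List.ofFn (h ∘ τ)) := fun τ => by
      have h2 := jacobiSum_eq (M.phi hI π).1 χ (by simp [hχ, sm]) n (fun m hm => by
        rw [M.phi_apply hI π m (show m < n + 2 by omega) hb]
        exact M.F_corr m 2 _) (h ∘ τ)
      have h3 : permSign τ * koszul τ β * dsgn (List.ofFn (h ∘ τ)) = _ :=
        permSign_mul_koszul_mul_dsgn h τ
      refine (congrArg _ h2).trans ?_
      simp only [smul_smul]
      congr 1
      linear_combination kappa n * h3
    rw [Finset.sum_congr rfl fun τ _ => h1 τ, ← Finset.smul_sum, sum_koszul_wsum,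
      M.JJ_eq_zero hI n b (hπ (n + 1) b hb) _ (List.length_ofFn), smul_zero]

end Model

/-! ### Smooth dependence of integrals on parameters -/

section Integrals

lemma contDiffOn_integral {P : Type*} [NormedAddCommGroup P] [NormedSpace ℝ P] {s : Set P}
    (hs : IsOpen s) {H : P × ℝ → ℝ} (hH : ContDiffOn ℝ ∞ H (s ×ˢ Set.univ)) :
    ContDiffOn ℝ ∞ (fun p => ∫ t in (0 : ℝ)..1, H (p, t)) s := by
  let b : ContDiffBump (-(1 / 2) : ℝ) := ⟨1, 2, by norm_num, by norm_num⟩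
  have hf : MeasureTheory.LocallyIntegrable (Set.indicator (Set.Ioc (0 : ℝ) 1) fun _ => (1 : ℝ))
      MeasureTheory.volume :=
    ((MeasureTheory.integrable_indicator_iff measurableSet_Ioc).2
      (MeasureTheory.integrableOn_const (by simp) (by simp))).locallyIntegrable
  have hg : ContDiffOn ℝ ∞ (fun q : P × ℝ => b q.2 * H (q.1, -q.2)) (s ×ˢ Set.univ) := by
    refine (b.contDiff.comp contDiff_snd).contDiffOn.mul
      (hH.comp (contDiff_fst.prodMk contDiff_snd.neg).contDiffOn ?_)
    rintro ⟨p, t⟩ ⟨hp, -⟩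
    exact ⟨hp, trivial⟩
  have key := MeasureTheory.contDiffOn_convolution_right_with_param_comp (n := ⊤) (μ := MeasureTheory.volume)
    (ContinuousLinearMap.mul ℝ ℝ) (v := fun _ : P => (0 : ℝ)) contDiffOn_const
    (g := fun p x => b x * H (p, -x)) hs (isCompact_closedBall (-(1 / 2) : ℝ) 2) ?_ hf hg
  · refine key.congr fun p _ => ?_
    rw [intervalIntegral.integral_of_le zero_le_one,
      ← MeasureTheory.integral_indicator measurableSet_Ioc]
    refine MeasureTheory.integral_congr_ae (Filter.Eventually.of_forall fun t => ?_)
    by_cases ht : t ∈ Set.Ioc (0 : ℝ) 1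
    · have : b (0 - t) = 1 := b.one_of_mem_closedBall (by
        rw [Metric.mem_closedBall, Real.dist_eq, abs_le]
        constructor <;> [have := ht.2; have := ht.1] <;> simp only [b] <;> linarith)
      simp only [Set.indicator_of_mem ht, ContinuousLinearMap.mul_apply', this, one_mul]
      simp
    · simp [Set.indicator_of_notMem ht]
  · intro p x _ hx
    rw [b.zero_of_le_dist (le_of_lt (not_le.1 hx)), zero_mul]

lemma contMDiff_integral {EN HN N : Type*} [NormedAddCommGroup EN] [NormedSpace ℝ EN]
    [TopologicalSpace HN] {I : ModelWithCorners ℝ EN HN} [I.Boundaryless] [TopologicalSpace N]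
    [ChartedSpace HN N] [IsManifold I ∞ N] {H : N × ℝ → ℝ}
    (hH : ContMDiff (I.prod 𝓘(ℝ, ℝ)) 𝓘(ℝ, ℝ) ∞ H) :
    ContMDiff I 𝓘(ℝ, ℝ) ∞ (fun z => ∫ t in (0 : ℝ)..1, H (z, t)) := by
  intro z
  rw [contMDiffAt_iff_source_of_mem_source (x' := z) (mem_chart_source HN z), I.range_eq_univ,
    contMDiffWithinAt_univ, contMDiffAt_iff_contDiffAt]
  have h : ContMDiffOn (𝓘(ℝ, EN).prod 𝓘(ℝ, ℝ)) 𝓘(ℝ, ℝ) ∞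
      (fun q : EN × ℝ => H ((extChartAt I z).symm q.1, q.2))
      ((extChartAt I z).target ×ˢ Set.univ) :=
    hH.comp_contMDiffOn (((contMDiffOn_extChartAt_symm z).comp contMDiff_fst.contMDiffOn
      fun q hq => hq.1).prodMk contMDiff_snd.contMDiffOn)
  rw [← modelWithCornersSelf_prod, chartedSpaceSelf_prod, contMDiffOn_iff_contDiffOn] at h
  exact (contDiffOn_integral (isOpen_extChartAt_target z) h).contDiffAt
    (extChartAt_target_mem_nhds z)

end Integrals

lemma contMDiffMap_sum_apply {EN HN N ι : Type*} [NormedAddCommGroup EN] [NormedSpace ℝ EN]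
    [TopologicalSpace HN] {I : ModelWithCorners ℝ EN HN} [TopologicalSpace N]
    [ChartedSpace HN N] (s : Finset ι) (f : ι → C^∞⟮I, N; 𝓘(ℝ, ℝ), ℝ⟯) (x : N) :
    (∑ i ∈ s, f i) x = ∑ i ∈ s, f i x :=
  map_sum ((Pi.evalRingHom _ x).comp ContMDiffMap.coeFnRingHom) f s

/-! ### Point derivations of the algebra of smooth functions -/

section PointDerivations

variable {V : Type*} [NormedAddCommGroup V] [NormedSpace ℝ V] [FiniteDimensional ℝ V]

lemma exists_eq_sum_coord_mul {G : V → ℝ} (hG : ContDiff ℝ ∞ G) (c : V) (h0 : G c = 0) :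
    ∃ g : Fin (Module.finrank ℝ V) → V → ℝ, (∀ i, ContDiff ℝ ∞ (g i)) ∧
      (∀ i, g i c = fderiv ℝ G c (Module.finBasis ℝ V i)) ∧
      ∀ y, G y = ∑ i, (Module.finBasis ℝ V).coord i (y - c) * g i y := by
  have hG' : ContDiff ℝ ∞ (fderiv ℝ G) := hG.fderiv_right (by simp)
  refine ⟨fun i y => ∫ t in (0 : ℝ)..1, fderiv ℝ G (c + t • (y - c)) (Module.finBasis ℝ V i),
    fun i => ?_, fun i => by simp, fun y => ?_⟩
  · rw [← contDiffOn_univ]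
    refine contDiffOn_integral isOpen_univ (H := fun q : V × ℝ =>
      fderiv ℝ G (c + q.2 • (q.1 - c)) (Module.finBasis ℝ V i)) (ContDiff.contDiffOn ?_)
    exact (hG'.comp (contDiff_const.add (contDiff_snd.smul (contDiff_fst.sub contDiff_const)))).clm_apply
      contDiff_const
  · have hc : ∀ i, Continuous fun t : ℝ =>
        fderiv ℝ G (c + t • (y - c)) (Module.finBasis ℝ V i) := fun i =>
      (hG'.continuous.comp (by fun_prop)).clm_apply continuous_const
    have hd : ∀ t : ℝ, HasDerivAt (fun t : ℝ => G (c + t • (y - c)))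
        (fderiv ℝ G (c + t • (y - c)) (y - c)) t := fun t => by
      refine ((hG.differentiable (by simp)) _).hasFDerivAt.comp_hasDerivAt t ?_
      simpa using ((hasDerivAt_id t).smul_const (y - c)).const_add c
    have hs : ∀ t : ℝ, fderiv ℝ G (c + t • (y - c)) (y - c) =
        ∑ i, (Module.finBasis ℝ V).coord i (y - c) *
          fderiv ℝ G (c + t • (y - c)) (Module.finBasis ℝ V i) := fun t => by
      refine (congrArg _ ((Module.finBasis ℝ V).sum_repr (y - c)).symm).trans ?_
      simp only [map_sum, map_smul, smul_eq_mul, Module.Basis.coord_apply]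
    have key := intervalIntegral.integral_eq_sub_of_hasDerivAt (a := 0) (b := 1)
      (fun t _ => hd t) (by
        simp_rw [hs]
        exact (continuous_finsetSum _ fun i _ => (hc i).const_mul _).intervalIntegrable _ _)
    simp only [one_smul, add_sub_cancel, zero_smul, add_zero, h0, sub_zero] at key
    rw [← key]
    simp_rw [hs]
    rw [intervalIntegral.integral_finsetSum fun i _ =>
      ((hc i).const_mul _).intervalIntegrable _ _]
    simp_rw [intervalIntegral.integral_const_mul]

variable {C : Type*} [TopologicalSpace C] [T2Space C] [ChartedSpace V C] [IsManifold 𝓘(ℝ, V) ∞ C]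

/-- A smooth function of the coordinates, cut off by a bump function. -/
def cutoff {x₀ : C} (b : SmoothBumpFunction 𝓘(ℝ, V) x₀) {g : V → ℝ} (hg : ContDiff ℝ ∞ g) :
    BaseFun V C :=
  ⟨fun x => b x • g (extChartAt 𝓘(ℝ, V) x₀ x), b.contMDiff_smul
    (hg.contMDiff.comp_contMDiffOn contMDiffOn_extChartAt)⟩

lemma pointDer_eq_zero {x₀ : C} (T : BaseFun V C →ₗ[ℝ] ℝ)
    (hT : ∀ f g : BaseFun V C, T (f * g) = f x₀ * T g + g x₀ * T f) {K : BaseFun V C}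
    (hK : mfderiv 𝓘(ℝ, V) 𝓘(ℝ, ℝ) K x₀ = 0) : T K = 0 := by
  have hT1 : T 1 = 0 := by simpa using hT 1 1
  wlog h0 : K x₀ = 0 generalizing K
  · have := this (K := K - algebraMap ℝ _ (K x₀)) ?_ ?_
    · rw [map_sub, sub_eq_zero, Algebra.algebraMap_eq_smul_one, map_smul, hT1] at this
      simpa using this
    · have : mfderiv 𝓘(ℝ, V) 𝓘(ℝ, ℝ) (fun x => K x - K x₀) x₀ =
          mfderiv 𝓘(ℝ, V) 𝓘(ℝ, ℝ) K x₀ - mfderiv 𝓘(ℝ, V) 𝓘(ℝ, ℝ) (fun _ => K x₀) x₀ :=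
        mfderiv_sub (K.contMDiff.mdifferentiableAt (by simp)) mdifferentiableAt_const
      refine this.trans ?_
      rw [hK, mfderiv_const]
      exact sub_zero _
    · exact sub_self _
  let b : SmoothBumpFunction 𝓘(ℝ, V) x₀ := Classical.arbitrary _
  set c := extChartAt 𝓘(ℝ, V) x₀ x₀ with hc
  let G : V → ℝ := fun y => b.toContDiffBump y * K ((extChartAt 𝓘(ℝ, V) x₀).symm y)
  have hKs : ContDiffOn ℝ ∞ (fun y => K ((extChartAt 𝓘(ℝ, V) x₀).symm y))
      (extChartAt 𝓘(ℝ, V) x₀).target :=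
    contMDiffOn_iff_contDiffOn.1 (K.contMDiff.comp_contMDiffOn (contMDiffOn_extChartAt_symm x₀))
  have hG : ContDiff ℝ ∞ G := by
    rw [contDiff_iff_contDiffAt]
    intro y
    by_cases hy : y ∈ Metric.closedBall c b.rOut
    · refine b.toContDiffBump.contDiff.contDiffAt.mul (hKs.contDiffAt ?_)
      refine (isOpen_extChartAt_target x₀).mem_nhds (b.closedBall_subset ⟨hy, ?_⟩)
      simp
    · refine (contDiffAt_const (c := (0 : ℝ))).congr_of_eventuallyEq ?_
      filter_upwards [Metric.isClosed_closedBall.isOpen_compl.mem_nhds hy] with z hz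
      have : b.toContDiffBump z = 0 :=
        b.toContDiffBump.zero_of_le_dist (le_of_lt (not_le.1 hz))
      simp only [G, this, zero_mul]
  have hG0 : G c = 0 := by simp [G, c, h0]
  have hdG : fderiv ℝ G c = 0 := by
    have h1 : G =ᶠ[𝓝 c] fun y => K ((extChartAt 𝓘(ℝ, V) x₀).symm y) := by
      filter_upwards [b.toContDiffBump.eventuallyEq_one] with y hy
      simp only [G, hy, Pi.one_apply, one_mul]
    rw [h1.fderiv_eq]
    have h2 : fderivWithin ℝ (writtenInExtChartAt 𝓘(ℝ, V) 𝓘(ℝ, ℝ) x₀ K) (Set.range 𝓘(ℝ, V)) c = 0 :=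
      (K.contMDiff.mdifferentiableAt (by simp)).mfderiv.symm.trans hK
    rw [ModelWithCorners.range_eq_univ, fderivWithin_univ] at h2
    exact h2
  obtain ⟨g, hg, hgc, hsum⟩ := exists_eq_sum_coord_mul hG c hG0
  have hl : ∀ i, ContDiff ℝ ∞ fun y => (Module.finBasis ℝ V).coord i (y - c) := fun i =>
    (LinearMap.toContinuousLinearMap ((Module.finBasis ℝ V).coord i)).contDiff.comp
      (contDiff_id.sub contDiff_const)
  let β : BaseFun V C := ⟨b, b.contMDiff⟩
  have hβ : β x₀ = 1 := b.eq_one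
  have e1 : β * β * (β * K) = ∑ i, cutoff b (hl i) * cutoff b (hg i) := by
    ext x
    have e2 : (∑ i, cutoff b (hl i) * cutoff b (hg i)) x =
        ∑ i, (cutoff b (hl i) * cutoff b (hg i)) x :=
      map_sum (ContMDiffMap.coeFnAddMonoidHom.comp (AddMonoidHom.id _) |>.comp (AddMonoidHom.id _) |> (Pi.evalAddMonoidHom (fun _ : C => ℝ) x).comp) _ _
    rw [e2]
    change b x * b x * (b x * K x) = ∑ i, (b x * _) * (b x * _)
    by_cases hx : x ∈ (chartAt V x₀).source
    · have e3 : b x * K x = G (extChartAt 𝓘(ℝ, V) x₀ x) := by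
        simp only [G, b.eqOn_source hx, Function.comp_apply]
        rw [(extChartAt 𝓘(ℝ, V) x₀).left_inv (by simpa using hx)]
      rw [e3, hsum, Finset.mul_sum]
      exact Finset.sum_congr rfl fun i _ => by ring
    · have : b x = 0 := by
        by_contra h
        exact hx (b.support_subset_source h)
      simp [this]
  have e4 : T (β * β * (β * K)) = T K := by
    rw [hT, hT β K, hT β β]
    change (β x₀ * β x₀) * _ + (β x₀ * K x₀) * _ = _
    rw [hβ, h0]
    ring
  rw [← e4, e1, map_sum]
  refine Finset.sum_eq_zero fun i _ => ?_
  rw [hT]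
  have h1 : cutoff b (hl i) x₀ = 0 := by
    change b x₀ • (Module.finBasis ℝ V).coord i (c - c) = 0
    simp
  have h2 : cutoff b (hg i) x₀ = 0 := by
    change b x₀ • g i c = 0
    rw [hgc, hdG]; simp
  rw [h1, h2, zero_mul, zero_mul, add_zero]

end PointDerivations

/-! ### Finite families of fibrewise linear functions separating the points of the fibres -/

set_option linter.unusedSectionVars false

section Separating

variable {V : Type*} [NormedAddCommGroup V] [NormedSpace ℝ V] [FiniteDimensional ℝ V]
  {F : Type*} [NormedAddCommGroup F] [NormedSpace ℝ F] [FiniteDimensional ℝ F]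
  {C : Type*} [TopologicalSpace C] [T2Space C] [SigmaCompactSpace C]
  [ChartedSpace V C] [IsManifold 𝓘(ℝ, V) ∞ C]
  {E : C → Type*} [∀ x, AddCommGroup (E x)] [∀ x, Module ℝ (E x)]
  [∀ x, TopologicalSpace (E x)] [TopologicalSpace (Bundle.TotalSpace F E)]
  [FiberBundle F E] [VectorBundle ℝ F E] [ContMDiffVectorBundle ∞ F E 𝓘(ℝ, V)]

variable (V C) in
lemma exists_smooth_exhaustion : ∃ g : BaseFun V C, ∀ r : ℝ, IsCompact {x | g x ≤ r} := by
  have : LocallyCompactSpace C := ChartedSpace.locallyCompactSpace V C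
  let K := CompactExhaustion.choice C
  obtain ⟨g, hg⟩ := exists_contMDiffMap_forall_mem_convex_of_local_const (n := ⊤) 𝓘(ℝ, V)
    (t := fun x : C => Set.Ici (K.find x : ℝ)) (fun x => convex_Ici _) fun x => by
      refine ⟨(K.find x + 1 : ℕ), ?_⟩
      filter_upwards [mem_interior_iff_mem_nhds.1 (K.subset_interior_succ _ (K.mem_find x))]
        with y hy
      exact Set.mem_Ici.2 (Nat.cast_le.2 (K.mem_iff_find_le.1 hy))
  refine ⟨g, fun r => (K.isCompact ⌈r⌉₊).of_isClosed_subset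
    (isClosed_le g.contMDiff.continuous continuous_const) fun x hx => ?_⟩
  rw [K.mem_iff_find_le]
  exact Nat.cast_le.1 ((Set.mem_Ici.1 (hg x)).trans (le_trans hx (Nat.le_ceil r)))

/-- Functions given on the regions `{j ≤ G ≤ j + 1/2}` can be glued. -/
lemma exists_glue {EN HN N : Type*} [NormedAddCommGroup EN] [NormedSpace ℝ EN]
    [TopologicalSpace HN] {I : ModelWithCorners ℝ EN HN} [TopologicalSpace N]
    [ChartedSpace HN N] (G : C^∞⟮I, N; 𝓘(ℝ, ℝ), ℝ⟯) (h : ℤ → C^∞⟮I, N; 𝓘(ℝ, ℝ), ℝ⟯) :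
    ∃ (h' : C^∞⟮I, N; 𝓘(ℝ, ℝ), ℝ⟯) (ρ : ℝ → ℝ) (k : ℝ → ℤ), (∀ z, h' z = ρ (G z) * h (k (G z)) z) ∧
      ∀ (j : ℤ) z, G z ∈ Set.Icc (j : ℝ) (j + 1 / 2) → h' =ᶠ[𝓝 z] h j := by
  let b : ContDiffBump (1 / 4 : ℝ) := ⟨3 / 10, 4 / 10, by norm_num, by norm_num⟩
  let k : ℝ → ℤ := fun s => ⌊s + 1 / 4⌋
  let ρ : ℝ → ℝ := fun s => b (s - k s)
  have hb : ∀ s : ℝ, 4 / 10 ≤ |s - 1 / 4| → b s = 0 := fun s hs => b.zero_of_le_dist hs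
  have hk : ∀ s, (k s : ℝ) ≤ s + 1 / 4 ∧ s + 1 / 4 < k s + 1 := fun s =>
    ⟨Int.floor_le _, Int.lt_floor_add_one _⟩
  have key : ∀ (j : ℤ) z, |G z - j - 1 / 4| < 6 / 10 →
      ρ (G z) * h (k (G z)) z = b (G z - j) * h j z := by
    intro j z hz
    by_cases hj : k (G z) = j
    · simp only [ρ, hj]
    · obtain ⟨h1, h2⟩ := hk (G z)
      obtain ⟨h3, h4⟩ := abs_lt.1 hz
      have e : b (G z - j) = 0 ∧ b (G z - k (G z)) = 0 := by
        rcases lt_or_gt_of_ne hj with h | h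
        · have h' : (k (G z) : ℝ) + 1 ≤ j := by exact_mod_cast h
          exact ⟨hb _ (le_abs.2 (Or.inr (by linarith))), hb _ (le_abs.2 (Or.inl (by linarith)))⟩
        · have h' : (j : ℝ) + 1 ≤ k (G z) := by exact_mod_cast h
          exact ⟨hb _ (le_abs.2 (Or.inl (by linarith))), hb _ (le_abs.2 (Or.inr (by linarith)))⟩
      simp only [ρ, e.1, e.2, zero_mul]
  have hev : ∀ (j : ℤ) z (c : ℝ), |G z - j - 1 / 4| < c → ∀ᶠ y in 𝓝 z, |G y - j - 1 / 4| < c :=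
    fun j z c hz => (isOpen_lt (((G.contMDiff.continuous.sub continuous_const).sub
      continuous_const).abs) continuous_const).mem_nhds hz
  refine ⟨⟨fun z => ρ (G z) * h (k (G z)) z, fun z => ?_⟩, ρ, k, fun z => rfl, fun j z hz => ?_⟩
  · have h0 : |G z - k (G z) - 1 / 4| < 6 / 10 := by
      obtain ⟨h1, h2⟩ := hk (G z)
      exact abs_lt.2 ⟨by linarith, by linarith⟩
    refine ContMDiffAt.congr_of_eventuallyEq ?_ ((hev _ z _ h0).mono fun y hy => key _ y hy)
    exact ((b.contDiff.contMDiff.comp (G.contMDiff.sub contMDiff_const)).mul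
      (h (k (G z))).contMDiff) z
  · have h0 : |G z - j - 1 / 4| < 3 / 10 := abs_lt.2 ⟨by linarith [hz.1], by linarith [hz.2]⟩
    filter_upwards [hev j z _ h0] with y hy
    refine (key j y (hy.trans (by norm_num))).trans ?_
    rw [b.one_of_mem_closedBall (Metric.mem_closedBall.2 hy.le), one_mul]

lemma dense_compl_range {n : ℕ} (hn : Module.finrank ℝ V + Module.finrank ℝ F < n)
    (θ : Fin n → TotFun V F E) :
    Dense (Set.range fun (z : Bundle.TotalSpace F E) (i : Fin n) => θ i z)ᶜ := by
  let Θ : Bundle.TotalSpace F E → Fin n → ℝ := fun z i => θ i z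
  have hΘ : ContMDiff ((𝓘(ℝ, V)).prod 𝓘(ℝ, F)) 𝓘(ℝ, Fin n → ℝ) ∞ Θ :=
    contMDiff_pi_space.2 fun i => (θ i).contMDiff
  let φ : C → PartialEquiv (Bundle.TotalSpace F E) (V × F) := fun x =>
    extChartAt ((𝓘(ℝ, V)).prod 𝓘(ℝ, F)) (Bundle.zeroSection F E x)
  obtain ⟨s, hs, hU⟩ := countable_cover_nhds_of_sigmaCompact
    (f := fun x : C => (trivializationAt F E x).baseSet ∩ (chartAt V x).source) fun x =>
      Filter.inter_mem ((trivializationAt F E x).open_baseSet.mem_nhds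
        (FiberBundle.mem_baseSet_trivializationAt' _)) (chart_source_mem_nhds V x)
  have : Countable s := hs
  have hsub : Set.range Θ ⊆ ⋃ x : s, (fun y => Θ ((φ x).symm y)) '' (φ x).target := by
    rintro _ ⟨z, rfl⟩
    obtain ⟨x, hx, hz⟩ := Set.mem_iUnion₂.1 (hU.symm ▸ Set.mem_univ z.1)
    have hz' : z ∈ (φ x).source := by
      simp only [φ, FiberBundle.extChartAt]
      simpa [Bundle.zeroSection, Bundle.Trivialization.mem_source,
        (trivializationAt F E x).coe_fst' hz.1] using hz
    exact Set.mem_iUnion.2 ⟨⟨x, hx⟩, φ x z, (φ x).map_source hz', by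
      simp only [(φ x).left_inv hz']⟩
  refine dense_compl_of_dimH_lt_finrank ((dimH_mono hsub).trans_lt ?_)
  rw [dimH_iUnion]
  refine lt_of_le_of_lt (iSup_le fun x => ?_) (b := ((Module.finrank ℝ (V × F) : ℕ) : ENNReal)) ?_
  · rw [← Real.dimH_univ_eq_finrank (V × F)]
    refine (dimH_image_le_of_locally_lipschitzOn fun y hy => ?_).trans
      (dimH_mono (Set.subset_univ _))
    have h1 : ContDiffAt ℝ 1 (fun y => Θ ((φ x).symm y)) y := by
      have h2 : ContMDiffOn 𝓘(ℝ, V × F) 𝓘(ℝ, Fin n → ℝ) ∞ (fun y => Θ ((φ x).symm y))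
          (φ x).target := hΘ.comp_contMDiffOn (contMDiffOn_extChartAt_symm _)
      exact ((contMDiffOn_iff_contDiffOn.1 h2).contDiffAt
        ((isOpen_extChartAt_target _).mem_nhds hy)).of_le (by exact_mod_cast le_top)
    obtain ⟨K, t, ht, hL⟩ := h1.exists_lipschitzOnWith
    exact ⟨K, t, nhdsWithin_le_nhds ht, hL⟩
  · rw [Module.finrank_prod, Module.finrank_pi_fintype]
    simpa using by exact_mod_cast hn

variable {W : Type*} [AddCommGroup W] [Module ℝ W] (ev : W →ₗ[ℝ] TotFun V F E)

/-- The members of the family `l` have no common zero in the fibre over `x` except `0`. -/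
def Separates {ι : Type*} (l : ι → W) (x : C) : Prop :=
  ∀ v : E x, (∀ i, ev (l i) ⟨x, v⟩ = 0) → v = 0

variable {ev}

lemma exists_separates_succ (hlin : ∀ w x, IsLinearMap ℝ fun v : E x => ev w ⟨x, v⟩) {n : ℕ}
    (hn : Module.finrank ℝ V + Module.finrank ℝ F ≤ n) (l : Fin (n + 1) → W) :
    ∃ l' : Fin n → W, ∀ x, Separates ev l x → Separates ev l' x := by
  obtain ⟨ξ, h0, hξ⟩ := (dense_compl_range (n := n + 1) (by omega)
    fun i => ev (l i)).inter_open_nonempty {ξ | ξ (Fin.last n) ≠ 0}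
    (isOpen_ne_fun (continuous_apply _) continuous_const) ⟨fun _ => 1, one_ne_zero⟩
  refine ⟨fun i => l i.castSucc - (ξ i.castSucc / ξ (Fin.last n)) • l (Fin.last n),
    fun x hx v hv => ?_⟩
  set t := ev (l (Fin.last n)) ⟨x, v⟩ / ξ (Fin.last n) with ht
  have hl : ∀ i, ev (l i) ⟨x, v⟩ = t * ξ i := fun i => by
    refine Fin.lastCases (div_mul_cancel₀ _ h0).symm (fun i => ?_) i
    have h1 := hv i
    rw [map_sub, map_smul] at h1
    change ev (l i.castSucc) ⟨x, v⟩ - ξ i.castSucc / ξ (Fin.last n) * ev (l (Fin.last n)) ⟨x, v⟩ = 0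
      at h1
    rw [sub_eq_zero.1 h1, ht]
    ring
  by_cases h : t = 0
  · exact hx v fun i => by rw [hl, h, zero_mul]
  · refine absurd ⟨⟨x, t⁻¹ • v⟩, funext fun i => ?_⟩ hξ
    change ev (l i) ⟨x, t⁻¹ • v⟩ = ξ i
    rw [(hlin (l i) x).map_smul, hl, smul_eq_mul, inv_mul_cancel_left₀ h]

lemma exists_separates_fin (hlin : ∀ w x, IsLinearMap ℝ fun v : E x => ev w ⟨x, v⟩) {n : ℕ}
    (l : Fin n → W) : ∃ l' : Fin (Module.finrank ℝ V + Module.finrank ℝ F) → W,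
      ∀ x, Separates ev l x → Separates ev l' x := by
  by_cases h : n ≤ Module.finrank ℝ V + Module.finrank ℝ F
  · refine ⟨fun i => if hi : (i : ℕ) < n then l ⟨i, hi⟩ else 0, fun x hx v hv => hx v fun i => ?_⟩
    simpa using hv ⟨i, by omega⟩
  · induction n with
    | zero => omega
    | succ n ih =>
      obtain ⟨l', hl'⟩ := exists_separates_succ hlin (n := n) (by omega) l
      by_cases hn : n ≤ Module.finrank ℝ V + Module.finrank ℝ F
      · obtain rfl : n = Module.finrank ℝ V + Module.finrank ℝ F := by omega
        exact ⟨l', hl'⟩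
      · obtain ⟨l'', hl''⟩ := ih l' hn
        exact ⟨l'', fun x hx => hl'' x (hl' x hx)⟩

lemma exists_separates_of_isCompact (hlin : ∀ w x, IsLinearMap ℝ fun v : E x => ev w ⟨x, v⟩)
    (hloc : ∀ x, ∃ (n : ℕ) (l : Fin n → W), ∀ᶠ y in 𝓝 x, Separates ev l y) {K : Set C}
    (hK : IsCompact K) : ∃ l : Fin (Module.finrank ℝ V + Module.finrank ℝ F) → W,
      ∀ x ∈ K, Separates ev l x := by
  refine hK.induction_on (p := fun s => ∃ l : Fin (Module.finrank ℝ V + Module.finrank ℝ F) → W,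
    ∀ x ∈ s, Separates ev l x) ⟨0, fun x hx => hx.elim⟩
    (fun s t h ih => ih.imp fun l hl x hx => hl x (h hx)) (fun s t h1 h2 => ?_) fun x _ => ?_
  · obtain ⟨l, hl⟩ := h1
    obtain ⟨m, hm⟩ := h2
    obtain ⟨l', hl'⟩ := exists_separates_fin hlin (Fin.append l m)
    refine ⟨l', fun x hx => hl' x fun v hv => ?_⟩
    rcases hx with hx | hx
    · exact hl x hx v fun i => by simpa using hv (Fin.castAdd _ i)
    · exact hm x hx v fun i => by simpa only [Fin.append_right] using hv (Fin.natAdd _ i)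
  · obtain ⟨n, l, hl⟩ := hloc x
    obtain ⟨l', hl'⟩ := exists_separates_fin hlin l
    exact ⟨_, mem_nhdsWithin_of_mem_nhds hl, l', fun y hy => hl' y hy⟩

/-- Finitely many fibrewise linear functions separate the points of all fibres. -/
theorem exists_separates (hlin : ∀ w x, IsLinearMap ℝ fun v : E x => ev w ⟨x, v⟩)
    (hloc : ∀ x, ∃ (n : ℕ) (l : Fin n → W), ∀ᶠ y in 𝓝 x, Separates ev l y)
    (hglue : ∀ (g : BaseFun V C) (w : ℤ → W), ∃ w' : W, ∀ (j : ℤ) x,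
      g x ∈ Set.Icc (j : ℝ) (j + 1 / 2) → ∀ v : E x, ev w' ⟨x, v⟩ = ev (w j) ⟨x, v⟩) :
    ∃ (d : ℕ) (l : Fin d ⊕ Fin d → W), ∀ x, Separates ev l x := by
  obtain ⟨g, hg⟩ := exists_smooth_exhaustion V C
  have key : ∀ G : BaseFun V C, (∀ r : ℝ, IsCompact {x | G x ≤ r}) →
      ∃ l : Fin (Module.finrank ℝ V + Module.finrank ℝ F) → W,
        ∀ (j : ℤ) x, G x ∈ Set.Icc (j : ℝ) (j + 1 / 2) → Separates ev l x := by
    intro G hG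
    choose l hl using fun j : ℤ => exists_separates_of_isCompact hlin hloc (hG (j + 1 / 2))
    choose l' hl' using fun i => hglue G fun j => l j i
    exact ⟨l', fun j x hx v hv => hl j x hx.2 v fun i => by rw [← hl' i j x hx, hv]⟩
  obtain ⟨l, hl⟩ := key g hg
  obtain ⟨m, hm⟩ := key (g + algebraMap ℝ _ (1 / 2)) fun r => by
    convert hg (r - 1 / 2) using 3 with x
    exact (le_sub_iff_add_le (b := (1 / 2 : ℝ))).symm
  refine ⟨_, Sum.elim l m, fun x v hv => ?_⟩
  have h1 := Int.floor_le (g x)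
  have h2 := Int.lt_floor_add_one (g x)
  by_cases h : g x ≤ ⌊g x⌋ + 1 / 2
  · exact hl _ x ⟨h1, h⟩ v fun i => hv (Sum.inl i)
  · refine hm (⌊g x⌋ + 1) x ?_ v fun i => hv (Sum.inr i)
    change g x + 1 / 2 ∈ _
    push_cast
    constructor <;> linarith

end Separating

/-! ### Finite frames and dual frames of a vector bundle -/

section LinearAlgebra

variable {X κ : Type*} [AddCommGroup X] [Module ℝ X] [Fintype κ]

lemma eq_of_gram_eq {l : κ → Module.Dual ℝ X} (hl : ∀ v, (∀ i, l i v = 0) → v = 0) {s t : X}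
    (h : ∀ w, ∑ ν, l ν s * l ν w = ∑ ν, l ν t * l ν w) : s = t := by
  rw [← sub_eq_zero]
  refine hl _ fun i => ?_
  have h1 : ∑ ν, l ν (s - t) * l ν (s - t) = 0 := by
    have := h (s - t)
    simp_rw [map_sub (l _) s t, sub_mul, Finset.sum_sub_distrib]
    simp_rw [← map_sub]
    rw [this, sub_self]
  exact mul_self_eq_zero.1
    ((Finset.sum_eq_zero_iff_of_nonneg fun ν _ => mul_self_nonneg _).1 h1 i (Finset.mem_univ _))

lemma exists_gram_eq [FiniteDimensional ℝ X] {l : κ → Module.Dual ℝ X}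
    (hl : ∀ v, (∀ i, l i v = 0) → v = 0) (m : Module.Dual ℝ X) :
    ∃ s : X, ∀ w, ∑ ν, l ν s * l ν w = m w := by
  let G : X →ₗ[ℝ] Module.Dual ℝ X := ∑ ν, (l ν).smulRight (l ν)
  have hG : ∀ s w, G s w = ∑ ν, l ν s * l ν w := fun s w => by simp [G]
  have hi : Function.Injective G := fun s t h => eq_of_gram_eq hl fun w => by rw [← hG, ← hG, h]
  obtain ⟨s, hs⟩ := ((LinearMap.injective_iff_surjective_of_finrank_eq_finrank
    (Subspace.dual_finrank_eq (K := ℝ) (V := X)).symm).1 hi) m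
  exact ⟨s, fun w => by rw [← hG, hs]⟩

end LinearAlgebra

section Frames

variable {V : Type*} [NormedAddCommGroup V] [NormedSpace ℝ V] [FiniteDimensional ℝ V]
  {F : Type*} [NormedAddCommGroup F] [NormedSpace ℝ F] [FiniteDimensional ℝ F]
  {C : Type*} [TopologicalSpace C] [T2Space C] [SigmaCompactSpace C]
  [ChartedSpace V C] [IsManifold 𝓘(ℝ, V) ∞ C]
  {E : C → Type*} [∀ x, AddCommGroup (E x)] [∀ x, Module ℝ (E x)]
  [∀ x, TopologicalSpace (E x)] [TopologicalSpace (Bundle.TotalSpace F E)]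
  [FiberBundle F E] [VectorBundle ℝ F E] [ContMDiffVectorBundle ∞ F E 𝓘(ℝ, V)]

variable (V F E) in
/-- The space of functions which are linear on the fibres. -/
def linSubmodule : Submodule ℝ (TotFun V F E) where
  carrier := {u | ∀ x, IsLinearMap ℝ fun e : E x => u ⟨x, e⟩}
  zero_mem' x := ⟨fun _ _ => (add_zero (0 : ℝ)).symm, fun c _ => (mul_zero c).symm⟩
  add_mem' {u w} hu hw x := ⟨fun a b => by
    change u _ + w _ = (u _ + w _) + (u _ + w _)
    rw [(hu x).map_add, (hw x).map_add]; ring, fun c a => by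
    change u _ + w _ = c * (u _ + w _)
    rw [(hu x).map_smul, (hw x).map_smul, smul_eq_mul, smul_eq_mul]; ring⟩
  smul_mem' r u hu x := ⟨fun a b => by
    change r * u _ = r * u _ + r * u _
    rw [(hu x).map_add]; ring, fun c a => by
    change r * u _ = c * (r * u _)
    rw [(hu x).map_smul, smul_eq_mul]; ring⟩

lemma exists_linFun_eventually (x₀ : C) (m : F →L[ℝ] ℝ) :
    ∃ u : LinFun V F E, ∀ᶠ x in 𝓝 x₀, ∀ v : E x,
      u.1 ⟨x, v⟩ = m (trivializationAt F E x₀ ⟨x, v⟩).2 := by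
  set T := trivializationAt F E x₀
  have hT : T.baseSet ∈ 𝓝 x₀ :=
    T.open_baseSet.mem_nhds (FiberBundle.mem_baseSet_trivializationAt' _)
  obtain ⟨b, -, hb⟩ := (SmoothBumpFunction.nhds_basis_tsupport (I := 𝓘(ℝ, V)) x₀).mem_iff.1 hT
  refine ⟨⟨⟨fun z => b z.1 * m (T z).2, fun z => ?_⟩, fun x => ?_⟩, ?_⟩
  · by_cases hz : z.1 ∈ T.baseSet
    · refine ((b.contMDiff.comp (Bundle.contMDiff_proj E)) z).mul
        (m.contDiff.contMDiff.contMDiffAt.comp z ?_)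
      exact contMDiffAt_snd.comp z (T.contMDiffOn.contMDiffAt
        (T.open_source.mem_nhds (T.mem_source.2 hz)))
    · refine (contMDiffAt_const (c := (0 : ℝ))).congr_of_eventuallyEq ?_
      have h1 : (tsupport b)ᶜ ∈ 𝓝 z.1 :=
        (isClosed_tsupport _).isOpen_compl.mem_nhds fun h => hz (hb h)
      filter_upwards [(FiberBundle.continuous_proj F E).continuousAt.preimage_mem_nhds h1] with y hy
      rw [image_eq_zero_of_notMem_tsupport hy, zero_mul]
  · by_cases hx : x ∈ T.baseSet
    · have hl := T.linear ℝ hx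
      constructor
      · intro v w
        change b x * m (T ⟨x, v + w⟩).2 = b x * m (T ⟨x, v⟩).2 + b x * m (T ⟨x, w⟩).2
        rw [hl.map_add, map_add, mul_add]
      · intro c v
        change b x * m (T ⟨x, c • v⟩).2 = c * (b x * m (T ⟨x, v⟩).2)
        rw [hl.map_smul, map_smul, smul_eq_mul]; ring
    · have h0 : b x = 0 := image_eq_zero_of_notMem_tsupport fun h => hx (hb h)
      constructor
      · intro v w
        change b x * _ = b x * _ + b x * _
        simp [h0]
      · intro c v
        change b x * _ = c * (b x * _)
        simp [h0]
  · filter_upwards [b.eventuallyEq_one] with x hx v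
    change b x * _ = _
    rw [hx, Pi.one_apply, one_mul]

variable (V F E) in
lemma exists_linFun_frame : ∃ (d : ℕ) (u : Fin d ⊕ Fin d → LinFun V F E),
    ∀ x (v : E x), (∀ i, (u i).1 ⟨x, v⟩ = 0) → v = 0 := by
  refine (exists_separates (ev := (linSubmodule V F E).subtype) (fun w x => w.2 x)
    (fun x₀ => ?_) fun g w => ?_).elim fun d ⟨l, hl⟩ => ⟨d, fun i => ⟨(l i).1, (l i).2⟩, hl⟩
  · choose u hu using fun i : Fin (Module.finrank ℝ F) => exists_linFun_eventually (V := V)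
      (E := E) x₀ (LinearMap.toContinuousLinearMap ((Module.finBasis ℝ F).coord i))
    refine ⟨_, fun i => ⟨(u i).1, (u i).2⟩, ?_⟩
    filter_upwards [Filter.eventually_all.2 hu, (trivializationAt F E x₀).open_baseSet.mem_nhds
      (FiberBundle.mem_baseSet_trivializationAt' _)] with x hx hx' v hv
    refine ((trivializationAt F E x₀).linearEquivAt ℝ x hx').map_eq_zero_iff.1 ?_
    refine (Module.finBasis ℝ F).ext_elem_iff.2 fun i => ?_
    rw [map_zero, Finsupp.zero_apply, Bundle.Trivialization.linearEquivAt_apply]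
    exact (hx i v).symm.trans (hv i)
  · obtain ⟨h', ρ, k, hform, heq⟩ := exists_glue (pullback g : TotFun V F E) fun j => (w j).1
    refine ⟨⟨h', fun x => ⟨fun a b => ?_, fun c a => ?_⟩⟩, fun j x hx v =>
      (heq j ⟨x, v⟩ hx).eq_of_nhds⟩
    · rw [hform, hform, hform]
      change ρ (g x) * (w (k (g x))).1 _ = ρ (g x) * (w (k (g x))).1 _ + ρ (g x) * (w (k (g x))).1 _
      rw [((w (k (g x))).2 x).map_add, mul_add]
    · rw [hform, hform]
      change ρ (g x) * (w (k (g x))).1 _ = c * (ρ (g x) * (w (k (g x))).1 _)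
      rw [((w (k (g x))).2 x).map_smul, smul_eq_mul]; ring

/-- A finite separating family of fibrewise linear functions has a dual family of sections. -/
lemma exists_dual_frame {κ : Type*} [Fintype κ] (u : κ → LinFun V F E)
    (hu : ∀ x (v : E x), (∀ i, (u i).1 ⟨x, v⟩ = 0) → v = 0) :
    ∃ e : κ → Sec V F E, ∀ x (v : E x), ∑ μ, (u μ).1 ⟨x, v⟩ • e μ x = v := by
  have hfd : ∀ x, FiniteDimensional ℝ (E x) := fun x =>
    ((trivializationAt F E x).linearEquivAt ℝ x
      (FiberBundle.mem_baseSet_trivializationAt' _)).symm.finiteDimensional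
  choose e he using fun x μ => exists_gram_eq (l := fun i => (u i).at x) (hu x)
    ((u μ).at x)
  suffices h : ∀ μ, ContMDiff 𝓘(ℝ, V) ((𝓘(ℝ, V)).prod 𝓘(ℝ, F)) ∞
      fun x => (⟨x, e x μ⟩ : Bundle.TotalSpace F E) by
    refine ⟨fun μ => ⟨fun x => e x μ, h μ⟩, fun x v => ?_⟩
    refine eq_of_gram_eq (l := fun i => (u i).at x) (hu x) fun w => ?_
    change ∑ ν, (u ν).at x (∑ μ, (u μ).at x v • e x μ) * _ = _
    simp_rw [map_sum, map_smul, smul_eq_mul, Finset.sum_mul]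
    rw [Finset.sum_comm]
    simp_rw [mul_assoc, ← Finset.mul_sum, he]
  intro μ x₀
  set T := trivializationAt F E x₀ with hTdef
  have hT : T.baseSet ∈ 𝓝 x₀ :=
    T.open_baseSet.mem_nhds (FiberBundle.mem_baseSet_trivializationAt' _)
  rw [Bundle.contMDiffAt_section]
  let b := Module.finBasis ℝ F
  let U : κ → C → F →L[ℝ] ℝ := fun ν x =>
    ∑ i, (u ν).1 ⟨x, T.symm x (b i)⟩ • LinearMap.toContinuousLinearMap (b.coord i)
  have hU : ∀ ν, ∀ x ∈ T.baseSet, ∀ v : E x, U ν x (T ⟨x, v⟩).2 = (u ν).at x v := by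
    intro ν x hx v
    have h1 : v = ∑ i, b.repr (T ⟨x, v⟩).2 i • T.symm x (b i) := by
      apply (T.linearEquivAt ℝ x hx).injective
      simp_rw [map_sum, map_smul, ← T.linearEquivAt_symm_apply (R := ℝ) x hx, LinearEquiv.apply_symm_apply,
        b.sum_repr, T.linearEquivAt_apply]
    conv_rhs => rw [h1]
    simp only [U, map_sum, map_smul, sum_apply, smul_eq_mul,
      smul_apply]
    exact Finset.sum_congr rfl fun i _ => mul_comm _ _
  have hUs : ∀ ν, ContMDiffAt 𝓘(ℝ, V) 𝓘(ℝ, F →L[ℝ] ℝ) ∞ (U ν) x₀ := by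
    intro ν
    refine contMDiffAt_finsetSum fun i _ => ?_
    have h1 : ContMDiffOn 𝓘(ℝ, V) 𝓘(ℝ, ℝ) ∞
        (fun x => (u ν).1 (T.toOpenPartialHomeomorph.symm (x, b i))) T.baseSet := by
      refine (u ν).1.contMDiff.comp_contMDiffOn (T.contMDiffOn_symm.comp
        (contMDiff_id.prodMk contMDiff_const).contMDiffOn fun x hx => T.mem_target.2 hx)
    refine ((h1.contMDiffAt hT).smul
      (contMDiffAt_const (c := LinearMap.toContinuousLinearMap (b.coord i)))).congr_of_eventuallyEq ?_
    filter_upwards [hT] with x hx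
    simp only [Pi.smul_apply', T.mk_symm hx]
  let G : C → F →L[ℝ] F →L[ℝ] ℝ := fun x => ∑ ν, (U ν x).smulRight (U ν x)
  have hGs : ContMDiffAt 𝓘(ℝ, V) 𝓘(ℝ, F →L[ℝ] F →L[ℝ] ℝ) ∞ G x₀ := by
    refine contMDiffAt_finsetSum fun ν _ => ?_
    have h1 : ContDiff ℝ ∞ fun p : (F →L[ℝ] ℝ) × (F →L[ℝ] ℝ) => p.1.smulRight p.2 := by
      apply IsBoundedBilinearMap.contDiff
      exact isBoundedBilinearMap_smulRight
    exact h1.contMDiff.contMDiffAt.comp x₀ ((hUs ν).prodMk_space (hUs ν))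
  have hG : ∀ x ∈ T.baseSet, ∃ A : F ≃L[ℝ] F →L[ℝ] ℝ, (A : F →L[ℝ] F →L[ℝ] ℝ) = G x := by
    intro x hx
    have hi : Function.Injective (G x) := by
      intro s t hst
      refine eq_of_gram_eq (l := fun ν => (U ν x : F →ₗ[ℝ] ℝ)) (fun f hf => ?_) fun w => ?_
      · have h1 : f = (T ⟨x, T.symm x f⟩).2 := by rw [T.apply_mk_symm hx]
        have h2 : T.symm x f = 0 := hu x _ fun ν => by
          have := hf ν
          rw [h1] at this
          exact (hU ν x hx _).symm.trans this
        rw [← T.linearEquivAt_symm_apply (R := ℝ) x hx] at h2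
        exact (LinearEquiv.map_eq_zero_iff _).1 h2
      · have := DFunLike.congr_fun hst w
        simpa [G, sum_apply] using this
    have hd : Module.finrank ℝ F = Module.finrank ℝ (F →L[ℝ] ℝ) := by
      rw [← (LinearMap.toContinuousLinearMap (𝕜 := ℝ) (E := F) (F' := ℝ)).finrank_eq]
      exact (Subspace.dual_finrank_eq (K := ℝ) (V := F)).symm
    exact ⟨(LinearEquiv.ofInjectiveOfFinrankEq (G x : F →ₗ[ℝ] F →L[ℝ] ℝ) hi hd).toContinuousLinearEquiv,
      by ext; rfl⟩
  obtain ⟨A, hA⟩ := hG x₀ (mem_of_mem_nhds hT)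
  have key : ∀ x ∈ T.baseSet, (T ⟨x, e x μ⟩).2 = (G x).inverse (U μ x) := by
    intro x hx
    obtain ⟨A, hA⟩ := hG x hx
    rw [← hA, ContinuousLinearMap.inverse_equiv]
    refine (A.symm_apply_eq.2 ?_).symm
    ext f
    have h1 : f = (T ⟨x, T.symm x f⟩).2 := by rw [T.apply_mk_symm hx]
    change _ = (A : F →L[ℝ] F →L[ℝ] ℝ) _ f
    rw [hA, h1, hU μ x hx, ← he x μ]
    simp only [G, sum_apply, ContinuousLinearMap.smulRight_apply,
      smul_apply, smul_eq_mul, hU _ x hx]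
  refine ContMDiffAt.congr_of_eventuallyEq (ContMDiffAt.clm_apply (ContMDiffAt.comp x₀
    (g := ContinuousLinearMap.inverse) (ContDiffAt.contMDiffAt ?_) hGs) (hUs μ))
    (Filter.mem_of_superset hT key)
  rw [← hA]
  exact contDiffAt_map_inverse A

end Frames

/-! ### Differentials and vector fields on the base -/

section Tangent

variable {V : Type*} [NormedAddCommGroup V] [NormedSpace ℝ V]
  {C : Type*} [TopologicalSpace C] [ChartedSpace V C] [IsManifold 𝓘(ℝ, V) ∞ C]

/-- The tangent spaces of the base. -/
abbrev TC (V : Type*) [NormedAddCommGroup V] [NormedSpace ℝ V] {C : Type*} [TopologicalSpace C]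
    [ChartedSpace V C] (x : C) : Type _ := TangentSpace 𝓘(ℝ, V) x

/-- The differential of a function on the base. -/
def dAt (f : BaseFun V C) (x : C) : TC V x →ₗ[ℝ] ℝ :=
  ((mfderiv 𝓘(ℝ, V) 𝓘(ℝ, ℝ) f x : TC V x →L[ℝ] TangentSpace 𝓘(ℝ, ℝ) (f x)) :
    TC V x →ₗ[ℝ] TangentSpace 𝓘(ℝ, ℝ) (f x))

lemma hasMFDerivAt_base (f : BaseFun V C) (x : C) :
    HasMFDerivAt 𝓘(ℝ, V) 𝓘(ℝ, ℝ) f x (mfderiv 𝓘(ℝ, V) 𝓘(ℝ, ℝ) f x) :=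
  (f.contMDiff.mdifferentiableAt (by simp)).hasMFDerivAt

lemma dAt_eq {f : BaseFun V C} {x : C} {f' : TC V x →L[ℝ] ℝ}
    (h : HasMFDerivAt 𝓘(ℝ, V) 𝓘(ℝ, ℝ) f x f') (v : TC V x) : dAt f x v = f' v :=
  DFunLike.congr_fun h.mfderiv v

lemma dAt_add (f g : BaseFun V C) (x : C) : dAt (f + g) x = dAt f x + dAt g x :=
  LinearMap.ext fun v => dAt_eq (f := f + g) ((hasMFDerivAt_base f x).add (hasMFDerivAt_base g x)) v

lemma dAt_smul (r : ℝ) (f : BaseFun V C) (x : C) : dAt (r • f) x = r • dAt f x :=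
  LinearMap.ext fun v => dAt_eq (f := r • f) ((hasMFDerivAt_base f x).const_smul r) v

lemma dAt_mul (f g : BaseFun V C) (x : C) : dAt (f * g) x = f x • dAt g x + g x • dAt f x :=
  LinearMap.ext fun v => dAt_eq (f := f * g) ((hasMFDerivAt_base f x).mul (hasMFDerivAt_base g x)) v

/-- The differential as a linear map to functions on the tangent bundle. -/
def dLin : BaseFun V C →ₗ[ℝ] TotFun V V (TC V : C → Type _) where
  toFun f := ⟨fun z => dAt f z.1 z.2,
    (contMDiff_snd_tangentBundle_modelSpace ℝ 𝓘(ℝ, ℝ)).comp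
      (f.contMDiff.contMDiff_tangentMap (m := ∞) (by simp))⟩
  map_add' f g := by ext z; exact LinearMap.congr_fun (dAt_add f g z.1) z.2
  map_smul' r f := by ext z; exact LinearMap.congr_fun (dAt_smul r f z.1) z.2

/-- A vector field on the base as a derivation. -/
def vfDer (X : Sec V V (TC V : C → Type _)) : Derivation ℝ (BaseFun V C) (BaseFun V C) :=
  Derivation.mk'
    { toFun := fun f => ⟨fun x => dAt f x (X x), (dLin f).contMDiff.comp X.contMDiff⟩
      map_add' := fun f g => by ext x; exact LinearMap.congr_fun (dAt_add f g x) (X x)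
      map_smul' := fun r f => by ext x; exact LinearMap.congr_fun (dAt_smul r f x) (X x) }
    fun f g => by ext x; exact LinearMap.congr_fun (dAt_mul f g x) (X x)

variable [FiniteDimensional ℝ V] [T2Space C]

lemma dAt_cutoff {x₀ : C} (b : SmoothBumpFunction 𝓘(ℝ, V) x₀) (m : V →L[ℝ] ℝ) :
    ∀ᶠ x in 𝓝 x₀, ∀ v : TC V x, dAt (cutoff b m.contDiff) x v =
      m (mfderiv 𝓘(ℝ, V) 𝓘(ℝ, V) (extChartAt 𝓘(ℝ, V) x₀) x v) := by
  filter_upwards [b.eventuallyEq_one.eventuallyEq_nhds, chart_source_mem_nhds V x₀] with x hx hs v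
  have h1 : HasMFDerivAt 𝓘(ℝ, V) 𝓘(ℝ, ℝ) (fun y => m (extChartAt 𝓘(ℝ, V) x₀ y)) x
      (m.comp (mfderiv 𝓘(ℝ, V) 𝓘(ℝ, V) (extChartAt 𝓘(ℝ, V) x₀) x)) :=
    m.hasMFDerivAt.comp x ((contMDiffAt_extChartAt' (n := ∞) hs).mdifferentiableAt (by simp)).hasMFDerivAt
  refine dAt_eq (h1.congr_of_eventuallyEq ?_) v
  filter_upwards [hx] with y hy
  change b y • (_ : ℝ) = _
  rw [hy, Pi.one_apply, one_smul]

variable [SigmaCompactSpace C]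

variable (V C) in
/-- Finitely many functions on the base and vector fields which are dual to each other. -/
lemma exists_tangent_frame : ∃ (d : ℕ) (f : Fin d ⊕ Fin d → BaseFun V C)
    (X : Fin d ⊕ Fin d → Sec V V (TC V : C → Type _)),
    ∀ x (v : TC V x), ∑ i, dAt (f i) x v • X i x = v := by
  obtain ⟨d, f, hf⟩ : ∃ (d : ℕ) (l : Fin d ⊕ Fin d → BaseFun V C), ∀ x, Separates dLin l x := by
    refine exists_separates (fun f x => (dAt f x).isLinear) (fun x₀ => ?_) fun g w => ?_
    · let b : SmoothBumpFunction 𝓘(ℝ, V) x₀ := Classical.arbitrary _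
      refine ⟨_, fun i : Fin (Module.finrank ℝ V) => cutoff b
        (LinearMap.toContinuousLinearMap ((Module.finBasis ℝ V).coord i)).contDiff, ?_⟩
      filter_upwards [Filter.eventually_all.2 fun i => dAt_cutoff b
        (LinearMap.toContinuousLinearMap ((Module.finBasis ℝ V).coord i)),
        chart_source_mem_nhds V x₀] with x hx hs v hv
      have h1 : mfderiv 𝓘(ℝ, V) 𝓘(ℝ, V) (extChartAt 𝓘(ℝ, V) x₀) x v = (0 : V) :=
        (Module.finBasis ℝ V).ext_elem_iff.2 fun i => by
          rw [map_zero, Finsupp.zero_apply]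
          exact (hx i v).symm.trans (hv i)
      obtain ⟨A, hA⟩ := isInvertible_mfderiv_extChartAt (I := 𝓘(ℝ, V)) (x := x₀) (y := x)
        (by simpa using hs)
      rw [← hA] at h1
      exact (A.map_eq_zero_iff).1 h1
    · obtain ⟨h', ρ, k, -, heq⟩ := exists_glue g w
      exact ⟨h', fun j x hx v => DFunLike.congr_fun (heq j x hx).mfderiv_eq v⟩
  obtain ⟨X, hX⟩ := exists_dual_frame (fun i => (⟨dLin (f i), fun x => (dAt (f i) x).isLinear⟩ :
    LinFun V V (TC V : C → Type _))) hf
  exact ⟨d, f, X, hX⟩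

/-- A point derivation is determined by its values on functions with spanning differentials. -/
lemma pointDer_eq {ι : Type*} [Fintype ι] {f : ι → BaseFun V C}
    {X : ι → Sec V V (TC V : C → Type _)} (hX : ∀ x (v : TC V x), ∑ i, dAt (f i) x v • X i x = v)
    {x₀ : C} (T : BaseFun V C →ₗ[ℝ] ℝ)
    (hT : ∀ f g : BaseFun V C, T (f * g) = f x₀ * T g + g x₀ * T f) (h : BaseFun V C) :
    T h = ∑ i, vfDer (X i) h x₀ * T (f i) := by
  have key : T (h - ∑ i, vfDer (X i) h x₀ • f i) = 0 := by
    refine pointDer_eq_zero T hT ?_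
    have hsum : ∀ s : Finset ι, dAt (∑ i ∈ s, vfDer (X i) h x₀ • f i) x₀ =
        ∑ i ∈ s, vfDer (X i) h x₀ • dAt (f i) x₀ := fun s => by
      induction s using Finset.cons_induction with
      | empty =>
        have := dAt_smul 0 (0 : BaseFun V C) x₀
        simpa using this
      | cons i s hi ih => rw [Finset.sum_cons, Finset.sum_cons, dAt_add, dAt_smul, ih]
    refine ContinuousLinearMap.ext fun v => ?_
    change dAt (h - _) x₀ v = 0
    rw [sub_eq_add_neg, ← neg_one_smul ℝ, dAt_add, dAt_smul, hsum]
    have h1 := congrArg (dAt h x₀) (hX x₀ v)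
    rw [map_sum] at h1
    simp only [map_smul, smul_eq_mul] at h1
    simp only [LinearMap.add_apply, LinearMap.smul_apply, LinearMap.sum_apply, smul_eq_mul, ← h1]
    change _ + -1 * ∑ i, dAt h x₀ (X i x₀) * _ = 0
    simp_rw [mul_comm]
    ring
  rw [map_sub, map_sum, sub_eq_zero] at key
  simpa using key

end Tangent

/-! ### Calculus on the total space -/

section TotalSpace

variable {V : Type*} [NormedAddCommGroup V] [NormedSpace ℝ V]
  {F : Type*} [NormedAddCommGroup F] [NormedSpace ℝ F]
  {C : Type*} [TopologicalSpace C] [ChartedSpace V C]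
  {E : C → Type*} [∀ x, AddCommGroup (E x)] [∀ x, Module ℝ (E x)]
  [∀ x, TopologicalSpace (E x)] [TopologicalSpace (Bundle.TotalSpace F E)]
  [FiberBundle F E] [VectorBundle ℝ F E] {κ : Type*} [Fintype κ]

lemma contMDiff_comb {EN HN N : Type*} [NormedAddCommGroup EN] [NormedSpace ℝ EN]
    [TopologicalSpace HN] {I : ModelWithCorners ℝ EN HN} [TopologicalSpace N]
    [ChartedSpace HN N] {f : N → C} (hf : ContMDiff I 𝓘(ℝ, V) ∞ f) {c : κ → N → ℝ}
    (hc : ∀ μ, ContMDiff I 𝓘(ℝ, ℝ) ∞ (c μ)) (e : κ → Sec V F E) :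
    ContMDiff I ((𝓘(ℝ, V)).prod 𝓘(ℝ, F)) ∞
      (fun n => (⟨f n, ∑ μ, c μ n • e μ (f n)⟩ : Bundle.TotalSpace F E)) := by
  intro n₀
  rw [Bundle.contMDiffAt_totalSpace]
  refine ⟨hf n₀, ?_⟩
  have h1 : ∀ μ, ContMDiffAt I 𝓘(ℝ, F) ∞
      (fun n => (trivializationAt F E (f n₀) ⟨f n, e μ (f n)⟩).2) n₀ := fun μ =>
    ContMDiffAt.comp (g := fun x : C => (trivializationAt F E (f n₀) ⟨x, e μ x⟩).2) n₀
      ((Bundle.contMDiffAt_section (f n₀)).1 ((e μ).contMDiff (f n₀))) (hf n₀)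
  have h2 : ContMDiffAt I 𝓘(ℝ, F) ∞
      (fun n => ∑ μ, c μ n • (trivializationAt F E (f n₀) ⟨f n, e μ (f n)⟩).2) n₀ :=
    contMDiffAt_finsetSum fun μ _ => (hc μ n₀).smul (h1 μ)
  refine h2.congr_of_eventuallyEq ?_
  have hb : (trivializationAt F E (f n₀)).baseSet ∈ 𝓝 (f n₀) :=
    (trivializationAt F E (f n₀)).open_baseSet.mem_nhds
      (FiberBundle.mem_baseSet_trivializationAt' _)
  filter_upwards [hf.continuous.continuousAt.preimage_mem_nhds hb] with n hn
  have := map_sum ((trivializationAt F E (f n₀)).linearEquivAt ℝ (f n) hn)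
    (fun μ => c μ n • e μ (f n)) Finset.univ
  simpa only [map_smul, Bundle.Trivialization.linearEquivAt_apply] using this

/-- The section `∑ c_μ e_μ`. -/
def combSec (e : κ → Sec V F E) (c : κ → BaseFun V C) : Sec V F E :=
  ⟨fun x => ∑ μ, c μ x • e μ x, contMDiff_comb contMDiff_id (fun μ => (c μ).contMDiff) e⟩

/-- The restriction of a function on the total space to a section. -/
def along (s : Sec V F E) : TotFun V F E →ₐ[ℝ] BaseFun V C where
  toFun h := ContMDiffMap.comp h ⟨fun x => ⟨x, s x⟩, s.contMDiff⟩
  map_one' := rfl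
  map_mul' _ _ := rfl
  map_zero' := rfl
  map_add' _ _ := rfl
  commutes' _ := rfl

variable [ContMDiffVectorBundle ∞ F E 𝓘(ℝ, V)]

lemma exists_fibre_function (h : TotFun V F E) (x : C) : ∃ k : F → ℝ, ContDiff ℝ ∞ k ∧
    ∀ v : E x, h ⟨x, v⟩ = k ((trivializationAt F E x).linearEquivAt ℝ x
      (FiberBundle.mem_baseSet_trivializationAt' x) v) := by
  have hx := FiberBundle.mem_baseSet_trivializationAt' (F := F) (E := E) x
  refine ⟨fun f => h ((trivializationAt F E x).toOpenPartialHomeomorph.symm (x, f)), ?_, fun v => ?_⟩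
  · have h1 := h.contMDiff.comp_contMDiffOn ((trivializationAt F E x).contMDiffOn_symm (n := ∞)
      (IB := 𝓘(ℝ, V)))
    have h2 : ContMDiff 𝓘(ℝ, F) (𝓘(ℝ, V).prod 𝓘(ℝ, F)) ∞ (fun f : F => ((x, f) : C × F)) :=
      contMDiff_const.prodMk contMDiff_id
    exact (h1.comp_contMDiff h2 fun f => (trivializationAt F E x).mem_target.2 hx).contDiff
  · rw [Bundle.Trivialization.linearEquivAt_apply]
    congr 1
    exact ((trivializationAt F E x).toOpenPartialHomeomorph.left_inv
      ((trivializationAt F E x).mem_source.2 hx)).symm.trans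
      (congrArg _ ((trivializationAt F E x).mk_proj_snd' hx).symm)

variable [IsManifold 𝓘(ℝ, V) ∞ C]

lemma vertLift_apply {h : TotFun V F E} {x : C} {k : F → ℝ} (hk : ContDiff ℝ ∞ k)
    {T : E x ≃ₗ[ℝ] F} (hT : ∀ v, h ⟨x, v⟩ = k (T v)) (s : Sec V F E) (v : E x) :
    vertLift s h ⟨x, v⟩ = fderiv ℝ k (T v) (T (s x)) := by
  change deriv (fun t : ℝ => h ⟨x, v + t • s x⟩) 0 = _
  simp_rw [hT, map_add, map_smul]
  have h1 : HasDerivAt (fun t : ℝ => T v + t • T (s x)) (T (s x)) 0 := by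
    simpa using (((hasDerivAt_id (0 : ℝ)).smul_const (T (s x))).const_add (T v))
  have h2 : HasFDerivAt k (fderiv ℝ k (T v)) (T v + (0 : ℝ) • T (s x)) := by
    rw [zero_smul, add_zero]
    exact ((hk.differentiable (by simp)) _).hasFDerivAt
  exact (h2.comp_hasDerivAt 0 h1).deriv

lemma vertLift_pullback (s : Sec V F E) (f : BaseFun V C) :
    vertLift s (pullback f : TotFun V F E) = 0 := by
  ext z
  exact deriv_const 0 (f z.1)

lemma vertLift_lin (s : Sec V F E) (w : LinFun V F E) :
    vertLift s w.1 = pullback (pairing w s) := by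
  ext z
  change deriv (fun t : ℝ => w.1 ⟨z.1, z.2 + t • s z.1⟩) 0 = w.at z.1 (s z.1)
  have : ∀ t : ℝ, w.1 ⟨z.1, z.2 + t • s z.1⟩ = w.at z.1 z.2 + t • w.at z.1 (s z.1) := fun t => by
    rw [← map_smul, ← map_add]; rfl
  simp_rw [this]
  simp

lemma vertLift_comm (s t : Sec V F E) (h : TotFun V F E) :
    vertLift s (vertLift t h) = vertLift t (vertLift s h) := by
  ext ⟨x, v⟩
  obtain ⟨k, hk, hT⟩ := exists_fibre_function h x
  have h1 : ∀ w : F, ContDiff ℝ ∞ fun f => fderiv ℝ k f w := fun w =>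
    (hk.fderiv_right (m := ∞) (by simp)).clm_apply contDiff_const
  have h2 : ∀ f w, HasFDerivAt (fun f => fderiv ℝ k f w)
      ((ContinuousLinearMap.apply ℝ ℝ w).comp (fderiv ℝ (fderiv ℝ k) f)) f := fun f w =>
    (ContinuousLinearMap.apply ℝ ℝ w).hasFDerivAt.comp f
      (((hk.fderiv_right (m := ∞) (by simp)).differentiable (by simp)) f).hasFDerivAt
  rw [vertLift_apply (h1 _) (vertLift_apply hk hT t), vertLift_apply (h1 _) (vertLift_apply hk hT s),
    (h2 _ _).fderiv, (h2 _ _).fderiv]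
  exact (hk.contDiffAt.isSymmSndFDerivAt (by simpa using ENat.LEInfty.out)).eq _ _

/-- The derivative of a function along a path in a fibre. -/
lemma hasDerivAt_fibre {e : κ → Sec V F E} (h : TotFun V F E) (x : C) (a c : κ → ℝ) (s : ℝ) :
    HasDerivAt (fun s : ℝ => h ⟨x, ∑ μ, (a μ + s * c μ) • e μ x⟩)
      (∑ μ, c μ * vertLift (e μ) h ⟨x, ∑ μ, (a μ + s * c μ) • e μ x⟩) s := by
  obtain ⟨k, hk, hT⟩ := exists_fibre_function h x
  simp_rw [vertLift_apply hk hT, hT]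
  set T := (trivializationAt F E x).linearEquivAt ℝ x (FiberBundle.mem_baseSet_trivializationAt' x)
  have h1 : HasDerivAt (fun s : ℝ => T (∑ μ, (a μ + s * c μ) • e μ x))
      (∑ μ, c μ • T (e μ x)) s := by
    simp_rw [map_sum, map_smul]
    refine HasDerivAt.fun_sum fun μ _ => ?_
    simpa using (((hasDerivAt_id s).mul_const (c μ)).const_add (a μ)).smul_const (T (e μ x))
  have h2 := ((hk.differentiable (by simp)) (T (∑ μ, (a μ + s * c μ) • e μ x))).hasFDerivAt
  have := h2.comp_hasDerivAt s h1
  simp only [map_sum, map_smul, smul_eq_mul] at this ⊢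
  exact this

lemma exists_eq_sum_lin_mul {e : κ → Sec V F E} {u : κ → LinFun V F E}
    (hue : ∀ x (v : E x), ∑ μ, (u μ).1 ⟨x, v⟩ • e μ x = v) (h : TotFun V F E) (a : κ → ℝ) :
    ∃ g : κ → TotFun V F E,
      (∀ μ z, (∀ ν, (u ν).1 z = a ν) → g μ z = vertLift (e μ) h z) ∧
      h = pullback (along (combSec e fun μ => algebraMap ℝ _ (a μ)) h) +
        ∑ μ, ((u μ).1 - algebraMap ℝ _ (a μ)) * g μ := by
  have hs : ∀ μ, ContMDiff (((𝓘(ℝ, V)).prod 𝓘(ℝ, F)).prod 𝓘(ℝ, ℝ)) 𝓘(ℝ, ℝ) ∞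
      (fun q : Bundle.TotalSpace F E × ℝ => vertLift (e μ) h
        ⟨q.1.1, ∑ ν, (a ν + q.2 * ((u ν).1 q.1 - a ν)) • e ν q.1.1⟩) := fun μ => by
    refine (vertLift (e μ) h).contMDiff.comp
      (contMDiff_comb ((Bundle.contMDiff_proj E).comp contMDiff_fst) (fun ν => ?_) e)
    exact contMDiff_const.add (contMDiff_snd.mul
      (((u ν).1.contMDiff.comp contMDiff_fst).sub contMDiff_const))
  refine ⟨fun μ => ⟨_, contMDiff_integral (hs μ)⟩, fun μ z hz => ?_, ?_⟩
  · refine (intervalIntegral.integral_congr (g := fun _ => vertLift (e μ) h z)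
      fun t _ => ?_).trans (by simp)
    simp only [hz, sub_self, mul_zero, add_zero]
    refine congrArg (fun v => vertLift (e μ) h ⟨z.1, v⟩) ?_
    simp_rw [← hz]
    exact hue z.1 z.2
  · ext z
    have hc : ∀ μ, Continuous fun s : ℝ => vertLift (e μ) h
        ⟨z.1, ∑ ν, (a ν + s * ((u ν).1 z - a ν)) • e ν z.1⟩ := fun μ =>
      (hs μ).continuous.comp (Continuous.prodMk_right z)
    have key := intervalIntegral.integral_eq_sub_of_hasDerivAt (a := 0) (b := 1)
      (fun s _ => hasDerivAt_fibre (e := e) h z.1 a (fun μ => (u μ).1 z - a μ) s)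
      ((continuous_finsetSum _ fun μ _ => (hc μ).const_mul _).intervalIntegrable _ _)
    rw [intervalIntegral.integral_finsetSum fun μ _ =>
      ((hc μ).const_mul _).intervalIntegrable _ _] at key
    simp_rw [intervalIntegral.integral_const_mul] at key
    have e1 : h ⟨z.1, ∑ μ, (a μ + 1 * ((u μ).1 z - a μ)) • e μ z.1⟩ = h z := by
      congr 1
      refine congrArg (Bundle.TotalSpace.mk z.1) ?_
      simp only [one_mul, add_sub_cancel]
      exact hue z.1 z.2
    rw [e1] at key
    change h z = along (combSec e fun μ => algebraMap ℝ _ (a μ)) h z.1 + (∑ μ, _ : TotFun V F E) z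
    rw [contMDiffMap_sum_apply]
    change h z = _ + ∑ μ, ((u μ).1 z - a μ) * _
    refine (sub_eq_iff_eq_add'.1 key.symm).trans ?_
    congr 1
    simp only [zero_mul, add_zero]
    rfl

end TotalSpace

/-! ### Horizontal vector fields -/

section Horizontal

variable {V : Type*} [NormedAddCommGroup V] [NormedSpace ℝ V]
  {F : Type*} [NormedAddCommGroup F] [NormedSpace ℝ F]
  {C : Type*} [TopologicalSpace C] [ChartedSpace V C] [IsManifold 𝓘(ℝ, V) ∞ C]
  {E : C → Type*} [∀ x, AddCommGroup (E x)] [∀ x, Module ℝ (E x)]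
  [∀ x, TopologicalSpace (E x)] [TopologicalSpace (Bundle.TotalSpace F E)]
  [FiberBundle F E] [VectorBundle ℝ F E] [ContMDiffVectorBundle ∞ F E 𝓘(ℝ, V)]
  {κ : Type*} [Fintype κ]

/-- Derivatives in the direction of a vector field are smooth in additional parameters. -/
lemma contMDiff_partial_dAt {EN HN N : Type*} [NormedAddCommGroup EN] [NormedSpace ℝ EN]
    [TopologicalSpace HN] {I : ModelWithCorners ℝ EN HN} [TopologicalSpace N]
    [ChartedSpace HN N] [IsManifold I ∞ N] {H : N × C → ℝ}
    (hH : ContMDiff (I.prod 𝓘(ℝ, V)) 𝓘(ℝ, ℝ) ∞ H) {f : N → C} (hf : ContMDiff I 𝓘(ℝ, V) ∞ f)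
    (X : Sec V V (TC V : C → Type _)) (h : N → BaseFun V C) (hh : ∀ n x, h n x = H (n, x)) :
    ContMDiff I 𝓘(ℝ, ℝ) ∞ fun n => dAt (h n) (f n) (X (f n)) := by
  have h1 : ContMDiff I (I.tangent.prod 𝓘(ℝ, V).tangent) ∞ fun n : N =>
      ((⟨n, 0⟩, ⟨f n, X (f n)⟩) : TangentBundle I N × TangentBundle 𝓘(ℝ, V) C) :=
    (Bundle.contMDiff_zeroSection ℝ (TangentSpace I : N → Type _)).prodMk (X.contMDiff.comp hf)
  have h2 := (contMDiff_snd_tangentBundle_modelSpace ℝ 𝓘(ℝ, ℝ)).comp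
    ((hH.contMDiff_tangentMap (m := ∞) (by simp)).comp
      ((contMDiff_equivTangentBundleProd_symm (n := ∞)).comp h1))
  refine h2.congr fun n => ?_
  have h3 : HasMFDerivAt 𝓘(ℝ, V) (I.prod 𝓘(ℝ, V)) (fun x : C => (n, x)) (f n)
      (ContinuousLinearMap.inr ℝ (TangentSpace I n) (TC V (f n))) :=
    by
    rw [← mfderiv_prod_right]
    exact (contMDiff_const.prodMk contMDiff_id (n := 1)).mdifferentiableAt (by simp) |>.hasMFDerivAt
  have h4 : HasMFDerivAt 𝓘(ℝ, V) 𝓘(ℝ, ℝ) (h n) (f n) _ :=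
    (((hH.mdifferentiableAt (by simp) (x := (n, f n))).hasMFDerivAt.comp (f n) h3)).congr_of_eventuallyEq
      (Filter.Eventually.of_forall fun x => hh n x)
  exact DFunLike.congr_fun h4.mfderiv (X (f n))

/-- The sections `e` and the dual sections `u` are dual to each other: `∑ u_μ(v) e_μ = v`. -/
abbrev DualFrames (e : κ → Sec V F E) (u : κ → LinFun V F E) : Prop :=
  ∀ x (v : E x), ∑ μ, (u μ).1 ⟨x, v⟩ • e μ x = v

/-- The horizontal lift of a vector field on the base with respect to a frame: it differentiates
with constant coefficients in the frame. -/
def horLift {e : κ → Sec V F E} {u : κ → LinFun V F E}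
    (hue : DualFrames e u) (X : Sec V V (TC V : C → Type _)) :
    Derivation ℝ (TotFun V F E) (TotFun V F E) :=
  let s := fun z : Bundle.TotalSpace F E => combSec e fun μ => algebraMap ℝ (BaseFun V C) ((u μ).1 z)
  Derivation.mk'
    { toFun := fun h => ⟨fun z => dAt (along (s z) h) z.1 (X z.1),
        contMDiff_partial_dAt (H := fun q : Bundle.TotalSpace F E × C =>
          h ⟨q.2, ∑ μ, (u μ).1 q.1 • e μ q.2⟩) (h.contMDiff.comp (contMDiff_comb contMDiff_snd
            (fun μ => (u μ).1.contMDiff.comp contMDiff_fst) e)) (Bundle.contMDiff_proj E) X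
          (fun z => along (s z) h) fun _ _ => rfl⟩
      map_add' := fun f g => by
        ext z
        exact LinearMap.congr_fun (dAt_add (along (s z) f) (along (s z) g) z.1) (X z.1)
      map_smul' := fun r f => by
        ext z
        exact LinearMap.congr_fun (dAt_smul r (along (s z) f) z.1) (X z.1) }
    fun f g => by
      ext z
      have h1 : ∀ h : TotFun V F E, along (s z) h z.1 = h z := fun h =>
        congrArg (fun v => h ⟨z.1, v⟩) (hue z.1 z.2)
      have := LinearMap.congr_fun (dAt_mul (along (s z) f) (along (s z) g) z.1) (X z.1)
      rw [LinearMap.add_apply, LinearMap.smul_apply, LinearMap.smul_apply, h1, h1] at this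
      exact this

variable {e : κ → Sec V F E} {u : κ → LinFun V F E}

lemma dAt_comb (c : κ → ℝ) (w : LinFun V F E) (x : C) (v : TC V x) :
    dAt (along (combSec e fun μ => algebraMap ℝ _ (c μ)) w.1) x v =
      ∑ μ, c μ * dAt (pairing w (e μ)) x v := by
  have h1 : along (combSec e fun μ => algebraMap ℝ _ (c μ)) w.1 = ∑ μ, c μ • pairing w (e μ) := by
    ext y
    rw [contMDiffMap_sum_apply]
    exact (map_sum (w.at y) (fun μ => c μ • e μ y) Finset.univ).trans
      (Finset.sum_congr rfl fun μ _ => map_smul (w.at y) _ _)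
  have h2 : ∀ s : Finset κ, dAt (∑ μ ∈ s, c μ • pairing w (e μ)) x v =
      ∑ μ ∈ s, c μ * dAt (pairing w (e μ)) x v := fun s => by
    induction s using Finset.cons_induction with
    | empty => simpa using LinearMap.congr_fun (dAt_smul 0 (0 : BaseFun V C) x) v
    | cons i s hi ih =>
      rw [Finset.sum_cons, Finset.sum_cons, dAt_add, LinearMap.add_apply, dAt_smul, ih]
      rfl
  rw [h1, h2]

lemma horLift_lin (hue : DualFrames e u) (X : Sec V V (TC V : C → Type _)) (w : LinFun V F E) :
    horLift hue X w.1 = ∑ μ, pullback (vfDer X (pairing w (e μ))) * (u μ).1 := by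
  ext z
  rw [contMDiffMap_sum_apply]
  refine (dAt_comb (fun μ => (u μ).1 z) w z.1 (X z.1)).trans
    (Finset.sum_congr rfl fun μ _ => mul_comm _ _)

lemma vertLift_eq_sum (hue : DualFrames e u) (s : Sec V F E) (h : TotFun V F E) :
    vertLift s h = ∑ μ, pullback (pairing (u μ) s) * vertLift (e μ) h := by
  ext ⟨x, v⟩
  rw [contMDiffMap_sum_apply]
  obtain ⟨k, hk, hT⟩ := exists_fibre_function h x
  change _ = ∑ μ, (u μ).1 ⟨x, s x⟩ * vertLift (e μ) h ⟨x, v⟩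
  simp_rw [vertLift_apply hk hT]
  conv_lhs => rw [← hue x (s x)]
  simp only [map_sum, map_smul, smul_eq_mul]

lemma lin_eq_sum (hue : DualFrames e u) (w : LinFun V F E) :
    w.1 = ∑ μ, pullback (pairing w (e μ)) * (u μ).1 := by
  ext ⟨x, v⟩
  rw [contMDiffMap_sum_apply]
  change w.at x v = ∑ μ, w.at x (e μ x) * (u μ).1 ⟨x, v⟩
  conv_lhs => rw [← hue x v]
  simp only [map_sum, map_smul, smul_eq_mul, mul_comm]

lemma exists_eq_sum_of_restrict_eq_zero (hue : DualFrames e u) {h : TotFun V F E} (h0 : restrict h = 0) :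
    ∃ g : κ → TotFun V F E, h = ∑ μ, (u μ).1 * g μ := by
  obtain ⟨g, -, hg⟩ := exists_eq_sum_lin_mul hue h 0
  have h1 : pullback (along (combSec e fun μ => algebraMap ℝ (BaseFun V C) ((0 : κ → ℝ) μ)) h) =
      (0 : TotFun V F E) := by
    ext z
    have h2 : ∑ μ, (0 : ℝ) • e μ z.1 = 0 := by simp
    exact (congrArg (fun v => h ⟨z.1, v⟩) h2).trans (DFunLike.congr_fun h0 z.1)
  refine ⟨g, hg.trans ?_⟩
  rw [h1, zero_add]
  simp only [Pi.zero_apply, map_zero, sub_zero]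

variable [FiniteDimensional ℝ V] [T2Space C] [SigmaCompactSpace C] {η : Type*} [Fintype η]
  {f : η → BaseFun V C} {X : η → Sec V V (TC V : C → Type _)}

lemma derivation_base_eq
    (hfX : ∀ x (v : TC V x), ∑ i, dAt (f i) x v • X i x = v)
    (D : Derivation ℝ (BaseFun V C) (BaseFun V C)) (h : BaseFun V C) :
    D h = ∑ i, vfDer (X i) h * D (f i) := by
  ext x
  rw [contMDiffMap_sum_apply]
  refine pointDer_eq hfX
    { toFun := fun h => D h x
      map_add' := fun a b => by rw [map_add]; rfl
      map_smul' := fun r a => by rw [D.map_smul]; rfl } (fun a b => ?_) h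
  change D (a * b) x = _
  rw [D.leibniz]
  rfl

lemma derivation_total_eq (hue : DualFrames e u)
    (hfX : ∀ x (v : TC V x), ∑ i, dAt (f i) x v • X i x = v)
    (D : Derivation ℝ (TotFun V F E) (TotFun V F E)) (h : TotFun V F E) :
    D h = ∑ i, D (pullback (f i)) * horLift hue (X i) h +
      ∑ μ, D (u μ).1 * vertLift (e μ) h := by
  ext z
  obtain ⟨g, hg, hsum⟩ := exists_eq_sum_lin_mul hue h fun μ => (u μ).1 z
  set a := along (combSec e fun μ => algebraMap ℝ (BaseFun V C) ((u μ).1 z)) h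
  have h1 : D (pullback a) z = ∑ i, vfDer (X i) a z.1 * D (pullback (f i)) z := by
    refine pointDer_eq hfX
      { toFun := fun h => D (pullback h) z
        map_add' := fun a b => by
          change D (pullback a + pullback b) z = _; rw [map_add]; rfl
        map_smul' := fun r a => by
          change D (r • pullback a) z = _; rw [D.map_smul]; rfl } (fun a b => ?_) a
    change D (pullback a * pullback b) z = _
    rw [D.leibniz]
    rfl
  have h2 : ∀ μ, D (((u μ).1 - algebraMap ℝ _ ((u μ).1 z)) * g μ) z =
      D (u μ).1 z * vertLift (e μ) h z := fun μ => by
    rw [D.leibniz, map_sub, D.map_algebraMap, sub_zero]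
    change ((u μ).1 z - (u μ).1 z) * _ + g μ z * _ = _
    rw [hg μ z fun _ => rfl]
    ring
  have h3 : D h z = D (pullback a) z +
      ∑ μ, D (((u μ).1 - algebraMap ℝ _ ((u μ).1 z)) * g μ) z := by
    conv_lhs => rw [hsum]
    rw [map_add, map_sum]
    change _ + (∑ μ, _ : TotFun V F E) z = _
    rw [contMDiffMap_sum_apply]
  rw [h3, h1]
  simp_rw [h2]
  change _ = (∑ i, _ : TotFun V F E) z + (∑ μ, _ : TotFun V F E) z
  rw [contMDiffMap_sum_apply, contMDiffMap_sum_apply]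
  congr 1
  exact Finset.sum_congr rfl fun i _ => mul_comm _ _

end Horizontal

/-! ### Exterior algebras -/

section Exterior

variable {X : Type*} [AddCommGroup X] [Module ℝ X]

lemma exterior_mul_mem {i k : ℕ} {a b : ExteriorAlgebra ℝ X} (ha : a ∈ ⋀[ℝ]^i X)
    (hb : b ∈ ⋀[ℝ]^k X) : a * b ∈ ⋀[ℝ]^(i + k) X := SetLike.mul_mem_graded ha hb

lemma exterior_eq_zero [FiniteDimensional ℝ X] {i : ℕ} (hi : Module.finrank ℝ X < i)
    {a : ExteriorAlgebra ℝ X} (ha : a ∈ ⋀[ℝ]^i X) : a = 0 := by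
  have h1 : Module.finrank ℝ (⋀[ℝ]^i X) = 0 := by
    rw [exteriorPower.finrank_eq, Nat.choose_eq_zero_of_lt hi]
  have := Module.finrank_zero_iff.1 h1
  exact congrArg Subtype.val (Subsingleton.elim (⟨a, ha⟩ : ⋀[ℝ]^i X) 0)

lemma algebraMapInv_eq_zero {i : ℕ} {a : ExteriorAlgebra ℝ X} (ha : a ∈ ⋀[ℝ]^(i + 1) X) :
    ExteriorAlgebra.algebraMapInv a = 0 := by
  change a ∈ LinearMap.range (ExteriorAlgebra.ι ℝ) ^ (i + 1) at ha
  rw [pow_succ'] at ha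
  refine Submodule.mul_induction_on ha ?_ fun x y hx hy => by rw [map_add, hx, hy, add_zero]
  rintro _ ⟨v, rfl⟩ b -
  rw [map_mul]
  simp [ExteriorAlgebra.algebraMapInv]

lemma algebraMap_algebraMapInv {a : ExteriorAlgebra ℝ X} (ha : a ∈ ⋀[ℝ]^0 X) :
    algebraMap ℝ _ (ExteriorAlgebra.algebraMapInv a) = a := by
  change a ∈ LinearMap.range (ExteriorAlgebra.ι ℝ) ^ 0 at ha
  rw [pow_zero, Submodule.mem_one] at ha
  obtain ⟨r, rfl⟩ := ha
  rw [ExteriorAlgebra.algebraMap_leftInverse]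

lemma contractLeft_eq_zero (d : Module.Dual ℝ X) {a : ExteriorAlgebra ℝ X} (ha : a ∈ ⋀[ℝ]^0 X) :
    CliffordAlgebra.contractLeft d a = 0 := by
  rw [← algebraMap_algebraMapInv ha]
  exact CliffordAlgebra.contractLeft_algebraMap _ d _

lemma contractLeft_mem (d : Module.Dual ℝ X) {i : ℕ} {a : ExteriorAlgebra ℝ X}
    (ha : a ∈ ⋀[ℝ]^(i + 1) X) : CliffordAlgebra.contractLeft d a ∈ ⋀[ℝ]^i X := by
  suffices h : ∀ n, ∀ a ∈ LinearMap.range (ExteriorAlgebra.ι ℝ : X →ₗ[ℝ] _) ^ n, ∀ i, n = i + 1 →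
      CliffordAlgebra.contractLeft d a ∈ ⋀[ℝ]^i X from h _ a ha i rfl
  intro n a ha
  induction ha using Submodule.pow_induction_on_left' with
  | algebraMap r => intro i hi; omega
  | add x y n hx hy h1 h2 =>
    intro i hi
    rw [map_add]
    exact Submodule.add_mem _ (h1 i hi) (h2 i hi)
  | mem_mul m hm n b hb ih =>
    rintro i hi
    obtain rfl : n = i := by omega
    obtain ⟨v, rfl⟩ := hm
    rw [show CliffordAlgebra.contractLeft d (ExteriorAlgebra.ι ℝ v * b) = _ from
      CliffordAlgebra.contractLeft_ι_mul d v b]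
    refine Submodule.sub_mem _ (Submodule.smul_mem _ _ hb) ?_
    cases n with
    | zero => rw [contractLeft_eq_zero d hb, mul_zero]; exact Submodule.zero_mem _
    | succ n =>
      rw [add_comm]
      refine exterior_mul_mem (i := 1) ?_ (ih n rfl)
      change _ ∈ LinearMap.range _ ^ 1
      rw [pow_one]
      exact ⟨v, rfl⟩

lemma exterior_euler {κ : Type*} [Fintype κ] {e : κ → X} {u : κ → Module.Dual ℝ X}
    (hue : ∀ v, ∑ μ, u μ v • e μ = v) {i : ℕ} {a : ExteriorAlgebra ℝ X} (ha : a ∈ ⋀[ℝ]^i X) :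
    ∑ μ, ExteriorAlgebra.ι ℝ (e μ) * CliffordAlgebra.contractLeft (u μ) a = (i : ℝ) • a := by
  change a ∈ LinearMap.range (ExteriorAlgebra.ι ℝ) ^ i at ha
  induction ha using Submodule.pow_induction_on_left' with
  | algebraMap r =>
    rw [Nat.cast_zero, zero_smul]
    refine Finset.sum_eq_zero fun μ _ => ?_
    rw [show CliffordAlgebra.contractLeft (u μ) (algebraMap ℝ (ExteriorAlgebra ℝ X) r) = 0 from
      CliffordAlgebra.contractLeft_algebraMap _ (u μ) r, mul_zero]
  | add x y n hx hy h1 h2 => simp_rw [map_add, mul_add, Finset.sum_add_distrib, h1, h2, smul_add]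
  | mem_mul m hm n b hb ih =>
    obtain ⟨v, rfl⟩ := hm
    have h1 : ∀ μ, ExteriorAlgebra.ι ℝ (e μ) *
        CliffordAlgebra.contractLeft (u μ) (ExteriorAlgebra.ι ℝ v * b) =
        ExteriorAlgebra.ι ℝ (u μ v • e μ) * b +
          ExteriorAlgebra.ι ℝ v * (ExteriorAlgebra.ι ℝ (e μ) *
            CliffordAlgebra.contractLeft (u μ) b) := fun μ => by
      rw [show CliffordAlgebra.contractLeft (u μ) (ExteriorAlgebra.ι ℝ v * b) = _ from
        CliffordAlgebra.contractLeft_ι_mul (u μ) v b, mul_sub, mul_smul_comm, map_smul,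
        smul_mul_assoc, sub_eq_add_neg, ← mul_assoc, ← mul_assoc,
        eq_neg_of_add_eq_zero_left (ExteriorAlgebra.ι_add_mul_swap (e μ) v), neg_mul, neg_neg]
    simp_rw [h1, Finset.sum_add_distrib, ← Finset.sum_mul, ← Finset.mul_sum, ih, ← map_sum, hue]
    rw [Nat.succ_eq_add_one, Nat.cast_add, Nat.cast_one, add_smul, one_smul, mul_smul_comm, add_comm]

/-- The homogeneous components in the exterior algebra. -/
def extProj (i : ℕ) : ExteriorAlgebra ℝ X →ₗ[ℝ] ExteriorAlgebra ℝ X :=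
  GradedAlgebra.proj (fun i : ℕ => ⋀[ℝ]^i X) i

lemma extProj_mem (i : ℕ) (a : ExteriorAlgebra ℝ X) : extProj i a ∈ ⋀[ℝ]^i X :=
  SetLike.coe_mem _

lemma extProj_mul (i : ℕ) (a b : ExteriorAlgebra ℝ X) : extProj i (a * b) =
    ∑ q ∈ Finset.HasAntidiagonal.antidiagonal i, extProj q.1 a * extProj q.2 b := by
  simp only [extProj, GradedAlgebra.proj_apply, DirectSum.decompose_mul,
    DirectSum.coe_mul_apply_eq_sum_antidiagonal]

lemma extProj_of_mem {i : ℕ} {a : ExteriorAlgebra ℝ X} (ha : a ∈ ⋀[ℝ]^i X) (k : ℕ) :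
    extProj k a = if i = k then a else 0 := by
  split_ifs with h
  · subst h
    exact DirectSum.decompose_of_mem_same (fun i : ℕ => ⋀[ℝ]^i X) ha
  · exact DirectSum.decompose_of_mem_ne (fun i : ℕ => ⋀[ℝ]^i X) ha h

lemma sum_extProj [FiniteDimensional ℝ X] {n : ℕ} (hn : Module.finrank ℝ X = n)
    (a : ExteriorAlgebra ℝ X) : ∑ i ∈ Finset.range (n + 1), extProj i a = a := by
  classical
  refine Eq.trans (Finset.sum_subset (fun i hi => ?_) fun i _ hi => ?_).symm
    (DirectSum.sum_support_decompose (fun i : ℕ => ⋀[ℝ]^i X) a)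
  · by_contra h
    refine DFinsupp.mem_support_iff.1 hi (Subtype.ext (exterior_eq_zero ?_ (extProj_mem i a)))
    rw [Finset.mem_range] at h
    omega
  · rw [DFinsupp.notMem_support_iff] at hi
    exact congrArg Subtype.val hi

end Exterior

/-! ### Sections of the bundle of exterior algebras -/

section ExteriorSections

variable {V : Type*} [NormedAddCommGroup V] [NormedSpace ℝ V]
  {F : Type*} [NormedAddCommGroup F] [NormedSpace ℝ F]
  {C : Type*} [TopologicalSpace C] [ChartedSpace V C]
  {E : C → Type*} [∀ x, AddCommGroup (E x)] [∀ x, Module ℝ (E x)]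
  [∀ x, TopologicalSpace (E x)] [TopologicalSpace (Bundle.TotalSpace F E)]
  [FiberBundle F E] [VectorBundle ℝ F E]

lemma mem_extDeg_natCast {i : ℕ} {a : extSections V F E} :
    a ∈ extDeg V F E i ↔ ∀ x, a.1 x ∈ ⋀[ℝ]^i (E x) := by
  change (if 0 ≤ (i : ℤ) then ∀ x, a.1 x ∈ ⋀[ℝ]^(i : ℤ).toNat (E x) else a = 0) ↔ _
  rw [if_pos (Int.natCast_nonneg i), Int.toNat_natCast]

lemma eq_zero_of_mem_extDeg {i : ℤ} (hi : i < 0) {a : extSections V F E}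
    (ha : a ∈ extDeg V F E i) : a = 0 := by
  change (if 0 ≤ i then ∀ x, a.1 x ∈ ⋀[ℝ]^i.toNat (E x) else a = 0) at ha
  rwa [if_neg (not_le.2 hi)] at ha

variable (F E) in
lemma finrank_fibre (x : C) : Module.finrank ℝ (E x) = Module.finrank ℝ F :=
  ((trivializationAt F E x).linearEquivAt ℝ x
    (FiberBundle.mem_baseSet_trivializationAt' _)).finrank_eq

variable (F E) in
lemma finiteDimensional_fibre [FiniteDimensional ℝ F] (x : C) : FiniteDimensional ℝ (E x) :=
  ((trivializationAt F E x).linearEquivAt ℝ x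
    (FiberBundle.mem_baseSet_trivializationAt' _)).symm.finiteDimensional

/-- Functions as elements of degree zero. -/
def ofFunHom : BaseFun V C →ₐ[ℝ] extSections V F E where
  toFun := ofFun
  map_one' := by ext x; exact map_one _
  map_mul' f g := by ext x; exact map_mul _ _ _
  map_zero' := by ext x; exact map_zero _
  map_add' f g := by ext x; exact map_add _ _ _
  commutes' r := by ext x; rfl

lemma ofFun_comm (f : BaseFun V C) (a : extSections V F E) : ofFun f * a = a * ofFun f := by
  ext x
  exact Algebra.commutes (f x) (a.1 x)

lemma ofSec_mul_ofSec (s t : Sec V F E) :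
    (ofSec s * ofSec t : extSections V F E) = -(ofSec t * ofSec s) := by
  ext x
  exact eq_neg_of_add_eq_zero_left (ExteriorAlgebra.ι_add_mul_swap _ _)

lemma ofFun_mem (f : BaseFun V C) : (ofFun f : extSections V F E) ∈ extDeg V F E 0 := by
  refine (mem_extDeg_natCast (i := 0)).2 fun x => ?_
  change _ ∈ LinearMap.range _ ^ 0
  rw [pow_zero]
  exact Submodule.algebraMap_mem _

lemma ofSec_mem (s : Sec V F E) : ofSec s ∈ extDeg V F E 1 := by
  refine (mem_extDeg_natCast (i := 1)).2 fun x => ?_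
  change _ ∈ LinearMap.range _ ^ 1
  rw [pow_one]
  exact ⟨s x, rfl⟩

lemma extDeg_mul_mem (i k : ℤ) (a b : extSections V F E) (ha : a ∈ extDeg V F E i)
    (hb : b ∈ extDeg V F E k) : a * b ∈ extDeg V F E (i + k) := by
  by_cases hi : i < 0
  · rw [eq_zero_of_mem_extDeg hi ha, zero_mul]
    exact Submodule.zero_mem _
  by_cases hk : k < 0
  · rw [eq_zero_of_mem_extDeg hk hb, mul_zero]
    exact Submodule.zero_mem _
  lift i to ℕ using not_lt.1 hi
  lift k to ℕ using not_lt.1 hk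
  rw [← Nat.cast_add, mem_extDeg_natCast]
  exact fun x => exterior_mul_mem (mem_extDeg_natCast.1 ha x) (mem_extDeg_natCast.1 hb x)

lemma eq_zero_of_finrank_lt [FiniteDimensional ℝ F] (i : ℤ) (a : extSections V F E)
    (hi : (Module.finrank ℝ F : ℤ) < i) (ha : a ∈ extDeg V F E i) : a = 0 := by
  lift i to ℕ using by omega
  ext x
  have := finiteDimensional_fibre F E x
  exact exterior_eq_zero (by rw [finrank_fibre F E]; omega) (mem_extDeg_natCast.1 ha x)

lemma contract_mem (w : LinFun V F E) (i : ℤ) (a : extSections V F E) (ha : a ∈ extDeg V F E i) :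
    contract w a ∈ extDeg V F E (i - 1) := by
  by_cases hi : i < 0
  · rw [eq_zero_of_mem_extDeg hi ha, map_zero]
    exact Submodule.zero_mem _
  lift i to ℕ using not_lt.1 hi
  cases i with
  | zero =>
    have : contract w a = 0 := by
      ext x
      exact contractLeft_eq_zero _ (mem_extDeg_natCast.1 ha x)
    rw [this]
    exact Submodule.zero_mem _
  | succ i =>
    rw [Nat.cast_add, Nat.cast_one, add_sub_cancel_right, mem_extDeg_natCast]
    exact fun x => contractLeft_mem _ (mem_extDeg_natCast.1 ha x)

lemma contract_ofFun_mul (w : LinFun V F E) (f : BaseFun V C) (a : extSections V F E) :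
    contract w (ofFun f * a) = ofFun f * contract w a := by
  ext x
  exact CliffordAlgebra.contractLeft_algebraMap_mul _ _ _

lemma contract_ofSec_mul (w : LinFun V F E) (s : Sec V F E) (a : extSections V F E) :
    contract w (ofSec s * a) = ofFun (pairing w s) * a - ofSec s * contract w a := by
  ext x
  refine (CliffordAlgebra.contractLeft_ι_mul _ _ _).trans ?_
  rw [Algebra.smul_def]
  rfl

lemma contract_contract (w w' : LinFun V F E) (a : extSections V F E) :
    contract w (contract w' a) = -contract w' (contract w a) := by
  ext x
  exact CliffordAlgebra.contractLeft_comm _ _ _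

lemma contMDiff_algebraMapInv (a : extSections V F E) :
    ContMDiff 𝓘(ℝ, V) 𝓘(ℝ, ℝ) ∞ fun x => ExteriorAlgebra.algebraMapInv (a.1 x) := by
  have key : ∀ a' ∈ Algebra.adjoin ℝ (extGenerators V F E),
      ContMDiff 𝓘(ℝ, V) 𝓘(ℝ, ℝ) ∞ fun x => ExteriorAlgebra.algebraMapInv (a' x) := by
    intro a' ha'
    induction ha' using Algebra.adjoin_induction with
    | mem g hg =>
      rcases hg with ⟨f, rfl⟩ | ⟨s, rfl⟩
      · exact f.contMDiff.congr fun x => ExteriorAlgebra.algebraMap_leftInverse _ _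
      · refine contMDiff_const (c := (0 : ℝ)) |>.congr fun x => ?_
        simp [ExteriorAlgebra.algebraMapInv]
    | algebraMap r =>
      exact contMDiff_const (c := r) |>.congr fun x => ExteriorAlgebra.algebraMap_leftInverse _ _
    | add a b _ _ ha hb => exact (ha.add hb).congr fun x => map_add _ _ _
    | mul a b _ _ ha hb => exact (ha.mul hb).congr fun x => map_mul _ _ _
  intro x₀
  obtain ⟨a', ha', h⟩ := a.2 x₀
  exact (key a' ha' x₀).congr_of_eventuallyEq (h.mono fun x hx => congrArg _ hx)

/-- The component of degree zero. -/
def degZero : extSections V F E →ₗ[ℝ] BaseFun V C where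
  toFun a := ⟨_, contMDiff_algebraMapInv a⟩
  map_add' a b := by ext x; exact map_add ExteriorAlgebra.algebraMapInv (a.1 x) (b.1 x)
  map_smul' r a := by ext x; exact map_smul ExteriorAlgebra.algebraMapInv r (a.1 x)

lemma degZero_ofFun (f : BaseFun V C) : degZero (ofFun f : extSections V F E) = f := by
  ext x
  exact ExteriorAlgebra.algebraMap_leftInverse _ _

lemma degZero_ofFun_mul (f : BaseFun V C) (a : extSections V F E) :
    degZero (ofFun f * a) = f * degZero a := by
  ext x
  refine (map_mul ExteriorAlgebra.algebraMapInv (algebraMap ℝ _ (f x)) (a.1 x)).trans ?_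
  exact congrArg (· * _) (ExteriorAlgebra.algebraMap_leftInverse _ _)

lemma degZero_eq_zero (i : ℤ) (a : extSections V F E) (hi : 0 < i) (ha : a ∈ extDeg V F E i) :
    degZero a = 0 := by
  lift i to ℕ using hi.le
  obtain ⟨i, rfl⟩ := Nat.exists_eq_succ_of_ne_zero (n := i) (by omega)
  ext x
  exact algebraMapInv_eq_zero (mem_extDeg_natCast.1 ha x)

lemma ofFun_degZero (a : extSections V F E) (ha : a ∈ extDeg V F E 0) : ofFun (degZero a) = a := by
  ext x
  exact algebraMap_algebraMapInv ((mem_extDeg_natCast (i := 0)).1 ha x)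

lemma extProj_mem_adjoin (i : ℕ) {a : ∀ x, ExteriorAlgebra ℝ (E x)}
    (ha : a ∈ Algebra.adjoin ℝ (extGenerators V F E)) :
    (fun x => extProj i (a x)) ∈ Algebra.adjoin ℝ (extGenerators V F E) := by
  have hmem : ∀ (n : ℕ) (a : ∀ x, ExteriorAlgebra ℝ (E x)) (_ : ∀ x, a x ∈ ⋀[ℝ]^n (E x))
      (_ : a ∈ Algebra.adjoin ℝ (extGenerators V F E)) (i : ℕ),
      (fun x => extProj i (a x)) ∈ Algebra.adjoin ℝ (extGenerators V F E) := by
    intro n a h1 h2 i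
    by_cases h : n = i
    · convert h2 using 1
      funext x
      rw [extProj_of_mem (h1 x), if_pos h]
    · convert Subalgebra.zero_mem (Algebra.adjoin ℝ (extGenerators V F E)) using 1
      funext x
      rw [extProj_of_mem (h1 x), if_neg h]
      rfl
  induction ha using Algebra.adjoin_induction generalizing i with
  | mem g hg =>
    have h := Algebra.subset_adjoin (R := ℝ) hg
    rcases hg with ⟨f, rfl⟩ | ⟨s, rfl⟩
    · exact hmem 0 _ ((mem_extDeg_natCast (i := 0)).1 (ofFun_mem (F := F) (E := E) f)) h i
    · exact hmem 1 _ ((mem_extDeg_natCast (i := 1)).1 (ofSec_mem s)) h i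
  | algebraMap r =>
    exact hmem 0 _ ((mem_extDeg_natCast (V := V) (F := F) (E := E) (i := 0)).1
      (ofFun_mem (V := V) (F := F) (E := E) (algebraMap ℝ (BaseFun V C) r)))
      (Subalgebra.algebraMap_mem _ r) i
  | add a b _ _ ha hb =>
    convert add_mem (ha i) (hb i) using 1
    funext x
    exact map_add _ _ _
  | mul a b _ _ ha hb =>
    convert Subalgebra.sum_mem _ (t := Finset.HasAntidiagonal.antidiagonal i)
      (fun q _ => mul_mem (ha q.1) (hb q.2)) using 1
    funext x
    rw [Finset.sum_apply]
    exact extProj_mul i (a x) (b x)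

lemma exists_decomposition [FiniteDimensional ℝ F] (a : extSections V F E) :
    ∃ c : ℕ → extSections V F E, (∀ i : ℕ, c i ∈ extDeg V F E i) ∧
      a = ∑ i ∈ Finset.range (Module.finrank ℝ F + 1), c i := by
  refine ⟨fun i => ⟨fun x => extProj i (a.1 x), fun x₀ => ?_⟩,
    fun i => mem_extDeg_natCast.2 fun x => extProj_mem i _, ?_⟩
  · obtain ⟨a', ha', h⟩ := a.2 x₀
    exact ⟨_, extProj_mem_adjoin i ha', h.mono fun x hx => congrArg _ hx⟩
  · ext x
    have := finiteDimensional_fibre F E x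
    rw [AddSubmonoidClass.coe_finsetSum, Finset.sum_apply]
    exact (sum_extProj (finrank_fibre F E x) (a.1 x)).symm

variable {κ : Type*} [Fintype κ] {e : κ → Sec V F E} {u : κ → LinFun V F E}

lemma extSections_sum_apply (f : κ → extSections V F E) (x : C) :
    (∑ μ, f μ : extSections V F E).1 x = ∑ μ, (f μ).1 x := by
  rw [AddSubmonoidClass.coe_finsetSum, Finset.sum_apply]

lemma extSections_euler (hue : DualFrames e u) (i : ℤ) (a : extSections V F E)
    (ha : a ∈ extDeg V F E i) : ∑ μ, ofSec (e μ) * contract (u μ) a = (i : ℝ) • a := by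
  by_cases hi : i < 0
  · simp [eq_zero_of_mem_extDeg hi ha]
  lift i to ℕ using not_lt.1 hi
  ext x
  rw [extSections_sum_apply]
  exact (exterior_euler (u := fun μ => (u μ).at x) (hue x) (mem_extDeg_natCast.1 ha x)).trans
    (by rw [Int.cast_natCast]; rfl)

lemma contract_eq_sum (hue : DualFrames e u) (w : LinFun V F E) (a : extSections V F E) :
    contract w a = ∑ μ, ofFun (pairing w (e μ)) * contract (u μ) a := by
  ext x
  rw [extSections_sum_apply]
  have h1 : w.at x = ∑ μ, w.at x (e μ x) • (u μ).at x := by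
    ext v
    rw [LinearMap.sum_apply]
    conv_lhs => rw [← hue x v]
    simp only [map_sum, map_smul, smul_eq_mul, LinearMap.smul_apply]
    exact Finset.sum_congr rfl fun μ _ => mul_comm _ _
  change CliffordAlgebra.contractLeft (w.at x) (a.1 x) = _
  conv_lhs => rw [h1]
  rw [map_sum, LinearMap.sum_apply]
  refine Finset.sum_congr rfl fun μ _ => ?_
  rw [map_smul, LinearMap.smul_apply, Algebra.smul_def]
  rfl

lemma exists_ofSec_eq (hue : DualFrames e u) (a : extSections V F E) (ha : a ∈ extDeg V F E 1) :
    ∃ s, ofSec s = a := by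
  refine ⟨combSec e fun μ => degZero (contract (u μ) a), ?_⟩
  have h1 := extSections_euler hue 1 a ha
  rw [Int.cast_one, one_smul] at h1
  rw [← h1]
  ext x
  rw [extSections_sum_apply]
  refine (map_sum (ExteriorAlgebra.ι ℝ) _ _).trans (Finset.sum_congr rfl fun μ _ => ?_)
  rw [map_smul, Algebra.smul_def, Algebra.commutes]
  refine congrArg (_ * ·) ?_
  have h2 := ofFun_degZero (contract (u μ) a) (contract_mem _ 1 _ ha)
  rw [h1]
  exact congrFun (congrArg Subtype.val h2) x

end ExteriorSections

/-! ### The model given by a vector bundle -/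

section Bundle

variable {V : Type*} [NormedAddCommGroup V] [NormedSpace ℝ V] [FiniteDimensional ℝ V]
  {F : Type*} [NormedAddCommGroup F] [NormedSpace ℝ F] [FiniteDimensional ℝ F]
  {C : Type*} [TopologicalSpace C] [T2Space C] [SigmaCompactSpace C]
  [ChartedSpace V C] [IsManifold 𝓘(ℝ, V) ∞ C]
  {E : C → Type*} [∀ x, AddCommGroup (E x)] [∀ x, Module ℝ (E x)]
  [∀ x, TopologicalSpace (E x)] [TopologicalSpace (Bundle.TotalSpace F E)]
  [FiberBundle F E] [VectorBundle ℝ F E] [ContMDiffVectorBundle ∞ F E 𝓘(ℝ, V)]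
  {κ η : Type*} [Fintype κ] [Fintype η] {e : κ → Sec V F E} {u : κ → LinFun V F E}
  {f : η → BaseFun V C} {X : η → Sec V V (TC V : C → Type _)}

/-- The algebraic data of a vector bundle with finite frames. -/
def bundleModel (hue : DualFrames e u)
    (hfX : ∀ x (v : TC V x), ∑ i, dAt (f i) x v • X i x = v) :
    Model (BaseFun V C) (TotFun V F E) (extSections V F E) (extDeg V F E) (Sec V F E)
      (LinFun V F E) κ η where
  p := { toFun := pullback, map_one' := rfl, map_mul' := fun _ _ => rfl, map_zero' := rfl,
         map_add' := fun _ _ => rfl, commutes' := fun _ => rfl }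
  r := { toFun := restrict, map_one' := rfl, map_mul' := fun _ _ => rfl, map_zero' := rfl,
         map_add' := fun _ _ => rfl, commutes' := fun _ => rfl }
  j := ofFunHom
  ε := degZero
  sec := ofSec
  con := contract
  lin w := w.1
  vert := vertLift
  pair := pairing
  e := e
  u := u
  x := f
  dB i := vfDer (X i)
  dO i := horLift hue (X i)
  bd := Module.finrank ℝ F
  r_p _ := rfl
  j_comm := ofFun_comm
  j_mem := ofFun_mem
  sec_mem := ofSec_mem
  mul_mem := extDeg_mul_mem
  neg_eq _ _ hi ha := eq_zero_of_mem_extDeg hi ha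
  bd_eq := eq_zero_of_finrank_lt
  decomp := exists_decomposition
  ε_j := degZero_ofFun
  ε_mul := degZero_ofFun_mul
  ε_pos := degZero_eq_zero
  j_ε := ofFun_degZero
  sec_sec := ofSec_mul_ofSec
  con_mem := contract_mem
  con_j_mul := contract_ofFun_mul
  con_sec_mul := contract_ofSec_mul
  con_con := contract_contract
  euler := extSections_euler hue
  con_eq := contract_eq_sum hue
  sec_surj := exists_ofSec_eq hue
  vert_p := vertLift_pullback
  vert_lin := vertLift_lin
  r_lin w := by ext x; exact (w.at x).map_zero
  vert_comm := vertLift_comm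
  lin_eq := lin_eq_sum hue
  lin_sum c := ⟨⟨_, Submodule.sum_mem (linSubmodule V F E) (t := Finset.univ)
    (f := fun μ => pullback (c μ) * (u μ).1) fun μ _ x =>
      (c μ x • (u μ).at x).isLinear⟩, rfl⟩
  vert_eq := vertLift_eq_sum hue
  ker h h0 := exists_eq_sum_of_restrict_eq_zero hue h0
  dO_p i f := rfl
  dO_lin i w := horLift_lin hue (X i) w
  tightB := derivation_base_eq hfX
  tightO := derivation_total_eq hue hfX

variable (V F E) in
/-- A vector bundle over a `σ`-compact base has finite frames. -/
lemma exists_bundle_frames : ∃ (d d' : ℕ) (e : Fin d ⊕ Fin d → Sec V F E)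
    (u : Fin d ⊕ Fin d → LinFun V F E) (f : Fin d' ⊕ Fin d' → BaseFun V C)
    (X : Fin d' ⊕ Fin d' → Sec V V (TC V : C → Type _)), DualFrames e u ∧
      ∀ x (v : TC V x), ∑ i, dAt (f i) x v • X i x = v := by
  obtain ⟨d, u, hu⟩ := exists_linFun_frame V F E
  obtain ⟨e, he⟩ := exists_dual_frame u hu
  obtain ⟨d', f, X, hX⟩ := exists_tangent_frame V C
  exact ⟨d, d', e, u, f, X, he, hX⟩

lemma mem_zeroIdeal_iff (h : TotFun V F E) : h ∈ zeroIdeal V F E ↔ restrict h = 0 :=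
  ⟨fun hh => by ext x; exact hh x, fun hh x => DFunLike.congr_fun hh x⟩

end Bundle

/-! ### Translation between the bundle and its model -/

lemma Model.lieL_pair {B O A : Type*} [CommRing B] [Algebra ℝ B] [CommRing O] [Algebra ℝ O]
    [Ring A] [Algebra ℝ A] {𝒜 : ℤ → Submodule ℝ A} {S L κ η : Type*} [Fintype κ] [Fintype η]
    (M : Model B O A 𝒜 S L κ η) (v : List S) (β : biDer O) (h k : O) :
    M.lieL v (X2 β) [h, k] =
      v.foldr (fun s b => lieDer (M.vert s) b) (fun h k => β.1 h k) h k := by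
  induction v generalizing h k with
  | nil => rfl
  | cons s v ih =>
    change M.vert s (M.lieL v (X2 β) [h, k]) - M.lieL v (X2 β) [h, M.vert s k] -
      M.lieL v (X2 β) [M.vert s h, k] = _
    rw [ih, ih, ih]
    exact sub_right_comm _ _ _

section Bundle

variable {V : Type*} [NormedAddCommGroup V] [NormedSpace ℝ V] [FiniteDimensional ℝ V]
  {F : Type*} [NormedAddCommGroup F] [NormedSpace ℝ F] [FiniteDimensional ℝ F]
  {C : Type*} [TopologicalSpace C] [T2Space C] [SigmaCompactSpace C]
  [ChartedSpace V C] [IsManifold 𝓘(ℝ, V) ∞ C]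
  {E : C → Type*} [∀ x, AddCommGroup (E x)] [∀ x, Module ℝ (E x)]
  [∀ x, TopologicalSpace (E x)] [TopologicalSpace (Bundle.TotalSpace F E)]
  [FiberBundle F E] [VectorBundle ℝ F E] [ContMDiffVectorBundle ∞ F E 𝓘(ℝ, V)]
  {κ η : Type*} [Fintype κ] [Fintype η] {e : κ → Sec V F E} {u : κ → LinFun V F E}
  {f : η → BaseFun V C} {X : η → Sec V V (TC V : C → Type _)}
  (hue : DualFrames e u) (hfX : ∀ x (v : TC V x), ∑ i, dAt (f i) x v • X i x = v)

lemma isFourier_iff {Φ : FormalBivector V F E ≃+ FormalMultiDer V F E} :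
    IsFourier Φ ↔ (bundleModel hue hfX).IsFou (zeroIdeal V F E) Φ := by
  have h1 : ∀ q : (bundleModel hue hfX).Dual, IsDual q.der q.X := fun q =>
    ⟨⟨q.mem, q.mul⟩, q.base, q.fibre⟩
  have h2 : ∀ {δ X}, IsDual (V := V) (F := F) (E := E) δ X →
      ∃ q : (bundleModel hue hfX).Dual, q.der = δ ∧ q.X = X := fun {δ X} h =>
    ⟨⟨δ, X, h.derivation.degree, h.derivation.leibniz, h.base, h.fibre⟩, rfl, rfl⟩
  refine ⟨fun h => ⟨h.map_smul, h.continuous,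
    fun k w q q' => h.linear_linear k w _ _ _ _ (h1 q) (h1 q'),
    fun k w s q => h.vertical_linear k w s _ _ (h1 q), h.vertical_vertical⟩,
    fun h => ⟨h.map_smul, h.continuous, fun k w δ δ' X X' hX hX' => ?_,
    fun k w s δ X hX => ?_, h.vertical_vertical⟩⟩
  · obtain ⟨q, rfl, rfl⟩ := h2 hX
    obtain ⟨q', rfl, rfl⟩ := h2 hX'
    exact h.linear_linear k w q q'
  · obtain ⟨q, rfl, rfl⟩ := h2 hX
    exact h.vertical_linear k w s q

lemma hasGeneratorValues_iff {π : FormalBivector V F E}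
    {l : ∀ n, MultilinearMap ℝ (fun _ : Fin n => extSections V F E) (extSections V F E)} :
    HasGeneratorValues π l ↔ (bundleModel hue hfX).GenVals (zeroIdeal V F E) kappa π l := by
  have key : ∀ {k : ℕ} (v : Fin k → Sec V F E) (β : biDer (TotFun V F E)) h h',
      (bundleModel hue hfX).lieL (List.ofFn v) (X2 β) [h, h'] = iterLie v β h h' := fun v β h h' =>
    (bundleModel hue hfX).lieL_pair _ β h h'
  constructor
  · refine fun h => ⟨fun k v f g β hβ => ?_, fun k v f w β hβ => ?_, fun k v w w' β hβ => ?_⟩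
    · rw [key]; exact h.fun_fun k v f g β hβ
    · rw [key]; exact h.fun_lin k v f w β hβ
    · rw [key]; exact h.lin_lin k v w w' β hβ
  · refine fun h => ⟨fun k v f g β hβ => ?_, fun k v f w β hβ => ?_, fun k v w w' β hβ => ?_⟩
    · have := h.fun_fun k v f g β hβ
      rwa [key] at this
    · have := h.fun_lin k v f w β hβ
      rwa [key] at this
    · have := h.lin_lin k v w w' β hβ
      rwa [key] at this

/-! ### Taylor components -/

lemma eq_zero_of_locally_const {Q : List (TotFun V F E) → TotFun V F E} (hQ : IsMV 2 Q)
    {c : BaseFun V C} {x : C} (hc : ∀ᶠ y in 𝓝 x, c y = c x) (k : TotFun V F E) (w : E x) :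
    Q [pullback c, k] ⟨x, w⟩ = 0 := by
  obtain ⟨b, -, hb⟩ := (SmoothBumpFunction.nhds_basis_support (I := 𝓘(ℝ, V)) hc).mem_iff.1 hc
  let χ : BaseFun V C := ⟨b, b.contMDiff⟩
  have h1 : (pullback χ * pullback c : TotFun V F E) = c x • pullback χ := by
    ext z
    change b z.1 * c z.1 = c x * b z.1
    by_cases hz : b z.1 = 0
    · rw [hz, zero_mul, mul_zero]
    · rw [show c z.1 = c x from hb hz, mul_comm]
  have h2 := congrArg (fun h => h ⟨x, w⟩) (congrFun (congrArg (fun h => ins h Q) h1) [k])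
  simp only [hQ.mul, hQ.2.2.1] at h2
  change b x * Q [pullback c, k] ⟨x, w⟩ + c x * Q [pullback χ, k] ⟨x, w⟩ =
    c x * Q [pullback χ, k] ⟨x, w⟩ at h2
  rw [b.eq_one, one_mul] at h2
  linarith

lemma iterLie_apply_eq (hue : DualFrames e u)
    (hfX : ∀ x (v : TC V x), ∑ i, dAt (f i) x v • X i x = v) {U : Set C} (v : List (Sec V F E)) (β : biDer (TotFun V F E))
    (h k : TotFun V F E)
    (hh : ∀ s ∈ v, ∀ x ∈ U, ∃ c : BaseFun V C, vertLift s h = pullback c ∧ ∀ᶠ y in 𝓝 x, c y = c x)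
    (hk : ∀ s ∈ v, ∀ x ∈ U, ∃ c : BaseFun V C, vertLift s k = pullback c ∧ ∀ᶠ y in 𝓝 x, c y = c x)
    {x : C} (hx : x ∈ U) (w : E x) :
    v.foldr (fun s b => lieDer (vertLift s) b) (fun h k => β.1 h k) h k ⟨x, w⟩ =
      v.foldr (fun s h => vertLift s h) (β.1 h k) ⟨x, w⟩ := by
  induction v generalizing w with
  | nil => rfl
  | cons s v ih =>
    have hl := fun h k => ((bundleModel hue hfX).lieL_pair v β h k).symm
    have hQ : IsMV 2 ((bundleModel hue hfX).lieL v (X2 β)) :=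
      (bundleModel hue hfX).lieL_isMV (isMV_X2 β) v
    obtain ⟨c, hc, hc'⟩ := hh s List.mem_cons_self x hx
    obtain ⟨d, hd, hd'⟩ := hk s List.mem_cons_self x hx
    have e1 := eq_zero_of_locally_const hQ hc' k w
    have e2 := eq_zero_of_locally_const hQ hd' h w
    have e3 := congrArg (fun q => q ⟨x, w⟩) (congrFun (hQ.anti (pullback d) h) [])
    change (bundleModel hue hfX).lieL v (X2 β) [h, pullback d] ⟨x, w⟩ =
      -(bundleModel hue hfX).lieL v (X2 β) [pullback d, h] ⟨x, w⟩ at e3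
    rw [e2, neg_zero, ← hd] at e3
    rw [← hc] at e1
    rw [← hl] at e1 e3
    have ih' := ih (fun t ht => hh t (List.mem_cons_of_mem _ ht))
      (fun t ht => hk t (List.mem_cons_of_mem _ ht))
    have e4 : vertLift s (v.foldr (fun s b => lieDer (vertLift s) b) (fun h k => β.1 h k) h k)
        ⟨x, w⟩ = vertLift s (v.foldr (fun s h => vertLift s h) (β.1 h k)) ⟨x, w⟩ :=
      congrArg (fun q : ℝ → ℝ => deriv q 0) (funext fun t => ih' _)
    refine Eq.trans ?_ e4
    refine Eq.trans (congrArg₂ (· - ·) (congrArg₂ (· - ·) rfl e1) e3) ?_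
    rw [sub_zero, sub_zero]

end Bundle

section Taylor

variable {V : Type*} [NormedAddCommGroup V] [NormedSpace ℝ V] [FiniteDimensional ℝ V]
  {F : Type*} [NormedAddCommGroup F] [NormedSpace ℝ F] [FiniteDimensional ℝ F]
  {C : Type*} [TopologicalSpace C] [T2Space C] [SigmaCompactSpace C]
  [ChartedSpace V C] [IsManifold 𝓘(ℝ, V) ∞ C]
  {E : C → Type*} [∀ x, AddCommGroup (E x)] [∀ x, Module ℝ (E x)]
  [∀ x, TopologicalSpace (E x)] [TopologicalSpace (Bundle.TotalSpace F E)]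
  [FiberBundle F E] [VectorBundle ℝ F E] [ContMDiffVectorBundle ∞ F E 𝓘(ℝ, V)]

lemma sum_dual_smul_eq {x : C} {e : Fin (Module.finrank ℝ F) → E x}
    {y : Fin (Module.finrank ℝ F) → Module.Dual ℝ (E x)}
    (h : ∀ μ ν, y ν (e μ) = if μ = ν then 1 else 0) (v : E x) : ∑ μ, y μ v • e μ = v := by
  have := finiteDimensional_fibre F E x
  have hli : LinearIndependent ℝ e := by
    rw [Fintype.linearIndependent_iff]
    intro g hg ν
    have := congrArg (y ν) hg
    simpa [h] using this
  let b := Module.Basis.mk hli (hli.span_eq_top_of_card_eq_finrank'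
    (by rw [Fintype.card_fin, finrank_fibre F E x])).ge
  have hb : ∀ μ, b μ = e μ := fun μ => by simp [b]
  have h1 : ∀ ν, y ν v = b.repr v ν := fun ν => by
    conv_lhs => rw [← b.sum_repr v]
    simp [hb, h]
  conv_rhs => rw [← b.sum_repr v]
  simp_rw [h1, hb]

lemma mul_smul_ofFun {x : C} (a : ExteriorAlgebra ℝ (E x)) (c : ℝ) (g : BaseFun V C) :
    a * (c • ofFun g : extSections V F E).1 x = c • g x • a := by
  have h : (c • ofFun g : extSections V F E).1 x = c • algebraMap ℝ (ExteriorAlgebra ℝ (E x)) (g x) :=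
    rfl
  rw [h, mul_smul_comm, ← Algebra.commutes, ← Algebra.smul_def]

variable {π : FormalBivector V F E}
  {l : ∀ n, MultilinearMap ℝ (fun _ : Fin n => extSections V F E) (extSections V F E)}

lemma hasTaylorComponents (hl : ∀ n, IsMultiDer (extDeg V F E) (l n))
    (hv : HasGeneratorValues π l) {x₀ : C} {e : Fin (Module.finrank ℝ F) → Sec V F E}
    {y : Fin (Module.finrank ℝ F) → LinFun V F E}
    (hy : ∀ᶠ x in 𝓝 x₀, ∀ μ ν, (y ν).at x (e μ x) = if μ = ν then 1 else 0) :
    HasTaylorComponents π l x₀ e y := by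
  obtain ⟨d, d', e', u', f', X', hue, hfX⟩ := exists_bundle_frames V F E
  obtain ⟨U, hU, hUo, hx₀⟩ := eventually_nhds_iff.1 hy
  let adm : TotFun V F E → Prop := fun h => ∀ μ, ∀ x ∈ U, ∃ c : BaseFun V C,
    vertLift (e μ) h = pullback c ∧ ∀ᶠ y in 𝓝 x, c y = c x
  have hfun : ∀ f : BaseFun V C, adm (pullback f) := fun f μ x _ =>
    ⟨0, vertLift_pullback (e μ) f, Filter.Eventually.of_forall fun _ => rfl⟩
  have hlin : ∀ ν, adm (y ν).1 := fun ν μ x hx => ⟨pairing (y ν) (e μ), vertLift_lin (e μ) (y ν), by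
    filter_upwards [hUo.mem_nhds hx] with z hz
    exact (hU z hz μ ν).trans (hU x hx μ ν).symm⟩
  have key : ∀ {k : ℕ} (μ : Fin k → Fin (Module.finrank ℝ F)) (β : biDer (TotFun V F E))
      (h h' : TotFun V F E), adm h → adm h' → restrict (iterLie (fun i => e (μ i)) β h h') x₀ =
        iterDer (fun i => e (μ i)) (β.1 h h') ⟨x₀, 0⟩ := fun μ β h h' hh hh' => by
    refine iterLie_apply_eq hue hfX (U := U) (List.ofFn fun i => e (μ i)) β h h' ?_ ?_ hx₀ 0
    all_goals
      intro s hs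
      obtain ⟨i, rfl⟩ := (List.mem_ofFn' _ _).1 hs
    exacts [hh _, hh' _]
  have hdual := sum_dual_smul_eq (hU x₀ hx₀)
  have euler : ∀ (n : ℕ) (a : extSections V F E), a ∈ extDeg V F E n →
      ∑ ν, ExteriorAlgebra.ι ℝ (e ν x₀) * (contract (y ν) a).1 x₀ = (n : ℝ) • a.1 x₀ :=
    fun n a ha => exterior_euler hdual (mem_extDeg_natCast.1 ha x₀)
  refine ⟨fun k μ f g β hβ => ?_, fun k μ f β hβ => ?_, fun k μ β hβ => ?_⟩
  · rw [hv.fun_fun k _ f g β hβ, ← key μ β _ _ (hfun f) (hfun g)]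
    rfl
  · have hd : l (k + 1) (Fin.append (fun i => ofSec (e (μ i))) ![ofFun f]) ∈ extDeg V F E (1 : ℕ) := by
      refine deg_cast ((hl (k + 1)).degree (Fin.append (fun _ : Fin k => (1 : ℤ)) ![0]) _ fun i => ?_) ?_
      · refine Fin.addCases (fun i => ?_) (fun i => ?_) i
        · simpa using ofSec_mem _
        · simpa using ofFun_mem f
      · rw [Fin.sum_univ_add]
        simp
        ring
    have h1 := euler 1 _ hd
    rw [Nat.cast_one, one_smul] at h1
    rw [← h1, Finset.smul_sum]
    refine Finset.sum_congr rfl fun ν _ => ?_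
    rw [hv.fun_lin k _ f (y ν) β hβ, ← key μ β _ _ (hfun f) (hlin ν)]
    exact mul_smul_ofFun _ _ _
  · have hd : l k (fun i => ofSec (e (μ i))) ∈ extDeg V F E (2 : ℕ) :=
      deg_cast ((hl k).degree (fun _ => 1) _ fun i => ofSec_mem _) (by simp)
    have h1 := euler 2 _ hd
    have h2 : (l k fun i => ofSec (e (μ i))).1 x₀ =
        (1 / 2 : ℝ) • ((2 : ℕ) : ℝ) • (l k fun i => ofSec (e (μ i))).1 x₀ := by
      rw [smul_smul]; norm_num
    rw [h2, ← h1, smul_comm (kappa k)]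
    refine congrArg _ ?_
    rw [Finset.smul_sum]
    refine Finset.sum_congr rfl fun ν _ => ?_
    have h3 := euler 1 _ (deg_cast (contract_mem (y ν) _ _ hd) (by norm_num))
    rw [Nat.cast_one, one_smul] at h3
    rw [← h3, Finset.mul_sum, Finset.smul_sum]
    refine Finset.sum_congr rfl fun ρ _ => ?_
    rw [hv.lin_lin k _ (y ν) (y ρ) β hβ, ← key μ β _ _ (hlin ν) (hlin ρ)]
    rw [← mul_assoc]
    exact mul_smul_ofFun _ _ _

end Taylor

end RelPoisson

end

theorem mainTheorem10
    {V : Type*} [NormedAddCommGroup V] [NormedSpace ℝ V] [FiniteDimensional ℝ V]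
    {F : Type*} [NormedAddCommGroup F] [NormedSpace ℝ F] [FiniteDimensional ℝ F]
    {C : Type*} [TopologicalSpace C] [T2Space C] [SigmaCompactSpace C]
    [ChartedSpace V C] [IsManifold 𝓘(ℝ, V) ∞ C]
    {E : C → Type*} [∀ x, AddCommGroup (E x)] [∀ x, Module ℝ (E x)]
    [∀ x, TopologicalSpace (E x)] [TopologicalSpace (Bundle.TotalSpace F E)]
    [FiberBundle F E] [VectorBundle ℝ F E] [ContMDiffVectorBundle ∞ F E 𝓘(ℝ, V)] :
    ∃ Φ : RelPoisson.FormalBivector V F E ≃+ RelPoisson.FormalMultiDer V F E,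
      RelPoisson.IsFourier Φ ∧
      (∀ Ψ : RelPoisson.FormalBivector V F E ≃+ RelPoisson.FormalMultiDer V F E,
        RelPoisson.IsFourier Ψ → Ψ = Φ) ∧
      ∀ π : RelPoisson.FormalBivector V F E, RelPoisson.IsPoisson π →
        RelPoisson.IsPInfty (RelPoisson.extDeg V F E) (RelPoisson.operations (Φ π)) ∧
        RelPoisson.HasGeneratorValues π (RelPoisson.operations (Φ π)) ∧
        (∀ l : ∀ n, MultilinearMap ℝ (fun _ : Fin n => RelPoisson.extSections V F E)
            (RelPoisson.extSections V F E),
          RelPoisson.IsPInfty (RelPoisson.extDeg V F E) l →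
          RelPoisson.HasGeneratorValues π l → l = RelPoisson.operations (Φ π)) ∧
        ∀ (x₀ : C) (e : Fin (Module.finrank ℝ F) → RelPoisson.Sec V F E)
          (y : Fin (Module.finrank ℝ F) → RelPoisson.LinFun V F E),
          (∀ᶠ x in 𝓝 x₀, ∀ μ ν, (y ν).at x (e μ x) = if μ = ν then 1 else 0) →
          RelPoisson.HasTaylorComponents π (RelPoisson.operations (Φ π)) x₀ e y := by
  obtain ⟨d, d', e, u, f, X, hue, hfX⟩ := RelPoisson.exists_bundle_frames V F E
  let M := RelPoisson.bundleModel hue hfX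
  have hI : ∀ h, h ∈ RelPoisson.zeroIdeal V F E ↔ M.r h = 0 := RelPoisson.mem_zeroIdeal_iff
  refine ⟨M.phi hI, (RelPoisson.isFourier_iff hue hfX).2 (M.isFou_phi hI), fun Ψ hΨ =>
    M.isFou_unique hI (M.isFou_phi hI) ((RelPoisson.isFourier_iff hue hfX).1 hΨ), fun π hπ => ?_⟩
  have hP : RelPoisson.IsPInfty (RelPoisson.extDeg V F E)
      (RelPoisson.operations (M.phi hI π)) := M.isPInfty_phi hI π hπ
  have hG : RelPoisson.HasGeneratorValues π (RelPoisson.operations (M.phi hI π)) :=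
    (RelPoisson.hasGeneratorValues_iff hue hfX).2 (M.genVals_phi hI RelPoisson.kappa π)
  exact ⟨hP, hG, fun l hl hl' => M.genVals_unique hl.multiDer hP.multiDer
    ((RelPoisson.hasGeneratorValues_iff hue hfX).1 hl')
    ((RelPoisson.hasGeneratorValues_iff hue hfX).1 hG),
    fun x₀ e y hy => RelPoisson.hasTaylorComponents hP.multiDer hG hy⟩
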